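/- For positive integers $\ell,k$ let $R(\ell,k)$ be the least $n$ such that every red/blue colouring of the edges of $K_n$ contains a red $K_\ell$ or a blue $K_k$; for real $C$, $R(\ell,C\ell)$ means $R(\ell,\lfloor C\ell\rfloor)$. Let $\phi$ be the standard normal density and, for $p\in(0,1/2)$, let $c_p>0$ satisfy $\mathbb P[Z\le -c_p]=p$ for $Z\sim N(0,1)$; put $a=a(p)=\phi(c_p)$. Let $G(n,d,p)$ be the random graph on $[n]$ in which $i\ne j$ are adjacent iff $\langle x_i,x_j\rangle\ge -c_p/\sqrt d$, where $x_1,\dots,x_n$ are independent $N(0,\tfrac1d I_d)$ vectors, and let $P_{\mathrm{red},r}$, $P_{\mathrm{blue},r}$ be the probabilities that $G(r,d,p)$ is an independent set, respectively a clique. Let $C>1$ and let $p_C\in(0,1/2)$ be the solution of $C=\log p_C/\log(1-p_C)$. We call $\varepsilon$ a *Hunter–Milojević–Sudakov (HMS) constant* for $C$ if $$p_C^{-1/2}+\varepsilon=\exp\Big(\max_{p\in[u,v]}\min\Big\{-\tfrac12\log p+\tfrac{a^3}{6p^3D}-\tfrac{K(p)}{D^2},\ -\tfrac C2\log(1-p)-\tfrac{C^2a^3}{6(1-p)^3D}-\tfrac{K(p)C^2}{D^2}\Big\}\Big)$$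 for some $0<u<p_C<v<1/2$, some $D>0$ and some continuous $K:[u,v]\to(0,\infty)$ such that for each $p\in[u,v]$ the HMS clique estimates $$P_{\mathrm{red},r}\le p^{\binom r2}\exp\Big(-\tfrac{a^3}{p^3\sqrt d}\tbinom r3+\tfrac{K(p)r^3}{E\sqrt d}+o(\ell^2)\Big),\qquad P_{\mathrm{blue},r}\le(1-p)^{\binom r2}\exp\Big(\tfrac{a^3}{(1-p)^3\sqrt d}\tbinom r3+\tfrac{K(p)r^3}{E\sqrt d}+o(\ell^2)\Big)$$ hold as $\ell\to\infty$, uniformly over all $E\ge D$ for which $d=E^2\ell^2$ is an integer and all integers $0\le r\le C\ell$. **Theorem.** (i) For every $C>1$: the equation $C=\log p/\log(1-p)$ has a unique solution $p=p_C\in(0,1/2)$; a positive HMS constant for $C$ exists; and for every HMS constant $\varepsilon_{\mathrm{HMS}}$ for $C$ there is a constant $\eta>\varepsilon_{\mathrm{HMS}}$ such that $$R(\ell,C\ell)\ge\big(p_C^{-1/2}+\eta\big)^\ell\quad\text{for all sufficiently large }\ell.\tag{1}$$ (ii) As $C\to\infty$ one may take in (1) $$\eta=\eta(C)=(e^{1/24}-1)p_C^{-1/2}+\Theta\Big(\frac{p_C^{-1/2}}{\log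 C}\Big),\quad\text{more precisely}\quad \eta(C)=(e^{1/24}-1)p_C^{-1/2}+\Big(\frac{e^{1/24}}{64}+o(1)\Big)\frac{p_C^{-1/2}}{\log C}.$$ That is, there is a function $\eta$ with these asymptotics such that (1) holds for all sufficiently large $C$; in particular $\eta(C)>(e^{1/24}-1)p_C^{-1/2}$, the value of $\varepsilon_{\mathrm{HMS}}$ that Hunter, Milojević and Sudakov state for large $C$, for all sufficiently large $C$. -/

import Mathlib

open Set Filter Topology MeasureTheory ProbabilityTheory Asymptotics
open scoped NNReal ENNReal

noncomputable section

/-- The Ramsey number `R(ℓ, k)`: the least `n` such that every red/blue colouring of the edges of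
the complete graph on `n` vertices has a red `K_ℓ` or a blue `K_k`. The colouring is given by the
graph `G` of its red edges; the blue edges are those of the complement. -/
def ramsey (l k : ℕ) : ℕ :=
  sInf {n : ℕ | ∀ G : SimpleGraph (Fin n), ¬ G.CliqueFree l ∨ ¬ Gᶜ.CliqueFree k}

/-- The equation that defines `p_C`: `p ∈ (0, 1/2)` and `C = log p / log (1 - p)`. -/
def SolvesErdos (C p : ℝ) : Prop :=
  p ∈ Ioo (0 : ℝ) (1 / 2) ∧ C = Real.log p / Real.log (1 - p)

/-- `p_C`, the solution of the equation above (for `C > 1` there is exactly one). -/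
def pC (C : ℝ) : ℝ := Classical.epsilon (SolvesErdos C)

/-- `c_p`, characterised for `0 < p < 1` by `ℙ[Z ≤ -c_p] = p` with `Z` standard normal:
minus the `p`-quantile of the standard normal law. -/
def cutoff (p : ℝ) : ℝ := -sInf {t : ℝ | p ≤ cdf (gaussianReal 0 1) t}

/-- `a = φ(c_p)`, with `φ` the standard normal density. -/
def cutoffDensity (p : ℝ) : ℝ := gaussianPDFReal 0 1 (cutoff p)

/-- The joint law of `n` independent vectors with distribution `N(0, I_d / d)`. -/
def gaussianVectors (n d : ℕ) : Measure (Fin n → Fin d → ℝ) :=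
  Measure.pi fun _ => Measure.pi fun _ => gaussianReal 0 ((d : ℝ≥0)⁻¹)

/-- The Gaussian random geometric graph as a function of the vectors: `i ≠ j` are adjacent iff
`⟨x_i, x_j⟩ ≥ -c_p / √d`. -/
def gaussianGraph {n d : ℕ} (p : ℝ) (x : Fin n → Fin d → ℝ) : SimpleGraph (Fin n) where
  Adj i j := i ≠ j ∧ -cutoff p / √(d : ℝ) ≤ ∑ k, x i k * x j k
  symm := ⟨fun i j h => ⟨h.1.symm, by simpa only [mul_comm] using h.2⟩⟩
  loopless := ⟨fun i h => h.1 rfl⟩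

/-- The probability that `G(r, d, p)` is an independent set (a red clique). -/
def probRed (r d : ℕ) (p : ℝ) : ℝ :=
  (gaussianVectors r d).real {x | gaussianGraph p x = ⊥}

/-- The probability that `G(r, d, p)` is a clique (a blue clique). -/
def probBlue (r d : ℕ) (p : ℝ) : ℝ :=
  (gaussianVectors r d).real {x | gaussianGraph p x = ⊤}

/-- The Hunter–Milojević–Sudakov clique estimates for the edge parameter `p`, with error constant
`K`, in all dimensions `d = E² ℓ²` with `E ≥ D` and for all clique sizes `r ≤ C ℓ`. As only
the exponents on the scale `ℓ²` matter, the estimates may be off by a factor `exp (o(ℓ²))`. -/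
def HMSEstimates (C p K D : ℝ) : Prop :=
  ∀ ζ : ℝ, 0 < ζ → ∀ᶠ l : ℕ in atTop, ∀ (E : ℝ) (d r : ℕ),
    D ≤ E → (d : ℝ) = E ^ 2 * (l : ℝ) ^ 2 → (r : ℝ) ≤ C * l →
      probRed r d p ≤ p ^ (r.choose 2) *
          Real.exp (-(cutoffDensity p ^ 3 / (p ^ 3 * √(d : ℝ))) * (r.choose 3 : ℝ)
            + K * (r : ℝ) ^ 3 / (E * √(d : ℝ)) + ζ * (l : ℝ) ^ 2) ∧
      probBlue r d p ≤ (1 - p) ^ (r.choose 2) *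
          Real.exp (cutoffDensity p ^ 3 / ((1 - p) ^ 3 * √(d : ℝ)) * (r.choose 3 : ℝ)
            + K * (r : ℝ) ^ 3 / (E * √(d : ℝ)) + ζ * (l : ℝ) ^ 2)

/-- The exponent per `ℓ²` of the red estimate with `r = ℓ`, `d = D² ℓ²`, as `ℓ → ∞`. -/
def rhoRed (p K D : ℝ) : ℝ :=
  -(1 / 2) * Real.log p + cutoffDensity p ^ 3 / (6 * p ^ 3) / D - K / D ^ 2

/-- The exponent per `C ℓ²` of the blue estimate with `r = C ℓ`, `d = D² ℓ²`, as `ℓ → ∞`. -/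
def rhoBlue (C p K D : ℝ) : ℝ :=
  -(C / 2) * Real.log (1 - p) - C ^ 2 * (cutoffDensity p ^ 3 / (6 * (1 - p) ^ 3)) / D
    - K * C ^ 2 / D ^ 2

/-- The optimised exponent `max_p min {ρ_red, ρ_blue}`, with `p` in the interval `[u, v]` on which
the estimates are available. -/
def rhoHMS (C u v : ℝ) (K : ℝ → ℝ) (D : ℝ) : ℝ :=
  sSup ((fun p => min (rhoRed p (K p) D) (rhoBlue C p (K p) D)) '' Icc u v)

/-- `ε` is a constant that the Hunter–Milojević–Sudakov method yields for `C`: it is given by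
`p_C^{-1/2} + ε = exp ρ_HMS(D)`, where the clique estimates hold with the error constant `K p > 0`
for all `p` in a neighbourhood `[u, v]` of `p_C` and in all dimensions at least `D² ℓ²`. -/
def IsHMSConstant (C ε : ℝ) : Prop :=
  ∃ (u v D : ℝ) (K : ℝ → ℝ),
    0 < u ∧ u < pC C ∧ pC C < v ∧ v < 1 / 2 ∧ 0 < D ∧
    ContinuousOn K (Icc u v) ∧ (∀ p ∈ Icc u v, 0 < K p) ∧
    (∀ p ∈ Icc u v, HMSEstimates C p (K p) D) ∧
    pC C ^ (-(1 / 2) : ℝ) + ε = Real.exp (rhoHMS C u v K D)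

/-- `R(ℓ, Cℓ) ≥ (p_C^{-1/2} + η)^ℓ` for all sufficiently large `ℓ`. For `Cℓ` not an integer the
floor is used; as `R(ℓ, k)` is nondecreasing in `k`, the bound for the ceiling follows. -/
def RamseyBound (C η : ℝ) : Prop :=
  ∀ᶠ l : ℕ in atTop, (pC C ^ (-(1 / 2) : ℝ) + η) ^ l ≤ (ramsey l ⌊C * (l : ℝ)⌋₊ : ℝ)

end

open scoped Matrix

/-! By the union bound, `R(ℓ, Cℓ) ≥ exp(ρ)^ℓ` as soon as, for one `p` and `d ≈ D²ℓ²`, the red and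
blue clique probabilities of the Gaussian graph have exponents above `ρ` per `ℓ²` and per `Cℓ²`
(`lt_ramsey_of_prob`, `exists_ramseyBound_of_prob_le`). The HMS red exponent carries a loss `K/D²`.
The improvement is a red estimate without it, `exists_probRed_le`: with `μ = a/p`, the probability
is at most `exp((n²/2) log p - μ³n³/(6√d) + o(n²))`, for `n ≤ e₁√d` with `μe₁ ≤ 1` or `c_p ≥ 0.9`.
Compactness bounds `K` below by some `k > 0`, so the red side gains at least `k/D²`; half of this
pays for a slightly larger `D`, which raises the blue exponent as well, the HMS blue estimate being
available in every larger dimension. Hence every HMS constant can be beaten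
(`exists_gt_ramseyBound`). The side condition of the red estimate costs nothing, because it holds
for every `p` at which the blue exponent exceeds the trivial one (`red_range_of_lt_rhoBlue`).

For the red estimate, the scaled inner products are compared with independent standard normal
entries `A`. Outside an event of probability `exp(-Bn²)`, and after deleting boundedly many vectors,
the Gram matrix is well conditioned with small rows (`exists_gaussRows_all_le`). There the density,
built up row by row, is at most `exp(∑ y²/2 + (d/2) log det(I + A/√d))` up to errors in the exponent
that are negligible once the parameters are small (`GoodRows.log_gramRatio_le`). In eigenvalues `l`
of `-A/n`, with `e = n/√d`, the quadratic part of `log det` cancels `∑ y²/2`, leaving `-(d/2) ∑ g(e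
l)`, where `g(x) = -log(1-x) - x - x²/2` is `logRem`.

In a red clique `-A/n` has nonnegative entries. Its top eigenvalue is at least its mean on the
constant vector; a tangent line of the convex `g` turns this eigenvalue into a tilt linear in the
entries, and a one-variable inequality (`exists_red_tangent`) shows that the optimal tilt earns the
full cubic term. The other positive eigenvalues only help, and small negative ones are negligible.
The boundedly many large negative ones form a matrix `P`. They raise the density by at most
`exp(n²‖P‖²/8)`, since `-g(-x) ≤ x²/4` on `[0, 1]`. A Chernoff bound over a net of low-rank matrices
charges exactly this amount for their presence (`exists_lintegral_le_of_outliers`).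

For a positive HMS constant, the same scheme with `tr A³` gives a blue estimate in high dimension,
and thereby the HMS estimates with `K = C` (`exists_hmsEstimates`). To first order in `1/D`, moving
`p` slightly above `p_C` improves both exponents exactly because `C (a/(1-p_C))² < (a/p_C)²`
(`mul_hazard_sq_lt`).

For large `C` a cruder blue estimate reaches much lower dimension (`exists_probBlue_le_of_mul_le`):
the Gaussian law of a new row is dominated by an independent standard row plus a correlated part,
and integrating out the rows one by one loses only `6b²n²`, `b = a/(1-p)`. Then `D = 3c³` and `p =
1.02 p_C` are admissible, and the red gain is about `1/18 - 0.01`, above `1/24` by more than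
`1/640`. This constant surplus covers the `1/(64 log C)` term. -/

/-! ### The standard normal law -/

/-- The standard normal law. -/
noncomputable abbrev stdNormal : Measure ℝ := gaussianReal 0 1

/-- The standard normal density. -/
noncomputable def normalPDF (x : ℝ) : ℝ := gaussianPDFReal 0 1 x

/-- The upper tail of the standard normal law. -/
noncomputable def normalTail (c : ℝ) : ℝ := stdNormal.real (Ici c)

/-- The hazard rate of the standard normal law. -/
noncomputable def hazard (c : ℝ) : ℝ := normalPDF c / normalTail c

lemma normalPDF_eq (x : ℝ) : normalPDF x = (√(2 * Real.pi))⁻¹ * Real.exp (-x ^ 2 / 2) := by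
  simp [normalPDF, gaussianPDFReal]

lemma normalPDF_pos (x : ℝ) : 0 < normalPDF x := gaussianPDFReal_pos _ _ _ one_ne_zero

lemma normalPDF_neg (x : ℝ) : normalPDF (-x) = normalPDF x := by simp [normalPDF_eq]

lemma hasDerivAt_normalPDF (x : ℝ) : HasDerivAt normalPDF (-x * normalPDF x) x := by
  have h : normalPDF = fun x => (√(2 * Real.pi))⁻¹ * Real.exp (-x ^ 2 / 2) :=
    funext normalPDF_eq
  rw [h]
  have := (((hasDerivAt_id x).pow 2).neg.div_const 2).exp.const_mul ((√(2 * Real.pi))⁻¹)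
  refine this.congr_deriv ?_
  simp
  ring

lemma continuous_normalPDF : Continuous normalPDF :=
  continuous_iff_continuousAt.2 fun x => (hasDerivAt_normalPDF x).continuousAt

lemma integrable_normalPDF : Integrable normalPDF := integrable_gaussianPDFReal 0 1

lemma stdNormal_real_eq_integral {s : Set ℝ} : stdNormal.real s = ∫ x in s, normalPDF x := by
  rw [measureReal_def, gaussianReal_apply_eq_integral _ one_ne_zero, ENNReal.toReal_ofReal]
  · rfl
  · exact integral_nonneg fun x => (normalPDF_pos x).le

lemma normalTail_eq_integral (c : ℝ) : normalTail c = ∫ x in Ioi c, normalPDF x := by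
  rw [normalTail, stdNormal_real_eq_integral, integral_Ici_eq_integral_Ioi]

lemma normalTail_sub (b c : ℝ) : normalTail b - normalTail c = ∫ x in b..c, normalPDF x := by
  rw [normalTail_eq_integral, normalTail_eq_integral,
    ← intervalIntegral.integral_interval_add_Ioi' (b := c)
      (continuous_normalPDF.intervalIntegrable _ _) integrable_normalPDF.integrableOn]
  ring

lemma hasDerivAt_normalTail (c : ℝ) : HasDerivAt normalTail (-normalPDF c) c := by
  have h : normalTail = fun x => normalTail 0 - ∫ t in (0 : ℝ)..x, normalPDF t := by
    funext x; rw [← normalTail_sub]; ring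
  rw [h]
  exact (continuous_normalPDF.integral_hasStrictDerivAt 0 c).hasDerivAt.const_sub _

lemma normalTail_pos (c : ℝ) : 0 < normalTail c := by
  rw [normalTail_eq_integral]
  have := (setIntegral_pos_iff_support_of_nonneg_ae (μ := volume) (f := normalPDF) (s := Ioi c)
    (Eventually.of_forall fun x => (normalPDF_pos x).le) integrable_normalPDF.integrableOn).2
  apply this
  have : Function.support normalPDF = univ := by
    ext x; simp [(normalPDF_pos x).ne']
  rw [this, univ_inter]
  simp

lemma normalTail_strictAnti : StrictAnti normalTail :=
  strictAnti_of_deriv_neg fun c => by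
    rw [(hasDerivAt_normalTail c).deriv]; linarith [normalPDF_pos c]

lemma normalTail_neg (c : ℝ) : normalTail (-c) = 1 - normalTail c := by
  have h1 : stdNormal.real (Iic c) = normalTail (-c) := by
    rw [normalTail]
    conv_lhs => rw [show stdNormal = stdNormal.map (fun x => -x) by
      rw [gaussianReal_map_neg]; simp]
    rw [map_measureReal_apply (by fun_prop) measurableSet_Iic]
    congr 1; ext x; simp
  have h2 : stdNormal.real (Iic c) + stdNormal.real (Iic c)ᶜ = 1 := by
    rw [measureReal_add_measureReal_compl measurableSet_Iic]; simp
  have h3 : stdNormal.real (Iic c)ᶜ = normalTail c := by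
    rw [compl_Iic, stdNormal_real_eq_integral, normalTail_eq_integral]
  linarith

lemma normalTail_zero : normalTail 0 = 1 / 2 := by
  have := normalTail_neg 0
  rw [neg_zero] at this; linarith

lemma normalTail_lt_one (c : ℝ) : normalTail c < 1 := by
  have := normalTail_neg c
  linarith [normalTail_pos (-c)]

lemma continuous_normalTail : Continuous normalTail :=
  continuous_iff_continuousAt.2 fun x => (hasDerivAt_normalTail x).continuousAt

lemma tendsto_normalTail : Tendsto normalTail atTop (𝓝 0) := by
  have h : normalTail = fun c => 1 - cdf stdNormal c := by
    funext c
    rw [cdf_eq_real]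
    have h2 : stdNormal.real (Iic c) + stdNormal.real (Iic c)ᶜ = 1 := by
      rw [measureReal_add_measureReal_compl measurableSet_Iic]; simp
    have h3 : stdNormal.real (Iic c)ᶜ = normalTail c := by
      rw [compl_Iic, stdNormal_real_eq_integral, normalTail_eq_integral]
    linarith
  rw [h]
  simpa using (tendsto_cdf_atTop stdNormal).const_sub 1

lemma cdf_stdNormal (c : ℝ) : cdf stdNormal c = normalTail (-c) := by
  rw [cdf_eq_real, normalTail_neg]
  have h2 : stdNormal.real (Iic c) + stdNormal.real (Iic c)ᶜ = 1 := by
    rw [measureReal_add_measureReal_compl measurableSet_Iic]; simp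
  have h3 : stdNormal.real (Iic c)ᶜ = normalTail c := by
    rw [compl_Iic, stdNormal_real_eq_integral, normalTail_eq_integral]
  linarith

lemma exists_normalTail_eq {p : ℝ} (h0 : 0 < p) (h1 : p < 1 / 2) : ∃ c, 0 < c ∧ normalTail c = p := by
  obtain ⟨b, hb0, hb⟩ : ∃ b, 0 < b ∧ normalTail b < p :=
    ((eventually_gt_atTop 0).and (tendsto_normalTail.eventually_lt_const h0)).exists
  obtain ⟨c, hc, hcp⟩ := intermediate_value_Icc' hb0.le continuous_normalTail.continuousOn
    (show p ∈ Icc (normalTail b) (normalTail 0) from ⟨hb.le, by rw [normalTail_zero]; exact h1.le⟩)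
  refine ⟨c, lt_of_le_of_ne hc.1 ?_, hcp⟩
  rintro rfl
  rw [normalTail_zero] at hcp; linarith

lemma cutoff_eq {p c : ℝ} (h : normalTail c = p) : cutoff p = c := by
  have : {t : ℝ | p ≤ cdf (gaussianReal 0 1) t} = Ici (-c) := by
    ext t
    simp only [mem_ofPred_eq, mem_Ici]
    rw [show cdf (gaussianReal 0 1) t = normalTail (-t) from cdf_stdNormal t, ← h,
      normalTail_strictAnti.le_iff_ge, neg_le]
  rw [cutoff, this, csInf_Ici, neg_neg]

lemma cutoff_pos {p : ℝ} (h0 : 0 < p) (h1 : p < 1 / 2) : 0 < cutoff p := by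
  obtain ⟨c, hc, hcp⟩ := exists_normalTail_eq h0 h1
  rwa [cutoff_eq hcp]

lemma normalTail_cutoff {p : ℝ} (h0 : 0 < p) (h1 : p < 1 / 2) : normalTail (cutoff p) = p := by
  obtain ⟨c, hc, hcp⟩ := exists_normalTail_eq h0 h1
  rw [cutoff_eq hcp, hcp]

lemma hazard_pos (c : ℝ) : 0 < hazard c := div_pos (normalPDF_pos c) (normalTail_pos c)

lemma hasDerivAt_hazard (c : ℝ) : HasDerivAt hazard (hazard c * (hazard c - c)) c := by
  have := (hasDerivAt_normalPDF c).div (hasDerivAt_normalTail c) (normalTail_pos c).ne'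
  refine this.congr_deriv ?_
  have := (normalTail_pos c).ne'
  rw [hazard]; field_simp; ring

lemma hasDerivAt_log_normalTail (c : ℝ) :
    HasDerivAt (fun x => Real.log (normalTail x)) (-hazard c) c := by
  convert (hasDerivAt_normalTail c).log (normalTail_pos c).ne' using 1
  simp only [hazard]; ring

lemma continuous_hazard : Continuous hazard :=
  continuous_iff_continuousAt.2 fun x => (hasDerivAt_hazard x).continuousAt

/-- Comparison of the normal tail with `φ V`: the sign of the derivative of `V` decides. -/
lemma normalTail_le_of_deriv {V V' : ℝ → ℝ} {a : ℝ} (hV : ∀ x ∈ Ici a, HasDerivAt V (V' x) x)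
    (hle : ∀ x ∈ Ici a, V' x - x * V x + 1 ≤ 0) (hnn : ∀ x ∈ Ici a, 0 ≤ V x) :
    normalTail a ≤ normalPDF a * V a := by
  have hd : ∀ x ∈ Ici a, HasDerivAt (fun x => normalPDF x * V x - normalTail x)
      (normalPDF x * (V' x - x * V x + 1)) x := fun x hx => 
    (((hasDerivAt_normalPDF x).mul (hV x hx)).sub (hasDerivAt_normalTail x)).congr_deriv
      (by ring)
  have hanti : AntitoneOn (fun x => normalPDF x * V x - normalTail x) (Ici a) := by
    refine antitoneOn_of_deriv_nonpos (convex_Ici a)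
      (fun x hx => (hd x hx).continuousAt.continuousWithinAt)
      (fun x hx => (hd x (interior_subset hx)).differentiableAt.differentiableWithinAt)
      fun x hx => ?_
    rw [(hd x (interior_subset hx)).deriv]
    exact mul_nonpos_of_nonneg_of_nonpos (normalPDF_pos x).le (hle x (interior_subset hx))
  -- The antitone function `φV - normalTail` lies above `-normalTail`, which vanishes at infinity,
  -- so it is nonnegative at `a`. In the reverse comparison boundedness of `V` plays this role.
  have : (0 : ℝ) ≤ normalPDF a * V a - normalTail a := by
    have ht : Tendsto (fun x => -normalTail x) atTop (𝓝 0) := by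
      simpa using tendsto_normalTail.neg
    refine le_of_tendsto ht ?_
    filter_upwards [eventually_ge_atTop a] with x hx
    have h1 := hanti (self_mem_Ici) hx hx
    have h2 := mul_nonneg (normalPDF_pos x).le (hnn x hx)
    simp only at h1
    linarith
  linarith

lemma tendsto_normalPDF_atTop : Tendsto normalPDF atTop (𝓝 0) := by
  have h : normalPDF = fun x => (√(2 * Real.pi))⁻¹ * Real.exp (-x ^ 2 / 2) := funext normalPDF_eq
  rw [h]
  have : Tendsto (fun x : ℝ => -x ^ 2 / 2) atTop atBot := by
    have h2 : Tendsto (fun x : ℝ => x ^ 2 / 2) atTop atTop :=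
      (tendsto_pow_atTop two_ne_zero).atTop_div_const (by norm_num)
    refine (tendsto_neg_atTop_atBot.comp h2).congr fun x => ?_
    simp only [Function.comp]; ring
  simpa using (Real.tendsto_exp_atBot.comp this).const_mul ((√(2 * Real.pi))⁻¹)

/-- The reverse comparison, for bounded `V`. -/
lemma le_normalTail_of_deriv {V V' : ℝ → ℝ} {a B : ℝ} (hV : ∀ x ∈ Ici a, HasDerivAt V (V' x) x)
    (hle : ∀ x ∈ Ici a, 0 ≤ V' x - x * V x + 1) (hB : ∀ x ∈ Ici a, V x ≤ B) :
    normalPDF a * V a ≤ normalTail a := by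
  have hd : ∀ x ∈ Ici a, HasDerivAt (fun x => normalPDF x * V x - normalTail x)
      (normalPDF x * (V' x - x * V x + 1)) x := fun x hx => 
    (((hasDerivAt_normalPDF x).mul (hV x hx)).sub (hasDerivAt_normalTail x)).congr_deriv
      (by ring)
  have hmono : MonotoneOn (fun x => normalPDF x * V x - normalTail x) (Ici a) := by
    refine monotoneOn_of_deriv_nonneg (convex_Ici a)
      (fun x hx => (hd x hx).continuousAt.continuousWithinAt)
      (fun x hx => (hd x (interior_subset hx)).differentiableAt.differentiableWithinAt)
      fun x hx => ?_
    rw [(hd x (interior_subset hx)).deriv]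
    exact mul_nonneg (normalPDF_pos x).le (hle x (interior_subset hx))
  have : normalPDF a * V a - normalTail a ≤ 0 := by
    have ht : Tendsto (fun x => normalPDF x * B) atTop (𝓝 0) := by
      simpa using tendsto_normalPDF_atTop.mul_const B
    refine ge_of_tendsto ht ?_
    filter_upwards [eventually_ge_atTop a] with x hx
    have h1 := hmono (self_mem_Ici) hx hx
    have h2 := mul_le_mul_of_nonneg_left (hB x hx) (normalPDF_pos x).le
    simp only at h1
    linarith [normalTail_pos x]
  linarith

lemma antitoneOn_Ici_of_hasDerivAt {f f' : ℝ → ℝ} {a : ℝ}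
    (hd : ∀ x ∈ Ici a, HasDerivAt f (f' x) x) (hf : ∀ x ∈ Ici a, f' x ≤ 0) :
    AntitoneOn f (Ici a) := by
  refine antitoneOn_of_deriv_nonpos (convex_Ici a)
    (fun x hx => (hd x hx).continuousAt.continuousWithinAt)
    (fun x hx => (hd x (interior_subset hx)).differentiableAt.differentiableWithinAt)
    fun x hx => ?_
  rw [(hd x (interior_subset hx)).deriv]
  exact hf x (interior_subset hx)

lemma monotoneOn_Ici_of_hasDerivAt {f f' : ℝ → ℝ} {a : ℝ}
    (hd : ∀ x ∈ Ici a, HasDerivAt f (f' x) x) (hf : ∀ x ∈ Ici a, 0 ≤ f' x) :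
    MonotoneOn f (Ici a) := by
  have := (antitoneOn_Ici_of_hasDerivAt (fun x hx => (hd x hx).neg)
    (fun x hx => neg_nonpos.2 (hf x hx))).neg
  simpa using this

/-! ### The hazard rate: sharp bounds, monotonicity and convexity. -/

lemma normalPDF_eq_hazard_mul (c : ℝ) : normalPDF c = hazard c * normalTail c := by
  rw [hazard, div_mul_cancel₀ _ (normalTail_pos c).ne']

/-- Comparison with `V = 1/x` gives the weak inequality. Equality at `c` would be a local minimum of
`hazard - id`, but the derivative there would be `-1`. -/
lemma lt_hazard (c : ℝ) : c < hazard c := by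
  rcases le_or_gt c 0 with h | h
  · exact h.trans_lt (hazard_pos c)
  have key : ∀ x, 0 < x → x ≤ hazard x := fun x hx => by
    have hV : ∀ y ∈ Ici x, HasDerivAt (fun y : ℝ => y⁻¹) (-(y ^ 2)⁻¹) y := fun y hy =>
      hasDerivAt_inv (hx.trans_le hy).ne'
    have := normalTail_le_of_deriv hV (fun y hy => by
      have hy0 : 0 < y := hx.trans_le hy
      rw [mul_inv_cancel₀ hy0.ne']
      have : 0 < (y ^ 2)⁻¹ := by positivity
      linarith) (fun y hy => inv_nonneg.2 (hx.trans_le hy).le)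
    rw [hazard, le_div_iff₀ (normalTail_pos x)]
    calc x * normalTail x ≤ x * (normalPDF x * x⁻¹) := mul_le_mul_of_nonneg_left this hx.le
      _ = normalPDF x := by field_simp
  rcases (key c h).lt_or_eq with h' | h'
  · exact h'
  exfalso
  have hd := (hasDerivAt_hazard c).sub (hasDerivAt_id c)
  have hmin : IsLocalMin (hazard - id) c := by
    filter_upwards [lt_mem_nhds h] with y hy
    simp only [Pi.sub_apply, id]
    rw [← h']; linarith [key y hy]
  have := hmin.hasDerivAt_eq_zero hd
  rw [← h'] at this
  norm_num at this

/-- The derivative of the hazard rate. -/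
noncomputable def hazardDeriv (c : ℝ) : ℝ := hazard c * (hazard c - c)

lemma hazardDeriv_pos (c : ℝ) : 0 < hazardDeriv c :=
  mul_pos (hazard_pos c) (sub_pos.2 (lt_hazard c))

lemma hazard_strictMono : StrictMono hazard :=
  strictMono_of_deriv_pos fun c => by
    rw [(hasDerivAt_hazard c).deriv]; exact hazardDeriv_pos c

/-- The bound is the larger root of `(h - c)(2h - c) = 1`, so it says that the derivative of
`hazardDeriv` is nonnegative on the half-line. It comes from the comparison with `V` equal to the
reciprocal of the bound. -/
lemma hazard_lower {c : ℝ} (hc : 0 ≤ c) : (3 * c + √(c ^ 2 + 8)) / 4 ≤ hazard c := by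
  have hs : ∀ x : ℝ, 0 < √(x ^ 2 + 8) := fun x => Real.sqrt_pos.2 (by positivity)
  have hss : ∀ x : ℝ, √(x ^ 2 + 8) ^ 2 = x ^ 2 + 8 := fun x => Real.sq_sqrt (by positivity)
  have hV : ∀ x ∈ Ici c, HasDerivAt (fun x => 4 / (3 * x + √(x ^ 2 + 8)))
      (-(4 * (3 + x / √(x ^ 2 + 8))) / (3 * x + √(x ^ 2 + 8)) ^ 2) x := fun x hx => by
    have hx0 : 0 ≤ x := hc.trans hx
    have h1 : HasDerivAt (fun x : ℝ => √(x ^ 2 + 8)) (x / √(x ^ 2 + 8)) x := by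
      have := (((hasDerivAt_id x).pow 2).add_const (8 : ℝ)).sqrt (by simp; positivity)
      refine this.congr_deriv ?_
      simp
      field_simp
    have h2 := ((hasDerivAt_id x).const_mul (3 : ℝ)).add h1
    have h3 := (hasDerivAt_const x (4 : ℝ)).div h2 (by
      have := hs x; simp only [Pi.add_apply, id]; positivity)
    refine h3.congr_deriv ?_
    simp
  have := normalTail_le_of_deriv hV (fun x hx => by
      have hx0 : 0 ≤ x := hc.trans hx
      have h1 := hs x
      have h2 := hss x
      set s := √(x ^ 2 + 8)
      have hp : 0 < 3 * x + s := by positivity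
      have h3 : x ^ 3 + 6 * x ≤ (x ^ 2 + 2) * s := by
        refine abs_le_of_sq_le_sq' ?_ (by positivity) |>.2
        rw [mul_pow, h2]; nlinarith
      have : -(4 * (3 + x / s)) / (3 * x + s) ^ 2 - x * (4 / (3 * x + s)) + 1
          = (-2 * ((x ^ 2 + 2) * s - (x ^ 3 + 6 * x))) / (s * (3 * x + s) ^ 2) := by
        field_simp
        linear_combination (2 * x + s) * h2
      rw [this]
      exact div_nonpos_of_nonpos_of_nonneg (by linarith) (by positivity))
    (fun x hx => by have hx0 : 0 ≤ x := hc.trans hx; have := hs x; positivity)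
  rw [hazard, le_div_iff₀ (normalTail_pos c)]
  have hp : 0 < 3 * c + √(c ^ 2 + 8) := by have := hs c; positivity
  calc (3 * c + √(c ^ 2 + 8)) / 4 * normalTail c
      ≤ (3 * c + √(c ^ 2 + 8)) / 4 * (normalPDF c * (4 / (3 * c + √(c ^ 2 + 8)))) :=
        mul_le_mul_of_nonneg_left this (by positivity)
    _ = normalPDF c := by field_simp

/-- The bound is the positive root of `h(h - c) = 1`; with it `1 - hazardDeriv`, the variance of the
normal law truncated to the tail, is nonnegative. -/
lemma hazard_upper {c : ℝ} (hc : 0 ≤ c) : hazard c ≤ (c + √(c ^ 2 + 4)) / 2 := by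
  have hs : ∀ x : ℝ, 0 < √(x ^ 2 + 4) := fun x => Real.sqrt_pos.2 (by positivity)
  have hss : ∀ x : ℝ, √(x ^ 2 + 4) ^ 2 = x ^ 2 + 4 := fun x => Real.sq_sqrt (by positivity)
  have hV : ∀ x ∈ Ici c, HasDerivAt (fun x => (√(x ^ 2 + 4) - x) / 2)
      ((x / √(x ^ 2 + 4) - 1) / 2) x := fun x hx => by
    have h1 : HasDerivAt (fun x : ℝ => √(x ^ 2 + 4)) (x / √(x ^ 2 + 4)) x := by
      have := (((hasDerivAt_id x).pow 2).add_const (4 : ℝ)).sqrt (by simp; positivity)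
      refine this.congr_deriv ?_
      simp
      field_simp
    exact (h1.sub (hasDerivAt_id x)).div_const 2
  have := le_normalTail_of_deriv (B := 1) hV (fun x hx => by
      have hx0 : 0 ≤ x := hc.trans hx
      have h1 := hs x
      have h2 := hss x
      set s := √(x ^ 2 + 4)
      have h3 : x * (x ^ 2 + 3) ≤ (x ^ 2 + 1) * s := by
        refine abs_le_of_sq_le_sq' ?_ (by positivity) |>.2
        rw [mul_pow _ s, h2]; nlinarith
      have : (x / s - 1) / 2 - x * ((s - x) / 2) + 1
          = ((x ^ 2 + 1) * s - x * (x ^ 2 + 3)) / (2 * s) := by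
        field_simp
        linear_combination -x * h2
      rw [this]
      exact div_nonneg (by linarith) (by positivity))
    (fun x hx => by
      have hx0 : 0 ≤ x := hc.trans hx
      have : √(x ^ 2 + 4) ≤ x + 2 := Real.sqrt_le_iff.2 ⟨by positivity, by nlinarith⟩
      linarith)
  rw [hazard, div_le_iff₀ (normalTail_pos c)]
  have h1 := hs c
  have h2 := hss c
  calc normalPDF c = (c + √(c ^ 2 + 4)) / 2 * (normalPDF c * ((√(c ^ 2 + 4) - c) / 2)) := by
        linear_combination (-normalPDF c / 4) * h2
    _ ≤ _ := mul_le_mul_of_nonneg_left this (by positivity)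

lemma hazardDeriv_le_one {c : ℝ} (hc : 0 ≤ c) : hazardDeriv c ≤ 1 := by
  have h := hazard_upper hc
  have h0 := hazard_pos c
  have hss : √(c ^ 2 + 4) ^ 2 = c ^ 2 + 4 := Real.sq_sqrt (by positivity)
  have hs := Real.sqrt_nonneg (c ^ 2 + 4)
  have h1 : 2 * hazard c - c ≤ √(c ^ 2 + 4) := by linarith
  have h2 : 0 ≤ 2 * hazard c - c := by linarith [lt_hazard c]
  have := mul_self_le_mul_self h2 h1
  rw [hazardDeriv]; nlinarith

lemma hazard_sampford {c : ℝ} (hc : 0 ≤ c) : 1 ≤ (hazard c - c) * (2 * hazard c - c) := by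
  have h := hazard_lower hc
  have hss : √(c ^ 2 + 8) ^ 2 = c ^ 2 + 8 := Real.sq_sqrt (by positivity)
  have hs := Real.sqrt_nonneg (c ^ 2 + 8)
  have h1 : √(c ^ 2 + 8) ≤ 4 * hazard c - 3 * c := by linarith
  have := mul_self_le_mul_self hs h1
  nlinarith

lemma hasDerivAt_hazardDeriv (c : ℝ) : HasDerivAt hazardDeriv
    (hazard c * ((hazard c - c) * (2 * hazard c - c) - 1)) c := by
  have := (hasDerivAt_hazard c).mul ((hasDerivAt_hazard c).sub (hasDerivAt_id c))
  exact this.congr_deriv (by simp; ring)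

lemma hazardDeriv_monotoneOn : MonotoneOn hazardDeriv (Ici 0) :=
  monotoneOn_Ici_of_hasDerivAt (fun x _ => hasDerivAt_hazardDeriv x) fun x hx =>
    mul_nonneg (hazard_pos x).le (by linarith [hazard_sampford hx])

/-! ### Log-concavity of the tail and exponential moments of the truncated law. -/

/-- The hazard rate is minus the logarithmic derivative of the tail and increases, so the logarithm
of the tail is concave and lies below its tangents, in both directions. -/
lemma log_normalTail_add_le (c x : ℝ) :
    Real.log (normalTail (c + x)) ≤ Real.log (normalTail c) - hazard c * x := by
  have hd : ∀ x, HasDerivAt (fun x => Real.log (normalTail (c + x)) + hazard c * x)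
      (hazard c - hazard (c + x)) x := fun x => by
    have h1 := (hasDerivAt_log_normalTail (c + x)).comp_const_add c x
    exact (h1.add ((hasDerivAt_id x).const_mul (hazard c))).congr_deriv (by ring)
  rcases le_total 0 x with hx | hx
  · have := antitoneOn_Ici_of_hasDerivAt (a := 0) (fun x _ => hd x) (fun x hx => by
      have : hazard c ≤ hazard (c + x) := hazard_strictMono.monotone (by
        have : 0 ≤ x := hx
        linarith)
      linarith) self_mem_Ici hx hx
    simp at this; linarith
  · have hd' : ∀ y, HasDerivAt (fun y => Real.log (normalTail (c + -y)) + hazard c * -y)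
      (-(hazard c - hazard (c + -y))) y := fun y => by
      have := (hd (-y)).comp y (hasDerivAt_neg y)
      exact this.congr_deriv (by ring)
    have := antitoneOn_Ici_of_hasDerivAt (a := 0) (fun x _ => hd' x) (fun y hy => by
      have : hazard (c + -y) ≤ hazard c := hazard_strictMono.monotone (by
        have : 0 ≤ y := hy
        linarith)
      linarith) self_mem_Ici (show -x ∈ Ici 0 from neg_nonneg.2 hx) (neg_nonneg.2 hx)
    simp at this; linarith

/-- On the positive half-line the hazard rate is convex, so the quadratic Taylor polynomial is still
an upper bound. The quadratic term reduces the cost of a tilt from `θ²/2` to `(1 - hazardDeriv c)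
θ²/2`, which is what the sharp cubic term in the red estimate needs. -/
lemma log_normalTail_add_le_sq {c x : ℝ} (hc : 0 ≤ c) (hx : 0 ≤ x) :
    Real.log (normalTail (c + x)) ≤
      Real.log (normalTail c) - hazard c * x - hazardDeriv c / 2 * x ^ 2 := by
  have h1 : MonotoneOn (fun y => hazard (c + y) - hazardDeriv c * y) (Ici 0) :=
    monotoneOn_Ici_of_hasDerivAt (f' := fun y => hazardDeriv (c + y) - hazardDeriv c)
      (fun y _ => by
        have h1 := (hasDerivAt_hazard (c + y)).comp_const_add c y
        exact (h1.sub ((hasDerivAt_id y).const_mul (hazardDeriv c))).congr_deriv (by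
          simp [hazardDeriv]))
      fun y hy => by
        have hy : 0 ≤ y := hy
        exact sub_nonneg.2 (hazardDeriv_monotoneOn hc (show 0 ≤ c + y by positivity) (by linarith))
  have h2 : AntitoneOn (fun y => Real.log (normalTail (c + y)) + hazard c * y
      + hazardDeriv c / 2 * y ^ 2) (Ici 0) :=
    antitoneOn_Ici_of_hasDerivAt
      (f' := fun y => -hazard (c + y) + hazard c + hazardDeriv c * y)
      (fun y _ => by
        have h1 := (hasDerivAt_log_normalTail (c + y)).comp_const_add c y
        exact ((h1.add ((hasDerivAt_id y).const_mul (hazard c))).add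
          (((hasDerivAt_id y).pow 2).const_mul (hazardDeriv c / 2))).congr_deriv (by simp; ring))
      fun y hy => by
        have := h1 self_mem_Ici hy hy
        simp at this; linarith
  have := h2 self_mem_Ici hx hx
  simp at this; linarith

/-- The moment generating function of the truncated normal law. -/
lemma lintegral_exp_mul_stdNormal_Ici (t c : ℝ) :
    ∫⁻ y in Ici c, ENNReal.ofReal (Real.exp (t * y)) ∂stdNormal =
      ENNReal.ofReal (Real.exp (t ^ 2 / 2) * normalTail (c - t)) := by
  have h1 : ∀ s : Set ℝ, MeasurableSet s → ∀ f : ℝ → ℝ≥0∞, Measurable f →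
      ∫⁻ y in s, f y ∂stdNormal = ∫⁻ y in s, ENNReal.ofReal (normalPDF y) * f y := by
    intro s hs f hf
    rw [stdNormal, gaussianReal_of_var_ne_zero _ one_ne_zero,
      restrict_withDensity hs, lintegral_withDensity_eq_lintegral_mul _ (measurable_gaussianPDF 0 1) hf]
    rfl
  rw [h1 _ measurableSet_Ici _ (by fun_prop)]
  have h2 : ∀ y : ℝ, ENNReal.ofReal (normalPDF y) * ENNReal.ofReal (Real.exp (t * y))
      = ENNReal.ofReal (Real.exp (t ^ 2 / 2)) * ENNReal.ofReal (normalPDF (y - t)) := fun y => by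
    rw [← ENNReal.ofReal_mul (normalPDF_pos y).le, ← ENNReal.ofReal_mul (Real.exp_pos _).le]
    congr 1
    rw [normalPDF_eq, normalPDF_eq, mul_assoc, ← Real.exp_add, mul_left_comm, ← Real.exp_add]
    ring_nf
  simp_rw [h2]
  have hm : Measurable fun y => ENNReal.ofReal (normalPDF (y - t)) :=
    (continuous_normalPDF.measurable.comp (measurable_id.sub_const t)).ennreal_ofReal
  rw [lintegral_const_mul _ hm, ENNReal.ofReal_mul (Real.exp_pos _).le]
  congr 1
  have h3 : normalTail (c - t) = stdNormal.real (Ici (c - t)) := rfl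
  rw [h3, ofReal_measureReal, ← setLIntegral_one, h1 _ measurableSet_Ici _ measurable_const]
  have := lintegral_sub_right_eq_self (μ := volume)
    (fun y => (Ici (c - t)).indicator (fun y => ENNReal.ofReal (normalPDF y) * 1) y) t
  rw [← lintegral_indicator measurableSet_Ici, ← lintegral_indicator measurableSet_Ici, ← this]
  congr 1; ext y
  simp [indicator, mem_Ici]

lemma lintegral_exp_mul_stdNormal_Ici_le (t c : ℝ) :
    ∫⁻ y in Ici c, ENNReal.ofReal (Real.exp (t * y)) ∂stdNormal ≤
      ENNReal.ofReal (normalTail c * Real.exp (hazard c * t + t ^ 2 / 2)) := by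
  rw [lintegral_exp_mul_stdNormal_Ici]
  apply ENNReal.ofReal_le_ofReal
  have h := log_normalTail_add_le c (-t)
  have h2 : normalTail (c - t) ≤ normalTail c * Real.exp (hazard c * t) := by
    rw [← Real.log_le_log_iff (normalTail_pos _) (mul_pos (normalTail_pos _) (Real.exp_pos _)),
      Real.log_mul (normalTail_pos _).ne' (Real.exp_pos _).ne', Real.log_exp]
    rw [sub_eq_add_neg]; linarith
  calc _ ≤ Real.exp (t ^ 2 / 2) * (normalTail c * Real.exp (hazard c * t)) :=
        mul_le_mul_of_nonneg_left h2 (Real.exp_pos _).le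
    _ = _ := by rw [Real.exp_add]; ring

/-! ### Numerical bounds -/

lemma normalPDF_zero : normalPDF 0 = (√(2 * Real.pi))⁻¹ := by simp [normalPDF_eq]

lemma sqrt_two_pi_bounds : 2.5 < √(2 * Real.pi) ∧ √(2 * Real.pi) < 2.51 := by
  constructor
  · rw [Real.lt_sqrt (by norm_num)]; linarith [Real.pi_gt_d2]
  · rw [Real.sqrt_lt' (by norm_num)]; linarith [Real.pi_lt_d2]

/-- The minimum on the half-line is at `0`, where the value is `2/π`. Hence the truncated variance
is at most `3/8` for every positive cutoff. -/
lemma hazardDeriv_ge {c : ℝ} (hc : 0 ≤ c) : 5 / 8 ≤ hazardDeriv c := by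
  refine le_trans ?_ (hazardDeriv_monotoneOn self_mem_Ici hc hc)
  rw [hazardDeriv, hazard, normalTail_zero, normalPDF_zero, sub_zero, ← sq, div_pow, inv_pow,
    Real.sq_sqrt (by positivity)]
  have := Real.pi_lt_d2
  have := Real.pi_pos
  rw [div_le_div_iff₀ (by norm_num) (by norm_num)]
  rw [inv_eq_one_div, div_mul_eq_mul_div, le_div_iff₀ (by positivity)]
  linarith

/-- From the cutoff `0.9` on, the truncated variance is at most `0.268`, the hypothesis of
`exists_tangent_of_one_le`. -/
lemma hazardDeriv_ge_of_large {c : ℝ} (hc : 0.9 ≤ c) : 0.732 ≤ hazardDeriv c := by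
  have h0 : (0 : ℝ) ≤ 0.9 := by norm_num
  refine le_trans ?_ (hazardDeriv_monotoneOn (show (0.9 : ℝ) ∈ Ici 0 from h0) (h0.trans hc) hc)
  have h1 := hazard_lower h0
  have h2 : 2.968 ≤ √((0.9 : ℝ) ^ 2 + 8) := Real.le_sqrt_of_sq_le (by norm_num)
  have h3 : 1.417 ≤ hazard 0.9 := by linarith
  rw [hazardDeriv]
  nlinarith

lemma hazard_le_of_large {c : ℝ} (hc : 0.9 ≤ c) : hazard c ≤ 1.72 * c := by
  have h1 := hazard_upper (c := c) (by linarith)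
  have h2 : √(c ^ 2 + 4) ≤ 2.44 * c := Real.sqrt_le_iff.2 ⟨by linarith, by nlinarith⟩
  linarith

lemma cutoff_ge_of_small {p : ℝ} (h0 : 0 < p) (h1 : p ≤ 0.165) : 0.9 ≤ cutoff p := by
  have h2 : normalTail (cutoff p) = p := normalTail_cutoff h0 (by linarith)
  rw [← normalTail_strictAnti.le_iff_ge, h2]
  refine h1.trans ?_
  have hu := hazard_upper (c := 0.9) (by norm_num)
  have h3 : √((0.9 : ℝ) ^ 2 + 4) ≤ 2.2 := Real.sqrt_le_iff.2 ⟨by norm_num, by norm_num⟩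
  have h4 : hazard 0.9 ≤ 1.55 := by linarith
  have h5 := normalPDF_eq_hazard_mul 0.9
  have h6 : 0.2565 ≤ normalPDF 0.9 := by
    rw [normalPDF_eq, inv_mul_eq_div, le_div_iff₀ (by linarith [sqrt_two_pi_bounds.1])]
    have : (0.66 : ℝ) ≤ Real.exp (-0.9 ^ 2 / 2) := by
      have := Real.exp_bound_div_one_sub_of_interval (x := 0.405) (by norm_num) (by norm_num)
      have h7 := Real.quadratic_le_exp_of_nonneg (x := 0.405) (by norm_num)
      have h8 : Real.exp (-0.9 ^ 2 / 2) = Real.exp (-0.2025) * Real.exp (-0.2025) := by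
        rw [← Real.exp_add]; norm_num
      have h9 := Real.exp_bound (x := -0.2025) (by rw [abs_le]; norm_num) (n := 4) (by norm_num)
      rw [abs_le] at h9
      norm_num [Finset.sum_range_succ, Nat.factorial] at h9
      have h10 : (0.8155 : ℝ) ≤ Real.exp (-0.2025) := by
        norm_num; linarith [h9.1]
      rw [h8]; nlinarith
    nlinarith [sqrt_two_pi_bounds.2]
  have := normalTail_pos 0.9
  nlinarith

/-- The difference `F` of the two sides vanishes at `0` and at infinity, and `F' = φ k` with `k`
concave and `k 0 = 0`. So `F` first increases and then decreases, and is nonnegative throughout. -/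
lemma normalPDF_ge_mul {c : ℝ} (hc : 0 ≤ c) :
    4 * normalPDF 0 * (normalTail c * (1 - normalTail c)) ≤ normalPDF c := by
  set F : ℝ → ℝ := fun c => normalPDF c - 4 * normalPDF 0 * (normalTail c * (1 - normalTail c))
  set k : ℝ → ℝ := fun c => -c + 4 * normalPDF 0 * (1 - 2 * normalTail c)
  have hF : ∀ x, HasDerivAt F (normalPDF x * k x) x := fun x => by
    have h1 := hasDerivAt_normalTail x
    have := (hasDerivAt_normalPDF x).sub ((h1.mul (h1.const_sub 1)).const_mul (4 * normalPDF 0))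
    exact this.congr_deriv (by simp only [k]; ring)
  have hk : ∀ x, HasDerivAt k (-1 + 8 * normalPDF 0 * normalPDF x) x := fun x => by
    have := (hasDerivAt_neg x).add
      ((((hasDerivAt_normalTail x).const_mul 2).const_sub 1).const_mul (4 * normalPDF 0))
    exact this.congr_deriv (by ring)
  have hkc : ConcaveOn ℝ (Ici 0) k := by
    refine AntitoneOn.concaveOn_of_deriv (convex_Ici 0)
      (fun x _ => (hk x).continuousAt.continuousWithinAt)
      (fun x _ => (hk x).differentiableAt.differentiableWithinAt) ?_
    intro x hx y hy hxy
    rw [interior_Ici] at hx hy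
    rw [(hk x).deriv, (hk y).deriv]
    have : normalPDF y ≤ normalPDF x := by
      rw [normalPDF_eq, normalPDF_eq]
      have : x ^ 2 ≤ y ^ 2 := pow_le_pow_left₀ (le_of_lt hx) hxy 2
      gcongr
    nlinarith [normalPDF_pos 0]
  have hk0 : k 0 = 0 := by simp only [k, normalTail_zero]; norm_num
  have hF0 : F 0 = 0 := by simp only [F, normalTail_zero]; ring
  suffices h : 0 ≤ F c by simp only [F] at h; linarith
  rcases hc.eq_or_lt with rfl | hc
  · exact hF0.ge
  -- If `k c ≥ 0`, concavity makes `k` nonnegative on `[0, c]` and `F` has increased from `0`.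
  -- Otherwise `k` is nonpositive beyond `c` and `F` decreases to `0`.
  rcases le_or_gt 0 (k c) with hkc0 | hkc0
  · have hpos : ∀ x ∈ Icc 0 c, 0 ≤ k x := fun x hx => by
      have := hkc.2 (show (0 : ℝ) ∈ Ici 0 from self_mem_Ici) (show c ∈ Ici 0 from hc.le)
        (show 0 ≤ 1 - x / c from sub_nonneg.2 (div_le_one_of_le₀ hx.2 hc.le))
        (show 0 ≤ x / c from div_nonneg hx.1 hc.le) (by ring)
      simp only [smul_eq_mul, hk0, mul_zero, zero_add, div_mul_cancel₀ _ hc.ne'] at this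
      exact (mul_nonneg (div_nonneg hx.1 hc.le) hkc0).trans this
    have hm : MonotoneOn F (Icc 0 c) := by
      refine monotoneOn_of_deriv_nonneg (convex_Icc 0 c)
        (fun x _ => (hF x).continuousAt.continuousWithinAt)
        (fun x _ => (hF x).differentiableAt.differentiableWithinAt) fun x hx => ?_
      rw [(hF x).deriv]
      exact mul_nonneg (normalPDF_pos x).le (hpos x (interior_subset hx))
    rw [← hF0]; exact hm (left_mem_Icc.2 hc.le) (right_mem_Icc.2 hc.le) hc.le
  · have hneg : ∀ x ∈ Ici c, k x ≤ 0 := fun x hx => by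
      have hx0 : 0 < x := hc.trans_le hx
      by_contra! hcon
      have := hkc.2 (show (0 : ℝ) ∈ Ici 0 from self_mem_Ici) (show x ∈ Ici 0 from hx0.le)
        (show 0 ≤ 1 - c / x from sub_nonneg.2 (div_le_one_of_le₀ hx hx0.le))
        (show 0 ≤ c / x from div_nonneg hc.le hx0.le) (by ring)
      simp only [smul_eq_mul, hk0, mul_zero, zero_add, div_mul_cancel₀ _ hx0.ne'] at this
      have := mul_pos (div_pos hc hx0) hcon
      linarith
    have ha := antitoneOn_Ici_of_hasDerivAt (a := c) (fun x _ => hF x) fun x hx =>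
      mul_nonpos_of_nonneg_of_nonpos (normalPDF_pos x).le (hneg x hx)
    have ht : Tendsto F atTop (𝓝 0) := by
      have := tendsto_normalPDF_atTop.sub
        ((tendsto_normalTail.mul (tendsto_normalTail.const_sub 1)).const_mul (4 * normalPDF 0))
      simpa using this
    refine le_of_tendsto ht ?_
    filter_upwards [eventually_ge_atTop c] with x hx
    exact ha self_mem_Ici hx hx

/-! ### The rate function of the red estimate -/

/-- The function `-log (1 - x) - x - x² / 2`. -/
noncomputable def logRem (x : ℝ) : ℝ := -Real.log (1 - x) - x - x ^ 2 / 2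

/-- The derivative of `logRem`. -/
noncomputable def logRemDeriv (x : ℝ) : ℝ := x ^ 2 / (1 - x)

lemma hasDerivAt_logRem {x : ℝ} (hx : x < 1) : HasDerivAt logRem (logRemDeriv x) x := by
  have h1 : 1 - x ≠ 0 := by linarith
  have := ((((hasDerivAt_id x).const_sub 1).log h1).neg.sub (hasDerivAt_id x)).sub
    (((hasDerivAt_id x).pow 2).div_const 2)
  refine this.congr_deriv ?_
  simp only [id, logRemDeriv]; field_simp; norm_num; ring

/-- The derivative `x²/(1-x)` increases on `[0, 1)`, so the function is convex there and lies above
its tangents. -/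
lemma logRem_tangent {b x : ℝ} (hb0 : 0 ≤ b) (hb : b < 1) (hx0 : 0 ≤ x) (hx : x < 1) :
    logRem b + logRemDeriv b * (x - b) ≤ logRem x := by
  have hconv : ConvexOn ℝ (Ico 0 1) logRem := by
    refine MonotoneOn.convexOn_of_deriv (convex_Ico 0 1)
      (fun x hx => (hasDerivAt_logRem hx.2).continuousAt.continuousWithinAt)
      (fun x hx => (hasDerivAt_logRem (interior_subset hx).2).differentiableAt.differentiableWithinAt)
      ?_
    intro x hx y hy hxy
    have hx := interior_subset hx
    have hy := interior_subset hy
    rw [(hasDerivAt_logRem hx.2).deriv, (hasDerivAt_logRem hy.2).deriv, logRemDeriv, logRemDeriv]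
    have h1 : 0 < 1 - y := by linarith [hy.2]
    have h2 : x ^ 2 ≤ y ^ 2 := pow_le_pow_left₀ hx.1 hxy 2
    exact div_le_div₀ (by positivity) h2 h1 (by linarith)
  rcases lt_trichotomy x b with h | rfl | h
  · have := hconv.slope_le_of_hasDerivAt ⟨hx0, hx⟩ ⟨hb0, hb⟩ h (hasDerivAt_logRem hb)
    rw [slope_def_field, div_le_iff₀ (by linarith)] at this
    linarith
  · simp
  · have := hconv.le_slope_of_hasDerivAt ⟨hb0, hb⟩ ⟨hx0, hx⟩ h (hasDerivAt_logRem hb)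
    rw [slope_def_field, le_div_iff₀ (by linarith)] at this
    linarith

lemma logRem_ge_series {x : ℝ} (hx0 : 0 ≤ x) (hx : x < 1) :
    x ^ 3 / 3 + x ^ 4 / 4 + x ^ 5 / 5 + x ^ 6 / 6 + x ^ 7 / 7 ≤ logRem x := by
  have h := Real.hasSum_pow_div_log_of_abs_lt_one (by rwa [abs_of_nonneg hx0])
  have := sum_le_hasSum (Finset.range 7) (fun i _ => by positivity) h
  norm_num [Finset.sum_range_succ] at this
  rw [logRem]; linarith

/-- For `y ≤ 1` one has `y²/(1+y) ≤ y/2`; integrate. The constant `1/4` is exactly what the Chernoff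
bound for the outlier eigenvalues can absorb, and the restriction to `x ≤ 1` is met because the
matrix has nonnegative entries. -/
lemma logRem_neg_le {x : ℝ} (hx0 : 0 ≤ x) (hx : x ≤ 1) : -logRem (-x) ≤ x ^ 2 / 4 := by
  have hd : ∀ x : ℝ, 0 ≤ x → HasDerivAt (fun x => -logRem (-x) - x ^ 2 / 4)
      (logRemDeriv (-x) - x / 2) x := fun x hx => by
    have := ((hasDerivAt_logRem (x := -x) (by linarith)).comp x (hasDerivAt_neg x)).neg.sub
      (((hasDerivAt_id x).pow 2).div_const 4)
    refine this.congr_deriv ?_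
    simp; ring
  have hanti : AntitoneOn (fun x => -logRem (-x) - x ^ 2 / 4) (Icc 0 1) := by
    refine antitoneOn_of_deriv_nonpos (convex_Icc 0 1)
      (fun x hx => (hd x hx.1).continuousAt.continuousWithinAt)
      (fun x hx => (hd x (interior_subset hx).1).differentiableAt.differentiableWithinAt)
      fun x hx => ?_
    have hx := interior_subset hx
    rw [(hd x hx.1).deriv, logRemDeriv]
    have : (-x) ^ 2 / (1 - -x) ≤ x / 2 := by
      rw [div_le_div_iff₀ (by linarith [hx.1]) (by norm_num)]
      nlinarith [hx.1, hx.2]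
    linarith
  have := hanti (left_mem_Icc.2 zero_le_one) ⟨hx0, hx⟩ hx0
  simp [logRem] at this ⊢
  linarith

lemma logRem_neg_le_cube {x : ℝ} (hx0 : 0 ≤ x) : -logRem (-x) ≤ x ^ 3 / 3 := by
  have := monotoneOn_Ici_of_hasDerivAt (a := 0) (f := fun x => x ^ 3 / 3 + logRem (-x))
    (f' := fun x => x ^ 2 - logRemDeriv (-x)) (fun x hx => by
      have hx : 0 ≤ x := hx
      have := (((hasDerivAt_id x).pow 3).div_const 3).add
        ((hasDerivAt_logRem (x := -x) (by linarith)).comp x (hasDerivAt_neg x))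
      refine this.congr_deriv ?_
      simp; ring) (fun x hx => by
      have hx : 0 ≤ x := hx
      rw [logRemDeriv, sub_nonneg, div_le_iff₀ (by linarith)]
      nlinarith [mul_nonneg hx (sq_nonneg x)]) self_mem_Ici hx0 hx0
  simp [logRem] at this ⊢
  linarith

lemma logRem_nonneg {x : ℝ} (hx0 : 0 ≤ x) (hx : x < 1) : 0 ≤ logRem x :=
  le_trans (by positivity) (logRem_ge_series hx0 hx)

/-- With tangent slope `G(b) = b²/(1-b)`, the right-hand side is stationary in `b` when `X - b =
(3/8) G(b)`, and `G(b) ≈ X²` suggests `b = X - (3/8) X²`. The coefficient `3/32` is a quarter of the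
bound `3/8` for the truncated variance. -/
lemma exists_tangent_of_le_one {X : ℝ} (h0 : 0 ≤ X) (h1 : X ≤ 1) :
    ∃ b, 0 ≤ b ∧ b ≤ 3 / 4 ∧ b ≤ X ∧ X ^ 3 / 6 ≤ logRem b / 2 + logRemDeriv b / 2 * (X - b)
      - 3 / 32 * logRemDeriv b ^ 2 := by
  set b := X - 3 / 8 * X ^ 2 with hb
  have hb0 : 0 ≤ b := by rw [hb]; nlinarith
  have hb1 : b < 1 := by rw [hb]; nlinarith
  refine ⟨b, hb0, by rw [hb]; nlinarith, by rw [hb]; nlinarith, ?_⟩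
  have hg := logRem_ge_series hb0 hb1
  have hG : logRemDeriv b = X ^ 2 + X ^ 2 * ((b ^ 2 - X ^ 2 * (1 - b)) / (X ^ 2 * (1 - b))) ∨ X = 0 := by
    rcases eq_or_ne X 0 with h | h
    · exact Or.inr h
    · left
      have : 1 - b ≠ 0 := by linarith
      rw [logRemDeriv]; field_simp; ring
  rcases hG with hG | rfl
  swap
  · have : b = 0 := by simp [hb]
    rw [this]; simp [logRem, logRemDeriv]
  rcases h0.eq_or_lt with rfl | h0
  · have : b = 0 := by simp [hb]
    rw [this]; simp [logRem, logRemDeriv]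
  -- The slope is `X²(1 + w)`. As `b` is nearly stationary, `w` enters the inequality only through
  -- `w²`, and `w ≤ 0.13` is enough.
  set w := (b ^ 2 - X ^ 2 * (1 - b)) / (X ^ 2 * (1 - b)) with hw
  have hw1 : w = (X / 4 - 15 / 64 * X ^ 2) / (1 - b) := by
    have : 1 - b ≠ 0 := by linarith
    rw [hw]; field_simp; rw [hb]; ring
  have hwl : 0 ≤ w := by
    rw [hw1]; apply div_nonneg <;> nlinarith
  have hwu : w ≤ 0.13 := by
    rw [hw1, div_le_iff₀ (by linarith), hb]
    nlinarith [sq_nonneg (X - 0.671)]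
  have hw2 : w ^ 2 ≤ 169 / 10000 := by nlinarith
  have hXb : X - b = 3 / 8 * X ^ 2 := by rw [hb]; ring
  rw [hXb, hG]
  have e1 : (X ^ 2 + X ^ 2 * w) / 2 * (3 / 8 * X ^ 2) - 3 / 32 * (X ^ 2 + X ^ 2 * w) ^ 2
      = 3 / 32 * X ^ 4 * (1 - w ^ 2) + 0 := by ring
  have e2 : 3 / 32 * X ^ 4 * (1 - 169 / 10000) ≤ 3 / 32 * X ^ 4 * (1 - w ^ 2) := by gcongr
  -- What remains after the bound on `w` and the truncated series of `logRem b` is a polynomial; its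
  -- Bernstein form on `[0, 1]` has positive coefficients.
  have hpoly : 0 ≤ X ^ 4 * (9493 / 320000 * X ^ 0 * (1 - X) ^ 10 + 8943 / 32000 * X ^ 1 * (1 - X) ^ 9
      + 450347 / 384000 * X ^ 2 * (1 - X) ^ 8 + 7739869 / 2688000 * X ^ 3 * (1 - X) ^ 7
      + 55317127 / 12288000 * X ^ 4 * (1 - X) ^ 6 + 141736031 / 30720000 * X ^ 5 * (1 - X) ^ 5
      + 76276229 / 24576000 * X ^ 6 * (1 - X) ^ 4 + 32867863 / 24576000 * X ^ 7 * (1 - X) ^ 3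
      + 136548053 / 393216000 * X ^ 8 * (1 - X) ^ 2 + 2336123 / 49152000 * X ^ 9 * (1 - X) ^ 1
      + 133621651 / 55050240000 * X ^ 10 * (1 - X) ^ 0) := by
    have : 0 ≤ 1 - X := by linarith
    positivity
  have e3 : (b ^ 3 / 3 + b ^ 4 / 4 + b ^ 5 / 5 + b ^ 6 / 6 + b ^ 7 / 7) / 2
      + 3 / 32 * X ^ 4 * (1 - 169 / 10000) - X ^ 3 / 6 = X ^ 4 * (9493 / 320000 * X ^ 0 * (1 - X) ^ 10 + 8943 / 32000 * X ^ 1 * (1 - X) ^ 9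
      + 450347 / 384000 * X ^ 2 * (1 - X) ^ 8 + 7739869 / 2688000 * X ^ 3 * (1 - X) ^ 7
      + 55317127 / 12288000 * X ^ 4 * (1 - X) ^ 6 + 141736031 / 30720000 * X ^ 5 * (1 - X) ^ 5
      + 76276229 / 24576000 * X ^ 6 * (1 - X) ^ 4 + 32867863 / 24576000 * X ^ 7 * (1 - X) ^ 3
      + 136548053 / 393216000 * X ^ 8 * (1 - X) ^ 2 + 2336123 / 49152000 * X ^ 9 * (1 - X) ^ 1
      + 133621651 / 55050240000 * X ^ 10 * (1 - X) ^ 0) := by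
    rw [hb]; ring
  linarith

/-- The right-hand side is affine in `X` and the left one convex, so for a fixed tangent point only
the ends of an interval matter. Two tangent points suffice for `[1, 1.75]`. -/
lemma exists_tangent_of_one_le {X s : ℝ} (h0 : 1 ≤ X) (h1 : X ≤ 1.75) (hs : s ≤ 0.268) :
    ∃ b, 0 ≤ b ∧ b ≤ 3 / 4 ∧ b ≤ X ∧ X ^ 3 / 6 ≤ logRem b / 2 + logRemDeriv b / 2 * (X - b)
      - s / 4 * logRemDeriv b ^ 2 := by
  rcases le_total X 1.2 with h | h
  · refine ⟨0.7, by norm_num, by norm_num, by linarith, ?_⟩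
    have := logRem_ge_series (x := 0.7) (by norm_num) (by norm_num)
    have hG : logRemDeriv 0.7 = 49 / 30 := by rw [logRemDeriv]; norm_num
    rw [hG]
    norm_num at this ⊢
    nlinarith [mul_nonneg (sub_nonneg.2 h0) (sub_nonneg.2 h)]
  · refine ⟨0.75, by norm_num, by norm_num, by linarith, ?_⟩
    have := logRem_ge_series (x := 0.75) (by norm_num) (by norm_num)
    have hG : logRemDeriv 0.75 = 9 / 4 := by rw [logRemDeriv]; norm_num
    rw [hG]
    norm_num at this ⊢
    nlinarith [mul_nonneg (sub_nonneg.2 h) (sub_nonneg.2 h1)]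

/-! ### Gaussian vectors -/

/-- The standard Gaussian law on `ℝ^ι`. -/
noncomputable abbrev stdGauss (ι : Type*) [Fintype ι] : Measure (ι → ℝ) :=
  Measure.pi fun _ => stdNormal

section
variable {ι κ : Type*} [Fintype ι] [Fintype κ] [DecidableEq ι] [DecidableEq κ]

lemma charFunDual_stdNormal (L : StrongDual ℝ ℝ) :
    charFunDual stdNormal L = Complex.exp (-((L 1 : ℝ) : ℂ) ^ 2 / 2) := by
  rw [charFunDual_eq_charFun_map_one, gaussianReal_map_continuousLinearMap, charFun_gaussianReal]
  congr 1
  have : ((L 1 ^ 2).toNNReal : ℝ) = L 1 ^ 2 := Real.coe_toNNReal _ (sq_nonneg _)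
  simp only [map_zero, mul_one, Complex.ofReal_one, one_mul, one_pow, Complex.ofReal_zero, zero_mul,
    zero_sub, this, Complex.ofReal_pow]
  rw [neg_div]

lemma charFunDual_stdGauss (L : StrongDual ℝ (ι → ℝ)) :
    charFunDual (stdGauss ι) L
      = Complex.exp (((-(∑ i, L (Pi.single i 1) ^ 2) / 2 : ℝ) : ℂ)) := by
  rw [charFunDual_pi]
  simp_rw [charFunDual_stdNormal]
  rw [← Complex.exp_sum]
  congr 1
  simp only [ContinuousLinearMap.coe_comp, Function.comp]
  push_cast
  rw [neg_div, Finset.sum_div, ← Finset.sum_neg_distrib]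
  refine Finset.sum_congr rfl fun i _ => ?_
  simp [neg_div]

lemma charFunDual_map_mulVec (M : Matrix κ ι ℝ) (L : StrongDual ℝ (κ → ℝ)) :
    charFunDual ((stdGauss ι).map (fun g => M *ᵥ g)) L = Complex.exp (((-(
      (fun i => L (Pi.single i 1)) ⬝ᵥ ((M * Mᵀ) *ᵥ fun i => L (Pi.single i 1))) / 2 : ℝ) : ℂ)) := by
  set M' : (ι → ℝ) →L[ℝ] (κ → ℝ) := LinearMap.toContinuousLinearMap (Matrix.mulVecLin M) with hMd
  have hM' : (fun g => M *ᵥ g) = ⇑M' := by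
    funext g
    simp only [hMd, LinearMap.coe_toContinuousLinearMap', Matrix.mulVecLin_apply]
  have hL : ∀ v, L v = v ⬝ᵥ fun i => L (Pi.single i 1) := fun v => by
    conv_lhs => rw [← Finset.univ_sum_single v]
    rw [map_sum, dotProduct]
    refine Finset.sum_congr rfl fun i _ => ?_
    have : (Pi.single i (v i) : κ → ℝ) = v i • Pi.single i 1 := by
      rw [← Pi.single_smul, smul_eq_mul, mul_one]
    rw [this, map_smul, smul_eq_mul]
  rw [hM', charFunDual_map, charFunDual_stdGauss]
  congr 4
  set l := fun i => L (Pi.single i 1) with hl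
  rw [← Matrix.mulVec_mulVec, Matrix.dotProduct_mulVec, ← Matrix.mulVec_transpose, dotProduct]
  refine Finset.sum_congr rfl fun i _ => ?_
  rw [ContinuousLinearMap.comp_apply, hL, ← hM', sq]
  have : (M *ᵥ Pi.single i 1) ⬝ᵥ l = (Mᵀ *ᵥ l) i := by
    rw [Matrix.mulVec_single_one, Matrix.mulVec]
    rfl
  simp only [this]

/-- The law of `A g` depends only on `A Aᵀ`. -/
lemma map_mulVec_stdGauss {κ' : Type*} [Fintype κ'] [DecidableEq κ'] (A : Matrix κ ι ℝ)
    (B : Matrix κ κ' ℝ) (h : A * Aᵀ = B * Bᵀ) :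
    (stdGauss ι).map (fun g => A *ᵥ g) = (stdGauss κ').map (fun g => B *ᵥ g) := by
  apply Measure.ext_of_charFunDual
  funext L
  rw [charFunDual_map_mulVec, charFunDual_map_mulVec, h]

end

/-! ### Densities of Gaussian laws and the change of variables. -/

section
variable {ι κ : Type*} [Fintype ι] [Fintype κ]

/-- The density of the standard Gaussian law. -/
noncomputable def gaussDensity (x : ι → ℝ) : ℝ := ∏ i, normalPDF (x i)

lemma gaussDensity_eq (x : ι → ℝ) :
    gaussDensity x = (√(2 * Real.pi))⁻¹ ^ Fintype.card ι * Real.exp (-(x ⬝ᵥ x) / 2) := by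
  rw [gaussDensity]
  simp_rw [normalPDF_eq]
  rw [Finset.prod_mul_distrib, Finset.prod_const, Finset.card_univ, ← Real.exp_sum]
  congr 2
  rw [dotProduct, neg_div, Finset.sum_div, ← Finset.sum_neg_distrib]
  exact Finset.sum_congr rfl fun i _ => by ring

lemma continuous_gaussDensity : Continuous (gaussDensity : (ι → ℝ) → ℝ) :=
  continuous_finsetProd _ fun _ _ => continuous_normalPDF.comp (continuous_apply _)

lemma gaussDensity_nonneg (x : ι → ℝ) : 0 ≤ gaussDensity x :=
  Finset.prod_nonneg fun i _ => (normalPDF_pos _).le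

lemma stdGauss_eq_withDensity :
    stdGauss ι = (volume : Measure (ι → ℝ)).withDensity fun x => ENNReal.ofReal (gaussDensity x) := by
  refine Measure.pi_eq fun s hs => ?_
  have hint : ∀ i, ∫ x, (s i).indicator normalPDF x = stdNormal.real (s i) := fun i => by
    rw [integral_indicator (hs i), stdNormal_real_eq_integral]
  have hprod : ∀ x : ι → ℝ, ∏ i, (s i).indicator normalPDF (x i)
      = (univ.pi s).indicator gaussDensity x := fun x => by
    by_cases hx : x ∈ univ.pi s
    · rw [indicator_of_mem hx, gaussDensity]
      exact Finset.prod_congr rfl fun i _ => indicator_of_mem (hx i (mem_univ _)) _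
    · rw [indicator_of_notMem hx]
      simp only [mem_univ_pi, not_forall] at hx
      obtain ⟨i, hi⟩ := hx
      exact Finset.prod_eq_zero (Finset.mem_univ i) (indicator_of_notMem hi _)
  have h1 := integral_fintype_prod_eq_prod (μ := fun _ : ι => (volume : Measure ℝ))
    (fun i x => (s i).indicator normalPDF x)
  simp_rw [hint] at h1
  rw [withDensity_apply _ (MeasurableSet.univ_pi hs), ← lintegral_indicator (MeasurableSet.univ_pi hs)]
  have h2 : ∀ x : ι → ℝ, (univ.pi s).indicator (fun x => ENNReal.ofReal (gaussDensity x)) x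
      = ENNReal.ofReal (∏ i, (s i).indicator normalPDF (x i)) := fun x => by
    rw [hprod]
    by_cases hx : x ∈ univ.pi s <;> simp [hx]
  simp_rw [h2]
  have hi : Integrable (fun x : ι → ℝ => ∏ i, (s i).indicator normalPDF (x i))
      (Measure.pi fun _ => volume) :=
    Integrable.fintype_prod (f := fun i x => (s i).indicator normalPDF x)
      fun i => integrable_normalPDF.indicator (hs i)
  have h3 := ofReal_integral_eq_lintegral_ofReal hi (Eventually.of_forall fun x =>
    Finset.prod_nonneg fun i _ => indicator_nonneg (fun _ _ => (normalPDF_pos _).le) _)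
  rw [← volume_pi] at h3 h1
  rw [← h3, h1, ENNReal.ofReal_prod_of_nonneg fun i _ => measureReal_nonneg]
  exact Finset.prod_congr rfl fun i _ => ofReal_measureReal

lemma lintegral_stdGauss {f : (ι → ℝ) → ℝ≥0∞} (hf : Measurable f) :
    ∫⁻ x, f x ∂stdGauss ι = ∫⁻ x, ENNReal.ofReal (gaussDensity x) * f x := by
  rw [stdGauss_eq_withDensity, lintegral_withDensity_eq_lintegral_mul _
    continuous_gaussDensity.measurable.ennreal_ofReal hf]
  rfl

section
variable [DecidableEq κ]

/-- The density of a Gaussian law with covariance matrix `W = A Aᵀ` with respect to the standard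
Gaussian law. -/
noncomputable def gaussRatio (W : Matrix κ κ ℝ) (y : κ → ℝ) : ℝ :=
  (√W.det)⁻¹ * Real.exp ((y ⬝ᵥ y - y ⬝ᵥ W⁻¹ *ᵥ y) / 2)

lemma continuous_gaussRatio (W : Matrix κ κ ℝ) : Continuous (gaussRatio W) := by
  unfold gaussRatio
  fun_prop

lemma gaussRatio_nonneg (W : Matrix κ κ ℝ) (y : κ → ℝ) : 0 ≤ gaussRatio W y := by
  unfold gaussRatio; positivity

open scoped MatrixOrder Matrix.Norms.L2Operator in
lemma Matrix.PosSemidef.exists_eq_transpose_mul {W : Matrix κ κ ℝ} (hW : W.PosSemidef) :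
    ∃ B : Matrix κ κ ℝ, W = Bᵀ * B :=
  CStarAlgebra.nonneg_iff_eq_star_mul_self.mp hW.nonneg

/-- Change of variables between a nondegenerate Gaussian law and the standard one. -/
theorem lintegral_mulVec_stdGauss [DecidableEq ι] {A : Matrix κ ι ℝ} (hW : (A * Aᵀ).PosDef)
    {f : (κ → ℝ) → ℝ≥0∞} (hf : Measurable f) :
    ∫⁻ g, f (A *ᵥ g) ∂stdGauss ι
      = ∫⁻ y, f y * ENNReal.ofReal (gaussRatio (A * Aᵀ) y) ∂stdGauss κ := by
  obtain ⟨B, hB⟩ := hW.posSemidef.exists_eq_transpose_mul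
  set W := A * Aᵀ with hWdef
  -- Only `A Aᵀ` matters for the law of `A g`, so the rectangular `A` may be replaced by an
  -- invertible square root `S`, to which the linear change of variables applies.
  obtain ⟨S, hWS⟩ : ∃ S : Matrix κ κ ℝ, W = S * Sᵀ := ⟨Bᵀ, hB⟩
  have hdet : W.det = S.det ^ 2 := by rw [hWS, Matrix.det_mul, Matrix.det_transpose, sq]
  have hdpos := hW.det_pos
  have hS0 : S.det ≠ 0 := by
    intro h; rw [h] at hdet; simp [hdet] at hdpos
  have hSu : IsUnit S.det := isUnit_iff_ne_zero.2 hS0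
  have hmA : Measurable fun g : ι → ℝ => A *ᵥ g := by
    have : Continuous fun g : ι → ℝ => A *ᵥ g := by fun_prop
    exact this.measurable
  have hmS : Measurable fun g : κ → ℝ => S *ᵥ g := by
    have : Continuous fun g : κ → ℝ => S *ᵥ g := by fun_prop
    exact this.measurable
  have hmSi : Measurable fun g : κ → ℝ => S⁻¹ *ᵥ g := by
    have : Continuous fun g : κ → ℝ => S⁻¹ *ᵥ g := by fun_prop
    exact this.measurable
  rw [← lintegral_map hf hmA, map_mulVec_stdGauss A S (by rw [← hWdef, hWS]),
    lintegral_map hf hmS, lintegral_stdGauss (f := fun g => f (S *ᵥ g)) (hf.comp hmS)]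
  have hmr := (continuous_gaussRatio W).measurable.ennreal_ofReal
  rw [lintegral_stdGauss (f := fun y => f y * ENNReal.ofReal (gaussRatio W y)) (hf.mul hmr)]
  have hvol := Real.map_matrix_volume_pi_eq_smul_volume_pi (M := S) hS0
  have h1 : ∀ F : (κ → ℝ) → ℝ≥0∞, Measurable F →
      ∫⁻ g, F (S *ᵥ g) = ENNReal.ofReal |S.det⁻¹| * ∫⁻ y, F y := fun F hF => by
    have h : ∫⁻ g, F (S *ᵥ g) = ∫⁻ y, F y ∂(Measure.map (Matrix.toLin' S) volume) := by
      rw [lintegral_map hF (show Measurable fun g => Matrix.toLin' S g from hmS)]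
      rfl
    rw [h, hvol, lintegral_smul_measure, smul_eq_mul]
  have h2 : ∀ g : κ → ℝ, ENNReal.ofReal (gaussDensity g) * f (S *ᵥ g)
      = (fun y => ENNReal.ofReal (gaussDensity (S⁻¹ *ᵥ y)) * f y) (S *ᵥ g) := fun g => by
    simp only [Matrix.mulVec_mulVec, Matrix.nonsing_inv_mul _ hSu, Matrix.one_mulVec]
  have hm : Measurable fun y => ENNReal.ofReal (gaussDensity (S⁻¹ *ᵥ y)) * f y :=
    (continuous_gaussDensity.measurable.comp hmSi).ennreal_ofReal.mul hf
  rw [lintegral_congr h2, h1 _ hm, ← lintegral_const_mul _ hm]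
  refine lintegral_congr fun y => ?_
  rw [← mul_assoc, ← ENNReal.ofReal_mul (abs_nonneg _), mul_left_comm, mul_comm,
    ← ENNReal.ofReal_mul (gaussDensity_nonneg _)]
  congr 2
  have hroot : √W.det = |S.det| := by rw [hdet, Real.sqrt_sq_eq_abs]
  have hq : y ⬝ᵥ W⁻¹ *ᵥ y = (S⁻¹ *ᵥ y) ⬝ᵥ (S⁻¹ *ᵥ y) := by
    rw [hWS, Matrix.mul_inv_rev, ← Matrix.mulVec_mulVec, Matrix.dotProduct_mulVec,
      ← Matrix.mulVec_transpose, ← Matrix.transpose_nonsing_inv, Matrix.transpose_transpose]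
  have hexp : Real.exp (-(S⁻¹ *ᵥ y ⬝ᵥ S⁻¹ *ᵥ y) / 2)
      = Real.exp (-(y ⬝ᵥ y) / 2) * Real.exp ((y ⬝ᵥ y - S⁻¹ *ᵥ y ⬝ᵥ S⁻¹ *ᵥ y) / 2) := by
    rw [← Real.exp_add]; ring_nf
  rw [gaussRatio, hroot, hq, gaussDensity_eq, gaussDensity_eq, abs_inv, hexp]
  ring

end

end

/-! ### Triangular arrays and Gram matrices -/

/-- Triangular arrays: the entries below the diagonal of an `n × n` matrix, row by row. -/
def Tri : ℕ → Type
  | 0 => Unit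
  | n + 1 => Tri n × (Fin n → ℝ)

instance Tri.instMeasurableSpace : ∀ n, MeasurableSpace (Tri n)
  | 0 => inferInstanceAs (MeasurableSpace Unit)
  | n + 1 => @Prod.instMeasurableSpace _ _ (Tri.instMeasurableSpace n) _

namespace Tri

/-- The law of a triangular array with independent entries of law `ν`. -/
noncomputable def law (ν : Measure ℝ) : ∀ n, Measure (Tri n)
  | 0 => Measure.dirac ()
  | n + 1 => (law ν n).prod (Measure.pi fun _ => ν)

instance law.instSigmaFinite (ν : Measure ℝ) [SigmaFinite ν] : ∀ n, SigmaFinite (law ν n)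
  | 0 => inferInstanceAs (SigmaFinite (Measure.dirac ()))
  | n + 1 => by
    have := law.instSigmaFinite ν n
    exact inferInstanceAs (SigmaFinite ((law ν n).prod (Measure.pi fun _ => ν)))

/-- The symmetric matrix with zero diagonal given by a triangular array. -/
def mat : ∀ {n}, Tri n → Matrix (Fin n) (Fin n) ℝ
  | 0, _ => 0
  | _ + 1, A => fun i j => Fin.lastCases (Fin.lastCases 0 (fun j' => A.2 j') j)
      (fun i' => Fin.lastCases (A.2 i') (fun j' => mat A.1 i' j') j) i

@[simp] lemma mat_last_last {n} (A : Tri (n + 1)) : mat A (Fin.last n) (Fin.last n) = 0 := by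
  simp [mat]
@[simp] lemma mat_last_castSucc {n} (A : Tri (n + 1)) (j : Fin n) :
    mat A (Fin.last n) j.castSucc = A.2 j := by simp [mat]
@[simp] lemma mat_castSucc_last {n} (A : Tri (n + 1)) (j : Fin n) :
    mat A j.castSucc (Fin.last n) = A.2 j := by simp [mat]
@[simp] lemma mat_castSucc_castSucc {n} (A : Tri (n + 1)) (i j : Fin n) :
    mat A i.castSucc j.castSucc = mat A.1 i j := by simp [mat]

lemma mat_symm : ∀ {n} (A : Tri n) (i j : Fin n), mat A i j = mat A j i
  | 0, _, i, _ => i.elim0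
  | n + 1, A, i, j => by
    induction i using Fin.lastCases <;> induction j using Fin.lastCases <;> simp [mat_symm A.1]

lemma mat_diag : ∀ {n} (A : Tri n) (i : Fin n), mat A i i = 0
  | 0, _, i => i.elim0
  | n + 1, A, i => by
    induction i using Fin.lastCases <;> simp [mat_diag A.1]

lemma measurable_mat : ∀ {n} (i j : Fin n), Measurable fun A : Tri n => mat A i j
  | 0, i, _ => i.elim0
  | n + 1, i, j => by
    have h1 : Measurable fun A : Tri (n + 1) => A.1 := measurable_fst
    have h2 : Measurable fun A : Tri (n + 1) => A.2 := measurable_snd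
    induction i using Fin.lastCases with
    | last => induction j using Fin.lastCases with
      | last => simp
      | cast j => simp only [mat_last_castSucc]; exact (measurable_pi_apply j).comp h2
    | cast i => induction j using Fin.lastCases with
      | last => simp only [mat_castSucc_last]; exact (measurable_pi_apply i).comp h2
      | cast j => simp only [mat_castSucc_castSucc]; exact (measurable_mat i j).comp h1

/-- The sum of `f` over the entries. -/
def sum (f : ℝ → ℝ) : ∀ {n}, Tri n → ℝ
  | 0, _ => 0
  | _ + 1, A => sum f A.1 + ∑ j, f (A.2 j)

lemma two_mul_sum (f : ℝ → ℝ) : ∀ {n} (A : Tri n),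
    2 * sum f A = ∑ i, ∑ j, if i = j then 0 else f (mat A i j)
  | 0, _ => by simp [sum]
  | n + 1, A => by
    have := two_mul_sum f A.1
    simp only [Fin.sum_univ_castSucc, sum, mat_last_castSucc, mat_castSucc_last,
      mat_castSucc_castSucc, Finset.sum_add_distrib, Fin.castSucc_inj, mul_add, this]
    simp [Fin.castSucc_ne_last, (Fin.castSucc_ne_last _).symm]
    ring

/-- All entries lie in `s`. -/
def All (s : Set ℝ) {n} (A : Tri n) : Prop := ∀ i j, i ≠ j → mat A i j ∈ s

lemma all_succ (s : Set ℝ) {n} (A : Tri (n + 1)) : All s A ↔ All s A.1 ∧ ∀ j, A.2 j ∈ s := by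
  constructor
  · intro h
    refine ⟨fun i j hij => ?_, fun j => ?_⟩
    · simpa using h i.castSucc j.castSucc (by simpa using hij)
    · simpa using h (Fin.last n) j.castSucc (Fin.castSucc_ne_last j).symm
  · rintro ⟨h1, h2⟩ i j hij
    induction i using Fin.lastCases with
    | last => induction j using Fin.lastCases with
      | last => exact absurd rfl hij
      | cast j => simpa using h2 j
    | cast i => induction j using Fin.lastCases with
      | last => simpa using h2 i
      | cast j => simpa using h1 i j (by simpa using hij)

/-- This turns the requirement that all entries lie in `s` into a product of one-variable
restrictions, so that moments of the truncated normal law can be used entry by entry. -/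
lemma law_restrict (ν : Measure ℝ) [SigmaFinite ν] {s : Set ℝ} :
    ∀ n, law (ν.restrict s) n = (law ν n).restrict {A | All s A}
  | 0 => by
    have : {A : Tri 0 | All s A} = univ := by
      ext A; simp only [mem_univ, iff_true]; exact fun i => i.elim0
    rw [this, Measure.restrict_univ]; rfl
  | n + 1 => by
    have : {A : Tri (n + 1) | All s A} = {A : Tri n | All s A} ×ˢ (univ.pi fun _ => s) := by
      ext A
      exact (all_succ s A).trans (and_congr Iff.rfl (by simp))
    rw [this]
    have h2 : (law ν (n + 1)).restrict ({A : Tri n | All s A} ×ˢ (univ.pi fun _ => s))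
        = ((law ν n).restrict {A : Tri n | All s A}).prod
          ((Measure.pi fun _ : Fin n => ν).restrict (univ.pi fun _ => s)) :=
      (Measure.prod_restrict _ _).symm
    rw [h2, Measure.restrict_pi_pi, ← law_restrict ν n]
    rfl

lemma measurableSet_all {s : Set ℝ} (hs : MeasurableSet s) (n : ℕ) :
    MeasurableSet {A : Tri n | All s A} := by
  have : {A : Tri n | All s A} = ⋂ i, ⋂ j, ⋂ _ : i ≠ j, (fun A => mat A i j) ⁻¹' s := by
    ext A; simp [All]
  rw [this]
  exact MeasurableSet.iInter fun i => MeasurableSet.iInter fun j => MeasurableSet.iInter fun _ =>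
    measurable_mat i j hs

end Tri

/-! ### Gaussian rows, their Gram matrices, and the density built up row by row. -/

lemma lintegral_pi_succ {α : Type*} [MeasurableSpace α] (μ : Measure α) [SigmaFinite μ] {n : ℕ}
    (f : (Fin (n + 1) → α) → ℝ≥0∞) :
    ∫⁻ X, f X ∂(Measure.pi fun _ => μ)
      = ∫⁻ z : (Fin n → α) × α, f (Fin.snoc (α := fun _ => α) z.1 z.2)
        ∂((Measure.pi fun _ => μ).prod μ) := by
  have h1 := (measurePreserving_piFinSuccAbove (fun _ : Fin (n + 1) => μ) (Fin.last n)).symm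
  have h2 := Measure.measurePreserving_swap (μ := Measure.pi fun _ : Fin n => μ) (ν := μ)
  rw [← h1.map_eq, lintegral_map_equiv, ← h2.map_eq]
  rw [show (Prod.swap : (Fin n → α) × α → _) = ⇑(MeasurableEquiv.prodComm (α := Fin n → α) (β := α))
    from rfl, lintegral_map_equiv]
  refine lintegral_congr fun z => ?_
  congr 1
  simp [MeasurableEquiv.piFinSuccAbove, Fin.insertNthEquiv, Fin.insertNth_last',
    MeasurableEquiv.prodComm]

/-- The law of `n` independent standard Gaussian vectors in `ℝ^d`. -/
noncomputable abbrev gaussRows (n d : ℕ) : Measure (Fin n → Fin d → ℝ) :=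
  Measure.pi fun _ => stdGauss (Fin d)

section
variable {n d : ℕ}

/-- The matrix whose rows are the given vectors, scaled by `d^{-1/2}`. -/
noncomputable def rowMat (X : Fin n → Fin d → ℝ) : Matrix (Fin n) (Fin d) ℝ :=
  (√(d : ℝ))⁻¹ • Matrix.of X

/-- The Gram matrix of the scaled vectors. -/
noncomputable def gram (X : Fin n → Fin d → ℝ) : Matrix (Fin n) (Fin n) ℝ :=
  rowMat X * (rowMat X)ᵀ

lemma gram_apply (X : Fin n → Fin d → ℝ) (i j : Fin n) : gram X i j = (X i ⬝ᵥ X j) / d := by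
  simp only [gram, rowMat, Matrix.mul_apply, Matrix.transpose_apply, Matrix.smul_apply,
    Matrix.of_apply, smul_eq_mul, dotProduct, Finset.sum_div]
  refine Finset.sum_congr rfl fun k _ => ?_
  have : (√(d : ℝ))⁻¹ * (√(d : ℝ))⁻¹ = (d : ℝ)⁻¹ := by
    rw [← mul_inv, Real.mul_self_sqrt (Nat.cast_nonneg d)]
  linear_combination (X i k * X j k) * this

lemma rowMat_mulVec (X : Fin n → Fin d → ℝ) (g : Fin d → ℝ) (i : Fin n) :
    (rowMat X *ᵥ g) i = (X i ⬝ᵥ g) / √(d : ℝ) := by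
  rw [rowMat, Matrix.smul_mulVec, Pi.smul_apply, smul_eq_mul, inv_mul_eq_div]
  rfl

/-- The first `n` of `n + 1` vectors. -/
def initRows (X : Fin (n + 1) → Fin d → ℝ) : Fin n → Fin d → ℝ := fun i => X i.castSucc

end

/-- The triangular array of the inner products, scaled by `d^{-1/2}`. -/
noncomputable def gramTri {d : ℕ} : ∀ {n : ℕ}, (Fin n → Fin d → ℝ) → Tri n
  | 0, _ => ()
  | n + 1, X => (gramTri (initRows X), rowMat (initRows X) *ᵥ X (Fin.last n))

/-- The density of the law of `gramTri` with respect to independent standard Gaussian entries,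
conditionally on the norms. -/
noncomputable def gramRatio {d : ℕ} : ∀ {n : ℕ}, (Fin n → Fin d → ℝ) → ℝ
  | 0, _ => 1
  | n + 1, X => gramRatio (initRows X) *
      gaussRatio (gram (initRows X)) (rowMat (initRows X) *ᵥ X (Fin.last n))

lemma mat_gramTri {d : ℕ} : ∀ {n : ℕ} (X : Fin n → Fin d → ℝ) (i j : Fin n), i ≠ j →
    (gramTri X).mat i j = (X i ⬝ᵥ X j) / √(d : ℝ)
  | 0, _, i, _, _ => i.elim0
  | n + 1, X, i, j, hij => by
    induction i using Fin.lastCases with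
    | last => induction j using Fin.lastCases with
      | last => exact absurd rfl hij
      | cast j =>
        rw [Tri.mat_last_castSucc]
        simp only [gramTri, rowMat_mulVec]
        rw [dotProduct_comm]; rfl
    | cast i => induction j using Fin.lastCases with
      | last =>
        rw [Tri.mat_castSucc_last]
        simp only [gramTri, rowMat_mulVec]
        rfl
      | cast j =>
        rw [Tri.mat_castSucc_castSucc]
        exact mat_gramTri (initRows X) i j (by simpa using hij)

lemma gram_initRows {n d : ℕ} (X : Fin (n + 1) → Fin d → ℝ) :
    gram (initRows X) = (gram X).submatrix Fin.castSucc Fin.castSucc := by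
  ext i j; simp [gram_apply, initRows]

lemma gaussRatio_pos {κ : Type*} [Fintype κ] [DecidableEq κ] {W : Matrix κ κ ℝ} (hW : W.PosDef)
    (y : κ → ℝ) : 0 < gaussRatio W y :=
  mul_pos (inv_pos.2 (Real.sqrt_pos.2 hW.det_pos)) (Real.exp_pos _)

lemma gramRatio_pos {d : ℕ} : ∀ {n : ℕ} {X : Fin n → Fin d → ℝ}, (gram X).PosDef → 0 < gramRatio X
  | 0, _, _ => one_pos
  | n + 1, X, h => by
    have h' : (gram (initRows X)).PosDef := by
      rw [gram_initRows]; exact h.submatrix (Fin.castSucc_injective n)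
    exact mul_pos (gramRatio_pos h') (gaussRatio_pos h' _)

/-- Change of measure from Gram matrices of Gaussian vectors to independent entries. -/
theorem lintegral_gramTri_le {d : ℕ} : ∀ {n : ℕ} {H : Tri n → ℝ≥0∞}, Measurable H →
    ∀ G : (Fin n → Fin d → ℝ) → ℝ≥0∞,
    (∀ X, G X ≠ 0 → (gram X).PosDef ∧ G X * ENNReal.ofReal (gramRatio X) ≤ H (gramTri X)) →
    ∫⁻ X, G X ∂gaussRows n d ≤ ∫⁻ A, H A ∂Tri.law stdNormal n
  | 0, H, hH, G, hG => by
    have h1 : ∀ X, G X ≤ H () := fun X => by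
      by_cases h : G X = 0
      · simp [h]
      · have := (hG X h).2
        simp only [gramRatio, ENNReal.ofReal_one, mul_one] at this
        exact this
    calc ∫⁻ X, G X ∂gaussRows 0 d ≤ ∫⁻ _, H () ∂gaussRows 0 d := lintegral_mono h1
      _ = H () := by simp
      _ = ∫⁻ A, H A ∂Tri.law stdNormal 0 := (lintegral_dirac' _ hH).symm
  | n + 1, H, hH, G, hG => by
    rw [gaussRows, lintegral_pi_succ]
    -- Only the inequality half of Tonelli is needed, so `G` need not be measurable; this lets the
    -- induction replace `G` by its integral over the last vector.
    refine (lintegral_prod_le _).trans ?_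
    set H' : Tri n → ℝ≥0∞ := fun A => ∫⁻ y, H (A, y) ∂(stdGauss (Fin n)) with hH'
    have hH'm : Measurable H' := Measurable.lintegral_prod_right' hH
    have hlaw : ∫⁻ A, H A ∂Tri.law stdNormal (n + 1) = ∫⁻ A, H' A ∂Tri.law stdNormal n :=
      lintegral_prod _ hH.aemeasurable
    rw [hlaw]
    refine lintegral_gramTri_le hH'm _ fun X hX => ?_
    have hinit : ∀ g : Fin d → ℝ, initRows (Fin.snoc (α := fun _ => Fin d → ℝ) X g) = X := fun g => by
      funext i; simp [initRows]
    have hPD : (gram X).PosDef := by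
      by_contra hcon
      refine hX ?_
      rw [lintegral_eq_zero_of_ae_eq_zero]
      refine Eventually.of_forall fun g => ?_
      by_contra hne
      have := (hG _ hne).1.submatrix (Fin.castSucc_injective n)
      rw [← gram_initRows, hinit] at this
      exact hcon this
    refine ⟨hPD, ?_⟩
    have hrpos := gramRatio_pos hPD
    rw [← lintegral_mul_const' _ _ ENNReal.ofReal_ne_top]
    have hHm : Measurable fun y => H (gramTri X, y) := hH.comp measurable_prodMk_left
    have hrm := (continuous_gaussRatio (gram X)).measurable.ennreal_ofReal
    -- The factor of the new row is divided out here, as a function of the inner products alone; the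
    -- change of variables below restores it and leaves a standard Gaussian row.
    have hstep : ∀ g : Fin d → ℝ, G (Fin.snoc (α := fun _ => Fin d → ℝ) X g)
        * ENNReal.ofReal (gramRatio X) ≤
        (fun y => H (gramTri X, y) * (ENNReal.ofReal (gaussRatio (gram X) y))⁻¹) (rowMat X *ᵥ g) := by
      intro g
      by_cases hz : G (Fin.snoc (α := fun _ => Fin d → ℝ) X g) = 0
      · simp [hz]
      have h2 := (hG _ hz).2
      have e1 : gramRatio (Fin.snoc (α := fun _ => Fin d → ℝ) X g)
          = gramRatio X * gaussRatio (gram X) (rowMat X *ᵥ g) := by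
        rw [gramRatio, hinit, Fin.snoc_last]
      have e2 : gramTri (Fin.snoc (α := fun _ => Fin d → ℝ) X g)
          = (gramTri X, rowMat X *ᵥ g) := by
        rw [gramTri, hinit, Fin.snoc_last]
      rw [e1, e2, ENNReal.ofReal_mul hrpos.le, ← mul_assoc] at h2
      have hp := gaussRatio_pos hPD (rowMat X *ᵥ g)
      simp only
      rw [← div_eq_mul_inv, ENNReal.le_div_iff_mul_le (Or.inl (by simpa using hp))
        (Or.inl ENNReal.ofReal_ne_top)]
      exact h2
    calc _ ≤ ∫⁻ g, (fun y => H (gramTri X, y) * (ENNReal.ofReal (gaussRatio (gram X) y))⁻¹)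
            (rowMat X *ᵥ g) ∂stdGauss (Fin d) := lintegral_mono hstep
      _ = ∫⁻ y, H (gramTri X, y) * (ENNReal.ofReal (gaussRatio (gram X) y))⁻¹
            * ENNReal.ofReal (gaussRatio (gram X) y) ∂stdGauss (Fin n) :=
          lintegral_mulVec_stdGauss (A := rowMat X) hPD (hHm.mul hrm.inv)
      _ = H' (gramTri X) := by
          refine lintegral_congr fun y => ?_
          have hp := gaussRatio_pos hPD y
          rw [mul_assoc, ENNReal.inv_mul_cancel (by simpa using hp) ENNReal.ofReal_ne_top, mul_one]

/-- Bound for the probability of an event on which the density is bounded in terms of the inner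
products. -/
theorem gaussRows_le_lintegral {n d : ℕ} {H : Tri n → ℝ≥0∞} (hH : Measurable H)
    {S : Set (Fin n → Fin d → ℝ)} (hSm : MeasurableSet S) (hS : ∀ X ∈ S, (gram X).PosDef ∧
      ENNReal.ofReal (gramRatio X) ≤ H (gramTri X)) :
    gaussRows n d S ≤ ∫⁻ A, H A ∂Tri.law stdNormal n := by
  classical
  calc gaussRows n d S = ∫⁻ X, S.indicator 1 X ∂gaussRows n d := (lintegral_indicator_one hSm).symm
    _ ≤ _ := lintegral_gramTri_le hH _ fun X hX => by
        have : X ∈ S := by by_contra h; simp [h] at hX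
        simpa [this] using hS X this

/-! ### Linear algebra -/

lemma posDef_of_le {κ : Type*} [Fintype κ] {A : Matrix κ κ ℝ} (hA : A.IsSymm) {c : ℝ} (hc : 0 < c)
    (h : ∀ w : κ → ℝ, c * (w ⬝ᵥ w) ≤ w ⬝ᵥ A *ᵥ w) : A.PosDef := by
  have hH : A.IsHermitian := by
    rw [Matrix.IsHermitian, Matrix.conjTranspose_eq_transpose_of_trivial]; exact hA
  refine Matrix.PosDef.of_dotProduct_mulVec_pos hH fun x hx => ?_
  rw [star_trivial]
  refine lt_of_lt_of_le (mul_pos hc ?_) (h x)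
  rw [dotProduct]
  obtain ⟨i, hi⟩ := Function.ne_iff.1 hx
  exact Finset.sum_pos' (fun j _ => mul_self_nonneg _) ⟨i, Finset.mem_univ _, mul_self_pos.2 hi⟩

section
variable {κ : Type*} [Fintype κ] [DecidableEq κ]

lemma Matrix.IsSymm.exists_diagonalization {A : Matrix κ κ ℝ} (hA : A.IsSymm) :
    ∃ (U : Matrix κ κ ℝ) (l : κ → ℝ), Uᵀ * U = 1 ∧ U * Uᵀ = 1 ∧ A = U * Matrix.diagonal l * Uᵀ := by
  have hH : A.IsHermitian := by
    rw [Matrix.IsHermitian, Matrix.conjTranspose_eq_transpose_of_trivial]; exact hA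
  refine ⟨(hH.eigenvectorUnitary : Matrix κ κ ℝ), hH.eigenvalues, ?_, ?_, ?_⟩
  · have := Unitary.coe_star_mul_self hH.eigenvectorUnitary
    rwa [Matrix.star_eq_conjTranspose, Matrix.conjTranspose_eq_transpose_of_trivial] at this
  · have : (hH.eigenvectorUnitary : Matrix κ κ ℝ) * star (hH.eigenvectorUnitary : Matrix κ κ ℝ) = 1 :=
      Unitary.coe_mul_star_self hH.eigenvectorUnitary
    rwa [Matrix.star_eq_conjTranspose, Matrix.conjTranspose_eq_transpose_of_trivial] at this
  · have := hH.spectral_theorem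
    rw [Unitary.conjStarAlgAut_apply, Matrix.star_eq_conjTranspose,
      Matrix.conjTranspose_eq_transpose_of_trivial] at this
    simpa using this

lemma det_one_add_smul_of_diagonalization {A U : Matrix κ κ ℝ} {l : κ → ℝ} (h1 : U * Uᵀ = 1)
    (hA : A = U * Matrix.diagonal l * Uᵀ) (s t : ℝ) :
    (s • (1 : Matrix κ κ ℝ) + t • A).det = ∏ i, (s + t * l i) := by
  have : s • (1 : Matrix κ κ ℝ) + t • A = U * Matrix.diagonal (fun i => s + t * l i) * Uᵀ := by
    have hd : Matrix.diagonal (fun i => s + t * l i)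
        = s • (1 : Matrix κ κ ℝ) + t • Matrix.diagonal l := by
      ext i j
      by_cases h : i = j <;> simp [h]
    rw [hd, mul_add, add_mul, hA]
    simp only [Matrix.mul_smul, Matrix.smul_mul, mul_one, h1]
  rw [this, Matrix.det_mul, Matrix.det_mul, Matrix.det_diagonal, mul_right_comm, ← Matrix.det_mul, h1,
    Matrix.det_one, one_mul]

lemma trace_pow_two_of_diagonalization {A U : Matrix κ κ ℝ} {l : κ → ℝ} (h2 : Uᵀ * U = 1)
    (hA : A = U * Matrix.diagonal l * Uᵀ) : (A * A).trace = ∑ i, l i ^ 2 := by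
  have : A * A = U * (Matrix.diagonal l * Matrix.diagonal l) * Uᵀ := by
    calc A * A = U * Matrix.diagonal l * (Uᵀ * U) * Matrix.diagonal l * Uᵀ := by
          rw [hA]; simp only [Matrix.mul_assoc]
      _ = _ := by rw [h2]; simp only [Matrix.mul_assoc, Matrix.mul_one]
  rw [this, Matrix.trace_mul_comm, ← Matrix.mul_assoc, h2, one_mul, Matrix.diagonal_mul_diagonal,
    Matrix.trace_diagonal]
  exact Finset.sum_congr rfl fun i _ => by ring

lemma trace_of_diagonalization {A U : Matrix κ κ ℝ} {l : κ → ℝ} (h2 : Uᵀ * U = 1)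
    (hA : A = U * Matrix.diagonal l * Uᵀ) : A.trace = ∑ i, l i := by
  rw [hA, Matrix.trace_mul_comm, ← Matrix.mul_assoc, h2, one_mul, Matrix.trace_diagonal]

lemma dotProduct_mulVec_of_diagonalization {A U : Matrix κ κ ℝ} {l : κ → ℝ}
    (hA : A = U * Matrix.diagonal l * Uᵀ) (x y : κ → ℝ) :
    x ⬝ᵥ A *ᵥ y = ∑ i, l i * ((Uᵀ *ᵥ x) i * (Uᵀ *ᵥ y) i) := by
  rw [hA, Matrix.mul_assoc, ← Matrix.mulVec_mulVec, Matrix.dotProduct_mulVec,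
    ← Matrix.mulVec_transpose, ← Matrix.mulVec_mulVec, dotProduct]
  refine Finset.sum_congr rfl fun i _ => ?_
  rw [Matrix.mulVec_diagonal]; ring

lemma dotProduct_of_orthogonal {U : Matrix κ κ ℝ} (h1 : U * Uᵀ = 1) (x y : κ → ℝ) :
    x ⬝ᵥ y = ∑ i, (Uᵀ *ᵥ x) i * (Uᵀ *ᵥ y) i := by
  have := dotProduct_mulVec_of_diagonalization (A := 1) (U := U) (l := 1)
    (by rw [Matrix.diagonal_one', mul_one, h1]) x y
  simpa using this

lemma mulVec_col_of_diagonalization {A U : Matrix κ κ ℝ} {l : κ → ℝ} (h2 : Uᵀ * U = 1)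
    (hA : A = U * Matrix.diagonal l * Uᵀ) (i : κ) : A *ᵥ (fun k => U k i) = l i • fun k => U k i := by
  have hc : (fun k => U k i) = U *ᵥ Pi.single i 1 := by
    rw [Matrix.mulVec_single_one]; rfl
  rw [hc, Matrix.mulVec_mulVec, hA, Matrix.mul_assoc, h2, mul_one, ← Matrix.mulVec_mulVec,
    ← Matrix.mulVec_smul]
  congr 1
  ext k
  rw [Matrix.mulVec_diagonal]
  by_cases h : k = i <;> simp [h]

lemma col_dotProduct_col {U : Matrix κ κ ℝ} (h2 : Uᵀ * U = 1) (i j : κ) :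
    (fun k => U k i) ⬝ᵥ (fun k => U k j) = if i = j then 1 else 0 := by
  have := congrFun (congrFun h2 i) j
  rw [Matrix.one_apply] at this
  exact this

lemma le_eigenvalue {A U : Matrix κ κ ℝ} {l : κ → ℝ} (h2 : Uᵀ * U = 1)
    (hA : A = U * Matrix.diagonal l * Uᵀ) {c : ℝ} (hc : ∀ w : κ → ℝ, c * (w ⬝ᵥ w) ≤ w ⬝ᵥ A *ᵥ w)
    (i : κ) : c ≤ l i := by
  have := hc fun k => U k i
  rw [mulVec_col_of_diagonalization h2 hA, dotProduct_smul, col_dotProduct_col h2] at this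
  simpa using this

/-- `-log det W` for a matrix close to the identity. -/
lemma neg_log_det_le {W : Matrix κ κ ℝ} (hW : W.IsSymm) {c : ℝ} (hc : 0 < c)
    (h : ∀ w : κ → ℝ, c * (w ⬝ᵥ w) ≤ w ⬝ᵥ W *ᵥ w) :
    -Real.log W.det ≤ (Fintype.card κ - W.trace) + ((W - 1) * (W - 1)).trace / c := by
  obtain ⟨U, l, h2, h1, hA⟩ := hW.exists_diagonalization
  have hl := le_eigenvalue h2 hA h
  have hdet : W.det = ∏ i, l i := by
    have := det_one_add_smul_of_diagonalization h1 hA 0 1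
    simpa using this
  have hA1 : W - 1 = U * Matrix.diagonal (fun i => l i - 1) * Uᵀ := by
    have hd : Matrix.diagonal (fun i => l i - 1) = Matrix.diagonal l - (1 : Matrix κ κ ℝ) := by
      ext i j
      by_cases h : i = j <;> simp [h]
    rw [hd, mul_sub, sub_mul, ← hA, mul_one, h1]
  rw [trace_pow_two_of_diagonalization h2 hA1, trace_of_diagonalization h2 hA, hdet,
    Real.log_prod fun i _ => (hc.trans_le (hl i)).ne', Finset.sum_div, ← Finset.sum_neg_distrib]
  have : (Fintype.card κ : ℝ) - ∑ i, l i = ∑ i, (1 - l i) := by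
    rw [Finset.sum_sub_distrib]; simp
  rw [this, ← Finset.sum_add_distrib]
  refine Finset.sum_le_sum fun i _ => ?_
  have hp := hc.trans_le (hl i)
  have e1 := Real.log_le_sub_one_of_pos (inv_pos.2 hp)
  rw [Real.log_inv] at e1
  have e2 : (l i)⁻¹ - 1 = (1 - l i) + (l i - 1) ^ 2 / l i := by field_simp; ring
  have e3 : (l i - 1) ^ 2 / l i ≤ (l i - 1) ^ 2 / c := by gcongr; exact hl i
  linarith

/-- The inverse quadratic form is the maximum over `w` of the left-hand side; complete the square at
`y - W w`. Applied at the maximiser of the larger form, this shows that inversion reverses the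
order. -/
lemma two_mul_dotProduct_sub_le {W : Matrix κ κ ℝ} (hW : W.PosDef) (y w : κ → ℝ) :
    2 * (y ⬝ᵥ w) - w ⬝ᵥ W *ᵥ w ≤ y ⬝ᵥ W⁻¹ *ᵥ y := by
  have hu : IsUnit W.det := isUnit_iff_ne_zero.2 hW.det_pos.ne'
  have h := hW.inv.posSemidef.dotProduct_mulVec_nonneg (y - W *ᵥ w)
  have hs : Wᵀ = W := by
    have := hW.isHermitian
    rwa [Matrix.IsHermitian, Matrix.conjTranspose_eq_transpose_of_trivial] at this
  rw [star_trivial, Matrix.mulVec_sub, Matrix.mulVec_mulVec, Matrix.nonsing_inv_mul _ hu,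
    Matrix.one_mulVec, sub_dotProduct, dotProduct_sub, dotProduct_sub] at h
  have e : (W *ᵥ w) ⬝ᵥ W⁻¹ *ᵥ y = w ⬝ᵥ y := by
    conv_lhs => rw [← hs]
    rw [Matrix.mulVec_transpose, ← Matrix.dotProduct_mulVec, Matrix.mulVec_mulVec,
      hs, Matrix.mul_nonsing_inv _ hu, Matrix.one_mulVec]
  rw [e, dotProduct_comm w y, dotProduct_comm (W *ᵥ w) w] at h
  linarith

lemma dotProduct_inv_mulVec_anti {W V : Matrix κ κ ℝ} (hW : W.PosDef) (hV : V.PosDef)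
    (h : ∀ w : κ → ℝ, w ⬝ᵥ W *ᵥ w ≤ w ⬝ᵥ V *ᵥ w) (y : κ → ℝ) :
    y ⬝ᵥ V⁻¹ *ᵥ y ≤ y ⬝ᵥ W⁻¹ *ᵥ y := by
  have hu : IsUnit V.det := isUnit_iff_ne_zero.2 hV.det_pos.ne'
  have h1 := two_mul_dotProduct_sub_le hW y (V⁻¹ *ᵥ y)
  have h2 := h (V⁻¹ *ᵥ y)
  rw [Matrix.mulVec_mulVec _ V, Matrix.mul_nonsing_inv _ hu, Matrix.one_mulVec,
    dotProduct_comm _ y] at h2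
  linarith

lemma dotProduct_inv_mulVec_le {V : Matrix κ κ ℝ} (hV : V.PosDef) {c : ℝ} (hc : 0 < c)
    (h : ∀ w : κ → ℝ, c * (w ⬝ᵥ w) ≤ w ⬝ᵥ V *ᵥ w) (y : κ → ℝ) :
    y ⬝ᵥ V⁻¹ *ᵥ y ≤ (y ⬝ᵥ y) / c := by
  have hu : IsUnit V.det := isUnit_iff_ne_zero.2 hV.det_pos.ne'
  have h2 := h (V⁻¹ *ᵥ y)
  rw [Matrix.mulVec_mulVec _ V, Matrix.mul_nonsing_inv _ hu, Matrix.one_mulVec,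
    dotProduct_comm _ y] at h2
  set w := V⁻¹ *ᵥ y
  have h3 : 0 ≤ (y - c • w) ⬝ᵥ (y - c • w) :=
    Finset.sum_nonneg fun i _ => mul_self_nonneg _
  simp only [sub_dotProduct, dotProduct_sub, smul_dotProduct, dotProduct_smul, smul_eq_mul,
    dotProduct_comm w y] at h3
  rw [le_div_iff₀ hc]
  nlinarith

end

/-! ### The density on good configurations -/

namespace Tri

/-- The matrix `q I + d^{-1/2} A`. -/
noncomputable def shifted {n : ℕ} (q : ℝ) (d : ℕ) (A : Tri n) : Matrix (Fin n) (Fin n) ℝ :=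
  q • 1 + (√(d : ℝ))⁻¹ • mat A

lemma shifted_isSymm {n : ℕ} (q : ℝ) (d : ℕ) (A : Tri n) : (shifted q d A).IsSymm := by
  ext i j
  simp only [shifted, Matrix.transpose_apply, Matrix.add_apply, Matrix.smul_apply,
    mat_symm A j i]
  rw [Matrix.one_apply, Matrix.one_apply]
  simp [eq_comm]

/-- The second factor is the Schur complement of the last diagonal entry. The determinant therefore
accumulates one factor per row, just as the density does. -/
lemma det_shifted_succ {n : ℕ} {q : ℝ} {d : ℕ} (A : Tri (n + 1)) (h : (shifted q d A.1).det ≠ 0) :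
    (shifted q d A).det = (shifted q d A.1).det *
      (q - (A.2 ⬝ᵥ (shifted q d A.1)⁻¹ *ᵥ A.2) / d) := by
  have hinv : Invertible (shifted q d A.1) :=
    Matrix.invertibleOfIsUnitDet _ (isUnit_iff_ne_zero.2 h)
  set y : Fin n → ℝ := (√(d : ℝ))⁻¹ • A.2 with hy
  have hB : (shifted q d A).submatrix finSumFinEquiv finSumFinEquiv
      = Matrix.fromBlocks (shifted q d A.1) (Matrix.of fun i (_ : Fin 1) => y i)
        (Matrix.of fun (_ : Fin 1) j => y j) (Matrix.of fun (_ _ : Fin 1) => q) := by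
    have hr : ∀ i : Fin n, Fin.castAdd 1 i = i.castSucc := fun i => rfl
    have hl : ∀ i : Fin 1, Fin.natAdd n i = Fin.last n := fun i => by
      ext; simp
    ext i j
    rcases i with i | i <;> rcases j with j | j
    · simp [shifted, hr, Matrix.one_apply]
    · simp [shifted, hr, hl, hy, Fin.castSucc_ne_last]
    · simp [shifted, hr, hl, hy, (Fin.castSucc_ne_last _).symm]
    · simp [shifted, hl]
  rw [← Matrix.det_submatrix_equiv_self finSumFinEquiv, hB, Matrix.det_fromBlocks₁₁]
  congr 1
  rw [Matrix.det_unique]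
  simp only [Matrix.sub_apply, Matrix.of_apply]
  congr 1
  have : (A.2 ⬝ᵥ (shifted q d A.1)⁻¹ *ᵥ A.2) / d = y ⬝ᵥ (shifted q d A.1)⁻¹ *ᵥ y := by
    rw [hy, Matrix.mulVec_smul, dotProduct_smul, smul_dotProduct, smul_eq_mul, smul_eq_mul,
      ← mul_assoc, ← mul_inv, Real.mul_self_sqrt (Nat.cast_nonneg d), inv_mul_eq_div]
  rw [this, Matrix.dotProduct_mulVec]
  rw [Matrix.invOf_eq_nonsing_inv]
  simp only [Matrix.mul_apply, dotProduct, Matrix.vecMul, Matrix.of_apply]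

end Tri

/-- Configurations of vectors whose Gram matrix is close to the identity. -/
structure GoodRows (δ₀ δ₁ z v : ℝ) {n d : ℕ} (X : Fin n → Fin d → ℝ) : Prop where
  norm_le : ∀ i, gram X i i ≤ 1 + δ₀
  le_norm : ∀ i, 1 - δ₀ ≤ gram X i i
  quad : ∀ w : Fin n → ℝ, δ₁ * (w ⬝ᵥ w) ≤ w ⬝ᵥ gram X *ᵥ w
  sum_sq : ∑ i, ∑ j, (if i = j then 0 else gram X i j ^ 2) ≤ v
  -- With least eigenvalue at least `δ₁`, this makes the quadratic form subtracted in the Schur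
  -- complement at most `z`.
  row_sq : ∀ i, ∑ j, (if i = j then 0 else gram X i j ^ 2) ≤ z * δ₁

lemma gram_isSymm {n d : ℕ} (X : Fin n → Fin d → ℝ) : (gram X).IsSymm := by
  ext i j
  rw [Matrix.transpose_apply, gram_apply, gram_apply, dotProduct_comm]

/-- All conditions are inherited by the first rows: a test vector is extended by zero and the sums
only lose nonnegative terms. Inductions over rows rest on this. -/
lemma GoodRows.init {δ₀ δ₁ z v : ℝ} {n d : ℕ} {X : Fin (n + 1) → Fin d → ℝ}
    (h : GoodRows δ₀ δ₁ z v X) : GoodRows δ₀ δ₁ z v (initRows X) := by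
  have hg : ∀ i j, gram (initRows X) i j = gram X i.castSucc j.castSucc := fun i j => by
    rw [gram_initRows]; rfl
  have hrow : ∀ i, ∑ j, (if i = j then 0 else gram (initRows X) i j ^ 2)
      ≤ ∑ j, (if i.castSucc = j then 0 else gram X i.castSucc j ^ 2) := fun i => by
    rw [Fin.sum_univ_castSucc (n := n)]
    simp only [Fin.castSucc_inj, hg]
    exact le_add_of_nonneg_right (by split_ifs <;> positivity)
  refine ⟨fun i => ?_, fun i => ?_, fun w => ?_, ?_, fun i => (hrow i).trans (h.row_sq _)⟩
  · rw [hg]; exact h.norm_le _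
  · rw [hg]; exact h.le_norm _
  · have := h.quad (Fin.snoc (α := fun _ => ℝ) w 0)
    simpa [dotProduct, Matrix.mulVec, Fin.sum_univ_castSucc, hg] using this
  · refine le_trans ?_ h.sum_sq
    rw [Fin.sum_univ_castSucc (n := n)]
    refine (Finset.sum_le_sum fun i _ => hrow i).trans (le_add_of_nonneg_right ?_)
    exact Finset.sum_nonneg fun j _ => by split_ifs <;> positivity

lemma gram_eq_shifted {n d : ℕ} (X : Fin n → Fin d → ℝ) (q : ℝ) :
    (gramTri X).shifted q d = gram X + Matrix.diagonal fun i => q - gram X i i := by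
  ext i j
  by_cases h : i = j
  · subst h; simp [Tri.shifted, Tri.mat_diag]
  · have : (√(d : ℝ))⁻¹ * ((X i ⬝ᵥ X j) / √(d : ℝ)) = (X i ⬝ᵥ X j) / d := by
      rw [← div_eq_inv_mul, div_div, Real.mul_self_sqrt (Nat.cast_nonneg d)]
    simp [Tri.shifted, h, mat_gramTri X i j h, gram_apply, this]

lemma GoodRows.gram_posDef {δ₀ δ₁ z v : ℝ} {n d : ℕ} {X : Fin n → Fin d → ℝ}
    (h : GoodRows δ₀ δ₁ z v X) (h1 : 0 < δ₁) : (gram X).PosDef :=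
  posDef_of_le (gram_isSymm X) h1 h.quad

/-- The norms are not recorded in the triangular array. Raising all diagonal entries to their common
upper bound enlarges the quadratic form and leaves a function of the off-diagonal inner products
only. -/
lemma GoodRows.gram_le_shifted {δ₀ δ₁ z v : ℝ} {n d : ℕ} {X : Fin n → Fin d → ℝ}
    (h : GoodRows δ₀ δ₁ z v X) (w : Fin n → ℝ) :
    w ⬝ᵥ gram X *ᵥ w ≤ w ⬝ᵥ (gramTri X).shifted (1 + δ₀) d *ᵥ w := by
  rw [gram_eq_shifted, Matrix.add_mulVec, dotProduct_add]
  refine le_add_of_nonneg_right (Finset.sum_nonneg fun i _ => ?_)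
  rw [Matrix.mulVec_diagonal]
  have := h.norm_le i
  nlinarith [mul_nonneg (sub_nonneg.2 this) (mul_self_nonneg (w i))]

lemma GoodRows.shifted_ge {δ₀ δ₁ z v : ℝ} {n d : ℕ} {X : Fin n → Fin d → ℝ}
    (h : GoodRows δ₀ δ₁ z v X) (w : Fin n → ℝ) :
    δ₁ * (w ⬝ᵥ w) ≤ w ⬝ᵥ (gramTri X).shifted (1 + δ₀) d *ᵥ w :=
  (h.quad w).trans (h.gram_le_shifted w)

lemma GoodRows.shifted_posDef {δ₀ δ₁ z v : ℝ} {n d : ℕ} {X : Fin n → Fin d → ℝ}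
    (h : GoodRows δ₀ δ₁ z v X) (h1 : 0 < δ₁) : ((gramTri X).shifted (1 + δ₀) d).PosDef :=
  posDef_of_le (Tri.shifted_isSymm _ _ _) h1 h.shifted_ge

lemma GoodRows.trace_sub_one_sq_le {δ₀ δ₁ z v : ℝ} {n d : ℕ} {X : Fin n → Fin d → ℝ}
    (h : GoodRows δ₀ δ₁ z v X) : ((gram X - 1) * (gram X - 1)).trace ≤ n * δ₀ ^ 2 + v := by
  have : ((gram X - 1) * (gram X - 1)).trace = ∑ i, (gram X i i - 1) ^ 2
      + ∑ i, ∑ j, (if i = j then 0 else gram X i j ^ 2) := by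
    rw [Matrix.trace, ← Finset.sum_add_distrib]
    refine Finset.sum_congr rfl fun i _ => ?_
    rw [Matrix.diag_apply, Matrix.mul_apply, ← Finset.add_sum_erase _ _ (Finset.mem_univ i),
      ← Finset.add_sum_erase _ (fun j => if i = j then 0 else gram X i j ^ 2) (Finset.mem_univ i)]
    simp only [Matrix.sub_apply, Matrix.one_apply_eq, if_true, zero_add]
    congr 1
    · ring
    · refine Finset.sum_congr rfl fun j hj => ?_
      have hij : i ≠ j := (Finset.ne_of_mem_erase hj).symm
      rw [Matrix.one_apply_ne hij, Matrix.one_apply_ne hij.symm, if_neg hij,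
        show gram X j i = gram X i j from (gram_isSymm X).apply i j]
      ring
  rw [this]
  refine add_le_add ?_ h.sum_sq
  calc ∑ i, (gram X i i - 1) ^ 2 ≤ ∑ _i : Fin n, δ₀ ^ 2 := Finset.sum_le_sum fun i _ =>
        sq_le_sq' (by linarith [h.le_norm i]) (by linarith [h.norm_le i])
    _ = n * δ₀ ^ 2 := by simp

lemma GoodRows.neg_log_det_le {δ₀ δ₁ z v : ℝ} {n d : ℕ} {X : Fin n → Fin d → ℝ}
    (h : GoodRows δ₀ δ₁ z v X) (h1 : 0 < δ₁) :
    -Real.log (gram X).det ≤ n * δ₀ + (n * δ₀ ^ 2 + v) / δ₁ := by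
  refine (_root_.neg_log_det_le (gram_isSymm X) h1 h.quad).trans ?_
  have e1 : (Fintype.card (Fin n) : ℝ) - (gram X).trace ≤ n * δ₀ := by
    rw [Matrix.trace]
    have : ∑ i : Fin n, (1 - δ₀) ≤ ∑ i, (gram X).diag i :=
      Finset.sum_le_sum fun i _ => h.le_norm i
    simp at this ⊢; linarith
  have e2 := h.trace_sub_one_sq_le
  gcongr

/-- The logarithm of the density on good configurations. -/
theorem GoodRows.log_gramRatio_le {δ₀ δ₁ z v : ℝ} (h0 : 0 ≤ δ₀) (h1 : 0 < δ₁) (hz : z < 1)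
    (hv : 0 ≤ v) {N d : ℕ} (hd : 0 < d) : ∀ {n : ℕ} {X : Fin n → Fin d → ℝ}, n ≤ N →
    GoodRows δ₀ δ₁ z v X →
    Real.log (gramRatio X) ≤ n * ((N * δ₀ + (N * δ₀ ^ 2 + v) / δ₁) / 2)
      + Tri.sum (fun y => y ^ 2) (gramTri X) / 2
      + d * (1 - z) / 2 * (Real.log ((gramTri X).shifted (1 + δ₀) d).det - n * Real.log (1 + δ₀))
  | 0, X, _, _ => by simp [gramRatio, Tri.sum]
  | n + 1, X, hn, h => by
    have hi := h.init
    have ih := GoodRows.log_gramRatio_le h0 h1 hz hv hd (N := N) (by omega) hi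
    have hPD := hi.gram_posDef h1
    set Y := initRows X with hY
    set y := rowMat Y *ᵥ X (Fin.last n) with hy
    have hsPD := hi.shifted_posDef h1
    set V := (gramTri Y).shifted (1 + δ₀) d with hV
    have hd' : (0 : ℝ) < d := Nat.cast_pos.2 hd
    have hdet : ((gramTri X).shifted (1 + δ₀) d).det = V.det * (1 + δ₀ - (y ⬝ᵥ V⁻¹ *ᵥ y) / d) :=
      Tri.det_shifted_succ (gramTri X) hsPD.det_pos.ne'
    have hysq : y ⬝ᵥ y ≤ d * (z * δ₁) := by
      have := h.row_sq (Fin.last n)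
      rw [Fin.sum_univ_castSucc] at this
      simp only [(Fin.castSucc_ne_last _).symm, if_false, if_true, add_zero] at this
      have e : ∑ j : Fin n, gram X (Fin.last n) j.castSucc ^ 2 = (y ⬝ᵥ y) / d := by
        rw [dotProduct, Finset.sum_div]
        refine Finset.sum_congr rfl fun j _ => ?_
        rw [hy, rowMat_mulVec, gram_apply, dotProduct_comm, hY, initRows, div_mul_div_comm,
          Real.mul_self_sqrt hd'.le]
        field_simp
      rw [e, div_le_iff₀ hd'] at this
      linarith
    set ζ := (y ⬝ᵥ V⁻¹ *ᵥ y) / d with hζ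
    have hζ0 : 0 ≤ ζ := by
      refine div_nonneg ?_ hd'.le
      have := hsPD.inv.posSemidef.dotProduct_mulVec_nonneg y
      rwa [star_trivial] at this
    have hζz : ζ ≤ z := by
      have := dotProduct_inv_mulVec_le hsPD h1 hi.shifted_ge y
      rw [hζ, div_le_iff₀ hd']
      refine this.trans ?_
      rw [div_le_iff₀ h1]; linarith
    have hanti := dotProduct_inv_mulVec_anti hPD hsPD hi.gram_le_shifted y
    have hlogdet := hi.neg_log_det_le h1
    have hratio : Real.log (gramRatio X) = Real.log (gramRatio Y)
        + (-Real.log (gram Y).det / 2 + (y ⬝ᵥ y - y ⬝ᵥ (gram Y)⁻¹ *ᵥ y) / 2) := by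
      rw [gramRatio, Real.log_mul (gramRatio_pos hPD).ne' (gaussRatio_pos hPD _).ne', gaussRatio,
        Real.log_mul (inv_pos.2 (Real.sqrt_pos.2 hPD.det_pos)).ne' (Real.exp_pos _).ne', Real.log_exp,
        Real.log_inv, Real.log_sqrt hPD.det_pos.le, neg_div]
    have hq : 0 < 1 + δ₀ := by linarith
    have hqζ : 0 < 1 + δ₀ - ζ := by linarith
    -- The quadratic form of the new row is exchanged for the logarithm of its Schur complement, at
    -- the cost of a factor `1 - z`. These logarithms telescope to `log det`.
    have hlog : -ζ ≤ (1 - z) * (Real.log (1 + δ₀ - ζ) - Real.log (1 + δ₀)) := by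
      have e1 := Real.log_le_sub_one_of_pos (div_pos hq hqζ)
      rw [Real.log_div hq.ne' hqζ.ne'] at e1
      have e2 : (1 + δ₀) / (1 + δ₀ - ζ) - 1 = ζ / (1 + δ₀ - ζ) := by field_simp; ring
      have e3 : ζ / (1 + δ₀ - ζ) ≤ ζ / (1 - z) := by
        apply div_le_div_of_nonneg_left hζ0 (by linarith) (by linarith)
      have e4 : Real.log (1 + δ₀) - Real.log (1 + δ₀ - ζ) ≤ ζ / (1 - z) := by linarith
      rw [le_div_iff₀ (by linarith)] at e4
      linarith
    have hsum : Tri.sum (fun y => y ^ 2) (gramTri X) = Tri.sum (fun y => y ^ 2) (gramTri Y)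
        + y ⬝ᵥ y := by
      change Tri.sum _ (gramTri Y) + _ = _
      congr 1
      exact Finset.sum_congr rfl fun j _ => sq _
    -- The error per row is stated with the final number `N` of rows, so that it does not change
    -- along the induction.
    have hnN : (n : ℝ) ≤ N := by exact_mod_cast (Nat.le_succ n).trans hn
    have hdet2 : n * δ₀ + (n * δ₀ ^ 2 + v) / δ₁ ≤ N * δ₀ + (N * δ₀ ^ 2 + v) / δ₁ := by gcongr
    have hyd : y ⬝ᵥ V⁻¹ *ᵥ y = d * ζ := by rw [hζ]; field_simp
    rw [hratio, hdet, Real.log_mul hsPD.det_pos.ne' hqζ.ne', hsum]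
    rw [hyd] at hanti
    push_cast
    have := mul_le_mul_of_nonneg_left hlog (by positivity : (0 : ℝ) ≤ d / 2)
    linarith

/-! ### Exponential integrals over triangular arrays and a net argument -/

lemma lintegral_pi_prod {α : Type*} [MeasurableSpace α] (μ : Measure α) [SigmaFinite μ] :
    ∀ {n : ℕ} (f : Fin n → α → ℝ≥0∞), (∀ i, Measurable (f i)) →
    ∫⁻ x, ∏ i, f i (x i) ∂(Measure.pi fun _ => μ) = ∏ i, ∫⁻ x, f i x ∂μ
  | 0, f, _ => by simp
  | n + 1, f, hf => by
    rw [lintegral_pi_succ]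
    simp only [Fin.prod_univ_castSucc, Fin.snoc_castSucc, Fin.snoc_last]
    rw [lintegral_prod_mul (f := fun X : Fin n → α => ∏ i : Fin n, f i.castSucc (X i))
      (g := fun x => f (Fin.last n) x), lintegral_pi_prod μ (fun i => f i.castSucc) fun i => hf _]
    · exact (Finset.measurable_prod _ fun i _ => (hf _).comp (measurable_pi_apply i)).aemeasurable
    · exact (hf _).aemeasurable

namespace Tri

/-- Half the sum of `f i j (A i j)` over `i ≠ j`. -/
noncomputable def pairSum {n : ℕ} (f : Fin n → Fin n → ℝ → ℝ) (A : Tri n) : ℝ :=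
  (∑ i, ∑ j, if i = j then 0 else f i j (mat A i j)) / 2

lemma sum_eq_pairSum {n : ℕ} (f : ℝ → ℝ) (A : Tri n) : sum f A = pairSum (fun _ _ => f) A := by
  rw [pairSum, ← two_mul_sum]; ring

lemma pairSum_succ {n : ℕ} (f : Fin (n + 1) → Fin (n + 1) → ℝ → ℝ) (hf : ∀ i j, f i j = f j i)
    (A : Tri (n + 1)) :
    pairSum f A = pairSum (fun i j => f i.castSucc j.castSucc) A.1
      + ∑ j, f (Fin.last n) j.castSucc (A.2 j) := by
  simp only [pairSum, Fin.sum_univ_castSucc, mat_last_castSucc, mat_castSucc_last,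
    mat_castSucc_castSucc, Finset.sum_add_distrib, Fin.castSucc_inj, Fin.castSucc_ne_last,
    (Fin.castSucc_ne_last _).symm, if_false, if_true, add_zero,
    fun j : Fin n => hf j.castSucc (Fin.last n)]
  ring

lemma measurable_pairSum {n : ℕ} (f : Fin n → Fin n → ℝ → ℝ) (hf : ∀ i j, Measurable (f i j)) :
    Measurable (pairSum f) := by
  unfold pairSum
  refine Measurable.div_const (Finset.measurable_sum _ fun i _ => Finset.measurable_sum _ fun j _ => ?_) _
  split_ifs
  · exact measurable_const
  · exact (hf i j).comp (measurable_mat i j)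

/-- Independence of the entries turns the one-variable moment bound into a product. Here `θ` is a
tilt common to all entries and `t` the direction of a Chernoff bound; each unordered pair is counted
twice and halved. -/
lemma lintegral_exp_pairSum_le (ν : Measure ℝ) [SigmaFinite ν] {Z m θ : ℝ} (hZ : 0 ≤ Z)
    (hν : ∀ t, ∫⁻ y, ENNReal.ofReal (Real.exp ((t + θ) * y)) ∂ν
      ≤ ENNReal.ofReal (Z * Real.exp (m * t + t ^ 2))) :
    ∀ {n : ℕ} (t : Fin n → Fin n → ℝ), (∀ i j, t i j = t j i) →
    ∫⁻ A, ENNReal.ofReal (Real.exp (pairSum (fun i j y => (t i j + θ) * y) A)) ∂law ν n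
      ≤ ENNReal.ofReal (Z ^ n.choose 2 * Real.exp
        ((∑ i, ∑ j, if i = j then 0 else (m * t i j + t i j ^ 2)) / 2))
  | 0, t, _ => by
    have : ∀ A : Tri 0, pairSum (fun i j y => (t i j + θ) * y) A = 0 := fun A => by simp [pairSum]
    simp only [this]
    have h2 := lintegral_dirac' () (measurable_const (a := ENNReal.ofReal (Real.exp 0)) (β := Unit))
    refine (le_of_eq h2).trans ?_
    simp
  | n + 1, t, ht => by
    have hs : ∀ A : Tri (n + 1), ENNReal.ofReal (Real.exp (pairSum (fun i j y => (t i j + θ) * y) A))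
        = ENNReal.ofReal (Real.exp (pairSum (fun i j y => (t i.castSucc j.castSucc + θ) * y) A.1))
          * ∏ j, ENNReal.ofReal (Real.exp ((t (Fin.last n) j.castSucc + θ) * A.2 j)) := fun A => by
      rw [pairSum_succ _ (fun i j => by rw [ht]), Real.exp_add, ENNReal.ofReal_mul (Real.exp_pos _).le,
        Real.exp_sum, ENNReal.ofReal_prod_of_nonneg fun _ _ => (Real.exp_pos _).le]
    simp only [hs]
    have hm1 : Measurable fun A : Tri n => ENNReal.ofReal
        (Real.exp (pairSum (fun i j y => (t i.castSucc j.castSucc + θ) * y) A)) :=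
      (measurable_pairSum _ fun i j => by fun_prop).exp.ennreal_ofReal
    have hm2 : ∀ j : Fin n, Measurable fun y : ℝ => ENNReal.ofReal
        (Real.exp ((t (Fin.last n) j.castSucc + θ) * y)) := fun j => by fun_prop
    have hm3 : Measurable fun y : Fin n → ℝ => ∏ j, ENNReal.ofReal
        (Real.exp ((t (Fin.last n) j.castSucc + θ) * y j)) :=
      Finset.measurable_prod _ fun j _ => (hm2 j).comp (measurable_pi_apply j)
    have h1 := lintegral_prod_mul (μ := law ν n) (ν := Measure.pi fun _ : Fin n => ν)
      hm1.aemeasurable hm3.aemeasurable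
    refine (le_of_eq h1).trans ?_
    rw [lintegral_pi_prod ν _ hm2]
    refine (mul_le_mul' (lintegral_exp_pairSum_le ν hZ hν _ fun i j => ht _ _)
      (Finset.prod_le_prod' fun j _ => hν _)).trans ?_
    rw [← ENNReal.ofReal_prod_of_nonneg fun _ _ => mul_nonneg hZ (Real.exp_pos _).le,
      ← ENNReal.ofReal_mul (mul_nonneg (pow_nonneg hZ _) (Real.exp_pos _).le)]
    apply le_of_eq
    congr 1
    rw [Finset.prod_mul_distrib, ← Real.exp_sum, Finset.prod_const, Finset.card_univ, Fintype.card_fin,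
      mul_mul_mul_comm, ← pow_add, ← Real.exp_add]
    have hc : (n + 1).choose 2 = n.choose 2 + n := by
      rw [Nat.choose_succ_succ' n 1, Nat.choose_one_right, add_comm]
    rw [hc]
    congr 2
    simp only [Fin.sum_univ_castSucc, Finset.sum_add_distrib, Fin.castSucc_inj, Fin.castSucc_ne_last,
      (Fin.castSucc_ne_last _).symm, if_false, if_true, add_zero,
      fun j : Fin n => ht j.castSucc (Fin.last n)]
    ring

end Tri

/-- The symmetric matrix `∑ k, s k • q k (q k)ᵀ`. -/
def signedGram {R n : ℕ} (s : Fin R → ℝ) (q : Fin R → Fin n → ℝ) (i j : Fin n) : ℝ :=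
  ∑ k, s k * (q k i * q k j)

lemma signedGram_sub_le {R n : ℕ} {s : Fin R → ℝ} (hs : ∀ k, s k = 1 ∨ s k = -1)
    {q q' : Fin R → Fin n → ℝ} {B ε : ℝ} (hq : ∀ k i, |q k i| ≤ B) (hq' : ∀ k i, |q' k i| ≤ B)
    (hqq : ∀ k i, |q' k i - q k i| ≤ ε) (i j : Fin n) :
    |signedGram s q' i j - signedGram s q i j| ≤ R * (2 * B * ε) := by
  rw [signedGram, signedGram, ← Finset.sum_sub_distrib]
  refine (Finset.abs_sum_le_sum_abs _ _).trans ?_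
  have : ∀ k ∈ Finset.univ, |s k * (q' k i * q' k j) - s k * (q k i * q k j)| ≤ 2 * B * ε := by
    intro k _
    have hs1 : |s k| = 1 := by rcases hs k with h | h <;> simp [h]
    rw [← mul_sub, abs_mul, hs1, one_mul]
    have e : q' k i * q' k j - q k i * q k j
        = (q' k i - q k i) * q' k j + q k i * (q' k j - q k j) := by ring
    rw [e]
    refine (abs_add_le _ _).trans ?_
    rw [abs_mul, abs_mul]
    have h1 := mul_le_mul (hqq k i) (hq' k j) (abs_nonneg _) ((abs_nonneg _).trans (hqq k i))
    have h2 := mul_le_mul (hq k i) (hqq k j) (abs_nonneg _) ((abs_nonneg _).trans (hq k i))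
    linarith
  refine (Finset.sum_le_sum this).trans ?_
  simp

lemma signedGram_abs_le {R n : ℕ} {s : Fin R → ℝ} (hs : ∀ k, s k = 1 ∨ s k = -1)
    {q : Fin R → Fin n → ℝ} {B : ℝ} (hq : ∀ k i, |q k i| ≤ B) (i j : Fin n) :
    |signedGram s q i j| ≤ R * B ^ 2 := by
  refine (Finset.abs_sum_le_sum_abs _ _).trans ?_
  have : ∀ k ∈ Finset.univ, |s k * (q k i * q k j)| ≤ B ^ 2 := by
    intro k _
    have hs1 : |s k| = 1 := by rcases hs k with h | h <;> simp [h]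
    rw [abs_mul, hs1, one_mul, abs_mul, sq]
    exact mul_le_mul (hq k i) (hq k j) (abs_nonneg _) ((abs_nonneg _).trans (hq k i))
  refine (Finset.sum_le_sum this).trans ?_
  simp

/-- Every point of `[-B, B]` is close to a grid point. -/
lemma exists_grid {B N : ℕ} (hN : 0 < N) {x : ℝ} (hx : |x| ≤ B) :
    ∃ j : Fin (2 * B * N + 1), |((j : ℕ) : ℝ) / N - B| ≤ B ∧ |((j : ℕ) : ℝ) / N - B - x| ≤ 1 / N := by
  obtain ⟨h1, h2⟩ := abs_le.1 hx
  have hN' : (0 : ℝ) < N := Nat.cast_pos.2 hN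
  have h0 : 0 ≤ (x + B) * N := mul_nonneg (by linarith) hN'.le
  have hf := Nat.floor_le h0
  have hf2 := Nat.lt_floor_add_one ((x + B) * N)
  have hlt : ⌊(x + B) * N⌋₊ < 2 * B * N + 1 := by
    rw [Nat.lt_succ_iff]
    refine Nat.floor_le_of_le ?_
    push_cast
    exact mul_le_mul_of_nonneg_right (by linarith) hN'.le
  refine ⟨⟨_, hlt⟩, ?_, ?_⟩
  · have e1 : (⌊(x + B) * N⌋₊ : ℝ) / N ≤ x + B := (div_le_iff₀ hN').2 hf
    have e2 : (0 : ℝ) ≤ (⌊(x + B) * N⌋₊ : ℝ) / N := by positivity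
    rw [abs_le]
    constructor <;> simp only <;> linarith
  · have e1 : (⌊(x + B) * N⌋₊ : ℝ) / N ≤ x + B := (div_le_iff₀ hN').2 hf
    have e2 : x + B - 1 / N ≤ (⌊(x + B) * N⌋₊ : ℝ) / N := by
      rw [le_div_iff₀ hN', sub_mul, one_div_mul_cancel hN'.ne']; linarith
    rw [abs_le]
    have : (0 : ℝ) < 1 / N := by positivity
    constructor <;> simp only <;> linarith

/-- Bound for exponential functionals in the presence of finitely many outliers: the total weight is
not larger than that of the exponential of the linear part. -/
theorem exists_lintegral_le_of_outliers (R B : ℕ) {F M ζ : ℝ} (hF : 0 ≤ F) (hM : 0 ≤ M)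
    (hζ : 0 < ζ) :
    ∃ n₀ : ℕ, ∀ n ≥ n₀, ∀ (ν : Measure ℝ) [SigmaFinite ν] (Z m θ : ℝ), 0 ≤ Z → |m| ≤ M →
      (∀ t, ∫⁻ y, ENNReal.ofReal (Real.exp ((t + θ) * y)) ∂ν
        ≤ ENNReal.ofReal (Z * Real.exp (m * t + t ^ 2))) →
      ∀ Φ : Tri n → ℝ≥0∞, (∀ A, Φ A ≠ 0 → Tri.sum (fun y => y ^ 2) A ≤ F * n ^ 2 ∧
        ∃ (s : Fin R → ℝ) (q : Fin R → Fin n → ℝ), (∀ k, s k = 1 ∨ s k = -1) ∧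
          (∀ k i, |q k i| ≤ B) ∧
          ∑ i, ∑ j, signedGram s q i j ^ 2 - ζ ≤
            (∑ i, ∑ j, if i = j then 0 else signedGram s q i j * (A.mat i j - m)) / n ∧
          Φ A ≤ ENNReal.ofReal (Real.exp (θ * Tri.sum (fun y => y) A
            + n ^ 2 / 8 * ∑ i, ∑ j, signedGram s q i j ^ 2))) →
      ∃ H : Tri n → ℝ≥0∞, Measurable H ∧ (∀ A, Φ A ≤ H A) ∧
        ∫⁻ A, H A ∂Tri.law ν n ≤ ENNReal.ofReal (Z ^ n.choose 2 * Real.exp (2 * ζ * n ^ 2)) := by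
  -- the error terms are negligible
  set c₁ : ℝ := R * (2 * B) * (2 * (R * B ^ 2)) with hc₁
  set c₂ : ℝ := R * (2 * B) * (1 + 2 * F + M) with hc₂
  have hlim : ∀ᶠ n : ℕ in atTop,
      (c₁ / n + c₂ / n) + (R * Real.log 2 + R * Real.log (2 * B * (n : ℝ) ^ 3 + 1) * n) / n ^ 2 ≤ ζ := by
    have hl : Tendsto (fun n : ℕ => (c₁ / n + c₂ / n)
        + (R * Real.log 2 + R * Real.log (2 * B * (n : ℝ) ^ 3 + 1) * n) / n ^ 2) atTop (𝓝 0) := by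
      have h1 := tendsto_const_div_atTop_nhds_zero_nat c₁
      have h2 := tendsto_const_div_atTop_nhds_zero_nat c₂
      have h3 : Tendsto (fun n : ℕ => R * Real.log 2 / (n : ℝ) ^ 2) atTop (𝓝 0) :=
        tendsto_const_nhds.div_atTop
          ((tendsto_pow_atTop two_ne_zero).comp tendsto_natCast_atTop_atTop)
      have h4 : Tendsto (fun n : ℕ => Real.log (2 * B * (n : ℝ) ^ 3 + 1) / n) atTop (𝓝 0) := by
        have hup : Tendsto (fun n : ℕ => Real.log (2 * B + 1) / n + 3 * (Real.log n / n)) atTop (𝓝 0) := by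
          have e1 := tendsto_const_div_atTop_nhds_zero_nat (Real.log (2 * B + 1))
          have e2 := (Real.isLittleO_log_id_atTop.tendsto_div_nhds_zero).comp
            (tendsto_natCast_atTop_atTop (R := ℝ))
          simpa using e1.add (e2.const_mul 3)
        refine squeeze_zero' ?_ ?_ hup
        · filter_upwards with n
          exact div_nonneg (Real.log_nonneg (le_add_of_nonneg_left (by positivity))) (by positivity)
        · filter_upwards [eventually_ge_atTop 1] with n hn
          have hn' : (1 : ℝ) ≤ n := by exact_mod_cast hn
          have : Real.log (2 * B * (n : ℝ) ^ 3 + 1) ≤ Real.log (2 * B + 1) + 3 * Real.log n := by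
            rw [show (3 : ℝ) * Real.log n = Real.log ((n : ℝ) ^ 3) by rw [Real.log_pow]; norm_num,
              ← Real.log_mul (by positivity) (by positivity)]
            apply Real.log_le_log (by positivity)
            have : 1 ≤ (n : ℝ) ^ 3 := one_le_pow₀ hn'
            nlinarith
          calc _ ≤ (Real.log (2 * B + 1) + 3 * Real.log n) / n := by gcongr
            _ = _ := by ring
      have h5 := (h1.add h2).add (h3.add (h4.const_mul (R : ℝ)))
      simp only [add_zero, mul_zero] at h5
      refine h5.congr' ?_
      filter_upwards [eventually_ge_atTop 1] with n hn
      have hn' : (n : ℝ) ≠ 0 := by positivity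
      field_simp
    exact hl.eventually_le_const hζ
  obtain ⟨n₀, hn₀⟩ := eventually_atTop.1 (hlim.and (eventually_ge_atTop 1))
  refine ⟨n₀, fun n hn ν _ Z m θ hZ hm hν Φ hΦ => ?_⟩
  obtain ⟨herr, hn1⟩ := hn₀ n hn
  have hn1' : (1 : ℝ) ≤ n := by exact_mod_cast hn1
  have hnpos : (0 : ℝ) < n := by linarith
  -- With mesh `n⁻³` the rounding errors over all `n²` entries add up to `O(1/n)`, while the net has
  -- only `exp(O(n log n))` points, negligible against `exp(ζn²)`.
  set N := n ^ 3 with hN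
  have hNpos : 0 < N := by positivity
  set G : ℕ := 2 * B * N + 1 with hG
  set val : (Fin R → Fin n → Fin G) → Fin R → Fin n → ℝ := fun w k i => ((w k i : ℕ) : ℝ) / N - B
    with hval
  set sg : (Fin R → Bool) → Fin R → ℝ := fun b k => if b k then 1 else -1 with hsg
  set P : (Fin R → Fin n → Fin G) × (Fin R → Bool) → Fin n → Fin n → ℝ := fun w =>
    signedGram (sg w.2) (val w.1) with hP
  -- One Chernoff functional per point of the net: the linear form in the direction `(n/2) P`,
  -- together with the tilt `θ`, minus the quadratic cost.
  set f : (Fin R → Fin n → Fin G) × (Fin R → Bool) → Tri n → ℝ≥0∞ := fun w A =>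
    ENNReal.ofReal (Real.exp (Tri.pairSum (fun i j y => (n / 2 * P w i j + θ) * y) A)) *
      ENNReal.ofReal (Real.exp (-(n ^ 2 / 8 * ∑ i, ∑ j, P w i j ^ 2)
        - n / 4 * m * (∑ i, ∑ j, if i = j then 0 else P w i j)
        + n ^ 2 * (ζ + c₁ / n + c₂ / n))) with hf
  have hPs : ∀ w i j, P w i j = P w j i := fun w i j => by
    simp only [hP, signedGram]
    exact Finset.sum_congr rfl fun k _ => by ring
  have hpoint : ∀ A, Φ A ≤ ∑ w, f w A := fun A => by
    by_cases hA : Φ A = 0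
    · simp [hA]
    obtain ⟨hsq, s, q, hs, hq, hPA, hΦA⟩ := hΦ A hA
    choose w hw1 hw2 using fun k i => exists_grid hNpos (hq k i)
    set b : Fin R → Bool := fun k => decide (s k = 1)
    have hsb : sg b = s := by
      funext k
      rcases hs k with h | h <;> simp [hsg, b, h]
      norm_num
    refine le_trans ?_ (Finset.single_le_sum (f := fun w => f w A) (fun _ _ => zero_le)
      (Finset.mem_univ (w, b)))
    simp only [hf]
    rw [← ENNReal.ofReal_mul (Real.exp_pos _).le, ← Real.exp_add]
    refine hΦA.trans (ENNReal.ofReal_le_ofReal (Real.exp_le_exp.2 ?_))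
    have hPw : P (w, b) = signedGram s (val w) := by simp only [hP, hsb]
    rw [hPw]
    set p := signedGram s q
    set p' := signedGram s (val w)
    have hd : ∀ i j, |p' i j - p i j| ≤ R * (2 * B) / n ^ 3 := fun i j => by
      refine (signedGram_sub_le hs hq hw1 hw2 i j).trans (le_of_eq ?_)
      rw [hN]; push_cast; ring
    have hb1 : ∀ i j, |p i j| ≤ R * B ^ 2 := signedGram_abs_le hs hq
    have hb2 : ∀ i j, |p' i j| ≤ R * B ^ 2 := signedGram_abs_le hs hw1
    have hsqd : |∑ i, ∑ j, p' i j ^ 2 - ∑ i, ∑ j, p i j ^ 2| ≤ c₁ / n := by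
      simp only [← Finset.sum_sub_distrib]
      refine (Finset.abs_sum_le_sum_abs _ _).trans ((Finset.sum_le_sum fun i _ =>
        (Finset.abs_sum_le_sum_abs _ _).trans (Finset.sum_le_sum fun j _ =>
          (show |p' i j ^ 2 - p i j ^ 2| ≤ c₁ / n ^ 3 from ?_))).trans ?_)
      · rw [sq_sub_sq, abs_mul, mul_comm]
        refine (mul_le_mul (hd i j) ((abs_add_le _ _).trans (add_le_add (hb2 i j) (hb1 i j)))
          (abs_nonneg _) (by positivity)).trans (le_of_eq ?_)
        rw [hc₁]; ring
      · simp only [Finset.sum_const, Finset.card_univ, Fintype.card_fin, nsmul_eq_mul]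
        apply le_of_eq; field_simp
    have hsqsum : ∑ i, ∑ j, (if i = j then 0 else A.mat i j ^ 2) ≤ 2 * F * n ^ 2 := by
      rw [← Tri.two_mul_sum (fun y => y ^ 2)]; linarith
    have hlin : |(∑ i, ∑ j, if i = j then 0 else p' i j * (A.mat i j - m))
        - ∑ i, ∑ j, if i = j then 0 else p i j * (A.mat i j - m)| ≤ c₂ / n := by
      simp only [← Finset.sum_sub_distrib]
      refine (Finset.abs_sum_le_sum_abs _ _).trans ((Finset.sum_le_sum fun i _ =>
        (Finset.abs_sum_le_sum_abs _ _).trans (Finset.sum_le_sum fun j _ =>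
          (show _ ≤ R * (2 * B) / n ^ 3 * (1 + M + (if i = j then 0 else A.mat i j ^ 2)) from ?_))).trans ?_)
      · split_ifs with h
        · simp only [sub_self, abs_zero]; positivity
        · rw [← sub_mul, abs_mul]
          refine mul_le_mul (hd i j) ?_ (abs_nonneg _) (by positivity)
          refine (abs_sub _ _).trans ?_
          have : |A.mat i j| ≤ 1 + A.mat i j ^ 2 := by
            rw [abs_le]; constructor <;> nlinarith [sq_nonneg (A.mat i j + 1), sq_nonneg (A.mat i j - 1)]
          linarith
      · simp only [← Finset.mul_sum, Finset.sum_add_distrib, Finset.sum_const, Finset.card_univ,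
          Fintype.card_fin, nsmul_eq_mul]
        calc _ ≤ R * (2 * B) / n ^ 3 * (n * (n * (1 : ℝ)) + n * (n * M) + 2 * F * n ^ 2) := by gcongr
          _ = c₂ / n := by rw [hc₂]; field_simp; ring
    have hlin' : (∑ i, ∑ j, if i = j then 0 else p i j * (A.mat i j - m)) / n
        ≤ (∑ i, ∑ j, if i = j then 0 else p' i j * (A.mat i j - m)) / n + c₂ / n := by
      have h1 := (abs_le.1 hlin).1
      have h2 : (∑ i, ∑ j, if i = j then 0 else p i j * (A.mat i j - m))
        ≤ (∑ i, ∑ j, if i = j then 0 else p' i j * (A.mat i j - m)) + c₂ / n := by linarith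
      have h3 : c₂ / n / n ≤ c₂ / n := div_le_self (by positivity) hn1'
      calc _ ≤ ((∑ i, ∑ j, if i = j then 0 else p' i j * (A.mat i j - m)) + c₂ / n) / n := by gcongr
        _ ≤ _ := by rw [add_div]; linarith
    have hps : Tri.pairSum (fun i j y => (n / 2 * p' i j + θ) * y) A
        = n / 4 * (∑ i, ∑ j, if i = j then 0 else p' i j * (A.mat i j - m))
          + n / 4 * m * (∑ i, ∑ j, if i = j then 0 else p' i j)
          + θ * Tri.sum (fun y => y) A := by
      rw [Tri.sum_eq_pairSum, Tri.pairSum, Tri.pairSum]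
      simp only [Finset.mul_sum, Finset.sum_div, ← Finset.sum_add_distrib]
      refine Finset.sum_congr rfl fun i _ => Finset.sum_congr rfl fun j _ => ?_
      split_ifs <;> ring
    rw [hps]
    set S := ∑ i, ∑ j, p i j ^ 2
    set S' := ∑ i, ∑ j, p' i j ^ 2
    set L := ∑ i, ∑ j, if i = j then 0 else p' i j * (A.mat i j - m)
    have hS := abs_le.1 hsqd
    have hc10 : 0 ≤ c₁ / n := by positivity
    have hc20 : 0 ≤ c₂ / n := by positivity
    have key : S' ≤ L / n + c₂ / n + ζ + c₁ / n := by linarith [hS.2]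
    -- The hypothesis says that the pairing with `A - m` is at least the squared norm, up to errors.
    -- Hence `n²S'/8 = n²S'/4 - n²S'/8` is dominated by the linear form minus `n²S'/8`.
    have key2 : n ^ 2 / 4 * S' ≤ n / 4 * L + n ^ 2 / 4 * (c₂ / n + ζ + c₁ / n) := by
      have := mul_le_mul_of_nonneg_left key (by positivity : (0 : ℝ) ≤ n ^ 2 / 4)
      have e : (n : ℝ) ^ 2 / 4 * (L / n) = n / 4 * L := by field_simp
      nlinarith
    have key3 : n ^ 2 / 8 * S ≤ n ^ 2 / 8 * S' + n ^ 2 / 8 * (c₁ / n) := by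
      rw [← mul_add]; gcongr; linarith [hS.1]
    have key4 : (0 : ℝ) ≤ n ^ 2 * (c₂ / n) := by positivity
    have key5 : (0 : ℝ) ≤ n ^ 2 * (c₁ / n) := by positivity
    have key6 : (0 : ℝ) ≤ n ^ 2 * ζ := by positivity
    linarith
  have hfm : ∀ w, Measurable (f w) := fun w =>
    ((Tri.measurable_pairSum _ fun i j => by fun_prop).exp.ennreal_ofReal).mul_const _
  -- The exponential moment of the linear form costs exactly the `n²/8` times squared norm that `f`
  -- subtracts, so every point of the net contributes no more than `Z` to the number of pairs, up to
  -- the error factor.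
  have hfint : ∀ w, ∫⁻ A, f w A ∂Tri.law ν n
      ≤ ENNReal.ofReal (Z ^ n.choose 2 * Real.exp (n ^ 2 * (ζ + c₁ / n + c₂ / n))) := fun w => by
    simp only [hf]
    rw [lintegral_mul_const _ (Tri.measurable_pairSum _ fun i j => by fun_prop).exp.ennreal_ofReal]
    refine (mul_le_mul_left (Tri.lintegral_exp_pairSum_le ν hZ hν (fun i j => n / 2 * P w i j)
      fun i j => by rw [hPs]) _).trans ?_
    rw [← ENNReal.ofReal_mul (mul_nonneg (pow_nonneg hZ _) (Real.exp_pos _).le), mul_assoc,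
      ← Real.exp_add]
    refine ENNReal.ofReal_le_ofReal (mul_le_mul_of_nonneg_left (Real.exp_le_exp.2 ?_) (pow_nonneg hZ _))
    have : (∑ i, ∑ j, if i = j then 0 else (m * (n / 2 * P w i j) + (n / 2 * P w i j) ^ 2)) / 2
        ≤ n / 4 * m * (∑ i, ∑ j, if i = j then 0 else P w i j)
          + n ^ 2 / 8 * ∑ i, ∑ j, P w i j ^ 2 := by
      simp only [Finset.mul_sum, Finset.sum_div, ← Finset.sum_add_distrib]
      refine Finset.sum_le_sum fun i _ => Finset.sum_le_sum fun j _ => ?_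
      split_ifs
      · simp; positivity
      · apply le_of_eq; ring
    linarith
  refine ⟨fun A => ∑ w, f w A, Finset.measurable_sum _ fun w _ => hfm w, hpoint, ?_⟩
  calc ∫⁻ A, ∑ w, f w A ∂Tri.law ν n
      = ∑ w, ∫⁻ A, f w A ∂Tri.law ν n := lintegral_finsetSum _ fun w _ => hfm w
    _ ≤ ∑ _w : (Fin R → Fin n → Fin G) × (Fin R → Bool),
        ENNReal.ofReal (Z ^ n.choose 2 * Real.exp (n ^ 2 * (ζ + c₁ / n + c₂ / n))) :=
        Finset.sum_le_sum fun w _ => hfint w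
    _ ≤ _ := by
        rw [Finset.sum_const, Finset.card_univ, nsmul_eq_mul, ← ENNReal.ofReal_natCast,
          ← ENNReal.ofReal_mul (Nat.cast_nonneg _)]
        apply ENNReal.ofReal_le_ofReal
        have hcard : (Fintype.card ((Fin R → Fin n → Fin G) × (Fin R → Bool)) : ℝ)
            = Real.exp (R * Real.log 2 + R * Real.log (2 * B * (n : ℝ) ^ 3 + 1) * n) := by
          simp only [Fintype.card_prod, Fintype.card_fun, Fintype.card_fin, Fintype.card_bool]
          push_cast
          rw [Real.exp_add, mul_comm (R : ℝ) (Real.log 2), Real.exp_mul, Real.exp_log (by norm_num),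
            Real.rpow_natCast, show (R : ℝ) * Real.log (2 * B * (n : ℝ) ^ 3 + 1) * n
              = Real.log (2 * B * (n : ℝ) ^ 3 + 1) * ((n * R : ℕ) : ℝ) by push_cast; ring,
            Real.exp_mul, Real.exp_log (by positivity), Real.rpow_natCast, pow_mul]
          simp only [hG, hN]; push_cast; ring
        rw [hcard, mul_left_comm, ← Real.exp_add]
        refine mul_le_mul_of_nonneg_left (Real.exp_le_exp.2 ?_) (pow_nonneg hZ _)
        have e := mul_le_mul_of_nonneg_left herr (by positivity : (0 : ℝ) ≤ n ^ 2)
        rw [mul_add, mul_div_cancel₀ _ (by positivity)] at e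
        linarith

/-! ### Gram matrices with inner products in a given set -/

lemma continuous_gram {n d : ℕ} (i j : Fin n) :
    Continuous fun X : Fin n → Fin d → ℝ => gram X i j := by
  simp only [gram_apply, dotProduct]
  fun_prop

lemma isClosed_goodRows (δ₀ δ₁ z v : ℝ) (n d : ℕ) :
    IsClosed {X : Fin n → Fin d → ℝ | GoodRows δ₀ δ₁ z v X} := by
  have h : {X : Fin n → Fin d → ℝ | GoodRows δ₀ δ₁ z v X} =
      (⋂ i, {X | gram X i i ≤ 1 + δ₀}) ∩ (⋂ i, {X | 1 - δ₀ ≤ gram X i i}) ∩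
      (⋂ w : Fin n → ℝ, {X | δ₁ * (w ⬝ᵥ w) ≤ w ⬝ᵥ gram X *ᵥ w}) ∩
      {X | ∑ i, ∑ j, (if i = j then 0 else gram X i j ^ 2) ≤ v} ∩
      ⋂ i, {X | ∑ j, (if i = j then 0 else gram X i j ^ 2) ≤ z * δ₁} := by
    ext X
    simp only [mem_inter_iff, mem_iInter]
    exact ⟨fun h => ⟨⟨⟨⟨h.1, h.2⟩, h.3⟩, h.4⟩, h.5⟩, fun h => ⟨h.1.1.1.1, h.1.1.1.2, h.1.1.2, h.1.2, h.2⟩⟩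
  have hrow : ∀ i : Fin n, Continuous fun X : Fin n → Fin d → ℝ =>
      ∑ j, (if i = j then 0 else gram X i j ^ 2) := fun i => by
    refine continuous_finsetSum _ fun j _ => ?_
    split_ifs
    · exact continuous_const
    · exact (continuous_gram i j).pow 2
  rw [h]
  refine (((IsClosed.inter ?_ ?_).inter ?_).inter ?_).inter ?_
  · exact isClosed_iInter fun i => isClosed_le (continuous_gram i i) continuous_const
  · exact isClosed_iInter fun i => isClosed_le continuous_const (continuous_gram i i)
  · refine isClosed_iInter fun w => isClosed_le continuous_const ?_
    simp only [dotProduct, Matrix.mulVec]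
    exact continuous_finsetSum _ fun i _ => continuous_const.mul
      (continuous_finsetSum _ fun j _ => (continuous_gram i j).mul continuous_const)
  · exact isClosed_le (continuous_finsetSum _ fun i _ => hrow i) continuous_const
  · exact isClosed_iInter fun i => isClosed_le (hrow i) continuous_const

lemma measurable_gramTri {d : ℕ} : ∀ {n : ℕ}, Measurable (gramTri : (Fin n → Fin d → ℝ) → Tri n)
  | 0 => measurable_const
  | n + 1 => by
    have h1 : Measurable (initRows : (Fin (n + 1) → Fin d → ℝ) → Fin n → Fin d → ℝ) :=
      measurable_pi_lambda _ fun i => measurable_pi_apply _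
    have h2 : Measurable fun X : Fin (n + 1) → Fin d → ℝ => rowMat (initRows X) *ᵥ X (Fin.last n) := by
      refine measurable_pi_lambda _ fun i => ?_
      simp only [rowMat_mulVec, initRows, dotProduct]
      fun_prop
    exact (measurable_gramTri.comp h1).prodMk h2

lemma GoodRows.sum_sq_gramTri_le {δ₀ δ₁ z v : ℝ} {n d : ℕ} (hd : 0 < d) {X : Fin n → Fin d → ℝ}
    (h : GoodRows δ₀ δ₁ z v X) : Tri.sum (fun y => y ^ 2) (gramTri X) ≤ v * d / 2 := by
  have hd' : (0 : ℝ) < d := Nat.cast_pos.2 hd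
  have h1 := Tri.two_mul_sum (fun y => y ^ 2) (gramTri X)
  have h2 : ∑ i, ∑ j, (if i = j then 0 else (gramTri X).mat i j ^ 2)
      = (∑ i, ∑ j, (if i = j then 0 else gram X i j ^ 2)) * d := by
    simp only [Finset.sum_mul]
    refine Finset.sum_congr rfl fun i _ => Finset.sum_congr rfl fun j _ => ?_
    split_ifs with hij
    · simp
    · rw [mat_gramTri X i j hij, gram_apply, div_pow, Real.sq_sqrt hd'.le]
      field_simp
  have := mul_le_mul_of_nonneg_right h.sum_sq hd'.le
  linarith

/-- Good configurations with inner products in a given set: the density is bounded by outliers. -/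
theorem exists_gaussRows_goodRows_le (R B : ℕ) {F M ζ : ℝ} (hF : 0 ≤ F) (hM : 0 ≤ M) (hζ : 0 < ζ) :
    ∃ n₀ : ℕ, ∀ n ≥ n₀, ∀ (d : ℕ), 0 < d → ∀ (S : Set ℝ), MeasurableSet S →
      ∀ (Z m θ K δ₀ δ₁ z : ℝ), 0 ≤ Z → |m| ≤ M → 0 ≤ δ₀ → 0 < δ₁ → z < 1 →
      (∀ t, ∫⁻ y in S, ENNReal.ofReal (Real.exp ((t + θ) * y)) ∂stdNormal
        ≤ ENNReal.ofReal (Z * Real.exp (m * t + t ^ 2))) →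
      (∀ A : Tri n, A.All S → Tri.sum (fun y => y ^ 2) A ≤ F * n ^ 2 →
        (∀ w : Fin n → ℝ, δ₁ * (w ⬝ᵥ w) ≤ w ⬝ᵥ A.shifted (1 + δ₀) d *ᵥ w) →
        ∃ (s : Fin R → ℝ) (q : Fin R → Fin n → ℝ), (∀ k, s k = 1 ∨ s k = -1) ∧
          (∀ k i, |q k i| ≤ B) ∧
          ∑ i, ∑ j, signedGram s q i j ^ 2 - ζ ≤
            (∑ i, ∑ j, if i = j then 0 else signedGram s q i j * (A.mat i j - m)) / n ∧
          n * ((n * δ₀ + (n * δ₀ ^ 2 + 2 * F * n ^ 2 / d) / δ₁) / 2)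
            + Tri.sum (fun y => y ^ 2) A / 2
            + d * (1 - z) / 2 * (Real.log (A.shifted (1 + δ₀) d).det - n * Real.log (1 + δ₀))
            ≤ K + θ * Tri.sum (fun y => y) A + n ^ 2 / 8 * ∑ i, ∑ j, signedGram s q i j ^ 2) →
      gaussRows n d {X | GoodRows δ₀ δ₁ z (2 * F * n ^ 2 / d) X ∧ (gramTri X).All S}
        ≤ ENNReal.ofReal (Z ^ n.choose 2 * Real.exp (K + 2 * ζ * n ^ 2)) := by
  classical
  obtain ⟨n₀, hn₀⟩ := exists_lintegral_le_of_outliers R B hF hM hζ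
  refine ⟨n₀, fun n hn d hd S hS Z m θ K δ₀ δ₁ z hZ hm hδ₀ hδ₁ hz hν hpt => ?_⟩
  have hd' : (0 : ℝ) < d := Nat.cast_pos.2 hd
  set D : Tri n → ℝ := fun A => n * ((n * δ₀ + (n * δ₀ ^ 2 + 2 * F * n ^ 2 / d) / δ₁) / 2)
            + Tri.sum (fun y => y ^ 2) A / 2
            + d * (1 - z) / 2 * (Real.log (A.shifted (1 + δ₀) d).det - n * Real.log (1 + δ₀)) with hD
  set cond : Tri n → Prop := fun A => A.All S ∧ Tri.sum (fun y => y ^ 2) A ≤ F * n ^ 2 ∧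
    ∀ w : Fin n → ℝ, δ₁ * (w ⬝ᵥ w) ≤ w ⬝ᵥ A.shifted (1 + δ₀) d *ᵥ w with hcond
  -- The bound for the density, normalised by `exp K`, on the arrays that come from good rows; it
  -- vanishes elsewhere, and no measurability of it is required.
  set Φ : Tri n → ℝ≥0∞ := fun A => if cond A then ENNReal.ofReal (Real.exp (D A - K)) else 0 with hΦ
  obtain ⟨H, hHm, hΦH, hHint⟩ := hn₀ n hn (stdNormal.restrict S) Z m θ hZ hm hν Φ fun A hA => by
    have hc : cond A := by
      by_contra hc; simp [hΦ, hc] at hA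
    obtain ⟨s, q, hs, hq, h1, h2⟩ := hpt A hc.1 hc.2.1 hc.2.2
    refine ⟨hc.2.1, s, q, hs, hq, h1, ?_⟩
    simp only [hΦ, if_pos hc]
    exact ENNReal.ofReal_le_ofReal (Real.exp_le_exp.2 (by simp only [hD]; linarith))
  set H' : Tri n → ℝ≥0∞ := {A : Tri n | A.All S}.indicator
    fun A => ENNReal.ofReal (Real.exp K) * H A with hH'
  have hH'm : Measurable H' := (hHm.const_mul _).indicator (Tri.measurableSet_all hS n)
  have hset : MeasurableSet {X : Fin n → Fin d → ℝ |
      GoodRows δ₀ δ₁ z (2 * F * n ^ 2 / d) X ∧ (gramTri X).All S} :=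
    (isClosed_goodRows _ _ _ _ n d).measurableSet.inter
      (measurable_gramTri (Tri.measurableSet_all hS n))
  refine (gaussRows_le_lintegral hH'm hset fun X hX => ?_).trans ?_
  · have hg : GoodRows δ₀ δ₁ z (2 * F * n ^ 2 / d) X := hX.1
    have hPD := hg.gram_posDef hδ₁
    refine ⟨hPD, ?_⟩
    have hc : cond (gramTri X) := by
      refine ⟨hX.2, ?_, hg.shifted_ge⟩
      refine (hg.sum_sq_gramTri_le hd).trans (le_of_eq ?_)
      field_simp
    have h1 := hg.log_gramRatio_le hδ₀ hδ₁ hz (by positivity) hd le_rfl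
    have h2 : gramRatio X ≤ Real.exp K * Real.exp (D (gramTri X) - K) := by
      rw [← Real.exp_add, ← Real.log_le_iff_le_exp (gramRatio_pos hPD)]
      simp only [hD]; linarith
    have h3 := hΦH (gramTri X)
    simp only [hΦ, if_pos hc] at h3
    rw [hH', indicator_of_mem (show gramTri X ∈ {A : Tri n | A.All S} from hX.2)]
    calc ENNReal.ofReal (gramRatio X) ≤ ENNReal.ofReal (Real.exp K * Real.exp (D (gramTri X) - K)) :=
          ENNReal.ofReal_le_ofReal h2
      _ = ENNReal.ofReal (Real.exp K) * ENNReal.ofReal (Real.exp (D (gramTri X) - K)) :=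
          ENNReal.ofReal_mul (Real.exp_pos _).le
      _ ≤ _ := by gcongr
  · rw [hH', lintegral_indicator (Tri.measurableSet_all hS n), ← Tri.law_restrict,
      lintegral_const_mul _ hHm]
    refine (mul_le_mul_right hHint _).trans (le_of_eq ?_)
    rw [← ENNReal.ofReal_mul (Real.exp_pos _).le, Real.exp_add]
    ring_nf

/-! ### Outlier eigenvalues -/

/-- Padding by `none` fixes the number of outliers at `R`, independently of the matrix, so that one
net serves all matrices. -/
lemma exists_fin_enumeration {κ : Type*} (O : Finset κ) : ∀ R : ℕ, O.card ≤ R →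
    ∃ e : Fin R → Option κ, (∀ k i, e k = some i → i ∈ O) ∧
      ∀ f : κ → ℝ, ∑ k, (e k).elim 0 f = ∑ i ∈ O, f i := by
  classical
  induction O using Finset.induction_on with
  | empty => exact fun R _ => ⟨fun _ => none, by simp, by simp⟩
  | insert a O ha ih =>
    intro R hR
    rw [Finset.card_insert_of_notMem ha] at hR
    obtain ⟨R, rfl⟩ : ∃ R', R = R' + 1 := ⟨R - 1, by omega⟩
    obtain ⟨e, he, hsum⟩ := ih R (by omega)
    refine ⟨Fin.cons (some a) e, fun k i => ?_, fun f => ?_⟩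
    · refine Fin.cases ?_ (fun k => ?_) k
      · simp only [Fin.cons_zero, Option.some.injEq]; rintro rfl; exact Finset.mem_insert_self _ _
      · simp only [Fin.cons_succ]; exact fun h => Finset.mem_insert_of_mem (he k i h)
    · rw [Fin.sum_univ_succ, Finset.sum_insert ha, ← hsum f]
      simp

section
variable {κ : Type*} [Fintype κ] [DecidableEq κ]

lemma conj_diagonal_apply (U : Matrix κ κ ℝ) (a : κ → ℝ) (i j : κ) :
    (U * Matrix.diagonal a * Uᵀ) i j = ∑ k, a k * (U i k * U j k) := by
  rw [Matrix.mul_apply]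
  refine Finset.sum_congr rfl fun k _ => ?_
  rw [Matrix.mul_diagonal, Matrix.transpose_apply]; ring

lemma sum_mul_of_diagonalization {U : Matrix κ κ ℝ} (h2 : Uᵀ * U = 1) (a b : κ → ℝ) :
    ∑ i, ∑ j, (U * Matrix.diagonal a * Uᵀ) i j * (U * Matrix.diagonal b * Uᵀ) i j
      = ∑ k, a k * b k := by
  have h : ∑ i, ∑ j, (U * Matrix.diagonal a * Uᵀ) i j * (U * Matrix.diagonal b * Uᵀ) i j
      = ((U * Matrix.diagonal a * Uᵀ) * (U * Matrix.diagonal b * Uᵀ)ᵀ).trace := by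
    simp only [Matrix.trace, Matrix.diag_apply, Matrix.mul_apply, Matrix.transpose_apply]
  have e : (U * Matrix.diagonal a * Uᵀ) * (U * Matrix.diagonal b * Uᵀ)ᵀ
      = U * Matrix.diagonal (fun k => a k * b k) * Uᵀ := by
    rw [Matrix.transpose_mul, Matrix.transpose_mul, Matrix.transpose_transpose,
      Matrix.diagonal_transpose]
    calc U * Matrix.diagonal a * Uᵀ * (U * (Matrix.diagonal b * Uᵀ))
        = U * Matrix.diagonal a * (Uᵀ * U) * Matrix.diagonal b * Uᵀ := by
          simp only [Matrix.mul_assoc]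
      _ = _ := by
          rw [h2, mul_one, Matrix.mul_assoc U, Matrix.diagonal_mul_diagonal]
  rw [h, e, trace_of_diagonalization h2 rfl]

end

/-- The part of a symmetric matrix that belongs to finitely many outlier eigenvalues, as a signed
sum of squares. -/
lemma exists_signedGram_outliers {n : ℕ} {U : Matrix (Fin n) (Fin n) ℝ} {l : Fin n → ℝ}
    (h2 : Uᵀ * U = 1) {L η : ℝ} (hη : 0 < η) (hL : ∑ i, l i ^ 2 ≤ L) {R B : ℕ}
    (hR : L / η ^ 2 ≤ R) (hB : L ≤ (B : ℝ) ^ 4) (O : Finset (Fin n)) (hO : ∀ i ∈ O, η ≤ |l i|) (σ : ℝ)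
    (hσ : σ = 1 ∨ σ = -1) :
    ∃ (s : Fin R → ℝ) (q : Fin R → Fin n → ℝ), (∀ k, s k = 1 ∨ s k = -1) ∧
      (∀ k i, |q k i| ≤ B) ∧ signedGram s q
        = U * Matrix.diagonal (fun k => if k ∈ O then σ * l k else 0) * Uᵀ := by
  -- Each outlier contributes at least `η²` to the squared Hilbert–Schmidt norm, which is at most
  -- `L`.
  have hcard : O.card ≤ R := by
    have h1 : O.card * η ^ 2 ≤ L := by
      refine le_trans ?_ hL
      rw [← nsmul_eq_mul]
      refine (Finset.card_nsmul_le_sum O (fun i => l i ^ 2) (η ^ 2) fun i hi => ?_).trans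
        (Finset.sum_le_univ_sum_of_nonneg fun i => sq_nonneg _)
      rw [← sq_abs (l i)]
      exact pow_le_pow_left₀ hη.le (hO i hi) 2
    have h3 : (O.card : ℝ) ≤ L / η ^ 2 := by rwa [le_div_iff₀ (by positivity)]
    exact_mod_cast h3.trans hR
  obtain ⟨e, he, hsum⟩ := exists_fin_enumeration O R hcard
  have hB0 : (0 : ℝ) ≤ B := Nat.cast_nonneg B
  refine ⟨fun k => (e k).elim 1 fun i => if 0 ≤ σ * l i then 1 else -1,
    fun k j => (e k).elim 0 fun i => √|l i| * U j i, fun k => ?_, fun k j => ?_, ?_⟩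
  · cases h : e k with
    | none => simp [h]
    | some i => simp only [h, Option.elim_some]; split_ifs <;> simp
  · cases h : e k with
    | none => simp [h]
    | some i =>
      simp only [h, Option.elim_some]
      have hU : |U j i| ≤ 1 := by
        have h1 := col_dotProduct_col h2 i i
        rw [if_pos rfl, dotProduct] at h1
        have h4 := Finset.single_le_sum (f := fun k => U k i * U k i)
          (fun k _ => mul_self_nonneg (U k i)) (Finset.mem_univ j)
        rw [h1] at h4
        exact abs_le_one_iff_mul_self_le_one.2 h4
      have hl : l i ^ 2 ≤ (B : ℝ) ^ 4 :=
        (Finset.single_le_sum (f := fun i => l i ^ 2) (fun i _ => sq_nonneg _)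
          (Finset.mem_univ i)).trans (hL.trans hB)
      have hl2 : |l i| ≤ (B : ℝ) ^ 2 := abs_le_of_sq_le_sq (by nlinarith) (by positivity)
      have hl3 : √|l i| ≤ B := Real.sqrt_le_iff.2 ⟨hB0, hl2⟩
      rw [abs_mul, abs_of_nonneg (Real.sqrt_nonneg _)]
      calc √|l i| * |U j i| ≤ B * 1 := mul_le_mul hl3 hU (abs_nonneg _) hB0
        _ = B := mul_one _
  · ext a b
    rw [conj_diagonal_apply, signedGram]
    have : ∀ k, ((e k).elim 1 fun i => if 0 ≤ σ * l i then 1 else -1) *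
        (((e k).elim 0 fun i => √|l i| * U a i) * ((e k).elim 0 fun i => √|l i| * U b i))
        = (e k).elim 0 fun i => σ * l i * (U a i * U b i) := fun k => by
      cases h : e k with
      | none => simp
      | some i =>
        simp only [Option.elim]
        have hs : √|l i| * √|l i| = |l i| := Real.mul_self_sqrt (abs_nonneg _)
        have habs : |l i| = |σ * l i| := by rcases hσ with h | h <;> simp [h]
        split_ifs with h0
        · rw [abs_of_nonneg h0] at habs
          linear_combination (U a i * U b i) * hs + (U a i * U b i) * habs
        · rw [abs_of_neg (not_le.1 h0)] at habs
          linear_combination -(U a i * U b i) * hs - (U a i * U b i) * habs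
    simp only [this]
    rw [hsum fun i => σ * l i * (U a i * U b i)]
    rw [← Finset.sum_filter_add_sum_filter_not Finset.univ (fun k => k ∈ O)
      (fun k => (if k ∈ O then σ * l k else 0) * (U a k * U b k))]
    rw [Finset.sum_eq_zero (s := Finset.univ.filter fun k => k ∉ O), add_zero]
    · rw [Finset.filter_mem_eq_inter, Finset.univ_inter]
      exact Finset.sum_congr rfl fun k hk => by rw [if_pos hk]
    · intro k hk
      rw [if_neg (Finset.mem_filter.1 hk).2, zero_mul]

/-- The logarithm of the determinant in terms of the eigenvalues. -/
lemma log_det_shifted {n d : ℕ} (hn : 0 < n) (hd : 0 < d) {q : ℝ} (hq : 0 < q) (A : Tri n)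
    {U : Matrix (Fin n) (Fin n) ℝ} {l : Fin n → ℝ} (h2 : Uᵀ * U = 1) (h1 : U * Uᵀ = 1)
    (hA : (-(n : ℝ)⁻¹) • A.mat = U * Matrix.diagonal l * Uᵀ)
    (hl : ∀ i, n / (q * √(d : ℝ)) * l i < 1) :
    Real.log (A.shifted q d).det - n * Real.log q
      = -(Tri.sum (fun y => y ^ 2) A / (q ^ 2 * d)) - ∑ i, logRem (n / (q * √(d : ℝ)) * l i) := by
  have hn' : (0 : ℝ) < n := Nat.cast_pos.2 hn
  have hd' : (0 : ℝ) < d := Nat.cast_pos.2 hd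
  have hsd : 0 < √(d : ℝ) := Real.sqrt_pos.2 hd'
  set e := n / (q * √(d : ℝ)) with he
  have hsh : A.shifted q d = q • (1 : Matrix (Fin n) (Fin n) ℝ) + (-(q * e)) • ((-(n : ℝ)⁻¹) • A.mat) := by
    rw [Tri.shifted, smul_smul]
    congr 2
    rw [he]; field_simp
  rw [hsh, det_one_add_smul_of_diagonalization h1 hA,
    Real.log_prod fun i _ => by have := hl i; nlinarith]
  have e1 : ∀ i, Real.log (q + -(q * e) * l i)
      = Real.log q + (-(e * l i) - (e * l i) ^ 2 / 2 - logRem (e * l i)) := fun i => by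
    have : q + -(q * e) * l i = q * (1 - e * l i) := by ring
    rw [this, Real.log_mul hq.ne' (by linarith [hl i]), logRem]; ring
  simp only [e1, Finset.sum_add_distrib, Finset.sum_sub_distrib, Finset.sum_const, Finset.card_univ,
    Fintype.card_fin, nsmul_eq_mul]
  -- The diagonal of the array is zero, so the linear term of `log det` vanishes. The quadratic term
  -- is the sum of squares that later cancels the one in the density.
  have htr : ∑ i, e * l i = 0 := by
    rw [← Finset.mul_sum, ← trace_of_diagonalization h2 hA, Matrix.trace_smul, Matrix.trace]
    simp [Tri.mat_diag]
  have hsq : ∑ i, (e * l i) ^ 2 / 2 = Tri.sum (fun y => y ^ 2) A / (q ^ 2 * d) := by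
    have h3 : ∑ i, l i ^ 2 = 2 * Tri.sum (fun y => y ^ 2) A / n ^ 2 := by
      rw [Tri.two_mul_sum, Finset.sum_div]
      have := sum_mul_of_diagonalization h2 l l
      rw [← hA] at this
      simp only [← sq] at this
      rw [← this]
      refine Finset.sum_congr rfl fun i _ => ?_
      rw [Finset.sum_div]
      refine Finset.sum_congr rfl fun j _ => ?_
      split_ifs with h
      · subst h; simp [Tri.mat_diag]
      · simp only [Matrix.smul_apply, smul_eq_mul]; ring
    simp only [mul_pow]
    rw [← Finset.sum_div, ← Finset.mul_sum, h3, he, div_pow, mul_pow, Real.sq_sqrt hd'.le]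
    field_simp
  have htr' : ∑ i, -(e * l i) = 0 := by rw [Finset.sum_neg_distrib, htr, neg_zero]
  rw [htr', hsq]; ring

/-! ### Red cliques on good configurations -/

lemma Tri.sum_mat_eq {n : ℕ} (A : Tri n) : ∑ i, ∑ j, A.mat i j = 2 * Tri.sum (fun y => y) A := by
  rw [Tri.two_mul_sum]
  refine Finset.sum_congr rfl fun i _ => Finset.sum_congr rfl fun j _ => ?_
  split_ifs with h
  · subst h; exact Tri.mat_diag A i
  · rfl

lemma Tri.sum_mat_sq_eq {n : ℕ} (A : Tri n) :
    ∑ i, ∑ j, A.mat i j ^ 2 = 2 * Tri.sum (fun y => y ^ 2) A := by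
  rw [Tri.two_mul_sum]
  refine Finset.sum_congr rfl fun i _ => Finset.sum_congr rfl fun j _ => ?_
  split_ifs with h
  · subst h; simp [Tri.mat_diag A i]
  · rfl

lemma Tri.sum_le_of_all {n : ℕ} {c : ℝ} {A : Tri n} (hA : A.All (Iic (-c))) :
    2 * Tri.sum (fun y => y) A ≤ -(c * (n * (n - 1))) := by
  rw [Tri.two_mul_sum]
  calc ∑ i, ∑ j, (if i = j then 0 else A.mat i j) ≤ ∑ i : Fin n, ∑ j : Fin n, (-c + if i = j then c else 0) := by
        refine Finset.sum_le_sum fun i _ => Finset.sum_le_sum fun j _ => ?_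
        split_ifs with h
        · simp
        · simpa using hA i j h
    _ = _ := by simp [Finset.sum_add_distrib]; ring

lemma Tri.mat_neg_smul_isSymm {n : ℕ} (A : Tri n) (t : ℝ) : (t • A.mat).IsSymm := by
  ext i j
  simp [Tri.mat_symm A i j]

lemma Tri.dotProduct_shifted {n d : ℕ} (hn : 0 < n) (hd : 0 < d) {q : ℝ} (hq : 0 < q) (A : Tri n)
    (w : Fin n → ℝ) :
    w ⬝ᵥ A.shifted q d *ᵥ w
      = q * (w ⬝ᵥ w - n / (q * √(d : ℝ)) * (w ⬝ᵥ ((-(n : ℝ)⁻¹) • A.mat) *ᵥ w)) := by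
  have hn' : (0 : ℝ) < n := Nat.cast_pos.2 hn
  have hd' : 0 < √(d : ℝ) := Real.sqrt_pos.2 (Nat.cast_pos.2 hd)
  rw [Tri.shifted, Matrix.add_mulVec, dotProduct_add, Matrix.smul_mulVec, Matrix.smul_mulVec,
    Matrix.smul_mulVec, Matrix.one_mulVec, dotProduct_smul, dotProduct_smul, dotProduct_smul]
  simp only [smul_eq_mul]
  field_simp
  ring

-- In a red clique `M = -A/n` has nonnegative entries. Its top eigenvalue is at least the Rayleigh
-- quotient of the constant vector, and convexity of `logRem` replaces it by a tangent line in that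
-- quotient. Other positive eigenvalues are dropped because `logRem` is nonnegative there. Negative
-- eigenvalues above `-η` cost a cubic error. Those below `-η` are collected in the positive
-- semidefinite matrix `signedGram s v`, at a cost of a quarter of its squared norm.
set_option maxHeartbeats 1000000 in
theorem Tri.red_log_det_le {n d : ℕ} (hn : 0 < n) (hd : 0 < d) {q δ₁ F η b c : ℝ} (hq : 0 < q)
    (hδ₁ : 0 < δ₁) (hη : 0 < η) (hb0 : 0 ≤ b) (hb1 : b < 1) (hc : 0 ≤ c) {R B : ℕ}
    (hR : 2 * F / η ^ 2 ≤ R) (hB : 2 * F ≤ (B : ℝ) ^ 4) {A : Tri n} (hA : A.All (Iic (-c)))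
    (hF : Tri.sum (fun y => y ^ 2) A ≤ F * n ^ 2)
    (hquad : ∀ w : Fin n → ℝ, δ₁ * (w ⬝ᵥ w) ≤ w ⬝ᵥ A.shifted q d *ᵥ w) :
    n / (q * √(d : ℝ)) * (-(2 * Tri.sum (fun y => y) A) / n ^ 2) < 1 ∧
    ∃ (s : Fin R → ℝ) (v : Fin R → Fin n → ℝ), (∀ k, s k = 1 ∨ s k = -1) ∧ (∀ k i, |v k i| ≤ B) ∧
      (∀ m ≤ 0, ∑ i, ∑ j, signedGram s v i j ^ 2 + m * (2 * F / η) / n ≤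
        (∑ i, ∑ j, if i = j then 0 else signedGram s v i j * (A.mat i j - m)) / n) ∧
      Real.log (A.shifted q d).det - n * Real.log q
        ≤ -(Tri.sum (fun y => y ^ 2) A / (q ^ 2 * d)) - logRem b
          - logRemDeriv b * (n / (q * √(d : ℝ)) * (-(2 * Tri.sum (fun y => y) A) / n ^ 2) - b)
          + (n / (q * √(d : ℝ))) ^ 2 / 4 * (∑ i, ∑ j, signedGram s v i j ^ 2)
          + (n / (q * √(d : ℝ))) ^ 3 * η / 3 * (2 * F) := by
  have hn' : (0 : ℝ) < n := Nat.cast_pos.2 hn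
  have hd' : 0 < √(d : ℝ) := Real.sqrt_pos.2 (Nat.cast_pos.2 hd)
  set e := n / (q * √(d : ℝ)) with he
  have he0 : 0 < e := by positivity
  set M := (-(n : ℝ)⁻¹) • A.mat with hM
  obtain ⟨U, l, h2, h1, hMU⟩ := (Tri.mat_neg_smul_isSymm A (-(n : ℝ)⁻¹)).exists_diagonalization
  rw [← hM] at hMU
  have hM0 : ∀ i j, 0 ≤ M i j := fun i j => by
    rw [hM, Matrix.smul_apply, smul_eq_mul]
    by_cases h : i = j
    · subst h; simp [Tri.mat_diag]
    · have : A.mat i j ≤ -c := hA i j h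
      have : 0 ≤ (n : ℝ)⁻¹ := by positivity
      nlinarith
  have hMq : ∀ w : Fin n → ℝ, e * (w ⬝ᵥ M *ᵥ w) ≤ (1 - δ₁ / q) * (w ⬝ᵥ w) := fun w => by
    have h := hquad w
    rw [Tri.dotProduct_shifted hn hd hq] at h
    have h' : δ₁ / q * (w ⬝ᵥ w) ≤ w ⬝ᵥ w - e * (w ⬝ᵥ M *ᵥ w) := by
      rw [div_mul_eq_mul_div, div_le_iff₀ hq]; linarith
    linarith
  have hlt : 1 - δ₁ / q < 1 := by have : 0 < δ₁ / q := by positivity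
                                  linarith
  have hcol : ∀ i, (fun k => U k i) ⬝ᵥ (fun k => U k i) = 1 := fun i => by
    rw [col_dotProduct_col h2, if_pos rfl]
  have hleig : ∀ i, (fun k => U k i) ⬝ᵥ M *ᵥ (fun k => U k i) = l i := fun i => by
    rw [mulVec_col_of_diagonalization h2 hMU, dotProduct_smul, hcol, smul_eq_mul, mul_one]
  have hxlt : ∀ i, e * l i < 1 := fun i => by
    have := hMq fun k => U k i
    rw [hcol, hleig] at this; linarith
  -- Perron–Frobenius: replacing an eigenvector by its entrywise absolute value bounds the modulus
  -- of a negative eigenvalue by the largest value of the quadratic form.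
  have hxgt : ∀ i, -(e * l i) ≤ 1 := fun i => by
    have h := hMq fun k => |U k i|
    have e1 : (fun k => |U k i|) ⬝ᵥ (fun k => |U k i|) = 1 := by
      rw [← hcol i]; exact Finset.sum_congr rfl fun k _ => abs_mul_abs_self _
    have e2 : -(l i) ≤ (fun k => |U k i|) ⬝ᵥ M *ᵥ (fun k => |U k i|) := by
      rw [← hleig i]
      simp only [dotProduct, Matrix.mulVec, Finset.mul_sum, ← Finset.sum_neg_distrib]
      refine Finset.sum_le_sum fun a _ => Finset.sum_le_sum fun b _ => ?_
      have h3 : -(U a i * U b i) ≤ |U a i| * |U b i| := by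
        rw [← abs_mul]; exact neg_le_abs _
      nlinarith [hM0 a b]
    rw [e1] at h
    nlinarith
  -- the top eigenvalue
  have hone : (1 : Fin n → ℝ) ⬝ᵥ M *ᵥ 1 = -(2 * Tri.sum (fun y => y) A) / n := by
    rw [← Tri.sum_mat_eq]
    simp only [dotProduct, Matrix.mulVec, hM, Matrix.smul_apply, smul_eq_mul, Pi.one_apply, one_mul,
      mul_one, ← Finset.mul_sum]
    field_simp
  have hone' : (1 : Fin n → ℝ) ⬝ᵥ 1 = n := by simp [dotProduct]
  set X := e * (-(2 * Tri.sum (fun y => y) A) / n ^ 2) with hX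
  have hX1 : X < 1 := by
    have h := hMq 1
    rw [hone, hone'] at h
    have : X = e * (-(2 * Tri.sum (fun y => y) A) / n) / n := by rw [hX]; field_simp
    rw [this, div_lt_one hn']
    nlinarith
  have hX0 : 0 ≤ X := by
    have h3 := Tri.sum_le_of_all hA
    have : (1 : ℝ) ≤ n := by exact_mod_cast hn
    have h4 : 0 ≤ c * (n * (n - 1)) := mul_nonneg hc (mul_nonneg hn'.le (by linarith))
    exact mul_nonneg he0.le (div_nonneg (by linarith) (by positivity))
  refine ⟨hX1, ?_⟩
  have : Nonempty (Fin n) := ⟨⟨0, hn⟩⟩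
  obtain ⟨i₀, hi₀⟩ := Finite.exists_max fun i => e * l i
  have hXle : X ≤ e * l i₀ := by
    have h3 := dotProduct_mulVec_of_diagonalization hMU 1 1
    have h4 := dotProduct_of_orthogonal h1 (1 : Fin n → ℝ) 1
    rw [hone] at h3
    rw [hone'] at h4
    have h5 : e * (-(2 * Tri.sum (fun y => y) A) / n) ≤ e * l i₀ * n := by
      rw [h3, h4, Finset.mul_sum, Finset.mul_sum]
      refine Finset.sum_le_sum fun i _ => ?_
      rw [← mul_assoc]
      exact mul_le_mul_of_nonneg_right (hi₀ i) (mul_self_nonneg _)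
    have : X = e * (-(2 * Tri.sum (fun y => y) A) / n) / n := by rw [hX]; field_simp
    rw [this, div_le_iff₀ hn']; exact h5
  -- outliers
  classical
  set O : Finset (Fin n) := Finset.univ.filter fun i => l i < -η with hO
  have hl2 : ∑ i, l i ^ 2 ≤ 2 * F := by
    have h3 := sum_mul_of_diagonalization h2 l l
    rw [← hMU] at h3
    simp only [← sq] at h3
    rw [← h3]
    have : ∑ i, ∑ j, M i j ^ 2 = (∑ i, ∑ j, A.mat i j ^ 2) / n ^ 2 := by
      simp only [Finset.sum_div]
      refine Finset.sum_congr rfl fun i _ => Finset.sum_congr rfl fun j _ => ?_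
      rw [hM, Matrix.smul_apply, smul_eq_mul]; field_simp
    rw [this, Tri.sum_mat_sq_eq, div_le_iff₀ (by positivity)]
    linarith
  have hF0 : 0 ≤ 2 * F := (Finset.sum_nonneg fun i _ => sq_nonneg (l i)).trans hl2
  obtain ⟨s, v, hs, hv, hsv⟩ := exists_signedGram_outliers h2 hη hl2 hR hB O
    (fun i hi => by
      have : l i < -η := (Finset.mem_filter.1 hi).2
      rw [abs_of_neg (by linarith)]; linarith) (-1) (Or.inr rfl)
  have hP2 : ∑ i, ∑ j, signedGram s v i j ^ 2 = ∑ k, if k ∈ O then l k ^ 2 else 0 := by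
    have h3 := sum_mul_of_diagonalization h2 (fun k => if k ∈ O then -1 * l k else 0)
      (fun k => if k ∈ O then -1 * l k else 0)
    rw [← hsv] at h3
    simp only [← sq] at h3
    rw [h3]
    refine Finset.sum_congr rfl fun k _ => ?_
    split_ifs <;> ring
  refine ⟨s, v, hs, hv, fun m hm => ?_, ?_⟩
  · have e1 : (∑ i, ∑ j, if i = j then 0 else signedGram s v i j * (A.mat i j - m))
        = (∑ i, ∑ j, signedGram s v i j * A.mat i j)
          - m * ((∑ i, ∑ j, signedGram s v i j) - ∑ i, signedGram s v i i) := by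
      have : ∀ i, ∑ j, (if i = j then 0 else signedGram s v i j * (A.mat i j - m))
          = ∑ j, signedGram s v i j * A.mat i j - m * (∑ j, signedGram s v i j - signedGram s v i i) := by
        intro i
        have h3 : signedGram s v i i = ∑ j, if i = j then signedGram s v i j else 0 := by simp
        rw [h3, ← Finset.sum_sub_distrib, Finset.mul_sum, ← Finset.sum_sub_distrib]
        refine Finset.sum_congr rfl fun j _ => ?_
        split_ifs with h
        · subst h; rw [Tri.mat_diag]; ring
        · ring
      simp only [this, Finset.sum_sub_distrib, ← Finset.mul_sum]
    have e2 : ∑ i, ∑ j, signedGram s v i j * A.mat i j = n * ∑ k, if k ∈ O then l k ^ 2 else 0 := by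
      have h3 := sum_mul_of_diagonalization h2 (fun k => if k ∈ O then -1 * l k else 0) l
      rw [← hsv, ← hMU] at h3
      have h4 : ∑ i, ∑ j, signedGram s v i j * M i j
          = -(n : ℝ)⁻¹ * ∑ i, ∑ j, signedGram s v i j * A.mat i j := by
        simp only [Finset.mul_sum]
        refine Finset.sum_congr rfl fun i _ => Finset.sum_congr rfl fun j _ => ?_
        rw [hM, Matrix.smul_apply, smul_eq_mul]; ring
      have h5 : ∑ k, (if k ∈ O then -1 * l k else 0) * l k = -∑ k, if k ∈ O then l k ^ 2 else 0 := by
        rw [← Finset.sum_neg_distrib]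
        refine Finset.sum_congr rfl fun k _ => ?_
        split_ifs <;> ring
      rw [h4, h5] at h3
      have : (n : ℝ)⁻¹ * ∑ i, ∑ j, signedGram s v i j * A.mat i j
        = ∑ k, if k ∈ O then l k ^ 2 else 0 := by linarith
      rw [← this]; field_simp
    -- The matrix is positive semidefinite. As `m ≤ 0`, centring the entries at `m` can then only
    -- increase the pairing, except on the diagonal, where the trace bound `e4` makes the loss
    -- `O(1/n)`.
    have e3 : 0 ≤ ∑ i, ∑ j, signedGram s v i j := by
      have h3 := dotProduct_mulVec_of_diagonalization hsv 1 1
      have h4 : (1 : Fin n → ℝ) ⬝ᵥ Matrix.mulVec (signedGram s v) 1 = ∑ i, ∑ j, signedGram s v i j := by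
        simp [dotProduct, Matrix.mulVec]
      rw [← h4]
      refine le_of_le_of_eq ?_ h3.symm
      refine Finset.sum_nonneg fun i _ => mul_nonneg ?_ (mul_self_nonneg _)
      split_ifs with h
      · have : l i < -η := (Finset.mem_filter.1 h).2
        linarith
      · exact le_rfl
    have e4 : ∑ i, signedGram s v i i ≤ 2 * F / η := by
      have h3 : ∑ i, signedGram s v i i = ∑ k, if k ∈ O then -1 * l k else 0 :=
        trace_of_diagonalization (A := signedGram s v) h2 hsv
      rw [h3, le_div_iff₀ hη, Finset.sum_mul]
      refine (Finset.sum_le_sum fun k _ => ?_).trans hl2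
      split_ifs with h
      · have : l k < -η := (Finset.mem_filter.1 h).2
        nlinarith
      · rw [zero_mul]; positivity
    rw [hP2, e1, e2, le_div_iff₀ hn', add_mul, div_mul_cancel₀ _ hn'.ne']
    nlinarith
  · rw [log_det_shifted hn hd hq A h2 h1 hMU hxlt]
    have hbound : ∀ i, -logRem (e * l i)
        ≤ e ^ 2 / 4 * (if i ∈ O then l i ^ 2 else 0) + e ^ 3 * η / 3 * l i ^ 2 := fun i => by
      have hlast : 0 ≤ e ^ 3 * η / 3 * l i ^ 2 := by positivity
      rcases le_or_gt 0 (l i) with h | h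
      · have h3 := logRem_nonneg (mul_nonneg he0.le h) (hxlt i)
        have : 0 ≤ e ^ 2 / 4 * (if i ∈ O then l i ^ 2 else 0) := by
          split_ifs <;> positivity
        linarith
      · have hnn : 0 ≤ -(e * l i) := by nlinarith
        by_cases ho : i ∈ O
        · rw [if_pos ho]
          have h3 := logRem_neg_le hnn (hxgt i)
          rw [neg_neg] at h3
          have h4 : (-(e * l i)) ^ 2 / 4 = e ^ 2 / 4 * l i ^ 2 := by ring
          linarith
        · rw [if_neg ho, mul_zero, zero_add]
          have h3 := logRem_neg_le_cube hnn
          rw [neg_neg] at h3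
          have h4 : -η ≤ l i := by
            by_contra hcon
            exact ho (Finset.mem_filter.2 ⟨Finset.mem_univ _, not_le.1 hcon⟩)
          refine h3.trans ?_
          have : (-(e * l i)) ^ 3 / 3 = e ^ 3 / 3 * (-(l i)) * l i ^ 2 := by ring
          rw [this]
          have : e ^ 3 * η / 3 * l i ^ 2 = e ^ 3 / 3 * η * l i ^ 2 := by ring
          rw [this]
          gcongr
          linarith
    -- The tangent has nonnegative slope, so the top eigenvalue may be lowered to the Rayleigh
    -- quotient `X`.
    have htop : -logRem (e * l i₀) ≤ -logRem b - logRemDeriv b * (X - b) := by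
      have h3 := logRem_tangent hb0 hb1 (hX0.trans hXle) (hxlt i₀)
      have h4 : 0 ≤ logRemDeriv b := div_nonneg (sq_nonneg _) (by linarith)
      nlinarith
    have hsum : -∑ i, logRem (e * l i) ≤ (-logRem b - logRemDeriv b * (X - b))
        + ∑ i, (e ^ 2 / 4 * (if i ∈ O then l i ^ 2 else 0) + e ^ 3 * η / 3 * l i ^ 2) := by
      rw [← Finset.sum_neg_distrib, ← Finset.add_sum_erase _ _ (Finset.mem_univ i₀)]
      refine add_le_add htop ?_
      refine (Finset.sum_le_sum fun i _ => hbound i).trans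
        (Finset.sum_le_univ_sum_of_nonneg fun i => ?_)
      have : 0 ≤ e ^ 3 * η / 3 * l i ^ 2 := by positivity
      split_ifs <;> positivity
    rw [Finset.sum_add_distrib, ← Finset.mul_sum, ← Finset.mul_sum, ← hP2] at hsum
    have h6 : e ^ 3 * η / 3 * ∑ i, l i ^ 2 ≤ e ^ 3 * η / 3 * (2 * F) := by gcongr
    linarith

/-! ### Tilted moments of the lower tail and the arithmetic of the red exponent. -/

lemma lintegral_exp_mul_stdNormal_Iic (t c : ℝ) :
    ∫⁻ y in Iic (-c), ENNReal.ofReal (Real.exp (t * y)) ∂stdNormal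
      = ENNReal.ofReal (Real.exp (t ^ 2 / 2) * normalTail (c + t)) := by
  have h := lintegral_exp_mul_stdNormal_Ici (-t) c
  rw [neg_sq, sub_neg_eq_add] at h
  rw [← h]
  have hm : stdNormal.map (fun y => -y) = stdNormal := by
    have := gaussianReal_map_neg (μ := 0) (v := 1)
    rwa [neg_zero] at this
  conv_rhs => rw [← hm]
  rw [setLIntegral_map measurableSet_Ici (by fun_prop) measurable_neg]
  have : (fun y : ℝ => -y) ⁻¹' Ici c = Iic (-c) := by
    ext y; simp
  rw [this]
  simp

/-- The tilt `θ` is expanded to second order at `c`, which keeps the truncated variance in the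
normalisation. The direction `t` is then expanded at `c + θ`, where the tangent bound and a crude
`t²` suffice. The centre `-(hazard (c + θ) - θ)` is the mean of the tilted law. -/
lemma lintegral_exp_add_mul_stdNormal_Iic_le {c θ : ℝ} (hc : 0 ≤ c) (hθ : 0 ≤ θ) (t : ℝ) :
    ∫⁻ y in Iic (-c), ENNReal.ofReal (Real.exp ((t + θ) * y)) ∂stdNormal
      ≤ ENNReal.ofReal (normalTail c * Real.exp (-(hazard c * θ) + (1 - hazardDeriv c) / 2 * θ ^ 2)
        * Real.exp (-(hazard (c + θ) - θ) * t + t ^ 2)) := by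
  rw [lintegral_exp_mul_stdNormal_Iic]
  refine ENNReal.ofReal_le_ofReal ?_
  have h1 := log_normalTail_add_le (c + θ) t
  have h2 := log_normalTail_add_le_sq hc hθ
  have e1 : c + (t + θ) = c + θ + t := by ring
  rw [e1, ← Real.exp_log (normalTail_pos (c + θ + t)), ← Real.exp_log (normalTail_pos c),
    ← Real.exp_add, ← Real.exp_add, ← Real.exp_add, Real.exp_le_exp]
  nlinarith [sq_nonneg t]

/-- The function `hazard - id` decreases because the truncated variance is nonnegative. Tilting
therefore moves the mean towards `0`, which bounds the centres independently of `θ`. -/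
lemma hazard_add_le {c θ : ℝ} (hc : 0 ≤ c) (hθ : 0 ≤ θ) : hazard (c + θ) - θ ≤ hazard c := by
  have h := antitoneOn_Ici_of_hasDerivAt (f := fun x => hazard x - x) (f' := fun x => hazardDeriv x - 1)
    (a := 0) (fun x hx => (hasDerivAt_hazard x).sub (hasDerivAt_id x)) (fun x hx => by
      have := hazardDeriv_le_one (mem_Ici.1 hx); linarith)
  have := h (mem_Ici.2 hc) (mem_Ici.2 (add_nonneg hc hθ)) (by linarith)
  simp only at this
  linarith

lemma one_sub_mul_le_ratio {δ : ℝ} (h0 : 0 ≤ δ) :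
    1 - 4 * δ ≤ (1 - δ) / (1 + δ) ^ 2 / (1 + δ) := by
  rw [div_div, le_div_iff₀ (by positivity)]
  nlinarith [mul_nonneg h0 h0, mul_nonneg (mul_nonneg h0 h0) h0,
    mul_nonneg (mul_nonneg h0 h0) (mul_nonneg h0 h0)]

/-- The exponent of a tilted red bound, with tangent point `b`, is at most the true one. -/
lemma red_exponent_le {N e κ h s b G lR L θ C₂ E : ℝ} (he : 0 < e) (hκ : 0 ≤ κ) (hκ1 : κ ≤ 1)
    (hs : 0 ≤ s) (hC : C₂ = N ^ 2 / 2 - N / 2) (hθ : θ = κ * G / e)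
    (htan : (h * e) ^ 3 / 6 ≤ lR / 2 + G / 2 * (h * e - b) - s / 4 * G ^ 2) :
    C₂ * (L + (-(h * θ) + s / 2 * θ ^ 2)) + (E - κ * N ^ 2 / (2 * e ^ 2) * (lR - G * b))
      ≤ N ^ 2 / 2 * L - κ * (h ^ 3 * e * N ^ 2 / 6) + E
        - N / 2 * (L + (-(h * θ) + s / 2 * θ ^ 2)) := by
  subst hC hθ
  have h1 : N ^ 2 / 2 * (-(h * (κ * G / e)) + s / 2 * (κ * G / e) ^ 2)
      - κ * N ^ 2 / (2 * e ^ 2) * (lR - G * b)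
      = -(κ * N ^ 2 / e ^ 2) * (lR / 2 + G / 2 * (h * e - b) - s * κ / 4 * G ^ 2) := by
    field_simp
    ring
  have h2 : lR / 2 + G / 2 * (h * e - b) - s / 4 * G ^ 2
      ≤ lR / 2 + G / 2 * (h * e - b) - s * κ / 4 * G ^ 2 := by
    have : s * κ ≤ s := by nlinarith
    nlinarith [sq_nonneg G]
  have h3 : κ * N ^ 2 / e ^ 2 * ((h * e) ^ 3 / 6)
      ≤ κ * N ^ 2 / e ^ 2 * (lR / 2 + G / 2 * (h * e - b) - s * κ / 4 * G ^ 2) :=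
    mul_le_mul_of_nonneg_left (htan.trans h2) (by positivity)
  have h4 : κ * N ^ 2 / e ^ 2 * ((h * e) ^ 3 / 6) = κ * (h ^ 3 * e * N ^ 2 / 6) := by
    field_simp
  linarith

/-- The quadratic term of `log det` cancels the sum of squares in the density up to the factor `1 -
κ`. The outlier term becomes at most `N²/8` times the squared norm, and the slope of the tangent
becomes a tilt `κ G / e` of the sum of the entries. -/
lemma red_pointwise_le {N rd δ δ₁ F η b e e₁ S2 P2 T κ lR G LD : ℝ} (hN : 0 < N) (hrd : 0 < rd)
    (hδ : 0 ≤ δ) (hδ' : δ ≤ 1) (hδ₁ : 0 < δ₁) (hF : 0 ≤ F) (hη : 0 ≤ η)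
    (he : e = N / ((1 + δ) * rd)) (hκ : κ = (1 - δ) / (1 + δ) ^ 2) (hκ1 : κ ≤ 1)
    (he1 : N ≤ e₁ * rd) (hS2 : S2 ≤ F * N ^ 2) (hP2 : 0 ≤ P2)
    (hLD : LD ≤ -(S2 / ((1 + δ) ^ 2 * rd ^ 2)) - lR - G * (e * (-(2 * T) / N ^ 2) - b)
      + e ^ 2 / 4 * P2 + e ^ 3 * η / 3 * (2 * F)) :
    N * ((N * δ + (N * δ ^ 2 + 2 * F * N ^ 2 / rd ^ 2) / δ₁) / 2) + S2 / 2
        + rd ^ 2 * (1 - δ) / 2 * LD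
      ≤ (N ^ 2 * (δ / 2 + δ ^ 2 / (2 * δ₁) + (1 - κ) * F / 2 + e₁ * η * F / 3)
          + F * e₁ ^ 2 * N / δ₁ - κ * N ^ 2 / (2 * e ^ 2) * (lR - G * b))
        + κ * G / e * T + N ^ 2 / 8 * P2 := by
  have hq : 0 < 1 + δ := by linarith
  have he0 : 0 < e := by rw [he]; positivity
  have hrd2 : rd ^ 2 * (1 - δ) = κ * N ^ 2 / e ^ 2 := by
    rw [he, hκ]; field_simp
  have h0 : 0 ≤ κ * N ^ 2 / e ^ 2 := by
    rw [← hrd2]; exact mul_nonneg (by positivity) (by linarith)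
  have hκ0 : 0 ≤ κ := by rw [hκ]; exact div_nonneg (by linarith) (by positivity)
  have h1 := mul_le_mul_of_nonneg_left hLD (div_nonneg h0 two_pos.le)
  have hS : S2 / ((1 + δ) ^ 2 * rd ^ 2) = S2 * e ^ 2 / N ^ 2 := by
    rw [he]; field_simp
  have h2 : κ * N ^ 2 / e ^ 2 / 2 * (-(S2 / ((1 + δ) ^ 2 * rd ^ 2)) - lR - G * (e * (-(2 * T) / N ^ 2) - b)
      + e ^ 2 / 4 * P2 + e ^ 3 * η / 3 * (2 * F))
      = -(κ * S2 / 2) - κ * N ^ 2 / (2 * e ^ 2) * (lR - G * b) + κ * G / e * T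
        + κ * N ^ 2 / 8 * P2 + κ * e * η * F * N ^ 2 / 3 := by
    rw [hS]; field_simp; ring
  have h3 : (1 - κ) * S2 ≤ (1 - κ) * (F * N ^ 2) := mul_le_mul_of_nonneg_left hS2 (by linarith)
  have h4 : κ * (N ^ 2 / 8 * P2) ≤ 1 * (N ^ 2 / 8 * P2) :=
    mul_le_mul_of_nonneg_right hκ1 (by positivity)
  have hee : e ≤ e₁ := by
    rw [he, div_le_iff₀ (by positivity)]
    have : 0 ≤ e₁ := by
      by_contra hcon
      nlinarith
    nlinarith [mul_nonneg (mul_nonneg this hrd.le) hδ]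
  have h5 : κ * e * (η * F * N ^ 2 / 3) ≤ e₁ * (η * F * N ^ 2 / 3) :=
    mul_le_mul_of_nonneg_right (by nlinarith) (by positivity)
  have h6 : N ^ 2 / rd ^ 2 ≤ e₁ ^ 2 := by
    rw [div_le_iff₀ (by positivity), ← mul_pow]
    exact pow_le_pow_left₀ hN.le he1 2
  have h7 : F * N / δ₁ * (N ^ 2 / rd ^ 2) ≤ F * N / δ₁ * e₁ ^ 2 :=
    mul_le_mul_of_nonneg_left h6 (by positivity)
  have h8 : N * ((N * δ + (N * δ ^ 2 + 2 * F * N ^ 2 / rd ^ 2) / δ₁) / 2)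
      = N ^ 2 * (δ / 2 + δ ^ 2 / (2 * δ₁)) + F * N / δ₁ * (N ^ 2 / rd ^ 2) := by
    field_simp
    ring
  have h9 : F * e₁ ^ 2 * N / δ₁ = F * N / δ₁ * e₁ ^ 2 := by ring
  rw [hrd2, h8, h9]
  rw [h2] at h1
  linarith [h1, h3, h4, h5, h7]

/-- The normalisation of the tilted entries and the constant part of the tangent line combine,
through the tangent inequality, into the full cubic term. The remaining errors are of order `δN²`,
`ηN²` or `N`, and are paid by `ζ`. -/
lemma red_total_exponent_le {N rd e₁ e κ h s b G lR L θ δ δ₁ F η ζ : ℝ} (hN : 0 < N) (hrd : 0 < rd)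
    (hh : 0 ≤ h) (he₁ : 0 ≤ e₁) (hδ : 0 ≤ δ) (hδ1 : δ ≤ 1) (hδ₁ : 0 < δ₁) (hF : 0 ≤ F) (hζ : 0 ≤ ζ)
    (he : e = N / ((1 + δ) * rd)) (hκ : κ = (1 - δ) / (1 + δ) ^ 2) (hκ0 : 0 ≤ κ) (hκ1 : κ ≤ 1)
    (hs : 0 ≤ s) (hθ : θ = κ * G / e) (hθ1 : θ ≤ 4 * h ^ 2 * e₁)
    (htan : (h * e) ^ 3 / 6 ≤ lR / 2 + G / 2 * (h * e - b) - s / 4 * G ^ 2)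
    (hδζ : δ * (1 / 2 + 1 / (2 * δ₁) + 2 * F + h ^ 3 * e₁) ≤ ζ / 8) (hηζ : e₁ * η * F / 3 ≤ ζ / 8)
    (hNζ : -L / 2 + 2 * h ^ 3 * e₁ + F * e₁ ^ 2 / δ₁ ≤ ζ / 8 * N) (hNe : N ≤ e₁ * rd) :
    (N ^ 2 / 2 - N / 2) * (L + (-(h * θ) + s / 2 * θ ^ 2))
      + (N ^ 2 * (δ / 2 + δ ^ 2 / (2 * δ₁) + (1 - κ) * F / 2 + e₁ * η * F / 3)
          + F * e₁ ^ 2 * N / δ₁ - κ * N ^ 2 / (2 * e ^ 2) * (lR - G * b) + 2 * (ζ / 8) * N ^ 2)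
      ≤ N ^ 2 / 2 * L - h ^ 3 * N ^ 3 / (6 * rd) + ζ * N ^ 2 := by
  have hq : 0 < 1 + δ := by linarith
  have he0 : 0 < e := by rw [he]; positivity
  have hκ2 : 1 - 4 * δ ≤ κ / (1 + δ) := hκ ▸ one_sub_mul_le_ratio hδ
  have hκ3 : κ / (1 + δ) ≤ κ := div_le_self hκ0 (by linarith)
  have h1 := red_exponent_le (N := N) (L := L) (E := N ^ 2 * (δ / 2 + δ ^ 2 / (2 * δ₁)
    + (1 - κ) * F / 2 + e₁ * η * F / 3) + F * e₁ ^ 2 * N / δ₁) he0 hκ0 hκ1 hs rfl hθ htan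
  have h2 : κ * (h ^ 3 * e * N ^ 2 / 6) = κ / (1 + δ) * (h ^ 3 * N ^ 3 / (6 * rd)) := by
    rw [he]; field_simp
  set T := h ^ 3 * N ^ 3 / (6 * rd) with hT
  have hT0 : 0 ≤ T := by positivity
  have h3 : T ≤ h ^ 3 * e₁ * N ^ 2 / 6 := by
    rw [hT, div_le_iff₀ (by positivity)]
    have : h ^ 3 * N ^ 2 * N ≤ h ^ 3 * N ^ 2 * (e₁ * rd) := by gcongr
    linarith
  have h4 : (1 - 4 * δ) * T ≤ κ / (1 + δ) * T := mul_le_mul_of_nonneg_right hκ2 hT0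
  have h5 : δ * T ≤ δ * (h ^ 3 * e₁ * N ^ 2 / 6) := mul_le_mul_of_nonneg_left h3 hδ
  have h6 : δ / 2 + δ ^ 2 / (2 * δ₁) + (1 - κ) * F / 2 + δ * (h ^ 3 * e₁) ≤ ζ / 8 := by
    refine le_trans ?_ hδζ
    have : δ ^ 2 / (2 * δ₁) ≤ δ * (1 / (2 * δ₁)) := by
      rw [mul_one_div]; gcongr; nlinarith
    have h7 : (1 - κ) * F ≤ 4 * δ * F := mul_le_mul_of_nonneg_right (by linarith) hF
    linarith
  have h7 : -(N / 2 * (L + (-(h * θ) + s / 2 * θ ^ 2))) + F * e₁ ^ 2 * N / δ₁ ≤ ζ / 8 * N * N := by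
    have h8 : h * θ ≤ h * (4 * h ^ 2 * e₁) := mul_le_mul_of_nonneg_left hθ1 hh
    have h9 : 0 ≤ s / 2 * θ ^ 2 := by positivity
    have h10 := mul_le_mul_of_nonneg_right hNζ hN.le
    have h11 : N / 2 * (-L + h * θ - s / 2 * θ ^ 2) ≤ N / 2 * (-L + h * (4 * h ^ 2 * e₁)) :=
      mul_le_mul_of_nonneg_left (by linarith) (by positivity)
    have e1 : F * e₁ ^ 2 * N / δ₁ = F * e₁ ^ 2 / δ₁ * N := by ring
    rw [e1]
    linarith
  have h8 := mul_le_mul_of_nonneg_left h6 (sq_nonneg N)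
  have h9 := mul_le_mul_of_nonneg_left hηζ (sq_nonneg N)
  have h11 : 0 ≤ ζ * N ^ 2 := by positivity
  have h12 : 0 ≤ δ * (h ^ 3 * e₁ * N ^ 2) := by positivity
  rw [h2] at h1
  linarith

/-- Up to `X = 1` the bound `3/8` for the truncated variance, valid at every positive cutoff, is
enough. Beyond that the bound `0.268` is needed, hence the cutoff `0.9`. -/
lemma exists_red_tangent {c e : ℝ} (hc : 0 < c) (he : 0 ≤ e) (h : hazard c * e ≤ 1 ∨ 0.9 ≤ c)
    (hX : hazard c * e ≤ 1.75) :
    ∃ b, 0 ≤ b ∧ b ≤ 3 / 4 ∧ b ≤ hazard c * e ∧ (hazard c * e) ^ 3 / 6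
      ≤ logRem b / 2 + logRemDeriv b / 2 * (hazard c * e - b)
        - (1 - hazardDeriv c) / 4 * logRemDeriv b ^ 2 := by
  have hX0 : 0 ≤ hazard c * e := mul_nonneg (hazard_pos c).le he
  rcases le_or_gt (hazard c * e) 1 with h1 | h1
  · obtain ⟨b, hb0, hb1, hb2, hb3⟩ := exists_tangent_of_le_one hX0 h1
    refine ⟨b, hb0, hb1, hb2, hb3.trans ?_⟩
    have := hazardDeriv_ge hc.le
    nlinarith [sq_nonneg (logRemDeriv b)]
  · have h9 : 0.9 ≤ c := h.resolve_left (by linarith)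
    have := hazardDeriv_ge_of_large h9
    obtain ⟨b, hb0, hb1, hb2, hb3⟩ := exists_tangent_of_one_le h1.le hX
      (s := 1 - hazardDeriv c) (by linarith)
    exact ⟨b, hb0, hb1, hb2, hb3⟩

set_option maxHeartbeats 1000000 in
/-- The probability that good rows form a red clique. -/
theorem exists_gaussRows_red_le {c e₁ δ₁ F ζ : ℝ} (hc : 0 < c) (he₁ : 0 < e₁)
    (h : hazard c * e₁ ≤ 1 ∨ 0.9 ≤ c) (hδ₁ : 0 < δ₁) (hF : 0 ≤ F) (hζ : 0 < ζ) :
    ∃ δ₀ > 0, ∃ z > 0, z < 1 ∧ ∃ n₀ : ℕ, ∀ n ≥ n₀, ∀ d : ℕ, 0 < d → (n : ℝ) ≤ e₁ * √(d : ℝ) →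
      gaussRows n d {X | GoodRows δ₀ δ₁ z (2 * F * n ^ 2 / d) X ∧ (gramTri X).All (Iic (-c))}
        ≤ ENNReal.ofReal (Real.exp (n ^ 2 / 2 * Real.log (normalTail c)
          - hazard c ^ 3 * n ^ 3 / (6 * √(d : ℝ)) + ζ * n ^ 2)) := by
  set h0 := hazard c with hh0
  have hh : 0 < h0 := hazard_pos c
  set L := Real.log (normalTail c) with hL
  have hL0 : L < 0 := Real.log_neg (normalTail_pos c) (normalTail_lt_one c)
  -- parameters
  set Cδ := 1 / 2 + 1 / (2 * δ₁) + 2 * F + h0 ^ 3 * e₁ with hCδ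
  have hCδ0 : 0 < Cδ := by positivity
  set δ := min (1 / 2) (ζ / 8 / Cδ) with hδ
  have hδ0 : 0 < δ := lt_min (by norm_num) (by positivity)
  have hδh : δ ≤ 1 / 2 := min_le_left _ _
  have hδζ : δ * Cδ ≤ ζ / 8 := by
    rw [← le_div_iff₀ hCδ0]; exact min_le_right _ _
  set η := ζ / 8 / (e₁ * (F + 1)) with hη
  have hη0 : 0 < η := by positivity
  have hηζ : e₁ * η * F / 3 ≤ ζ / 8 := by
    have : e₁ * η * (F + 1) = ζ / 8 := by rw [hη]; field_simp
    linarith [mul_pos he₁ hη0, mul_nonneg (mul_pos he₁ hη0).le hF]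
  set R := ⌈2 * F / η ^ 2⌉₊ with hR
  set B := ⌈2 * F⌉₊ + 1 with hB
  have hRle : 2 * F / η ^ 2 ≤ R := Nat.le_ceil _
  have hBle : 2 * F ≤ (B : ℝ) ^ 4 := by
    have h1 : 2 * F ≤ (⌈2 * F⌉₊ : ℝ) := Nat.le_ceil _
    have h2 : (B : ℝ) = (⌈2 * F⌉₊ : ℝ) + 1 := by rw [hB]; push_cast; ring
    have h3 : (1 : ℝ) ≤ B := by rw [h2]; linarith
    calc 2 * F ≤ (B : ℝ) ^ 1 := by rw [pow_one]; linarith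
      _ ≤ (B : ℝ) ^ 4 := pow_le_pow_right₀ h3 (by norm_num)
  obtain ⟨n₁, hn₁⟩ := exists_gaussRows_goodRows_le R B hF hh.le (show 0 < ζ / 8 by positivity)
  set Q := -L / 2 + 2 * h0 ^ 3 * e₁ + F * e₁ ^ 2 / δ₁ with hQ
  refine ⟨δ, hδ0, δ, hδ0, by linarith, max (max n₁ 60) (max ⌈h0 * (2 * F / η) / (ζ / 8)⌉₊ ⌈Q / (ζ / 8)⌉₊),
    fun n hn d hd hnd => ?_⟩
  have hn1 : n₁ ≤ n := (le_max_left _ _).trans ((le_max_left _ _).trans hn)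
  have hn60 : 60 ≤ n := (le_max_right _ _).trans ((le_max_left _ _).trans hn)
  have hn2 : h0 * (2 * F / η) ≤ ζ / 8 * n := by
    rw [← div_le_iff₀' (by positivity)]
    exact (Nat.le_ceil _).trans (Nat.cast_le.2 ((le_max_left _ _).trans ((le_max_right _ _).trans hn)))
  have hn3 : Q ≤ ζ / 8 * n := by
    rw [← div_le_iff₀' (by positivity)]
    exact (Nat.le_ceil _).trans (Nat.cast_le.2 ((le_max_right _ _).trans ((le_max_right _ _).trans hn)))
  have hn0 : 0 < n := by omega
  have hn' : (60 : ℝ) ≤ n := by exact_mod_cast hn60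
  have hnp : (0 : ℝ) < n := by linarith
  have hrd : 0 < √(d : ℝ) := Real.sqrt_pos.2 (Nat.cast_pos.2 hd)
  have hrd2 : √(d : ℝ) ^ 2 = d := Real.sq_sqrt (Nat.cast_nonneg d)
  have hchoose : ((n.choose 2 : ℕ) : ℝ) = (n : ℝ) ^ 2 / 2 - n / 2 := by
    rw [Nat.cast_choose_two]; ring
  set e := n / ((1 + δ) * √(d : ℝ)) with he
  have he0 : 0 < e := by positivity
  have hee : e ≤ e₁ := by
    rw [he, div_le_iff₀ (by positivity)]
    linarith [mul_pos (mul_pos he₁ hrd) hδ0]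
  have hzero : 0 ≤ normalTail c := (normalTail_pos c).le
  have hZexp : ∀ x : ℝ, (normalTail c * Real.exp x) ^ n.choose 2
      = Real.exp (((n : ℝ) ^ 2 / 2 - n / 2) * (L + x)) := fun x => by
    conv_lhs => rw [← Real.exp_log (normalTail_pos c), ← Real.exp_add, ← Real.exp_nat_mul, hchoose]
  -- Below `1.75` a tangent point is available. Above it the hypotheses force `c ≥ 0.9`, and no
  -- array satisfies the conditions at all.
  rcases le_or_gt (h0 * e) 1.75 with hX | hX
  · obtain ⟨b, hb0, hb1, hb2, hb3⟩ := exists_red_tangent hc he0.le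
      (h.imp_left fun h1 => (mul_le_mul_of_nonneg_left hee hh.le).trans h1) hX
    rw [← hh0] at hb2 hb3
    set κ := (1 - δ) / (1 + δ) ^ 2 with hκ
    have hκ0 : 0 ≤ κ := div_nonneg (by linarith) (by positivity)
    have hκ1 : κ ≤ 1 := by rw [hκ, div_le_one (by positivity)]; linarith [sq_nonneg δ]
    set G := logRemDeriv b with hG
    have hG0 : 0 ≤ G := div_nonneg (sq_nonneg _) (by linarith)
    have hG1 : G ≤ 4 * b ^ 2 := by
      rw [hG, logRemDeriv, div_le_iff₀ (by linarith)]; nlinarith [sq_nonneg b]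
    set θ := κ * G / e with hθ
    have hθ0 : 0 ≤ θ := by positivity
    have hθ1 : θ ≤ 4 * h0 ^ 2 * e₁ := by
      rw [hθ, div_le_iff₀ he0]
      calc κ * G ≤ 1 * (4 * (h0 * e) ^ 2) := by
            refine mul_le_mul hκ1 (hG1.trans ?_) hG0 zero_le_one
            gcongr
        _ = 4 * h0 ^ 2 * e * e := by ring
        _ ≤ 4 * h0 ^ 2 * e₁ * e := by gcongr
    set s := 1 - hazardDeriv c with hs
    have hs0 : 0 ≤ s := by have := hazardDeriv_le_one hc.le; linarith
    set m := -(hazard (c + θ) - θ) with hm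
    have hmneg : m ≤ 0 := by have := lt_hazard (c + θ); linarith
    have hmabs : |m| ≤ h0 := by
      rw [abs_of_nonpos hmneg]; have := hazard_add_le hc.le hθ0; linarith
    set K := n ^ 2 * (δ / 2 + δ ^ 2 / (2 * δ₁) + (1 - κ) * F / 2 + e₁ * η * F / 3)
          + F * e₁ ^ 2 * n / δ₁ - κ * n ^ 2 / (2 * e ^ 2) * (logRem b - G * b) with hK
    refine (hn₁ n hn1 d hd (Iic (-c)) measurableSet_Iic
      (normalTail c * Real.exp (-(h0 * θ) + s / 2 * θ ^ 2)) m θ K δ δ₁ δ (by positivity) hmabs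
      hδ0.le hδ₁ (by linarith) (lintegral_exp_add_mul_stdNormal_Iic_le hc.le hθ0) ?_).trans ?_
    · intro A hA hAF hAq
      obtain ⟨-, s', v, hs', hv, hP, hLD⟩ := Tri.red_log_det_le hn0 hd (q := 1 + δ) (by linarith)
        hδ₁ hη0 hb0 (by linarith) hc.le hRle hBle hA hAF hAq
      refine ⟨s', v, hs', hv, ?_, ?_⟩
      · refine le_trans ?_ (hP m hmneg)
        have h1 : -(ζ / 8) ≤ m * (2 * F / η) / n := by
          rw [le_div_iff₀ hnp]
          have : -h0 ≤ m := (abs_le.1 hmabs).1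
          have h2 : 0 ≤ 2 * F / η := by positivity
          have := mul_le_mul_of_nonneg_right this h2
          linarith
        linarith
      · rw [← he] at hLD
        have h1 := red_pointwise_le (κ := κ) hnp hrd hδ0.le (by linarith : δ ≤ 1) hδ₁ hF hη0.le he hκ
          hκ1 hnd hAF (Finset.sum_nonneg fun i _ => Finset.sum_nonneg fun j _ => sq_nonneg _)
          (hLD.trans_eq (by rw [hrd2]))
        rw [hrd2] at h1
        exact h1
    · refine ENNReal.ofReal_le_ofReal ?_
      rw [hZexp, ← Real.exp_add, Real.exp_le_exp]
      exact red_total_exponent_le hnp hrd hh.le he₁.le hδ0.le (by linarith) hδ₁ hF hζ.le he hκ hκ0 hκ1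
        hs0 hθ hθ1 hb3 hδζ hηζ hn3 hnd
  · have h9 : 0.9 ≤ c := h.resolve_left fun h1 => by
      have := mul_le_mul_of_nonneg_left hee hh.le
      linarith
    -- Since `hazard c ≤ 1.72 c` and `1.75/1.72 > 1.0174`.
    have hec : 1.0174 ≤ e * c := by
      have := hazard_le_of_large h9
      rw [← hh0] at this
      have := mul_le_mul_of_nonneg_right this he0.le
      linarith
    refine (hn₁ n hn1 d hd (Iic (-c)) measurableSet_Iic (normalTail c) (-h0) 0
      (-(h0 ^ 3 * n ^ 3 / (6 * √(d : ℝ)))) δ δ₁ δ hzero (by rw [abs_neg, abs_of_pos hh])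
      hδ0.le hδ₁ (by linarith) (fun t => ?_) fun A hA hAF hAq => ?_).trans ?_
    · have := lintegral_exp_add_mul_stdNormal_Iic_le hc.le le_rfl t
      simpa using this
    -- The Rayleigh quotient of the constant vector must be below `1`, but all entries are at most
    -- `-c`, so it is at least `e c (1 - 1/n)`, which exceeds `1` for `n ≥ 60`.
    · exfalso
      have h1 := (Tri.red_log_det_le hn0 hd (q := 1 + δ) (by linarith)
        hδ₁ hη0 le_rfl one_pos hc.le hRle hBle hA hAF hAq).1
      rw [← he] at h1
      have h2 := Tri.sum_le_of_all hA
      have h3 : c * (1 - 1 / 60) ≤ -(2 * Tri.sum (fun y => y) A) / n ^ 2 := by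
        rw [le_div_iff₀ (by positivity)]
        have := mul_nonneg (mul_nonneg hc.le hnp.le) (sub_nonneg.2 hn')
        linarith
      have := mul_le_mul_of_nonneg_left h3 he0.le
      linarith
    · refine ENNReal.ofReal_le_ofReal ?_
      have := hZexp 0
      rw [Real.exp_zero, mul_one, add_zero] at this
      rw [this, ← Real.exp_add, Real.exp_le_exp]
      have h8 : 0 ≤ 2 * h0 ^ 3 * e₁ + F * e₁ ^ 2 / δ₁ := by positivity
      have : -L / 2 * n ≤ ζ / 8 * n * n := by
        refine mul_le_mul_of_nonneg_right ?_ hnp.le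
        linarith
      have h11 : 0 ≤ ζ * (n : ℝ) ^ 2 := by positivity
      linarith

/-! ### Blue cliques on good configurations, in high dimension. -/

lemma mul_of_diagonalization {κ : Type*} [Fintype κ] [DecidableEq κ] {A B U : Matrix κ κ ℝ}
    {a b : κ → ℝ} (h2 : Uᵀ * U = 1) (hA : A = U * Matrix.diagonal a * Uᵀ)
    (hB : B = U * Matrix.diagonal b * Uᵀ) :
    A * B = U * Matrix.diagonal (fun i => a i * b i) * Uᵀ := by
  calc A * B = U * Matrix.diagonal a * (Uᵀ * U) * Matrix.diagonal b * Uᵀ := by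
        rw [hA, hB]; simp only [Matrix.mul_assoc]
    _ = U * (Matrix.diagonal a * Matrix.diagonal b) * Uᵀ := by
        rw [h2]; simp only [Matrix.mul_assoc, Matrix.one_mul]
    _ = _ := by rw [Matrix.diagonal_mul_diagonal]

lemma sum_sum_mul_symm {n : ℕ} {P A : Matrix (Fin n) (Fin n) ℝ} (hA : A.IsSymm) :
    ∑ i, ∑ j, P i j * A i j = (P * A).trace := by
  simp only [Matrix.trace, Matrix.diag_apply, Matrix.mul_apply]
  exact Finset.sum_congr rfl fun i _ => Finset.sum_congr rfl fun j _ => by rw [hA.apply j i]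

/-- The derivative `x²/(1-x)` is above `x²` for positive and below it for negative `x`. Blue arrays
give no sign information on the entries, so this bound, valid on both sides, is applied to every
eigenvalue. -/
lemma pow_three_div_le_logRem {x : ℝ} (hx : x < 1) : x ^ 3 / 3 ≤ logRem x := by
  rcases le_or_gt 0 x with h | h
  · have hd : ∀ y ∈ Icc (0 : ℝ) x, HasDerivAt (fun y => logRem y - y ^ 3 / 3)
        (logRemDeriv y - y ^ 2) y := fun y hy => by
      have := ((hasDerivAt_logRem (lt_of_le_of_lt hy.2 hx)).sub
        (((hasDerivAt_id y).pow 3).div_const 3))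
      exact this.congr_deriv (by simp)
    have := monotoneOn_of_deriv_nonneg (convex_Icc 0 x)
      (fun y hy => (hd y hy).continuousAt.continuousWithinAt)
      (fun y hy => (hd y (interior_subset hy)).differentiableAt.differentiableWithinAt)
      (fun y hy => by
        have hy' := interior_subset hy
        rw [(hd y hy').deriv, logRemDeriv, sub_nonneg, le_div_iff₀ (by linarith [hy'.2])]
        nlinarith [hy'.1, sq_nonneg y])
      (left_mem_Icc.2 h) (right_mem_Icc.2 h) h
    simp [logRem] at this ⊢
    linarith
  · have := logRem_neg_le_cube (x := -x) (by linarith)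
    rw [neg_neg] at this
    nlinarith

/-- Expansion of `tr S³` about the constant matrix with entries `b / n`, with the quadratic terms
bounded by the outliers of the difference. -/
theorem exists_outliers_trace_cube_le {n : ℕ} (hn : 0 < n) {S : Matrix (Fin n) (Fin n) ℝ}
    (hS : S.IsSymm) {b η L Λ : ℝ} (hb : 0 ≤ b) (hη : 0 < η) (hΛ : 0 ≤ Λ) (hLΛ : L ≤ Λ ^ 2)
    (hL : ∑ i, ∑ j, (S i j - b / n) ^ 2 ≤ L) {R B : ℕ} (hR : L / η ^ 2 ≤ R)
    (hB : L ≤ (B : ℝ) ^ 4) :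
    ∃ (s : Fin R → ℝ) (v : Fin R → Fin n → ℝ), (∀ k, s k = 1 ∨ s k = -1) ∧ (∀ k i, |v k i| ≤ B) ∧
      ∑ i, ∑ j, signedGram s v i j * (S i j - b / n) = ∑ i, ∑ j, signedGram s v i j ^ 2 ∧
      -(L / η) ≤ ∑ i, signedGram s v i i ∧
      (S * S * S).trace ≤ -2 * b ^ 3 + 3 * b ^ 2 * ((∑ i, ∑ j, S i j) / n)
        + (3 * b + Λ) * (∑ i, ∑ j, signedGram s v i j ^ 2) + η * (3 * b * η + L) := by
  classical
  have hn' : (0 : ℝ) < n := Nat.cast_pos.2 hn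
  set N : Matrix (Fin n) (Fin n) ℝ := Matrix.of fun _ _ => (n : ℝ)⁻¹ with hN
  have hNij : ∀ i j, N i j = (n : ℝ)⁻¹ := fun i j => rfl
  set A : Matrix (Fin n) (Fin n) ℝ := S - b • N with hA
  have hAij : ∀ i j, A i j = S i j - b / n := fun i j => by
    rw [hA, Matrix.sub_apply, Matrix.smul_apply, hNij, smul_eq_mul, div_eq_mul_inv]
  have hAs : A.IsSymm := by
    ext i j
    rw [Matrix.transpose_apply, hAij, hAij, hS.apply]
  obtain ⟨U, l, h2, h1, hAU⟩ := hAs.exists_diagonalization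
  have hA2 := mul_of_diagonalization h2 hAU hAU
  have hA3 := mul_of_diagonalization h2 hA2 hAU
  have hl2 : ∑ i, l i ^ 2 ≤ L := by
    rw [← trace_pow_two_of_diagonalization h2 hAU, ← sum_sum_mul_symm hAs]
    refine le_trans (le_of_eq ?_) hL
    simp only [hAij, sq]
  have hlΛ : ∀ i, |l i| ≤ Λ := fun i => by
    refine abs_le_of_sq_le_sq ((Finset.single_le_sum (f := fun i => l i ^ 2)
      (fun j _ => sq_nonneg _) (Finset.mem_univ i)).trans (hl2.trans hLΛ)) hΛ
  have hL0 : 0 ≤ L := (Finset.sum_nonneg fun i _ => sq_nonneg (l i)).trans hl2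
  -- Outliers of both signs are collected here, since the trace of the cube is expanded rather than
  -- bounded by sign.
  set O : Finset (Fin n) := Finset.univ.filter fun i => η ≤ |l i| with hO
  obtain ⟨s, v, hs, hv, hsv⟩ := exists_signedGram_outliers h2 hη hl2 hR hB O
    (fun i hi => (Finset.mem_filter.1 hi).2) 1 (Or.inl rfl)
  have hP2 : ∑ i, ∑ j, signedGram s v i j ^ 2 = ∑ k, if k ∈ O then l k ^ 2 else 0 := by
    have h3 := sum_mul_of_diagonalization h2 (fun k => if k ∈ O then 1 * l k else 0)
      (fun k => if k ∈ O then 1 * l k else 0)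
    rw [← hsv] at h3
    simp only [← sq] at h3
    rw [h3]
    refine Finset.sum_congr rfl fun k _ => ?_
    split_ifs <;> ring
  have hsmall : ∀ k, l k ^ 2 ≤ (if k ∈ O then l k ^ 2 else 0) + η ^ 2 := fun k => by
    split_ifs with h
    · linarith [sq_nonneg η]
    · have : |l k| < η := by
        by_contra hcon
        exact h (Finset.mem_filter.2 ⟨Finset.mem_univ _, not_lt.1 hcon⟩)
      rw [zero_add, ← sq_abs]
      exact pow_le_pow_left₀ (abs_nonneg _) this.le 2
  refine ⟨s, v, hs, hv, ?_, ?_, ?_⟩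
  · have h3 := sum_mul_of_diagonalization h2 (fun k => if k ∈ O then 1 * l k else 0) l
    rw [← hsv, ← hAU] at h3
    simp only [hAij] at h3
    rw [h3, hP2]
    refine Finset.sum_congr rfl fun k _ => ?_
    split_ifs <;> ring
  · have h3 : ∑ i, signedGram s v i i = ∑ k, if k ∈ O then 1 * l k else 0 :=
      trace_of_diagonalization (A := signedGram s v) h2 hsv
    rw [h3, neg_le, ← Finset.sum_neg_distrib, le_div_iff₀ hη, Finset.sum_mul]
    refine (Finset.sum_le_sum fun k _ => ?_).trans hl2
    split_ifs with h
    · have h4 : η ≤ |l k| := (Finset.mem_filter.1 h).2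
      calc -(1 * l k) * η ≤ |l k| * |l k| :=
            mul_le_mul (by rw [one_mul]; exact neg_le_abs _) h4 hη.le (abs_nonneg _)
        _ = l k ^ 2 := by rw [abs_mul_abs_self, sq]
    · simp [sq_nonneg]
  · have hNN : N * N = N := by
      ext i j
      simp [Matrix.mul_apply, hNij, hn'.ne']
    have htN : N.trace = 1 := by
      simp [Matrix.trace, hNij, hn'.ne']
    have hNM : ∀ M : Matrix (Fin n) (Fin n) ℝ, (N * M).trace = (∑ i, ∑ j, M i j) / n := fun M => by
      simp only [Matrix.trace, Matrix.diag_apply, Matrix.mul_apply, hNij, ← Finset.mul_sum]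
      rw [Finset.sum_comm]
      field_simp
    have hSA : S = b • N + A := by rw [hA]; abel
    -- The matrix `N` of the constants `1/n` is a projection of trace `1`, so every word in `N` and
    -- `A` reduces under the trace to one of three types.
    have hexp : (S * S * S).trace = b ^ 3 + 3 * b ^ 2 * (N * A).trace + 3 * b * (N * (A * A)).trace
        + (A * A * A).trace := by
      have e1 : (N * A * N).trace = (N * A).trace := by
        rw [Matrix.trace_mul_comm, ← Matrix.mul_assoc, hNN]
      have e2 : (A * N * N).trace = (N * A).trace := by
        rw [Matrix.mul_assoc, hNN, Matrix.trace_mul_comm]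
      have e3 : (N * A * A).trace = (N * (A * A)).trace := by rw [Matrix.mul_assoc]
      have e4 : (A * N * A).trace = (N * (A * A)).trace := by
        rw [Matrix.mul_assoc, Matrix.trace_mul_comm, Matrix.mul_assoc]
      have e5 : (A * A * N).trace = (N * (A * A)).trace := Matrix.trace_mul_comm _ _
      have e6 : (N * N * N).trace = 1 := by rw [hNN, hNN, htN]
      have e7 : (N * N * A).trace = (N * A).trace := by rw [hNN]
      rw [hSA]
      simp only [add_mul, mul_add, Matrix.smul_mul, Matrix.mul_smul, Matrix.trace_add,
        Matrix.trace_smul, smul_eq_mul, e1, e2, e3, e4, e5, e6, e7]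
      ring
    have hNA : (N * A).trace = (∑ i, ∑ j, S i j) / n - b := by
      rw [hNM]
      simp only [hAij, Finset.sum_sub_distrib]
      simp
      field_simp
    have hNA2 : (N * (A * A)).trace ≤ ∑ i, ∑ j, signedGram s v i j ^ 2 + η ^ 2 := by
      have h3 := dotProduct_mulVec_of_diagonalization hA2 1 1
      have h4 : (1 : Fin n → ℝ) ⬝ᵥ (A * A) *ᵥ 1 = ∑ i, ∑ j, (A * A) i j := by
        simp [dotProduct, Matrix.mulVec]
      have h5 := dotProduct_of_orthogonal h1 (1 : Fin n → ℝ) 1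
      have h6 : (1 : Fin n → ℝ) ⬝ᵥ 1 = n := by simp [dotProduct]
      rw [h6] at h5
      rw [hNM, ← h4, h3, div_le_iff₀ hn', hP2]
      have h7 : ∀ k, (Uᵀ *ᵥ (1 : Fin n → ℝ)) k * (Uᵀ *ᵥ (1 : Fin n → ℝ)) k ≤ n := fun k => by
        rw [h5]
        exact Finset.single_le_sum (f := fun k => (Uᵀ *ᵥ (1 : Fin n → ℝ)) k * (Uᵀ *ᵥ (1 : Fin n → ℝ)) k)
          (fun j _ => mul_self_nonneg _) (Finset.mem_univ k)
      rw [add_mul, Finset.sum_mul]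
      nth_rewrite 2 [h5]
      rw [Finset.mul_sum, ← Finset.sum_add_distrib]
      refine Finset.sum_le_sum fun k _ => ?_
      have h8 := mul_self_nonneg ((Uᵀ *ᵥ (1 : Fin n → ℝ)) k)
      have h9 : 0 ≤ if k ∈ O then l k ^ 2 else 0 := by split_ifs <;> positivity
      have h10 := mul_le_mul_of_nonneg_left (h7 k) h9
      have h11 := mul_le_mul_of_nonneg_right (hsmall k) h8
      rw [← sq (l k)]
      linarith
    have hAAA : (A * A * A).trace ≤ Λ * ∑ i, ∑ j, signedGram s v i j ^ 2 + η * L := by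
      rw [trace_of_diagonalization h2 hA3, hP2, Finset.mul_sum]
      have : ∑ k, η * l k ^ 2 ≤ η * L := by
        rw [← Finset.mul_sum]; exact mul_le_mul_of_nonneg_left hl2 hη.le
      refine le_trans ?_ (add_le_add le_rfl this)
      rw [← Finset.sum_add_distrib]
      refine Finset.sum_le_sum fun k _ => ?_
      have e1 : l k * l k * l k = l k * l k ^ 2 := by ring
      rw [e1]
      split_ifs with h
      · have := mul_le_mul_of_nonneg_right ((le_abs_self _).trans (hlΛ k)) (sq_nonneg (l k))
        have := mul_nonneg hη.le (sq_nonneg (l k))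
        linarith
      · have h3 : |l k| < η := by
          by_contra hcon
          exact h (Finset.mem_filter.2 ⟨Finset.mem_univ _, not_lt.1 hcon⟩)
        have := mul_le_mul_of_nonneg_right ((le_abs_self _).trans h3.le) (sq_nonneg (l k))
        linarith
    rw [hexp, hNA]
    have := mul_le_mul_of_nonneg_left hNA2 (show 0 ≤ 3 * b by positivity)
    linarith

/-- The cubic lower bound on `logRem` leaves `e³/3` times the trace of the cube of `A/n`. Expanded
about the constant `b/n`, it gives a term linear in the sum of the entries, which acts as a tilt,
and quadratic terms carried by the outliers. -/
theorem Tri.blue_log_det_le {n d : ℕ} (hn : 0 < n) (hd : 0 < d) {q δ₁ F η b L Λ : ℝ} (hq : 0 < q)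
    (hδ₁ : 0 < δ₁) (hη : 0 < η) (hb : 0 ≤ b) (hΛ : 0 ≤ Λ) (hLΛ : L ≤ Λ ^ 2)
    (hFL : 4 * F + 2 * b ^ 2 ≤ L) {R B : ℕ} (hR : L / η ^ 2 ≤ R) (hB : L ≤ (B : ℝ) ^ 4) {A : Tri n}
    (hF : Tri.sum (fun y => y ^ 2) A ≤ F * n ^ 2)
    (hquad : ∀ w : Fin n → ℝ, δ₁ * (w ⬝ᵥ w) ≤ w ⬝ᵥ A.shifted q d *ᵥ w) :
    ∃ (s : Fin R → ℝ) (v : Fin R → Fin n → ℝ), (∀ k, s k = 1 ∨ s k = -1) ∧ (∀ k i, |v k i| ≤ B) ∧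
      ∑ i, ∑ j, signedGram s v i j ^ 2 - b * (L / η) / n ≤
        (∑ i, ∑ j, if i = j then 0 else signedGram s v i j * (A.mat i j - b)) / n ∧
      Real.log (A.shifted q d).det - n * Real.log q
        ≤ -(Tri.sum (fun y => y ^ 2) A / (q ^ 2 * d))
          + (n / (q * √(d : ℝ))) ^ 3 / 3 * (-2 * b ^ 3 + 6 * b ^ 2 * (Tri.sum (fun y => y) A / n ^ 2)
            + (3 * b + Λ) * (∑ i, ∑ j, signedGram s v i j ^ 2) + η * (3 * b * η + L)) := by
  have hn' : (0 : ℝ) < n := Nat.cast_pos.2 hn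
  have hd' : 0 < √(d : ℝ) := Real.sqrt_pos.2 (Nat.cast_pos.2 hd)
  set e := n / (q * √(d : ℝ)) with he
  have he0 : 0 < e := by positivity
  set S := (n : ℝ)⁻¹ • A.mat with hS
  have hSij : ∀ i j, S i j = A.mat i j / n := fun i j => by
    rw [hS, Matrix.smul_apply, smul_eq_mul]; field_simp
  obtain ⟨s, v, hs, hv, hP, htr, hcube⟩ := exists_outliers_trace_cube_le hn
    (Tri.mat_neg_smul_isSymm A (n : ℝ)⁻¹) hb hη hΛ hLΛ (R := R) (B := B) (by
      refine le_trans ?_ hFL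
      rw [← hS]
      calc ∑ i, ∑ j, (S i j - b / n) ^ 2
          ≤ ∑ i : Fin n, ∑ j : Fin n, (2 * A.mat i j ^ 2 / n ^ 2 + 2 * b ^ 2 / n ^ 2) := by
            refine Finset.sum_le_sum fun i _ => Finset.sum_le_sum fun j _ => ?_
            rw [hSij, ← sub_div, div_pow, ← add_div]
            gcongr
            nlinarith [sq_nonneg (A.mat i j + b)]
        _ = 2 * (2 * Tri.sum (fun y => y ^ 2) A) / n ^ 2 + 2 * b ^ 2 := by
            rw [← Tri.sum_mat_sq_eq]
            simp only [Finset.sum_add_distrib, ← Finset.sum_div, ← Finset.mul_sum]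
            simp
            field_simp
        _ ≤ _ := by
            gcongr
            rw [div_le_iff₀ (by positivity)]
            linarith) hR hB
  rw [← hS] at hP hcube
  refine ⟨s, v, hs, hv, ?_, ?_⟩
  · have e1 : (∑ i, ∑ j, if i = j then 0 else signedGram s v i j * (A.mat i j - b))
        = n * (∑ i, ∑ j, signedGram s v i j * (S i j - b / n)) + b * ∑ i, signedGram s v i i := by
      rw [Finset.mul_sum, Finset.mul_sum, ← Finset.sum_add_distrib]
      refine Finset.sum_congr rfl fun i _ => ?_
      have h3 : b * signedGram s v i i = ∑ j, if i = j then b * signedGram s v i j else 0 := by simp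
      rw [h3, Finset.mul_sum, ← Finset.sum_add_distrib]
      refine Finset.sum_congr rfl fun j _ => ?_
      rw [hSij]
      split_ifs with h
      · subst h; rw [Tri.mat_diag]; field_simp; ring
      · field_simp; ring
    rw [e1, hP, le_div_iff₀ hn', sub_mul, div_mul_cancel₀ _ hn'.ne']
    have := mul_le_mul_of_nonneg_left htr hb
    linarith
  · obtain ⟨U, l, h2, h1, hMU⟩ := (Tri.mat_neg_smul_isSymm A (-(n : ℝ)⁻¹)).exists_diagonalization
    have hMq : ∀ w : Fin n → ℝ, e * (w ⬝ᵥ ((-(n : ℝ)⁻¹) • A.mat) *ᵥ w) ≤ (1 - δ₁ / q) * (w ⬝ᵥ w) :=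
      fun w => by
        have h := hquad w
        rw [Tri.dotProduct_shifted hn hd hq] at h
        have h' : δ₁ / q * (w ⬝ᵥ w) ≤ w ⬝ᵥ w - e * (w ⬝ᵥ ((-(n : ℝ)⁻¹) • A.mat) *ᵥ w) := by
          rw [div_mul_eq_mul_div, div_le_iff₀ hq]; linarith
        linarith
    have hxlt : ∀ i, e * l i < 1 := fun i => by
      have := hMq fun k => U k i
      rw [mulVec_col_of_diagonalization h2 hMU, dotProduct_smul, col_dotProduct_col h2,
        if_pos rfl, smul_eq_mul] at this
      have : 0 < δ₁ / q := by positivity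
      linarith
    rw [log_det_shifted hn hd hq A h2 h1 hMU hxlt]
    have hSM : S * S * S = -((-(n : ℝ)⁻¹) • A.mat * ((-(n : ℝ)⁻¹) • A.mat) * ((-(n : ℝ)⁻¹) • A.mat)) := by
      rw [hS]; simp [neg_smul]
    have htr3 : (S * S * S).trace = -∑ i, l i * l i * l i := by
      rw [hSM, Matrix.trace_neg, trace_of_diagonalization h2
        (mul_of_diagonalization h2 (mul_of_diagonalization h2 hMU hMU) hMU)]
    have h3 : ∑ i, (e * l i) ^ 3 / 3 ≤ ∑ i, logRem (e * l i) :=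
      Finset.sum_le_sum fun i _ => pow_three_div_le_logRem (hxlt i)
    have h4 : ∑ i, (e * l i) ^ 3 / 3 = -(e ^ 3 / 3 * (S * S * S).trace) := by
      rw [htr3, mul_neg, neg_neg, Finset.mul_sum]
      exact Finset.sum_congr rfl fun i _ => by ring
    have h5 : (∑ i, ∑ j, S i j) / n = 2 * (Tri.sum (fun y => y) A / n ^ 2) := by
      have : ∑ i, ∑ j, S i j = 2 * Tri.sum (fun y => y) A / n := by
        rw [← Tri.sum_mat_eq]; simp only [hSij, Finset.sum_div]
      rw [this]; field_simp
    rw [h5] at hcube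
    have h6 := mul_le_mul_of_nonneg_left hcube (show 0 ≤ e ^ 3 / 3 by positivity)
    have e1 : 3 * b ^ 2 * (2 * (Tri.sum (fun y => y) A / (n : ℝ) ^ 2))
      = 6 * b ^ 2 * (Tri.sum (fun y => y) A / (n : ℝ) ^ 2) := by ring
    rw [e1] at h6
    linarith

lemma lintegral_exp_add_mul_stdNormal_Ici_le (a θ t : ℝ) :
    ∫⁻ y in Ici a, ENNReal.ofReal (Real.exp ((t + θ) * y)) ∂stdNormal
      ≤ ENNReal.ofReal (normalTail a * Real.exp (hazard a * θ + θ ^ 2)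
        * Real.exp (hazard a * t + t ^ 2)) := by
  refine (lintegral_exp_mul_stdNormal_Ici_le _ _).trans (ENNReal.ofReal_le_ofReal ?_)
  rw [mul_assoc, ← Real.exp_add]
  refine mul_le_mul_of_nonneg_left (Real.exp_le_exp.2 ?_) (normalTail_pos a).le
  nlinarith [sq_nonneg (t - θ)]

/-- The coefficient of the outliers is at most `e₁(3b + Λ)N²/6`, and the hypothesis `e₁(3b + Λ) ≤
3/4` brings it down to the `N²/8` that the Chernoff bound absorbs. This is where high dimension is
needed. -/
lemma blue_pointwise_le {N rd δ δ₁ F η b e e₁ S2 P2 T κ L Λ LD : ℝ} (hN : 0 < N) (hrd : 0 < rd)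
    (hδ : 0 ≤ δ) (hδ₁ : 0 < δ₁) (hF : 0 ≤ F) (hη : 0 ≤ η) (hb : 0 ≤ b) (hL : 0 ≤ L) (hΛ : 0 ≤ Λ)
    (he : e = N / ((1 + δ) * rd)) (hκ : κ = (1 - δ) / (1 + δ) ^ 2) (hκ0 : 0 ≤ κ) (hκ1 : κ ≤ 1)
    (he1 : N ≤ e₁ * rd) (hbΛ : e₁ * (3 * b + Λ) ≤ 3 / 4) (hS2 : S2 ≤ F * N ^ 2) (hP2 : 0 ≤ P2)
    (hLD : LD ≤ -(S2 / ((1 + δ) ^ 2 * rd ^ 2)) + e ^ 3 / 3 * (-2 * b ^ 3 + 6 * b ^ 2 * (T / N ^ 2)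
      + (3 * b + Λ) * P2 + η * (3 * b * η + L))) :
    N * ((N * δ + (N * δ ^ 2 + 2 * F * N ^ 2 / rd ^ 2) / δ₁) / 2) + S2 / 2
        + rd ^ 2 * (1 - δ) / 2 * LD
      ≤ (N ^ 2 * (δ / 2 + δ ^ 2 / (2 * δ₁) + (1 - κ) * F / 2 + e₁ * (η * (3 * b * η + L)) / 6)
          + F * e₁ ^ 2 * N / δ₁ - κ * e * N ^ 2 * b ^ 3 / 3)
        + κ * e * b ^ 2 * T + N ^ 2 / 8 * P2 := by
  have hq : 0 < 1 + δ := by linarith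
  have he0 : 0 < e := by rw [he]; positivity
  have hrd2 : rd ^ 2 * (1 - δ) = κ * N ^ 2 / e ^ 2 := by
    rw [he, hκ]; field_simp
  have h0 : 0 ≤ κ * N ^ 2 / e ^ 2 := by positivity
  have h1 := mul_le_mul_of_nonneg_left hLD (div_nonneg h0 two_pos.le)
  have hS : S2 / ((1 + δ) ^ 2 * rd ^ 2) = S2 * e ^ 2 / N ^ 2 := by
    rw [he]; field_simp
  have h2 : κ * N ^ 2 / e ^ 2 / 2 * (-(S2 / ((1 + δ) ^ 2 * rd ^ 2))
      + e ^ 3 / 3 * (-2 * b ^ 3 + 6 * b ^ 2 * (T / N ^ 2)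
      + (3 * b + Λ) * P2 + η * (3 * b * η + L)))
      = -(κ * S2 / 2) - κ * e * N ^ 2 * b ^ 3 / 3 + κ * e * b ^ 2 * T
        + κ * e * ((3 * b + Λ) * P2 * N ^ 2 / 6) + κ * e * (η * (3 * b * η + L) * N ^ 2 / 6) := by
    rw [hS]; field_simp; ring
  have h3 : (1 - κ) * S2 ≤ (1 - κ) * (F * N ^ 2) := mul_le_mul_of_nonneg_left hS2 (by linarith)
  have he₁ : 0 ≤ e₁ := by
    by_contra hcon
    nlinarith
  have hee : κ * e ≤ e₁ := by
    have : e ≤ e₁ := by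
      rw [he, div_le_iff₀ (by positivity)]
      linarith [mul_nonneg (mul_nonneg he₁ hrd.le) hδ]
    calc κ * e ≤ 1 * e₁ := mul_le_mul hκ1 this he0.le zero_le_one
      _ = e₁ := one_mul _
  have h4 : κ * e * ((3 * b + Λ) * P2 * N ^ 2 / 6) ≤ e₁ * ((3 * b + Λ) * P2 * N ^ 2 / 6) :=
    mul_le_mul_of_nonneg_right hee (by positivity)
  have h5 : κ * e * (η * (3 * b * η + L) * N ^ 2 / 6) ≤ e₁ * (η * (3 * b * η + L) * N ^ 2 / 6) :=
    mul_le_mul_of_nonneg_right hee (by positivity)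
  have h10 := mul_le_mul_of_nonneg_right hbΛ (show 0 ≤ P2 * N ^ 2 / 6 by positivity)
  have h6 : N ^ 2 / rd ^ 2 ≤ e₁ ^ 2 := by
    rw [div_le_iff₀ (by positivity), ← mul_pow]
    exact pow_le_pow_left₀ hN.le he1 2
  have h7 : F * N / δ₁ * (N ^ 2 / rd ^ 2) ≤ F * N / δ₁ * e₁ ^ 2 :=
    mul_le_mul_of_nonneg_left h6 (by positivity)
  have h8 : N * ((N * δ + (N * δ ^ 2 + 2 * F * N ^ 2 / rd ^ 2) / δ₁) / 2)
      = N ^ 2 * (δ / 2 + δ ^ 2 / (2 * δ₁)) + F * N / δ₁ * (N ^ 2 / rd ^ 2) := by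
    field_simp
    ring
  have h9 : F * e₁ ^ 2 * N / δ₁ = F * N / δ₁ * e₁ ^ 2 := by ring
  rw [hrd2, h8, h9]
  rw [h2] at h1
  linarith [h1, h3, h4, h5, h7, h10]

/-- With the tilt `θ = κ e b²`, the gain `N²bθ/2` of the normalisation minus the constant `κeN²b³/3`
of the expansion leaves the expected cubic term. The square of the tilt is the quartic error. -/
lemma blue_total_exponent_le {N rd e₁ e κ b L l θ δ δ₁ F η ζ : ℝ} (hN : 0 < N) (hrd : 0 < rd)
    (hb : 0 ≤ b) (hδ : 0 ≤ δ) (hF : 0 ≤ F)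
    (hζ : 0 ≤ ζ) (hδ₁ : 0 < δ₁)
    (he : e = N / ((1 + δ) * rd)) (hκ : κ = (1 - δ) / (1 + δ) ^ 2) (hκ0 : 0 ≤ κ) (hκ1 : κ ≤ 1)
    (hθ : θ = κ * e * b ^ 2)
    (hδζ : δ * (1 / 2 + 1 / (2 * δ₁) + 2 * F) ≤ ζ / 8) (hδ1 : δ ≤ 1)
    (hηζ : e₁ * (η * (3 * b * η + L)) / 6 ≤ ζ / 8)
    (hNζ : -l / 2 + F * e₁ ^ 2 / δ₁ ≤ ζ / 8 * N) :
    (N ^ 2 / 2 - N / 2) * (l + (b * θ + θ ^ 2))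
      + (N ^ 2 * (δ / 2 + δ ^ 2 / (2 * δ₁) + (1 - κ) * F / 2 + e₁ * (η * (3 * b * η + L)) / 6)
          + F * e₁ ^ 2 * N / δ₁ - κ * e * N ^ 2 * b ^ 3 / 3 + 2 * (ζ / 8) * N ^ 2)
      ≤ N ^ 2 / 2 * l + b ^ 3 * N ^ 3 / (6 * rd) + b ^ 4 * N ^ 4 / (2 * rd ^ 2) + ζ * N ^ 2 := by
  have hq : 0 < 1 + δ := by linarith
  have he0 : 0 < e := by rw [he]; positivity
  have hκ2 : 1 - 4 * δ ≤ κ := (hκ ▸ one_sub_mul_le_ratio hδ).trans (div_le_self hκ0 (by linarith))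
  have hee : κ * e ≤ N / rd := by
    have h1 : e ≤ N / rd := by
      rw [he]
      exact div_le_div_of_nonneg_left hN.le hrd (by nlinarith)
    calc κ * e ≤ 1 * (N / rd) := mul_le_mul hκ1 h1 he0.le zero_le_one
      _ = N / rd := one_mul _
  have hκe : 0 ≤ κ * e := by positivity
  have hθ0 : 0 ≤ θ := by rw [hθ]; positivity
  have h1 : κ * e * (b ^ 3 * N ^ 2 / 6) ≤ b ^ 3 * N ^ 3 / (6 * rd) := by
    have : b ^ 3 * N ^ 3 / (6 * rd) = N / rd * (b ^ 3 * N ^ 2 / 6) := by field_simp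
    rw [this]
    exact mul_le_mul_of_nonneg_right hee (by positivity)
  have h2 : N ^ 2 / 2 * θ ^ 2 ≤ b ^ 4 * N ^ 4 / (2 * rd ^ 2) := by
    have : b ^ 4 * N ^ 4 / (2 * rd ^ 2) = N ^ 2 / 2 * (N / rd * b ^ 2) ^ 2 := by field_simp
    rw [this, hθ]
    gcongr
  have h3 : N ^ 2 / 2 * (b * θ) - κ * e * N ^ 2 * b ^ 3 / 3 = κ * e * (b ^ 3 * N ^ 2 / 6) := by
    rw [hθ]; ring
  have h4 : 0 ≤ N / 2 * (b * θ + θ ^ 2) := by positivity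
  have h5 := mul_le_mul_of_nonneg_right hNζ hN.le
  have h6 : δ / 2 + δ ^ 2 / (2 * δ₁) + (1 - κ) * F / 2 ≤ ζ / 8 := by
    refine le_trans ?_ hδζ
    have : δ ^ 2 / (2 * δ₁) ≤ δ * (1 / (2 * δ₁)) := by
      rw [mul_one_div]; gcongr; nlinarith
    have h7 : (1 - κ) * F ≤ 4 * δ * F := mul_le_mul_of_nonneg_right (by linarith) hF
    linarith
  have h8 := mul_le_mul_of_nonneg_left h6 (sq_nonneg N)
  have h9 := mul_le_mul_of_nonneg_left hηζ (sq_nonneg N)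
  have h10 : 0 ≤ ζ * N ^ 2 := by positivity
  have e1 : F * e₁ ^ 2 * N / δ₁ = F * e₁ ^ 2 / δ₁ * N := by ring
  rw [e1]
  linarith

set_option maxHeartbeats 400000 in
/-- The probability that good rows form a blue clique, in dimension at least `(n / e₁)²`. -/
theorem exists_gaussRows_blue_le {F δ₁ M : ℝ} (hδ₁ : 0 < δ₁) (hF : 0 ≤ F) (hM : 0 ≤ M) :
    ∃ e₁ > 0, ∀ a, hazard a ≤ M → ∀ ζ > 0, ∃ δ₀ > 0, ∃ z > 0, z < 1 ∧ ∃ n₀ : ℕ, ∀ n ≥ n₀,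
      ∀ d : ℕ, 0 < d → (n : ℝ) ≤ e₁ * √(d : ℝ) →
      gaussRows n d {X | GoodRows δ₀ δ₁ z (2 * F * n ^ 2 / d) X ∧ (gramTri X).All (Ici a)}
        ≤ ENNReal.ofReal (Real.exp (n ^ 2 / 2 * Real.log (normalTail a)
          + hazard a ^ 3 * n ^ 3 / (6 * √(d : ℝ)) + hazard a ^ 4 * n ^ 4 / (2 * d) + ζ * n ^ 2)) := by
  -- Chosen so that `e₁(3b + Λ) ≤ 3/4` for every hazard rate `b ≤ M`; it depends on neither `ζ` nor
  -- the cutoff.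
  refine ⟨3 / 4 / (3 * M + (4 * F + 2 * M ^ 2 + 1)), by positivity, fun a ha ζ hζ => ?_⟩
  set b := hazard a with hb
  have hb0 : 0 < b := hazard_pos a
  set l := Real.log (normalTail a) with hl
  set L := 4 * F + 2 * b ^ 2 with hL
  have hL0 : 0 ≤ L := by positivity
  set Λ := L + 1 with hΛ
  have hLΛ : L ≤ Λ ^ 2 := by rw [hΛ]; nlinarith
  set e₁ := 3 / 4 / (3 * M + (4 * F + 2 * M ^ 2 + 1)) with he₁
  have he₁0 : 0 < e₁ := by positivity
  have hbΛ : e₁ * (3 * b + Λ) ≤ 3 / 4 := by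
    have h1 : b ^ 2 ≤ M ^ 2 := pow_le_pow_left₀ hb0.le ha 2
    rw [he₁, div_mul_eq_mul_div, div_le_iff₀ (by positivity)]
    exact mul_le_mul_of_nonneg_left (by linarith) (by norm_num)
  set Cδ := 1 / 2 + 1 / (2 * δ₁) + 2 * F with hCδ
  have hCδ0 : 0 < Cδ := by positivity
  set δ := min (1 / 2) (ζ / 8 / Cδ) with hδ
  have hδ0 : 0 < δ := lt_min (by norm_num) (by positivity)
  have hδh : δ ≤ 1 / 2 := min_le_left _ _
  have hδζ : δ * Cδ ≤ ζ / 8 := by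
    rw [← le_div_iff₀ hCδ0]; exact min_le_right _ _
  set η := min 1 (ζ / 8 / (e₁ * (3 * b + L))) with hη
  have hη0 : 0 < η := lt_min one_pos (by positivity)
  have hη1 : η ≤ 1 := min_le_left _ _
  have hηζ : e₁ * (η * (3 * b * η + L)) / 6 ≤ ζ / 8 := by
    have h1 : η * (e₁ * (3 * b + L)) ≤ ζ / 8 := by
      rw [← le_div_iff₀ (by positivity)]; exact min_le_right _ _
    have h2 : e₁ * (η * (3 * b * η + L)) ≤ e₁ * (η * (3 * b * 1 + L)) := by gcongr
    have h3 : 0 ≤ e₁ * (η * (3 * b * η + L)) := by positivity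
    linarith
  set R := ⌈L / η ^ 2⌉₊ with hR
  set B := ⌈L⌉₊ + 1 with hB
  have hBle : L ≤ (B : ℝ) ^ 4 := by
    have h1 : L ≤ (⌈L⌉₊ : ℝ) := Nat.le_ceil _
    have h2 : (B : ℝ) = (⌈L⌉₊ : ℝ) + 1 := by rw [hB]; push_cast; ring
    have h3 : (1 : ℝ) ≤ B := by rw [h2]; linarith
    calc L ≤ (B : ℝ) ^ 1 := by rw [pow_one]; linarith
      _ ≤ (B : ℝ) ^ 4 := pow_le_pow_right₀ h3 (by norm_num)
  obtain ⟨n₁, hn₁⟩ := exists_gaussRows_goodRows_le R B hF hb0.le (show 0 < ζ / 8 by positivity)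
  set Q := -l / 2 + F * e₁ ^ 2 / δ₁ with hQ
  refine ⟨δ, hδ0, δ, hδ0, by linarith, max (max n₁ 1) (max ⌈b * (L / η) / (ζ / 8)⌉₊ ⌈Q / (ζ / 8)⌉₊),
    fun n hn d hd hnd => ?_⟩
  have hn1 : n₁ ≤ n := (le_max_left _ _).trans ((le_max_left _ _).trans hn)
  have hn0 : 0 < n := (le_max_right _ _).trans ((le_max_left _ _).trans hn)
  have hn2 : b * (L / η) ≤ ζ / 8 * n := by
    rw [← div_le_iff₀' (by positivity)]
    exact (Nat.le_ceil _).trans (Nat.cast_le.2 ((le_max_left _ _).trans ((le_max_right _ _).trans hn)))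
  have hn3 : Q ≤ ζ / 8 * n := by
    rw [← div_le_iff₀' (by positivity)]
    exact (Nat.le_ceil _).trans (Nat.cast_le.2 ((le_max_right _ _).trans ((le_max_right _ _).trans hn)))
  have hnp : (0 : ℝ) < n := Nat.cast_pos.2 hn0
  have hrd : 0 < √(d : ℝ) := Real.sqrt_pos.2 (Nat.cast_pos.2 hd)
  have hrd2 : √(d : ℝ) ^ 2 = d := Real.sq_sqrt (Nat.cast_nonneg d)
  have hchoose : ((n.choose 2 : ℕ) : ℝ) = (n : ℝ) ^ 2 / 2 - n / 2 := by
    rw [Nat.cast_choose_two]; ring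
  set e := n / ((1 + δ) * √(d : ℝ)) with he
  have he0 : 0 < e := by positivity
  have hZexp : ∀ x : ℝ, (normalTail a * Real.exp x) ^ n.choose 2
      = Real.exp (((n : ℝ) ^ 2 / 2 - n / 2) * (l + x)) := fun x => by
    conv_lhs => rw [← Real.exp_log (normalTail_pos a), ← Real.exp_add, ← Real.exp_nat_mul, hchoose]
  set κ := (1 - δ) / (1 + δ) ^ 2 with hκ
  have hκ0 : 0 ≤ κ := div_nonneg (by linarith) (by positivity)
  have hκ1 : κ ≤ 1 := by rw [hκ, div_le_one (by positivity)]; linarith [sq_nonneg δ]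
  set θ := κ * e * b ^ 2 with hθ
  set K := n ^ 2 * (δ / 2 + δ ^ 2 / (2 * δ₁) + (1 - κ) * F / 2 + e₁ * (η * (3 * b * η + L)) / 6)
          + F * e₁ ^ 2 * n / δ₁ - κ * e * n ^ 2 * b ^ 3 / 3 with hK
  refine (hn₁ n hn1 d hd (Ici a) measurableSet_Ici
    (normalTail a * Real.exp (b * θ + θ ^ 2)) b θ K δ δ₁ δ
    (mul_nonneg (normalTail_pos a).le (Real.exp_pos _).le) (abs_of_pos hb0).le
    hδ0.le hδ₁ (by linarith) (lintegral_exp_add_mul_stdNormal_Ici_le a θ) ?_).trans ?_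
  · intro A hA hAF hAq
    obtain ⟨s', v, hs', hv, hP, hLD⟩ := Tri.blue_log_det_le hn0 hd (q := 1 + δ) (by linarith)
      hδ₁ hη0 hb0.le (by positivity : 0 ≤ Λ) hLΛ le_rfl (Nat.le_ceil (L / η ^ 2)) hBle hAF hAq
    refine ⟨s', v, hs', hv, ?_, ?_⟩
    · refine le_trans ?_ hP
      have h1 : b * (L / η) / n ≤ ζ / 8 := by
        rw [div_le_iff₀ hnp]; exact hn2
      linarith
    · rw [← he] at hLD
      have h1 := blue_pointwise_le (κ := κ) hnp hrd hδ0.le hδ₁ hF hη0.le hb0.le hL0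
        (by positivity : 0 ≤ Λ) he hκ hκ0 hκ1 hnd hbΛ hAF
        (Finset.sum_nonneg fun i _ => Finset.sum_nonneg fun j _ => sq_nonneg _)
        (hLD.trans_eq (by rw [hrd2]))
      rw [hrd2] at h1
      exact h1
  · refine ENNReal.ofReal_le_ofReal ?_
    rw [hZexp, ← Real.exp_add, Real.exp_le_exp]
    have := blue_total_exponent_le hnp hrd hb0.le hδ0.le hF hζ.le hδ₁ he hκ hκ0 hκ1 hθ hδζ
      (by linarith) hηζ hn3
    rw [hrd2] at this
    exact this

/-! ### Chi-square estimates -/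

lemma lintegral_exp_neg_mul_sq_stdNormal {τ : ℝ} (hτ : 0 < 1 + 2 * τ) :
    ∫⁻ x, ENNReal.ofReal (Real.exp (-(τ * x ^ 2))) ∂stdNormal
      = ENNReal.ofReal (√(1 + 2 * τ))⁻¹ := by
  have h1 : ∀ x, gaussianPDF 0 1 x * ENNReal.ofReal (Real.exp (-(τ * x ^ 2)))
      = ENNReal.ofReal ((√(2 * Real.pi))⁻¹ * Real.exp (-((1 + 2 * τ) / 2) * x ^ 2)) := fun x => by
    rw [gaussianPDF, ← ENNReal.ofReal_mul (gaussianPDFReal_nonneg _ _ _), gaussianPDFReal]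
    congr 1
    simp only [NNReal.coe_one, mul_one, sub_zero]
    rw [mul_assoc, ← Real.exp_add]
    congr 2
    ring
  rw [stdNormal, gaussianReal_of_var_ne_zero 0 one_ne_zero,
    lintegral_withDensity_eq_lintegral_mul _ (measurable_gaussianPDF _ _) (by fun_prop)]
  simp only [Pi.mul_apply, h1]
  have hi := (integrable_exp_neg_mul_sq (b := (1 + 2 * τ) / 2) (by linarith)).const_mul (√(2 * Real.pi))⁻¹
  rw [← ofReal_integral_eq_lintegral_ofReal hi (ae_of_all _ fun x => by positivity),
    integral_const_mul, integral_gaussian]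
  congr 1
  have hpi := Real.pi_pos
  rw [← Real.sqrt_inv, ← Real.sqrt_inv, ← Real.sqrt_mul (by positivity)]
  congr 1
  field_simp

lemma lintegral_pi_prod_same {n : ℕ} (f : ℝ → ℝ≥0∞) (hf : Measurable f) :
    ∫⁻ x, ∏ i, f (x i) ∂stdGauss (Fin n) = (∫⁻ x, f x ∂stdNormal) ^ n := by
  have := lintegral_pi_prod stdNormal (fun _ : Fin n => f) fun _ => hf
  simpa using this

lemma lintegral_exp_neg_mul_dotProduct_stdGauss {τ : ℝ} (hτ : 0 < 1 + 2 * τ) (d : ℕ) :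
    ∫⁻ g, ENNReal.ofReal (Real.exp (-(τ * (g ⬝ᵥ g)))) ∂stdGauss (Fin d)
      = ENNReal.ofReal ((√(1 + 2 * τ))⁻¹ ^ d) := by
  have : ∀ g : Fin d → ℝ, ENNReal.ofReal (Real.exp (-(τ * (g ⬝ᵥ g))))
      = ∏ i, ENNReal.ofReal (Real.exp (-(τ * g i ^ 2))) := fun g => by
    rw [← ENNReal.ofReal_prod_of_nonneg fun _ _ => (Real.exp_pos _).le, ← Real.exp_sum, dotProduct,
      Finset.mul_sum, ← Finset.sum_neg_distrib]
    simp only [sq]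
  simp only [this]
  rw [lintegral_pi_prod_same (fun x => ENNReal.ofReal (Real.exp (-(τ * x ^ 2)))) (by fun_prop),
    lintegral_exp_neg_mul_sq_stdNormal hτ, ENNReal.ofReal_pow (by positivity)]

lemma lintegral_exp_dotProduct_stdGauss {d : ℕ} (v : Fin d → ℝ) :
    ∫⁻ g, ENNReal.ofReal (Real.exp (v ⬝ᵥ g)) ∂stdGauss (Fin d)
      = ENNReal.ofReal (Real.exp (v ⬝ᵥ v / 2)) := by
  have h1 : ∀ g : Fin d → ℝ, ENNReal.ofReal (Real.exp (v ⬝ᵥ g))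
      = ∏ i, ENNReal.ofReal (Real.exp (v i * g i)) := fun g => by
    rw [← ENNReal.ofReal_prod_of_nonneg fun _ _ => (Real.exp_pos _).le, ← Real.exp_sum, dotProduct]
  have h2 : ∀ t : ℝ, ∫⁻ x, ENNReal.ofReal (Real.exp (t * x)) ∂stdNormal
      = ENNReal.ofReal (Real.exp (t ^ 2 / 2)) := fun t => by
    have hi := integrable_exp_mul_gaussianReal (μ := 0) (v := 1) t
    rw [← ofReal_integral_eq_lintegral_ofReal hi (ae_of_all _ fun x => (Real.exp_pos _).le)]
    have := congrFun (mgf_id_gaussianReal (μ := 0) (v := 1)) t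
    simp only [mgf, id] at this
    rw [this]; simp
  simp only [h1]
  rw [lintegral_pi_prod stdNormal (fun i x => ENNReal.ofReal (Real.exp (v i * x))) fun _ => by fun_prop]
  simp only [h2]
  rw [← ENNReal.ofReal_prod_of_nonneg fun _ _ => (Real.exp_pos _).le, ← Real.exp_sum, dotProduct,
    Finset.sum_div]
  simp only [sq]

lemma measure_le_of_lintegral_exp {Ω : Type*} [MeasurableSpace Ω] {μ : Measure Ω} {f : Ω → ℝ}
    (hf : Measurable f) {C a : ℝ}
    (h : ∫⁻ x, ENNReal.ofReal (Real.exp (f x)) ∂μ ≤ ENNReal.ofReal C) :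
    μ {x | a ≤ f x} ≤ ENNReal.ofReal (Real.exp (-a) * C) := by
  have h1 := mul_meas_ge_le_lintegral₀ (μ := μ) (f := fun x => ENNReal.ofReal (Real.exp (f x)))
    (by fun_prop) (ENNReal.ofReal (Real.exp a))
  have h2 : {x | ENNReal.ofReal (Real.exp a) ≤ ENNReal.ofReal (Real.exp (f x))} = {x | a ≤ f x} := by
    ext x
    simp only [mem_ofPred_eq]
    rw [ENNReal.ofReal_le_ofReal_iff (Real.exp_pos _).le, Real.exp_le_exp]
  rw [h2] at h1
  have h3 := h1.trans h
  rw [ENNReal.ofReal_mul (Real.exp_pos _).le]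
  calc μ {x | a ≤ f x} = ENNReal.ofReal (Real.exp (-a)) * (ENNReal.ofReal (Real.exp a) * μ {x | a ≤ f x}) := by
        rw [← mul_assoc, ← ENNReal.ofReal_mul (Real.exp_pos _).le, ← Real.exp_add]; simp
    _ ≤ _ := by gcongr

lemma measurable_dotProduct_self (d : ℕ) : Measurable fun g : Fin d → ℝ => g ⬝ᵥ g := by
  unfold dotProduct; fun_prop

/-- Small-ball estimate. -/
lemma stdGauss_dotProduct_le (d : ℕ) {t : ℝ} (ht : 0 < t) :
    stdGauss (Fin d) {g | g ⬝ᵥ g ≤ t * d} ≤ ENNReal.ofReal ((Real.exp (1 / 2) * √t) ^ d) := by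
  -- The parameter `τ = 1/(2t)` gives the moment the size `t^{d/2}` for small `t`, which is the
  -- order of the volume of the ball.
  have hτ : 0 < 1 + 2 * (1 / (2 * t)) := by positivity
  have h := measure_le_of_lintegral_exp (f := fun g : Fin d → ℝ => -(1 / (2 * t) * (g ⬝ᵥ g)))
    (a := -(d / 2)) (((measurable_dotProduct_self d).const_mul _).neg)
    (lintegral_exp_neg_mul_dotProduct_stdGauss hτ d).le
  refine (measure_mono fun g hg => ?_).trans (h.trans (ENNReal.ofReal_le_ofReal ?_))
  · simp only [mem_ofPred_eq, neg_le_neg_iff] at hg ⊢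
    calc 1 / (2 * t) * (g ⬝ᵥ g) ≤ 1 / (2 * t) * (t * d) := by gcongr
      _ = d / 2 := by field_simp
  · rw [neg_neg, mul_pow, ← Real.exp_nat_mul]
    have : (√(1 + 2 * (1 / (2 * t))))⁻¹ ≤ √t := by
      rw [← Real.sqrt_inv]
      refine Real.sqrt_le_sqrt ?_
      rw [inv_le_comm₀ (by positivity) ht]
      have : 2 * (1 / (2 * t)) = t⁻¹ := by field_simp
      linarith
    have e : (d : ℝ) / 2 = d * (1 / 2) := by ring
    rw [e]
    gcongr

lemma stdGauss_le_dotProduct (d : ℕ) (Q : ℝ) :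
    stdGauss (Fin d) {g | Q * d ≤ g ⬝ᵥ g} ≤ ENNReal.ofReal (Real.exp (-(Q / 4 - 1 / 2) * d)) := by
  have hτ : 0 < 1 + 2 * (-(1 / 4) : ℝ) := by norm_num
  have h0 := (lintegral_exp_neg_mul_dotProduct_stdGauss hτ d).le
  have h := measure_le_of_lintegral_exp (f := fun g : Fin d → ℝ => -(-(1 / 4) * (g ⬝ᵥ g)))
    (a := Q * d / 4) (((measurable_dotProduct_self d).const_mul _).neg) h0
  refine (measure_mono fun g hg => ?_).trans (h.trans (ENNReal.ofReal_le_ofReal ?_))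
  · simp only [mem_ofPred_eq] at hg ⊢; linarith
  · have : (√(1 + 2 * (-(1 / 4) : ℝ)))⁻¹ ≤ Real.exp (1 / 2) := by
      rw [inv_le_comm₀ (Real.sqrt_pos.2 hτ) (Real.exp_pos _), ← Real.exp_neg]
      refine Real.le_sqrt_of_sq_le ?_
      rw [← Real.exp_nat_mul]
      have h1 : Real.exp 1 > 2.7 := Real.exp_one_gt_d9.trans' (by norm_num)
      have h2 : Real.exp (((2 : ℕ) : ℝ) * -(1 / 2)) = (Real.exp 1)⁻¹ := by
        rw [← Real.exp_neg]; norm_num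
      rw [h2, inv_le_comm₀ (Real.exp_pos 1) (by norm_num)]
      norm_num
      linarith
    calc Real.exp (-(Q * d / 4)) * (√(1 + 2 * (-(1 / 4) : ℝ)))⁻¹ ^ d
        ≤ Real.exp (-(Q * d / 4)) * Real.exp (1 / 2) ^ d := by gcongr
      _ = _ := by rw [← Real.exp_nat_mul, ← Real.exp_add]; congr 1; ring

/-- Concentration of the norm of a Gaussian vector. -/
lemma stdGauss_norm_outlier_le (d : ℕ) {δ : ℝ} (hδ : 0 < δ) (hδ1 : δ ≤ 1) :
    stdGauss (Fin d) {g | g ⬝ᵥ g ≤ (1 - δ) * d ∨ (1 + δ) * d ≤ g ⬝ᵥ g}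
      ≤ ENNReal.ofReal (2 * Real.exp (-(δ ^ 2 / 16) * d)) := by
  have hsqrt : ∀ {x y : ℝ}, 0 < x → -(Real.log x) / 2 ≤ y → (√x)⁻¹ ^ d ≤ Real.exp (y * d) := by
    intro x y hx hy
    rw [← Real.exp_log (inv_pos.2 (Real.sqrt_pos.2 hx)), ← Real.exp_nat_mul, Real.exp_le_exp,
      Real.log_inv, Real.log_sqrt hx.le]
    have : (0 : ℝ) ≤ d := Nat.cast_nonneg d
    nlinarith
  have h1 : stdGauss (Fin d) {g | g ⬝ᵥ g ≤ (1 - δ) * d} ≤ ENNReal.ofReal (Real.exp (-(δ ^ 2 / 16) * d)) := by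
    -- The parameters `δ/4` here and `-δ/8` for the upper tail are not optimal; they leave room for
    -- the second-order errors and still give the rate `δ²/16`.
    have hτ : 0 < 1 + 2 * (δ / 4) := by positivity
    have h := measure_le_of_lintegral_exp (f := fun g : Fin d → ℝ => -(δ / 4 * (g ⬝ᵥ g)))
      (a := -(δ / 4 * ((1 - δ) * d))) (((measurable_dotProduct_self d).const_mul _).neg)
      (lintegral_exp_neg_mul_dotProduct_stdGauss hτ d).le
    refine (measure_mono fun g hg => ?_).trans (h.trans (ENNReal.ofReal_le_ofReal ?_))
    · simp only [mem_ofPred_eq] at hg ⊢; nlinarith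
    · have hlog : -(Real.log (1 + 2 * (δ / 4))) / 2 ≤ -(δ / 4) + δ ^ 2 / 8 := by
        have := Real.one_sub_inv_le_log_of_pos hτ
        have h2 : δ / 2 - δ ^ 2 / 4 ≤ 1 - (1 + 2 * (δ / 4))⁻¹ := by
          have : 1 - (1 + 2 * (δ / 4))⁻¹ = δ / 2 / (1 + δ / 2) := by field_simp; ring
          rw [this, le_div_iff₀ (by positivity)]
          nlinarith [mul_pos (mul_pos hδ hδ) hδ]
        linarith
      refine (mul_le_mul_of_nonneg_left (hsqrt hτ hlog) (Real.exp_pos _).le).trans ?_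
      rw [← Real.exp_add, Real.exp_le_exp]
      have : (0 : ℝ) ≤ d := Nat.cast_nonneg d
      nlinarith [mul_nonneg (sq_nonneg δ) this]
  have h2 : stdGauss (Fin d) {g | (1 + δ) * d ≤ g ⬝ᵥ g} ≤ ENNReal.ofReal (Real.exp (-(δ ^ 2 / 16) * d)) := by
    have hτ : 0 < 1 + 2 * (-(δ / 8)) := by linarith
    have h := measure_le_of_lintegral_exp (f := fun g : Fin d → ℝ => -(-(δ / 8) * (g ⬝ᵥ g)))
      (a := δ / 8 * ((1 + δ) * d)) (((measurable_dotProduct_self d).const_mul _).neg)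
      (lintegral_exp_neg_mul_dotProduct_stdGauss hτ d).le
    refine (measure_mono fun g hg => ?_).trans (h.trans (ENNReal.ofReal_le_ofReal ?_))
    · simp only [mem_ofPred_eq] at hg ⊢; nlinarith
    · have hlog : -(Real.log (1 + 2 * (-(δ / 8)))) / 2 ≤ δ / 8 + δ ^ 2 / 16 := by
        have := Real.one_sub_inv_le_log_of_pos hτ
        have h2 : (1 + 2 * (-(δ / 8)))⁻¹ - 1 ≤ δ / 4 + δ ^ 2 / 8 := by
          have : (1 + 2 * (-(δ / 8)))⁻¹ - 1 = δ / 4 / (1 + 2 * (-(δ / 8))) := by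
            rw [eq_div_iff hτ.ne', sub_mul, inv_mul_cancel₀ hτ.ne']; ring
          rw [this, div_le_iff₀ hτ]
          nlinarith [mul_pos (mul_pos hδ hδ) hδ, mul_nonneg (mul_pos hδ hδ).le (sub_nonneg.2 hδ1)]
        linarith
      refine (mul_le_mul_of_nonneg_left (hsqrt hτ hlog) (Real.exp_pos _).le).trans ?_
      rw [← Real.exp_add, Real.exp_le_exp]
      have : (0 : ℝ) ≤ d := Nat.cast_nonneg d
      nlinarith [mul_nonneg (sq_nonneg δ) this]
  rw [Set.ofPred_or]
  refine (measure_union_le _ _).trans ((add_le_add h1 h2).trans ?_)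
  rw [← ENNReal.ofReal_add (Real.exp_pos _).le (Real.exp_pos _).le, two_mul]

/-! ### Linear combinations of Gaussian rows. -/

/-- The combination of the vectors with coefficients `w`. -/
def rowComb {n d : ℕ} (w : Fin n → ℝ) (X : Fin n → Fin d → ℝ) : Fin d → ℝ := ∑ i, w i • X i

lemma measurable_rowComb {n d : ℕ} (w : Fin n → ℝ) :
    Measurable (rowComb w : (Fin n → Fin d → ℝ) → Fin d → ℝ) := by
  unfold rowComb; fun_prop

lemma dotProduct_gram_mulVec {n d : ℕ} (w : Fin n → ℝ) (X : Fin n → Fin d → ℝ) :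
    w ⬝ᵥ gram X *ᵥ w = (rowComb w X ⬝ᵥ rowComb w X) / d := by
  have h : w ᵥ* rowMat X = (√(d : ℝ))⁻¹ • rowComb w X := by
    ext k
    simp only [Matrix.vecMul, dotProduct, rowMat, Matrix.smul_apply, Matrix.of_apply, smul_eq_mul,
      rowComb, Pi.smul_apply, Finset.sum_apply, Finset.mul_sum]
    exact Finset.sum_congr rfl fun i _ => by ring
  rw [gram, ← Matrix.mulVec_mulVec, Matrix.dotProduct_mulVec, Matrix.mulVec_transpose, h,
    smul_dotProduct, dotProduct_smul, smul_eq_mul, smul_eq_mul, ← mul_assoc, ← mul_inv,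
    Real.mul_self_sqrt (Nat.cast_nonneg d), inv_mul_eq_div]

lemma map_rowComb_gaussRows {n d : ℕ} {w : Fin n → ℝ} (hw : w ⬝ᵥ w = 1) :
    (gaussRows n d).map (rowComb w) = stdGauss (Fin d) := by
  set T : (Fin n → Fin d → ℝ) →L[ℝ] (Fin d → ℝ) :=
    ∑ i, w i • ContinuousLinearMap.proj (R := ℝ) (φ := fun _ : Fin n => Fin d → ℝ) i with hT
  have hTw : (rowComb w : (Fin n → Fin d → ℝ) → Fin d → ℝ) = ⇑T := by
    funext X
    simp [hT, rowComb]
  apply Measure.ext_of_charFunDual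
  funext L
  rw [hTw, charFunDual_map, charFunDual_pi, charFunDual_stdGauss]
  simp only [charFunDual_stdGauss]
  rw [← Complex.exp_sum, ← Complex.ofReal_sum]
  congr 2
  have h1 : ∀ i k, ((L ∘SL T) ∘SL ContinuousLinearMap.single ℝ (fun _ : Fin n => Fin d → ℝ) i)
      (Pi.single k 1) = w i * L (Pi.single k 1) := fun i k => by
    simp only [ContinuousLinearMap.comp_apply, ContinuousLinearMap.single_apply, hT,
      _root_.sum_apply, _root_.smul_apply, ContinuousLinearMap.proj_apply]
    rw [Finset.sum_eq_single i (fun j _ hj => by simp [hj]) (by simp)]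
    simp
  simp only [h1, mul_pow, ← Finset.mul_sum, neg_div]
  rw [Finset.sum_neg_distrib, ← Finset.sum_div, ← Finset.sum_mul]
  have : ∑ i, w i ^ 2 = 1 := by rw [← hw, dotProduct]; simp only [sq]
  rw [this, one_mul]

/-! ### Extreme eigenvalues of the Gram matrix -/

section
variable {n d : ℕ}

lemma rowComb_sub (w v : Fin n → ℝ) (X : Fin n → Fin d → ℝ) :
    rowComb (w - v) X = rowComb w X - rowComb v X := by
  simp [rowComb, sub_smul, Finset.sum_sub_distrib]

lemma rowComb_smul (c : ℝ) (w : Fin n → ℝ) (X : Fin n → Fin d → ℝ) :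
    rowComb (c • w) X = c • rowComb w X := by
  simp [rowComb, Finset.smul_sum, smul_smul]

lemma rowComb_single (i : Fin n) (X : Fin n → Fin d → ℝ) : rowComb (Pi.single i 1) X = X i := by
  rw [rowComb, Finset.sum_eq_single i (fun j _ hj => by simp [hj]) (by simp)]
  simp

lemma rowComb_dotProduct_le (w : Fin n → ℝ) (X : Fin n → Fin d → ℝ) :
    rowComb w X ⬝ᵥ rowComb w X ≤ (w ⬝ᵥ w) * ∑ i, X i ⬝ᵥ X i := by
  simp only [dotProduct, rowComb, Finset.sum_apply, Pi.smul_apply, smul_eq_mul]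
  rw [Finset.sum_comm (f := fun i k => X i k * X i k), Finset.mul_sum]
  refine Finset.sum_le_sum fun k _ => ?_
  have := Finset.sum_mul_sq_le_sq_mul_sq Finset.univ w fun i => X i k
  simpa [sq] using this

lemma dotProduct_self_nonneg' {ι : Type*} [Fintype ι] (v : ι → ℝ) : 0 ≤ v ⬝ᵥ v :=
  Finset.sum_nonneg fun _ _ => mul_self_nonneg _

lemma dotProduct_self_le_two_mul {ι : Type*} [Fintype ι] (a b : ι → ℝ) :
    a ⬝ᵥ a ≤ 2 * (b ⬝ᵥ b) + 2 * ((a - b) ⬝ᵥ (a - b)) := by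
  simp only [dotProduct, Finset.mul_sum, ← Finset.sum_add_distrib, Pi.sub_apply]
  refine Finset.sum_le_sum fun i _ => ?_
  nlinarith [sq_nonneg (a i - 2 * b i)]

end

/-- The vector with coordinates `j / N - 1`. -/
noncomputable def gridVec {n N : ℕ} (j : Fin n → Fin (2 * 1 * N + 1)) : Fin n → ℝ :=
  fun i => ((j i : ℕ) : ℝ) / N - 1

lemma exists_gridVec {n N : ℕ} (hN : 0 < N) {w : Fin n → ℝ} (hw : ∀ i, |w i| ≤ 1) :
    ∃ j : Fin n → Fin (2 * 1 * N + 1), ∀ i, |gridVec j i - w i| ≤ 1 / N := by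
  choose j _ h2 using fun i => exists_grid (B := 1) hN (x := w i) (by simpa using hw i)
  exact ⟨j, fun i => by simpa [gridVec] using h2 i⟩

/-- Since the basis vectors are themselves grid points, control on the grid bounds the norms of all
rows, and hence every rounding error. -/
lemma exists_gridVec_eq_single {n N : ℕ} (hN : 0 < N) (i : Fin n) :
    ∃ j : Fin n → Fin (2 * 1 * N + 1), gridVec j = Pi.single i 1 := by
  have hN' : (N : ℝ) ≠ 0 := by positivity
  refine ⟨fun k => if k = i then ⟨2 * N, by omega⟩ else ⟨N, by omega⟩, ?_⟩
  funext k
  by_cases h : k = i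
  · subst h; simp [gridVec, hN']; norm_num
  · simp [gridVec, h, hN']

/-- A unit vector is within squared distance `n⁻³` of the grid. The norms of the rows, bounded
through the basis vectors, make the change of the form at most `Q/n²` in units of `d`, which is
small against `t`. -/
lemma quad_bounds_of_grid {n d : ℕ} (hn : 2 ≤ n) (hd : 0 < d) {t Q : ℝ} (ht : 0 < t)
    (htQ : Q / n ^ 2 ≤ t / 16) {X : Fin n → Fin d → ℝ}
    (h : ∀ j : Fin n → Fin (2 * 1 * n ^ 2 + 1), gridVec j ⬝ᵥ gridVec j ≠ 0 →
      t * d * (gridVec j ⬝ᵥ gridVec j) ≤ rowComb (gridVec j) X ⬝ᵥ rowComb (gridVec j) X ∧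
      rowComb (gridVec j) X ⬝ᵥ rowComb (gridVec j) X ≤ Q * d * (gridVec j ⬝ᵥ gridVec j))
    (w : Fin n → ℝ) :
    t / 16 * (w ⬝ᵥ w) ≤ w ⬝ᵥ gram X *ᵥ w ∧ w ⬝ᵥ gram X *ᵥ w ≤ (8 * Q + t / 8) * (w ⬝ᵥ w) := by
  have hd' : (0 : ℝ) < d := Nat.cast_pos.2 hd
  have hn' : (2 : ℝ) ≤ n := by exact_mod_cast hn
  have hn0 : (0 : ℝ) < n := by linarith
  -- reduction to unit vectors
  suffices hunit : ∀ w : Fin n → ℝ, w ⬝ᵥ w = 1 → t / 16 * d ≤ rowComb w X ⬝ᵥ rowComb w X ∧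
      rowComb w X ⬝ᵥ rowComb w X ≤ (8 * Q + t / 8) * d by
    rw [dotProduct_gram_mulVec, le_div_iff₀ hd', div_le_iff₀ hd']
    rcases (dotProduct_self_nonneg' w).eq_or_lt with h0 | h0
    · have hw : w = 0 := by
        have := (dotProduct_self_eq_zero (v := w)).1 h0.symm
        exact this
      subst hw
      simp [rowComb]
    · set c := √(w ⬝ᵥ w) with hc
      have hc0 : 0 < c := Real.sqrt_pos.2 h0
      have hcc : c * c = w ⬝ᵥ w := Real.mul_self_sqrt h0.le
      have h1 : (c⁻¹ • w) ⬝ᵥ (c⁻¹ • w) = 1 := by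
        rw [smul_dotProduct, dotProduct_smul, smul_eq_mul, smul_eq_mul, ← hcc]; field_simp
      obtain ⟨h2, h3⟩ := hunit _ h1
      rw [rowComb_smul, smul_dotProduct, dotProduct_smul, smul_eq_mul, smul_eq_mul, ← mul_assoc] at h2 h3
      have e : w ⬝ᵥ w * (c⁻¹ * c⁻¹ * rowComb w X ⬝ᵥ rowComb w X) = rowComb w X ⬝ᵥ rowComb w X := by
        rw [← hcc]; field_simp
      have h2' := mul_le_mul_of_nonneg_left h2 h0.le
      have h3' := mul_le_mul_of_nonneg_left h3 h0.le
      rw [e] at h2' h3'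
      constructor <;> linarith
  intro w hw
  have hn2 : 0 < n ^ 2 := by positivity
  have htrace : ∑ i, X i ⬝ᵥ X i ≤ n * (Q * d) := by
    have : ∀ i ∈ Finset.univ, X i ⬝ᵥ X i ≤ Q * d := fun i _ => by
      obtain ⟨j, hj⟩ := exists_gridVec_eq_single hn2 i
      have h1 : (Pi.single i 1 : Fin n → ℝ) ⬝ᵥ Pi.single i 1 = 1 := by simp
      have := (h j (by rw [hj, h1]; exact one_ne_zero)).2
      rw [hj, h1, rowComb_single, mul_one] at this
      exact this
    refine (Finset.sum_le_sum this).trans ?_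
    simp
  have hw1 : ∀ i, |w i| ≤ 1 := fun i => by
    have : w i * w i ≤ 1 := by
      rw [← hw]
      exact Finset.single_le_sum (f := fun i => w i * w i) (fun j _ => mul_self_nonneg _)
        (Finset.mem_univ i)
    exact abs_le_one_iff_mul_self_le_one.2 this
  obtain ⟨j, hj⟩ := exists_gridVec hn2 hw1
  set v := gridVec j with hv
  have hdiff : (w - v) ⬝ᵥ (w - v) ≤ 1 / n ^ 3 := by
    have h1 : ∀ i ∈ Finset.univ, (w - v) i * (w - v) i ≤ 1 / (n : ℝ) ^ 4 := fun i _ => by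
      have := hj i
      push_cast at this
      rw [← sq, ← sq_abs, Pi.sub_apply, abs_sub_comm]
      calc |v i - w i| ^ 2 ≤ (1 / (n : ℝ) ^ 2) ^ 2 := by gcongr
        _ = _ := by ring
    refine (Finset.sum_le_sum h1).trans (le_of_eq ?_)
    simp
    field_simp
  have hdiff8 : (w - v) ⬝ᵥ (w - v) ≤ 1 / 8 := hdiff.trans (by
    rw [div_le_div_iff_of_pos_left one_pos (by positivity) (by norm_num)]
    calc (8 : ℝ) = 2 ^ 3 := by norm_num
      _ ≤ n ^ 3 := by gcongr)
  have hq : rowComb (w - v) X ⬝ᵥ rowComb (w - v) X ≤ t / 16 * d := by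
    have hS : 0 ≤ ∑ i, X i ⬝ᵥ X i := Finset.sum_nonneg fun i _ => dotProduct_self_nonneg' _
    calc rowComb (w - v) X ⬝ᵥ rowComb (w - v) X ≤ (w - v) ⬝ᵥ (w - v) * ∑ i, X i ⬝ᵥ X i :=
          rowComb_dotProduct_le _ _
      _ ≤ 1 / n ^ 3 * (n * (Q * d)) := by gcongr
      _ = Q / n ^ 2 * d := by field_simp
      _ ≤ _ := by gcongr
  rw [rowComb_sub] at hq
  have hv1 := dotProduct_self_le_two_mul w v
  have hv2 := dotProduct_self_le_two_mul v w
  have hvw : (v - w) ⬝ᵥ (v - w) = (w - v) ⬝ᵥ (w - v) := by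
    rw [← neg_sub w v, neg_dotProduct_neg]
  rw [hvw] at hv2
  rw [hw] at hv1 hv2
  have hvpos : 3 / 8 ≤ v ⬝ᵥ v := by linarith
  obtain ⟨h1, h2⟩ := h j (by rw [← hv]; linarith)
  rw [← hv] at h1 h2
  have hr1 := dotProduct_self_le_two_mul (rowComb w X) (rowComb v X)
  have hr2 := dotProduct_self_le_two_mul (rowComb v X) (rowComb w X)
  have hrvw : (rowComb v X - rowComb w X) ⬝ᵥ (rowComb v X - rowComb w X)
      = (rowComb w X - rowComb v X) ⬝ᵥ (rowComb w X - rowComb v X) := by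
    rw [← neg_sub (rowComb w X) (rowComb v X), neg_dotProduct_neg]
  rw [hrvw] at hr2
  have htd : 0 < t * d := by positivity
  have hQd : 0 ≤ Q * d := by
    by_contra hcon
    have := dotProduct_self_nonneg' (rowComb v X)
    nlinarith
  constructor
  · nlinarith
  · nlinarith

lemma two_mul_grid_pow_le_exp {n : ℕ} (hn : 35 ≤ n) :
    2 * ((2 * 1 * n ^ 2 + 1 : ℕ) : ℝ) ^ n ≤ Real.exp (n ^ 2) := by
  have hn' : (35 : ℝ) ≤ n := by exact_mod_cast hn
  set y : ℝ := 2 * n + 1 with hy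
  have hy0 : 0 < y := by positivity
  have h1 : Real.log y ≤ 2 * √y := by
    have h2 := Real.log_le_sub_one_of_pos (Real.sqrt_pos.2 hy0)
    rw [Real.log_sqrt hy0.le] at h2
    linarith
  have h2 : √y ≤ (n - 1) / 4 := Real.sqrt_le_iff.2 ⟨by linarith, by rw [hy]; nlinarith⟩
  have h3 : Real.log (2 * n ^ 2 + 1) ≤ n - 1 := by
    have : Real.log (2 * (n : ℝ) ^ 2 + 1) ≤ Real.log (y ^ 2) :=
      Real.log_le_log (by positivity) (by rw [hy]; nlinarith)
    rw [Real.log_pow] at this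
    push_cast at this
    linarith
  have h4 : 2 * (n : ℝ) ^ 2 + 1 ≤ Real.exp (n - 1) := by
    rwa [← Real.log_le_iff_le_exp (by positivity)]
  push_cast
  calc 2 * (2 * (n : ℝ) ^ 2 + 1) ^ n ≤ Real.exp 1 * Real.exp (n - 1) ^ n := by
        have : (2 : ℝ) ≤ Real.exp 1 := by have := Real.exp_one_gt_d9; linarith
        gcongr
    _ = Real.exp (1 + n * (n - 1)) := by rw [← Real.exp_nat_mul, ← Real.exp_add]
    _ ≤ _ := Real.exp_le_exp.2 (by nlinarith)

/-- A normalised combination of the rows is a standard Gaussian vector. The thresholds are those for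
which the small-ball estimate and the upper tail estimate both equal `exp(-Md)`. -/
lemma gaussRows_rowComb_outlier_le {n d : ℕ} {w : Fin n → ℝ} (hw : w ⬝ᵥ w ≠ 0) (M : ℝ) :
    gaussRows n d {X | ¬ (Real.exp (-1 - 2 * M) * d * (w ⬝ᵥ w) ≤ rowComb w X ⬝ᵥ rowComb w X ∧
      rowComb w X ⬝ᵥ rowComb w X ≤ (4 * M + 2) * d * (w ⬝ᵥ w))}
      ≤ ENNReal.ofReal (2 * Real.exp (-M * d)) := by
  have hw0 : 0 < w ⬝ᵥ w := lt_of_le_of_ne (dotProduct_self_nonneg' w) hw.symm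
  set c := √(w ⬝ᵥ w) with hc
  have hc0 : 0 < c := Real.sqrt_pos.2 hw0
  have hcc : c * c = w ⬝ᵥ w := Real.mul_self_sqrt hw0.le
  have h1 : (c⁻¹ • w) ⬝ᵥ (c⁻¹ • w) = 1 := by
    rw [smul_dotProduct, dotProduct_smul, smul_eq_mul, smul_eq_mul, ← hcc]; field_simp
  set t := Real.exp (-1 - 2 * M) with ht
  set T : Set (Fin d → ℝ) := {g | g ⬝ᵥ g ≤ t * d} ∪ {g | (4 * M + 2) * d ≤ g ⬝ᵥ g} with hT
  have hsub : {X : Fin n → Fin d → ℝ | ¬ (t * d * (w ⬝ᵥ w) ≤ rowComb w X ⬝ᵥ rowComb w X ∧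
      rowComb w X ⬝ᵥ rowComb w X ≤ (4 * M + 2) * d * (w ⬝ᵥ w))}
      ⊆ rowComb (c⁻¹ • w) ⁻¹' T := by
    intro X hX
    have e : rowComb w X ⬝ᵥ rowComb w X
        = (w ⬝ᵥ w) * (rowComb (c⁻¹ • w) X ⬝ᵥ rowComb (c⁻¹ • w) X) := by
      rw [rowComb_smul, smul_dotProduct, dotProduct_smul, smul_eq_mul, smul_eq_mul, ← hcc]; field_simp
    simp only [mem_ofPred_eq, not_and_or, not_le] at hX
    rcases hX with h | h
    · left
      rw [e] at h
      simp only [mem_ofPred_eq]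
      nlinarith
    · right
      rw [e] at h
      simp only [mem_ofPred_eq]
      nlinarith
  have hm := measurable_dotProduct_self d
  have hTm : MeasurableSet T :=
    (measurableSet_le hm measurable_const).union (measurableSet_le measurable_const hm)
  refine (measure_mono hsub).trans ?_
  rw [← Measure.map_apply (measurable_rowComb _) hTm, map_rowComb_gaussRows h1]
  refine (measure_union_le _ _).trans ((add_le_add (stdGauss_dotProduct_le d (Real.exp_pos _))
    (stdGauss_le_dotProduct d _)).trans ?_)
  rw [← ENNReal.ofReal_add (by positivity) (Real.exp_pos _).le]
  refine ENNReal.ofReal_le_ofReal (le_of_eq ?_)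
  have e1 : √(Real.exp (-1 - 2 * M)) = Real.exp (-(1 / 2) - M) := by
    rw [Real.sqrt_eq_iff_mul_self_eq (Real.exp_pos _).le (Real.exp_pos _).le, ← Real.exp_add]
    congr 1; ring
  rw [e1, ← Real.exp_add, ← Real.exp_nat_mul, two_mul]
  congr 2 <;> ring

/-- With overwhelming probability the Gram matrix is bounded above and below. -/
theorem exists_quad_bounds {B e₁ : ℝ} (hB : 0 ≤ B) (he₁ : 0 < e₁) :
    ∃ δ₁ > 0, ∃ Q > 0, ∃ n₀ : ℕ, ∀ n ≥ n₀, ∀ d : ℕ, 0 < d → (n : ℝ) ≤ e₁ * √(d : ℝ) →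
      gaussRows n d {X | ¬ ∀ w : Fin n → ℝ, δ₁ * (w ⬝ᵥ w) ≤ w ⬝ᵥ gram X *ᵥ w ∧
        w ⬝ᵥ gram X *ᵥ w ≤ Q * (w ⬝ᵥ w)} ≤ ENNReal.ofReal (Real.exp (-(B * n ^ 2))) := by
  -- Then `Md ≥ (B + 1)n²`; one `n²` pays for the number of grid points.
  set M := (B + 1) * e₁ ^ 2 with hM
  have hM0 : 0 < M := by positivity
  set t := Real.exp (-1 - 2 * M) with ht
  have ht0 : 0 < t := Real.exp_pos _
  refine ⟨t / 16, by positivity, 8 * (4 * M + 2) + t / 8, by positivity,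
    max 35 ⌈(4 * M + 2) / (t / 16)⌉₊, fun n hn d hd hnd => ?_⟩
  have hn35 : 35 ≤ n := (le_max_left _ _).trans hn
  have hn' : (35 : ℝ) ≤ n := by exact_mod_cast hn35
  have hnt : (4 * M + 2) / n ^ 2 ≤ t / 16 := by
    have h1 : (4 * M + 2) / (t / 16) ≤ n :=
      (Nat.le_ceil _).trans (Nat.cast_le.2 ((le_max_right _ _).trans hn))
    rw [div_le_iff₀ (by positivity)] at h1 ⊢
    have : n * (t / 16) ≤ t / 16 * n ^ 2 := by
      have : (n : ℝ) ≤ n ^ 2 := by nlinarith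
      nlinarith
    linarith
  have hrd : √(d : ℝ) ^ 2 = d := Real.sq_sqrt (Nat.cast_nonneg d)
  have hMd : (B + 1) * n ^ 2 ≤ M * d := by
    have : (n : ℝ) ^ 2 ≤ (e₁ * √(d : ℝ)) ^ 2 := by gcongr
    rw [mul_pow, hrd] at this
    calc (B + 1) * (n : ℝ) ^ 2 ≤ (B + 1) * (e₁ ^ 2 * d) := by gcongr
      _ = M * d := by rw [hM]; ring
  set bad : (Fin n → Fin (2 * 1 * n ^ 2 + 1)) → Set (Fin n → Fin d → ℝ) := fun j =>
    {X | gridVec j ⬝ᵥ gridVec j ≠ 0 ∧ ¬ (t * d * (gridVec j ⬝ᵥ gridVec j)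
      ≤ rowComb (gridVec j) X ⬝ᵥ rowComb (gridVec j) X ∧
      rowComb (gridVec j) X ⬝ᵥ rowComb (gridVec j) X ≤ (4 * M + 2) * d * (gridVec j ⬝ᵥ gridVec j))}
    with hbad
  have hbadle : ∀ j, gaussRows n d (bad j) ≤ ENNReal.ofReal (2 * Real.exp (-M * d)) := fun j => by
    by_cases h0 : gridVec j ⬝ᵥ gridVec j = 0
    · have : bad j = ∅ := eq_empty_of_forall_notMem fun X hX => hX.1 h0
      rw [this, measure_empty]; exact zero_le
    · exact (measure_mono fun X hX => hX.2).trans (gaussRows_rowComb_outlier_le h0 M)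
  calc _ ≤ gaussRows n d (⋃ j, bad j) := measure_mono fun X hX => by
        by_contra hcon
        refine hX (quad_bounds_of_grid (by omega) hd ht0 hnt fun j hj => ?_)
        by_contra hj2
        exact hcon (mem_iUnion.2 ⟨j, hj, hj2⟩)
    _ ≤ ∑ j, gaussRows n d (bad j) := measure_iUnion_fintype_le _ _
    _ ≤ ∑ _ : Fin n → Fin (2 * 1 * n ^ 2 + 1), ENNReal.ofReal (2 * Real.exp (-M * d)) :=
        Finset.sum_le_sum fun j _ => hbadle j
    _ = ENNReal.ofReal (((2 * 1 * n ^ 2 + 1 : ℕ) : ℝ) ^ n * (2 * Real.exp (-M * d))) := by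
        rw [Finset.sum_const, nsmul_eq_mul, Finset.card_univ, Fintype.card_fun, Fintype.card_fin,
          Fintype.card_fin, ← Nat.cast_pow, ENNReal.ofReal_mul (Nat.cast_nonneg _),
          ENNReal.ofReal_natCast]
    _ ≤ _ := by
        refine ENNReal.ofReal_le_ofReal ?_
        calc ((2 * 1 * n ^ 2 + 1 : ℕ) : ℝ) ^ n * (2 * Real.exp (-M * d))
            = 2 * ((2 * 1 * n ^ 2 + 1 : ℕ) : ℝ) ^ n * Real.exp (-M * d) := by ring
          _ ≤ Real.exp (n ^ 2) * Real.exp (-M * d) := by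
              gcongr; exact two_mul_grid_pow_le_exp hn35
          _ ≤ _ := by rw [← Real.exp_add, Real.exp_le_exp]; linarith

/-! ### The sum of squares of the inner products -/

/-- The exponential of a square is a Gaussian average of exponentials of linear forms. After
exchanging the order of integration, the inner integral is a quadratic form of the Gram matrix,
bounded through `Q`, and the outer one is `√2` per coordinate, at most `e^{1/2}`. -/
lemma lintegral_exp_mulVec_sq_le {n d : ℕ} (X : Fin n → Fin d → ℝ) {Q : ℝ} (hQ : 0 < Q)
    (hX : ∀ w : Fin n → ℝ, w ⬝ᵥ gram X *ᵥ w ≤ Q * (w ⬝ᵥ w)) :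
    ∫⁻ g, ENNReal.ofReal (Real.exp (1 / (4 * Q) * (rowMat X *ᵥ g ⬝ᵥ rowMat X *ᵥ g))) ∂stdGauss (Fin d)
      ≤ ENNReal.ofReal (Real.exp (1 / 2) ^ n) := by
  set r := √(1 / (2 * Q)) with hr
  have hrr : r * r = 1 / (2 * Q) := Real.mul_self_sqrt (by positivity)
  have h1 : ∀ g : Fin d → ℝ, ENNReal.ofReal (Real.exp (1 / (4 * Q) * (rowMat X *ᵥ g ⬝ᵥ rowMat X *ᵥ g)))
      = ∫⁻ h, ENNReal.ofReal (Real.exp ((r • rowMat X *ᵥ g) ⬝ᵥ h)) ∂stdGauss (Fin n) := fun g => by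
    rw [lintegral_exp_dotProduct_stdGauss, smul_dotProduct, dotProduct_smul, smul_eq_mul,
      smul_eq_mul, ← mul_assoc, hrr]
    congr 2; field_simp; ring
  have hcont : Continuous fun z : (Fin d → ℝ) × (Fin n → ℝ) =>
      Real.exp ((r • rowMat X *ᵥ z.1) ⬝ᵥ z.2) := by
    simp only [dotProduct, Matrix.mulVec, Pi.smul_apply]
    fun_prop
  simp only [h1]
  rw [lintegral_lintegral_swap hcont.measurable.ennreal_ofReal.aemeasurable]
  have h2 : ∀ h : Fin n → ℝ, ∫⁻ g, ENNReal.ofReal (Real.exp ((r • rowMat X *ᵥ g) ⬝ᵥ h)) ∂stdGauss (Fin d)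
      ≤ ENNReal.ofReal (Real.exp (-(-(1 / 4) * (h ⬝ᵥ h)))) := fun h => by
    have e : ∀ g : Fin d → ℝ, (r • rowMat X *ᵥ g) ⬝ᵥ h = (r • (h ᵥ* rowMat X)) ⬝ᵥ g := fun g => by
      rw [smul_dotProduct, smul_dotProduct, dotProduct_comm, Matrix.dotProduct_mulVec]
    simp only [e]
    rw [lintegral_exp_dotProduct_stdGauss]
    refine ENNReal.ofReal_le_ofReal (Real.exp_le_exp.2 ?_)
    have h3 := hX h
    rw [gram, ← Matrix.mulVec_mulVec, Matrix.dotProduct_mulVec, Matrix.mulVec_transpose] at h3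
    rw [smul_dotProduct, dotProduct_smul, smul_eq_mul, smul_eq_mul, ← mul_assoc, hrr]
    calc 1 / (2 * Q) * (h ᵥ* rowMat X ⬝ᵥ h ᵥ* rowMat X) / 2
        ≤ 1 / (2 * Q) * (Q * (h ⬝ᵥ h)) / 2 := by gcongr
      _ = _ := by field_simp; ring
  refine (lintegral_mono h2).trans ?_
  have hτ : 0 < 1 + 2 * (-(1 / 4) : ℝ) := by norm_num
  rw [lintegral_exp_neg_mul_dotProduct_stdGauss hτ]
  refine ENNReal.ofReal_le_ofReal (pow_le_pow_left₀ (by positivity) ?_ n)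
  rw [inv_le_comm₀ (Real.sqrt_pos.2 hτ) (Real.exp_pos _), ← Real.exp_neg]
  refine Real.le_sqrt_of_sq_le ?_
  rw [← Real.exp_nat_mul]
  have h2 : Real.exp (((2 : ℕ) : ℝ) * -(1 / 2)) = (Real.exp 1)⁻¹ := by
    rw [← Real.exp_neg]; norm_num
  rw [h2, inv_le_comm₀ (Real.exp_pos 1) (by norm_num)]
  have h1 := Real.exp_one_gt_d9
  norm_num
  linarith

lemma quad_le_of_snoc {n d : ℕ} {Q : ℝ} {X : Fin n → Fin d → ℝ} {g : Fin d → ℝ}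
    (h : ∀ w : Fin (n + 1) → ℝ, w ⬝ᵥ gram (Fin.snoc (α := fun _ => Fin d → ℝ) X g) *ᵥ w
      ≤ Q * (w ⬝ᵥ w)) (w : Fin n → ℝ) : w ⬝ᵥ gram X *ᵥ w ≤ Q * (w ⬝ᵥ w) := by
  have hg : ∀ i j : Fin n, gram (Fin.snoc (α := fun _ => Fin d → ℝ) X g) i.castSucc j.castSucc
      = gram X i j := fun i j => by simp [gram_apply]
  have := h (Fin.snoc (α := fun _ => ℝ) w 0)
  simpa [dotProduct, Matrix.mulVec, Fin.sum_univ_castSucc, hg] using this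

lemma sum_gramTri_snoc {n d : ℕ} (X : Fin n → Fin d → ℝ) (g : Fin d → ℝ) :
    Tri.sum (fun y => y ^ 2) (gramTri (Fin.snoc (α := fun _ => Fin d → ℝ) X g))
      = Tri.sum (fun y => y ^ 2) (gramTri X) + rowMat X *ᵥ g ⬝ᵥ rowMat X *ᵥ g := by
  have hinit : initRows (Fin.snoc (α := fun _ => Fin d → ℝ) X g) = X := by
    funext i; simp [initRows]
  rw [gramTri, hinit, Fin.snoc_last]
  change _ + ∑ j, ((rowMat X *ᵥ g) j) ^ 2 = _
  simp only [dotProduct, sq]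

-- The bound on the largest eigenvalue passes to the first rows, so the rows can be integrated out
-- one at a time, each costing `e^{1/2}` per earlier row.
open Classical in
lemma lintegral_exp_sum_sq_gramTri_le {d : ℕ} {Q : ℝ} (hQ : 0 < Q) : ∀ n : ℕ,
    ∫⁻ X, (if ∀ w : Fin n → ℝ, w ⬝ᵥ gram X *ᵥ w ≤ Q * (w ⬝ᵥ w) then ENNReal.ofReal (Real.exp
      (1 / (4 * Q) * Tri.sum (fun y => y ^ 2) (gramTri X))) else 0) ∂gaussRows n d
      ≤ ENNReal.ofReal (Real.exp (1 / 2) ^ n.choose 2)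
  | 0 => by
    calc _ ≤ ∫⁻ _, 1 ∂gaussRows 0 d := lintegral_mono fun X => by
          split_ifs
          · simp [Tri.sum]
          · exact zero_le
      _ ≤ _ := by simp
  | n + 1 => by
    rw [gaussRows, lintegral_pi_succ]
    refine (lintegral_prod_le _).trans ?_
    calc _ ≤ ∫⁻ X, (if ∀ w : Fin n → ℝ, w ⬝ᵥ gram X *ᵥ w ≤ Q * (w ⬝ᵥ w) then ENNReal.ofReal (Real.exp
            (1 / (4 * Q) * Tri.sum (fun y => y ^ 2) (gramTri X))) else 0)
            * ENNReal.ofReal (Real.exp (1 / 2) ^ n) ∂gaussRows n d := by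
          refine lintegral_mono fun X => ?_
          by_cases hX : ∀ w : Fin n → ℝ, w ⬝ᵥ gram X *ᵥ w ≤ Q * (w ⬝ᵥ w)
          · rw [if_pos hX]
            calc _ ≤ ∫⁻ g, ENNReal.ofReal (Real.exp (1 / (4 * Q) * Tri.sum (fun y => y ^ 2) (gramTri X)))
                * ENNReal.ofReal (Real.exp (1 / (4 * Q) * (rowMat X *ᵥ g ⬝ᵥ rowMat X *ᵥ g)))
                ∂stdGauss (Fin d) := lintegral_mono fun g => by
                  split_ifs with h
                  · rw [← ENNReal.ofReal_mul (Real.exp_pos _).le, ← Real.exp_add, ← mul_add,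
                      ← sum_gramTri_snoc]
                  · exact zero_le
              _ ≤ _ := by
                  rw [lintegral_const_mul' _ _ ENNReal.ofReal_ne_top]
                  exact mul_le_mul' le_rfl (lintegral_exp_mulVec_sq_le X hQ hX)
          · rw [if_neg hX, zero_mul, nonpos_iff_eq_zero]
            have : ∀ g : Fin d → ℝ, ¬ ∀ w : Fin (n + 1) → ℝ,
                w ⬝ᵥ gram (Fin.snoc (α := fun _ => Fin d → ℝ) X g) *ᵥ w ≤ Q * (w ⬝ᵥ w) :=
              fun g h => hX (quad_le_of_snoc h)
            simp [this]
      _ ≤ ENNReal.ofReal (Real.exp (1 / 2) ^ n.choose 2) * ENNReal.ofReal (Real.exp (1 / 2) ^ n) := by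
          rw [lintegral_mul_const' _ _ ENNReal.ofReal_ne_top]
          exact mul_le_mul' (lintegral_exp_sum_sq_gramTri_le hQ n) le_rfl
      _ = _ := by
          rw [← ENNReal.ofReal_mul (by positivity), ← pow_add, Nat.choose_succ_succ' n 1,
            Nat.choose_one_right, add_comm]

/-- With overwhelming probability the sum of squares of the inner products is of order `n²`, unless
the largest eigenvalue of the Gram matrix is large. -/
lemma gaussRows_sum_sq_le {n d : ℕ} {B Q : ℝ} (hQ : 0 < Q) :
    gaussRows n d {X | (∀ w : Fin n → ℝ, w ⬝ᵥ gram X *ᵥ w ≤ Q * (w ⬝ᵥ w)) ∧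
      4 * Q * (B + 1) * n ^ 2 ≤ Tri.sum (fun y => y ^ 2) (gramTri X)}
      ≤ ENNReal.ofReal (Real.exp (-(B * n ^ 2))) := by
  classical
  have h1 := mul_meas_ge_le_lintegral₀ (μ := gaussRows n d) (f := fun X : Fin n → Fin d → ℝ =>
    if ∀ w : Fin n → ℝ, w ⬝ᵥ gram X *ᵥ w ≤ Q * (w ⬝ᵥ w) then ENNReal.ofReal (Real.exp
      (1 / (4 * Q) * Tri.sum (fun y => y ^ 2) (gramTri X))) else 0) (by
    refine Measurable.aemeasurable (Measurable.ite ?_ ?_ measurable_const)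
    · have : {X : Fin n → Fin d → ℝ | ∀ w : Fin n → ℝ, w ⬝ᵥ gram X *ᵥ w ≤ Q * (w ⬝ᵥ w)}
          = ⋂ w : Fin n → ℝ, {X | w ⬝ᵥ gram X *ᵥ w ≤ Q * (w ⬝ᵥ w)} := by ext; simp
      rw [this]
      refine (isClosed_iInter fun w => isClosed_le ?_ continuous_const).measurableSet
      simp only [dotProduct, Matrix.mulVec]
      exact continuous_finsetSum _ fun i _ => continuous_const.mul
        (continuous_finsetSum _ fun j _ => (continuous_gram i j).mul continuous_const)
    · have : Measurable fun X : Fin n → Fin d → ℝ => Tri.sum (fun y => y ^ 2) (gramTri X) := by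
        have h2 : (fun A : Tri n => Tri.sum (fun y => y ^ 2) A)
            = Tri.pairSum (fun _ _ y => y ^ 2) := funext fun A => Tri.sum_eq_pairSum _ A
        have h3 : Measurable fun A : Tri n => Tri.sum (fun y => y ^ 2) A := by
          rw [h2]
          exact Tri.measurable_pairSum _ fun i j => by fun_prop
        exact h3.comp measurable_gramTri
      fun_prop) (ENNReal.ofReal (Real.exp ((B + 1) * n ^ 2)))
  have h2 := h1.trans (lintegral_exp_sum_sq_gramTri_le hQ n)
  have h3 : Real.exp (1 / 2) ^ n.choose 2 ≤ Real.exp (n ^ 2) := by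
    rw [← Real.exp_nat_mul, Real.exp_le_exp, Nat.cast_choose_two]
    have : (0 : ℝ) ≤ n := Nat.cast_nonneg n
    nlinarith
  have h4 := h2.trans (ENNReal.ofReal_le_ofReal h3)
  have h5 : {X : Fin n → Fin d → ℝ | (∀ w : Fin n → ℝ, w ⬝ᵥ gram X *ᵥ w ≤ Q * (w ⬝ᵥ w)) ∧
      4 * Q * (B + 1) * n ^ 2 ≤ Tri.sum (fun y => y ^ 2) (gramTri X)} ⊆
      {X | ENNReal.ofReal (Real.exp ((B + 1) * n ^ 2)) ≤ if ∀ w : Fin n → ℝ, w ⬝ᵥ gram X *ᵥ w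
        ≤ Q * (w ⬝ᵥ w) then ENNReal.ofReal (Real.exp
        (1 / (4 * Q) * Tri.sum (fun y => y ^ 2) (gramTri X))) else 0} := by
    rintro X ⟨hX1, hX2⟩
    simp only [mem_ofPred_eq]
    rw [if_pos hX1]
    refine ENNReal.ofReal_le_ofReal (Real.exp_le_exp.2 ?_)
    rw [one_div, inv_mul_eq_div, le_div_iff₀ (by positivity)]
    linarith
  refine (measure_mono h5).trans ?_
  set m := gaussRows n d {X | ENNReal.ofReal (Real.exp ((B + 1) * n ^ 2)) ≤ if ∀ w : Fin n → ℝ,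
      w ⬝ᵥ gram X *ᵥ w ≤ Q * (w ⬝ᵥ w) then ENNReal.ofReal (Real.exp
        (1 / (4 * Q) * Tri.sum (fun y => y ^ 2) (gramTri X))) else 0}
  calc m = ENNReal.ofReal (Real.exp (-((B + 1) * n ^ 2))) * (ENNReal.ofReal (Real.exp ((B + 1) * n ^ 2)) * m) := by
        rw [← mul_assoc, ← ENNReal.ofReal_mul (Real.exp_pos _).le, ← Real.exp_add]; simp
    _ ≤ ENNReal.ofReal (Real.exp (-((B + 1) * n ^ 2))) * ENNReal.ofReal (Real.exp (n ^ 2)) := by gcongr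
    _ = _ := by
        rw [← ENNReal.ofReal_mul (Real.exp_pos _).le, ← Real.exp_add]; congr 2; ring

/-! ### Reduction to good rows -/

lemma measurePreserving_comp_pi {α : Type*} [MeasurableSpace α] (μ : Measure α)
    [IsProbabilityMeasure μ] {m n : ℕ} {f : Fin m → Fin n} (hf : Function.Injective f) :
    MeasurePreserving (fun (X : Fin n → α) j => X (f j)) (Measure.pi fun _ => μ)
      (Measure.pi fun _ => μ) := by
  refine ⟨by fun_prop, ?_⟩
  have h1 : iIndepFun (fun (i : Fin n) (X : Fin n → α) => X i) (Measure.pi fun _ => μ) :=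
    iIndepFun_pi (X := fun _ x => x) fun i => aemeasurable_id
  have h2 := (iIndepFun_iff_map_fun_eq_pi_map
    (fun i => (measurable_pi_apply (f i)).aemeasurable)).1 (h1.precomp hf)
  rw [h2]
  congr 1
  funext j
  exact (measurePreserving_eval (fun _ : Fin n => μ) (f j)).map_eq

lemma measurePreserving_comp_gaussRows {m n : ℕ} (d : ℕ) {f : Fin m → Fin n}
    (hf : Function.Injective f) :
    MeasurePreserving (fun (X : Fin n → Fin d → ℝ) j => X (f j)) (gaussRows n d) (gaussRows m d) :=
  measurePreserving_comp_pi _ hf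

lemma rowComb_comp {m n d : ℕ} (f : Fin m → Fin n) (w : Fin m → ℝ) (X : Fin n → Fin d → ℝ) :
    rowComb (∑ j, w j • Pi.single (f j) 1) X = rowComb w fun j => X (f j) := by
  simp only [rowComb, Finset.sum_apply, Pi.smul_apply, Finset.sum_smul]
  rw [Finset.sum_comm]
  refine Finset.sum_congr rfl fun j _ => ?_
  rw [Finset.sum_eq_single (f j) (fun i _ hi => by simp [hi]) (by simp)]
  simp

lemma dotProduct_sum_single {m n : ℕ} {f : Fin m → Fin n} (hf : Function.Injective f)
    (w : Fin m → ℝ) : (∑ j, w j • (Pi.single (f j) 1 : Fin n → ℝ))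
      ⬝ᵥ (∑ j, w j • (Pi.single (f j) 1 : Fin n → ℝ)) = w ⬝ᵥ w := by
  rw [sum_dotProduct]
  refine Finset.sum_congr rfl fun j _ => ?_
  rw [smul_dotProduct, single_one_dotProduct, Finset.sum_apply,
    Finset.sum_eq_single j (fun k _ hk => by simp [hf.ne hk.symm]) (by simp)]
  simp

lemma sum_comp_le_sum {m n : ℕ} {f : Fin m → Fin n} (hf : Function.Injective f) {a : Fin n → ℝ}
    (ha : ∀ i, 0 ≤ a i) : ∑ j, a (f j) ≤ ∑ i, a i := by
  classical
  rw [← Finset.sum_image (f := a) (s := Finset.univ) (g := f) fun x _ y _ h => hf h]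
  exact Finset.sum_le_univ_sum_of_nonneg ha

/-- After the removal of boundedly many vectors the remaining ones are good. -/
lemma exists_goodRows_comp {n d : ℕ} (hd : 0 < d) {δ₀ δ₁ z F : ℝ} (hδ₁ : 0 < δ₁) (hz : 0 < z)
    {X : Fin n → Fin d → ℝ}
    (hq : ∀ w : Fin n → ℝ, δ₁ * (w ⬝ᵥ w) ≤ w ⬝ᵥ gram X *ᵥ w)
    (hF : Tri.sum (fun y => y ^ 2) (gramTri X) ≤ F * n ^ 2)
    {j₁ j₂ j : ℕ} (hj : j₁ + j₂ ≤ j) (hjn : 2 * j ≤ n) (hj₂ : 2 * F * n ^ 2 / d / (z * δ₁) ≤ j₂)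
    {N : Finset (Fin n)} (hN : N.card ≤ j₁)
    (hNb : ∀ i, i ∉ N → 1 - δ₀ ≤ gram X i i ∧ gram X i i ≤ 1 + δ₀) :
    ∃ T : Finset (Fin n), ∃ hT : T.card = n - j,
      GoodRows δ₀ δ₁ z (2 * (4 * F) * ((n - j : ℕ) : ℝ) ^ 2 / d) fun i => X (T.orderEmbOfFin hT i) := by
  classical
  have hd' : (0 : ℝ) < d := Nat.cast_pos.2 hd
  have hn2 : (n : ℝ) ^ 2 ≤ 4 * ((n - j : ℕ) : ℝ) ^ 2 := by
    rw [Nat.cast_sub (by omega)]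
    have h1 : (2 : ℝ) * j ≤ n := by exact_mod_cast hjn
    have h2 : (0 : ℝ) ≤ n := Nat.cast_nonneg n
    nlinarith
  have hsum : ∑ i, ∑ k, (if i = k then 0 else gram X i k ^ 2) ≤ 2 * F * n ^ 2 / d := by
    have h1 := Tri.two_mul_sum (fun y => y ^ 2) (gramTri X)
    have h2 : ∑ i, ∑ j, (if i = j then 0 else (gramTri X).mat i j ^ 2)
        = (∑ i, ∑ j, (if i = j then 0 else gram X i j ^ 2)) * d := by
      simp only [Finset.sum_mul]
      refine Finset.sum_congr rfl fun i _ => Finset.sum_congr rfl fun j _ => ?_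
      split_ifs with hij
      · simp
      · rw [mat_gramTri X i j hij, gram_apply, div_pow, Real.sq_sqrt hd'.le]
        field_simp
    rw [le_div_iff₀ hd', ← h2, ← h1]
    linarith
  have hterm : ∀ i k, 0 ≤ (if i = k then 0 else gram X i k ^ 2) := fun i k => by
    split_ifs
    · exact le_rfl
    · exact sq_nonneg _
  have hF0 : 0 ≤ 2 * F * n ^ 2 / d :=
    (Finset.sum_nonneg fun i _ => Finset.sum_nonneg fun k _ => hterm i k).trans hsum
  -- The total of the row sums is bounded, so only boundedly many rows can exceed the threshold.
  set R : Finset (Fin n) := Finset.univ.filter fun i =>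
    z * δ₁ < ∑ k, (if i = k then 0 else gram X i k ^ 2) with hR
  have hRcard : R.card ≤ j₂ := by
    have h1 : R.card * (z * δ₁) ≤ 2 * F * n ^ 2 / d := by
      refine le_trans ?_ hsum
      rw [← nsmul_eq_mul]
      exact (Finset.card_nsmul_le_sum R _ _ fun i hi => (Finset.mem_filter.1 hi).2.le).trans
        (Finset.sum_le_univ_sum_of_nonneg fun i => Finset.sum_nonneg fun k _ => hterm i k)
    have h2 : (R.card : ℝ) ≤ 2 * F * n ^ 2 / d / (z * δ₁) := by
      rwa [le_div_iff₀ (by positivity)]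
    exact_mod_cast h2.trans hj₂
  -- The removed set is padded to exactly `j` elements, so that the number of remaining rows is
  -- fixed in advance.
  obtain ⟨J, hJ, hJc⟩ := Finset.exists_superset_card_eq (s := N ∪ R) (n := j)
    ((Finset.card_union_le _ _).trans (by omega)) (by rw [Fintype.card_fin]; omega)
  have hT : Jᶜ.card = n - j := by rw [Finset.card_compl, Fintype.card_fin, hJc]
  refine ⟨Jᶜ, hT, ?_⟩
  set f := Jᶜ.orderEmbOfFin hT with hf
  have hfinj : Function.Injective f := f.injective
  have hfJ : ∀ i, f i ∉ N ∧ f i ∉ R := fun i => by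
    have : f i ∈ Jᶜ := Finset.orderEmbOfFin_mem _ _ _
    have : f i ∉ N ∪ R := fun h => (Finset.mem_compl.1 this) (hJ h)
    simpa [not_or] using this
  have hgram : ∀ i k, gram (fun i => X (f i)) i k = gram X (f i) (f k) := fun i k => by
    rw [gram_apply, gram_apply]
  have hrow : ∀ i, ∑ k, (if i = k then 0 else gram (fun i => X (f i)) i k ^ 2)
      ≤ ∑ k, (if f i = k then 0 else gram X (f i) k ^ 2) := fun i => by
    refine le_trans (le_of_eq ?_) (sum_comp_le_sum hfinj (hterm (f i)))
    refine Finset.sum_congr rfl fun k _ => ?_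
    rw [hgram]
    simp [hfinj.eq_iff]
  refine ⟨fun i => ?_, fun i => ?_, fun w => ?_, ?_, fun i => (hrow i).trans ?_⟩
  · rw [hgram]; exact (hNb _ (hfJ i).1).2
  · rw [hgram]; exact (hNb _ (hfJ i).1).1
  · have h1 := hq (∑ j, w j • Pi.single (f j) 1)
    rw [dotProduct_gram_mulVec, rowComb_comp, dotProduct_sum_single hfinj] at h1
    rw [dotProduct_gram_mulVec]
    exact h1
  · refine (Finset.sum_le_sum fun i _ => hrow i).trans ((sum_comp_le_sum hfinj
      fun i => Finset.sum_nonneg fun k _ => hterm i k).trans (hsum.trans ?_))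
    have hF0' : 0 ≤ F ∨ n = 0 := by
      rcases Nat.eq_zero_or_pos n with h | h
      · exact Or.inr h
      · left
        by_contra hcon
        have : (0 : ℝ) < n := Nat.cast_pos.2 h
        have h3 : 2 * F * n ^ 2 / d < 0 := div_neg_of_neg_of_pos (by nlinarith [sq_pos_of_pos this]) hd'
        linarith
    rcases hF0' with h | h
    · gcongr ?_ / _
      nlinarith
    · subst h; simp
  · by_contra hcon
    exact (hfJ i).2 (Finset.mem_filter.2 ⟨Finset.mem_univ _, not_le.1 hcon⟩)

lemma gaussRows_norm_outliers_le {n d : ℕ} {δ : ℝ} (hδ : 0 < δ) (hδ1 : δ ≤ 1)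
    (T : Finset (Fin n)) :
    gaussRows n d {X | ∀ i ∈ T, X i ⬝ᵥ X i ≤ (1 - δ) * d ∨ (1 + δ) * d ≤ X i ⬝ᵥ X i}
      ≤ ENNReal.ofReal ((2 * Real.exp (-(δ ^ 2 / 16) * d)) ^ T.card) := by
  classical
  set Bad : Set (Fin d → ℝ) := {g | g ⬝ᵥ g ≤ (1 - δ) * d ∨ (1 + δ) * d ≤ g ⬝ᵥ g} with hBad
  have h : {X : Fin n → Fin d → ℝ | ∀ i ∈ T, X i ⬝ᵥ X i ≤ (1 - δ) * d ∨ (1 + δ) * d ≤ X i ⬝ᵥ X i}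
      = univ.pi fun i => if i ∈ T then Bad else univ := by
    ext X
    simp only [mem_ofPred_eq, Set.mem_pi, mem_univ, true_implies]
    refine forall_congr' fun i => ?_
    by_cases hi : i ∈ T <;> simp [hi, hBad]
  rw [h, gaussRows, Measure.pi_pi]
  have : ∀ i, stdGauss (Fin d) (if i ∈ T then Bad else univ)
      = if i ∈ T then stdGauss (Fin d) Bad else 1 := fun i => by
    split_ifs
    · rfl
    · exact measure_univ
  simp only [this]
  rw [Finset.prod_ite_mem, Finset.univ_inter, Finset.prod_const, ENNReal.ofReal_pow (by positivity)]
  exact pow_le_pow_left' (stdGauss_norm_outlier_le d hδ hδ1) _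

/-- Up to an event of overwhelmingly small probability, all inner products lie in `s` only if this
holds for good rows, after the removal of boundedly many rows. -/
theorem exists_gaussRows_all_le {B e₁ : ℝ} (hB : 0 ≤ B) (he₁ : 0 < e₁) :
    ∃ δ₁ > 0, ∃ F ≥ 0, ∀ δ₀ > 0, ∀ z > 0, ∃ j n₀ : ℕ, ∀ n ≥ n₀, ∀ d : ℕ, 0 < d →
      (n : ℝ) ≤ e₁ * √(d : ℝ) → ∀ s : Set ℝ, MeasurableSet s →
      gaussRows n d {X | (gramTri X).All s} ≤ ENNReal.ofReal (Real.exp (-(B * n ^ 2)))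
        + 2 ^ n * gaussRows (n - j) d {X | GoodRows δ₀ δ₁ z (2 * F * ((n - j : ℕ) : ℝ) ^ 2 / d) X ∧
          (gramTri X).All s} := by
  obtain ⟨δ₁, hδ₁, Q, hQ, n₁, hn₁⟩ := exists_quad_bounds (show 0 ≤ B + 2 by linarith) he₁
  set F₀ := 4 * Q * (B + 2 + 1) with hF₀
  have hF₀0 : 0 < F₀ := by positivity
  refine ⟨δ₁, hδ₁, 4 * F₀, by positivity, fun δ₀ hδ₀ z hz => ?_⟩
  set δ := min δ₀ 1 with hδ
  have hδ0 : 0 < δ := lt_min hδ₀ one_pos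
  set c := δ ^ 2 / 16 with hc
  have hc0 : 0 < c := by positivity
  -- The event that `j₁` given vectors all have atypical norm has probability about `exp(-c d j₁)`,
  -- at most `exp(-(B + 3)n²)` as `d ≥ n²/e₁²`. A union over the `2ⁿ` sets is then harmless.
  set j₁ := ⌈(B + 3) * e₁ ^ 2 / c⌉₊ with hj₁
  set j₂ := ⌈2 * F₀ * e₁ ^ 2 / (z * δ₁)⌉₊ with hj₂
  refine ⟨j₁ + j₂, max (max n₁ (2 * (j₁ + j₂))) (max (j₁ + 2) 2), fun n hn d hd hnd s hs => ?_⟩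
  have hn1 : n₁ ≤ n := (le_max_left _ _).trans ((le_max_left _ _).trans hn)
  have hnj : 2 * (j₁ + j₂) ≤ n := (le_max_right _ _).trans ((le_max_left _ _).trans hn)
  have hnj1 : j₁ + 2 ≤ n := (le_max_left _ _).trans ((le_max_right _ _).trans hn)
  have hn2 : (2 : ℝ) ≤ n := by
    exact_mod_cast (le_max_right _ _).trans ((le_max_right _ _).trans hn)
  have hd' : (0 : ℝ) < d := Nat.cast_pos.2 hd
  have hrd : √(d : ℝ) ^ 2 = d := Real.sq_sqrt hd'.le
  have hnd2 : (n : ℝ) ^ 2 ≤ e₁ ^ 2 * d := by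
    calc (n : ℝ) ^ 2 ≤ (e₁ * √(d : ℝ)) ^ 2 := by gcongr
      _ = _ := by rw [mul_pow, hrd]
  set j := j₁ + j₂ with hj
  set E₁ : Set (Fin n → Fin d → ℝ) := {X | ¬ ∀ w : Fin n → ℝ, δ₁ * (w ⬝ᵥ w) ≤ w ⬝ᵥ gram X *ᵥ w ∧
        w ⬝ᵥ gram X *ᵥ w ≤ Q * (w ⬝ᵥ w)} with hE₁
  set E₂ : Set (Fin n → Fin d → ℝ) := {X | (∀ w : Fin n → ℝ, w ⬝ᵥ gram X *ᵥ w ≤ Q * (w ⬝ᵥ w)) ∧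
      F₀ * n ^ 2 ≤ Tri.sum (fun y => y ^ 2) (gramTri X)} with hE₂
  set bad : Finset (Fin n) → Set (Fin n → Fin d → ℝ) := fun T => {X | T.card = j₁ ∧ ∀ i ∈ T,
    X i ⬝ᵥ X i ≤ (1 - δ) * d ∨ (1 + δ) * d ≤ X i ⬝ᵥ X i} with hbad
  set good : Set (Fin (n - j) → Fin d → ℝ) := {X | GoodRows δ₀ δ₁ z
    (2 * (4 * F₀) * ((n - j : ℕ) : ℝ) ^ 2 / d) X ∧ (gramTri X).All s} with hgood
  have hgoodm : MeasurableSet good := (isClosed_goodRows _ _ _ _ _ _).measurableSet.inter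
    (measurable_gramTri (Tri.measurableSet_all hs _))
  set ok : Finset (Fin n) → Set (Fin n → Fin d → ℝ) := fun T =>
    {X | ∃ hT : T.card = n - j, (fun i => X (T.orderEmbOfFin hT i)) ∈ good} with hok
  -- Either the form is badly conditioned, or the sum of squares is too large, or `j₁` norms are
  -- atypical, or some `n - j` of the rows are good. In the last case the inner products of those
  -- rows still lie in `s`.
  have hcover : {X : Fin n → Fin d → ℝ | (gramTri X).All s} ⊆ (E₁ ∪ E₂ ∪ ⋃ T, bad T) ∪ ⋃ T, ok T := by
    intro X hX
    by_contra hcon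
    simp only [mem_union, not_or, mem_iUnion, not_exists] at hcon
    obtain ⟨⟨⟨h1, h2⟩, h3⟩, h4⟩ := hcon
    have h1' : ∀ w : Fin n → ℝ, δ₁ * (w ⬝ᵥ w) ≤ w ⬝ᵥ gram X *ᵥ w ∧
        w ⬝ᵥ gram X *ᵥ w ≤ Q * (w ⬝ᵥ w) := by
      by_contra hcon; exact h1 hcon
    have h2' : Tri.sum (fun y => y ^ 2) (gramTri X) ≤ F₀ * n ^ 2 := by
      by_contra hcon
      exact h2 ⟨fun w => (h1' w).2, (not_le.1 hcon).le⟩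
    classical
    set N : Finset (Fin n) := Finset.univ.filter fun i =>
      X i ⬝ᵥ X i ≤ (1 - δ) * d ∨ (1 + δ) * d ≤ X i ⬝ᵥ X i with hN
    have hNc : N.card ≤ j₁ := by
      by_contra hcon
      obtain ⟨T, hT, hTc⟩ := Finset.exists_subset_card_eq (not_le.1 hcon).le
      exact h3 T ⟨hTc, fun i hi => (Finset.mem_filter.1 (hT hi)).2⟩
    obtain ⟨T, hT, hgr⟩ := exists_goodRows_comp hd (δ₀ := δ₀) hδ₁ hz (fun w => (h1' w).1) h2' le_rfl hnj
      (by
        refine le_trans ?_ (Nat.le_ceil (2 * F₀ * e₁ ^ 2 / (z * δ₁)))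
        gcongr
        rw [div_le_iff₀ hd']
        calc 2 * F₀ * (n : ℝ) ^ 2 ≤ 2 * F₀ * (e₁ ^ 2 * d) := by gcongr
          _ = _ := by ring) hNc (fun i hi => by
        have : ¬ (X i ⬝ᵥ X i ≤ (1 - δ) * d ∨ (1 + δ) * d ≤ X i ⬝ᵥ X i) := fun h =>
          hi (Finset.mem_filter.2 ⟨Finset.mem_univ _, h⟩)
        rw [not_or, not_le, not_le] at this
        have hδδ : δ ≤ δ₀ := min_le_left _ _
        rw [gram_apply, le_div_iff₀ hd', div_le_iff₀ hd']
        constructor <;> nlinarith)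
    refine h4 T ⟨hT, hgr, fun a b hab => ?_⟩
    have := hX (T.orderEmbOfFin hT a) (T.orderEmbOfFin hT b) (by simpa using hab)
    rw [mat_gramTri _ _ _ (by simpa using hab)] at this
    rw [mat_gramTri _ _ _ hab]
    exact this
  have hokle : ∀ T, gaussRows n d (ok T) ≤ gaussRows (n - j) d good := fun T => by
    by_cases hT : T.card = n - j
    · have h1 := (measurePreserving_comp_gaussRows d (T.orderEmbOfFin hT).injective).measure_preimage
        hgoodm.nullMeasurableSet
      rw [← h1]
      refine measure_mono fun X hX => ?_
      obtain ⟨_, h2⟩ := hX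
      exact h2
    · have : ok T = ∅ := eq_empty_of_forall_notMem fun X hX => hT hX.1
      rw [this, measure_empty]; exact zero_le
  have hbadle : ∀ T, gaussRows n d (bad T) ≤ ENNReal.ofReal ((2 * Real.exp (-c * d)) ^ j₁) := fun T => by
    by_cases hT : T.card = j₁
    · refine le_trans (measure_mono fun X hX => hX.2) ?_
      rw [← hT]
      exact gaussRows_norm_outliers_le hδ0 (min_le_right _ _) T
    · have : bad T = ∅ := eq_empty_of_forall_notMem fun X hX => hT hX.1
      rw [this, measure_empty]; exact zero_le
  have hcard : (Finset.univ : Finset (Finset (Fin n))).card = 2 ^ n := by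
    rw [Finset.card_univ, Fintype.card_finset, Fintype.card_fin]
  have hbadsum : gaussRows n d (⋃ T, bad T) ≤ ENNReal.ofReal (Real.exp (-((B + 2) * n ^ 2)) * Real.exp (n ^ 2)) := by
    refine (measure_iUnion_fintype_le _ _).trans ((Finset.sum_le_sum fun T _ => hbadle T).trans ?_)
    rw [Finset.sum_const, nsmul_eq_mul, hcard, Nat.cast_pow, Nat.cast_ofNat,
      show (2 : ℝ≥0∞) ^ n = ENNReal.ofReal (2 ^ n) by rw [ENNReal.ofReal_pow zero_le_two]; simp,
      ← ENNReal.ofReal_mul (by positivity)]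
    refine ENNReal.ofReal_le_ofReal ?_
    have h2e : (2 : ℝ) ≤ Real.exp 1 := by have := Real.exp_one_gt_d9; linarith
    have hj1 : (j₁ : ℝ) + 2 ≤ n := by exact_mod_cast hnj1
    calc (2 : ℝ) ^ n * (2 * Real.exp (-c * d)) ^ j₁ ≤ Real.exp 1 ^ n * (Real.exp 1 * Real.exp (-c * d)) ^ j₁ := by
          gcongr
      _ = Real.exp (n + j₁ - c * d * j₁) := by
          rw [← Real.exp_add, ← Real.exp_nat_mul, ← Real.exp_nat_mul, ← Real.exp_add]
          congr 1; ring
      _ ≤ _ := by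
          rw [← Real.exp_add, Real.exp_le_exp]
          have h1 : (B + 3) * e₁ ^ 2 ≤ j₁ * c := by
            rw [← div_le_iff₀ hc0]; exact Nat.le_ceil _
          have h2 : (B + 3) * n ^ 2 ≤ (B + 3) * (e₁ ^ 2 * d) := by gcongr
          have h3 := mul_le_mul_of_nonneg_right h1 hd'.le
          nlinarith
  calc _ ≤ gaussRows n d ((E₁ ∪ E₂ ∪ ⋃ T, bad T) ∪ ⋃ T, ok T) := measure_mono hcover
    _ ≤ gaussRows n d E₁ + gaussRows n d E₂ + gaussRows n d (⋃ T, bad T)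
        + gaussRows n d (⋃ T, ok T) := (measure_union_le _ _).trans
          (add_le_add ((measure_union_le _ _).trans (add_le_add (measure_union_le _ _) le_rfl)) le_rfl)
    _ ≤ ENNReal.ofReal (Real.exp (-((B + 2) * n ^ 2))) + ENNReal.ofReal (Real.exp (-((B + 2) * n ^ 2)))
        + ENNReal.ofReal (Real.exp (-((B + 2) * n ^ 2)) * Real.exp (n ^ 2))
        + 2 ^ n * gaussRows (n - j) d good := by
          refine add_le_add (add_le_add (add_le_add (hn₁ n hn1 d hd hnd) (gaussRows_sum_sq_le hQ))
            hbadsum) ?_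
          refine (measure_iUnion_fintype_le _ _).trans ((Finset.sum_le_sum fun T _ => hokle T).trans ?_)
          rw [Finset.sum_const, nsmul_eq_mul, hcard]
          simp
    _ ≤ _ := by
          refine add_le_add ?_ le_rfl
          rw [← ENNReal.ofReal_add (by positivity) (by positivity),
            ← ENNReal.ofReal_add (by positivity) (by positivity)]
          refine ENNReal.ofReal_le_ofReal ?_
          have h1 : Real.exp (-((B + 2) * n ^ 2)) ≤ Real.exp (-(B * n ^ 2)) * Real.exp (-4) := by
            rw [← Real.exp_add, Real.exp_le_exp]; nlinarith
          have h2 : Real.exp (-((B + 2) * n ^ 2)) * Real.exp (n ^ 2) ≤ Real.exp (-(B * n ^ 2)) * Real.exp (-4) := by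
            rw [← Real.exp_add, ← Real.exp_add, Real.exp_le_exp]; nlinarith
          have h3 : Real.exp (-4) ≤ 1 / 3 := by
            rw [Real.exp_neg, inv_le_comm₀ (Real.exp_pos _) (by norm_num)]
            have := Real.add_one_le_exp (4 : ℝ)
            norm_num at this ⊢
            linarith
          have h4 := mul_le_mul_of_nonneg_left h3 (Real.exp_pos (-(B * (n : ℝ) ^ 2))).le
          linarith

/-! ### The clique probabilities -/

lemma gaussianVectors_eq_map {n d : ℕ} (hd : 0 < d) :
    gaussianVectors n d = (gaussRows n d).map fun X i k => (√(d : ℝ))⁻¹ * X i k := by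
  have hd' : (0 : ℝ) < d := Nat.cast_pos.2 hd
  have h1 : stdNormal.map (fun y => (√(d : ℝ))⁻¹ * y) = gaussianReal 0 ((d : ℝ≥0)⁻¹) := by
    have := gaussianReal_map_const_mul (μ := 0) (v := 1) (√(d : ℝ))⁻¹
    rw [mul_zero, mul_one] at this
    rw [stdNormal, this]
    congr 1
    ext
    simp only [NNReal.coe_mk, NNReal.coe_inv, NNReal.coe_natCast]
    rw [inv_pow, Real.sq_sqrt hd'.le]
  have hp1 : IsProbabilityMeasure (stdNormal.map fun y => (√(d : ℝ))⁻¹ * y) :=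
    Measure.isProbabilityMeasure_map (by fun_prop)
  have h2 : (stdGauss (Fin d)).map (fun x k => (√(d : ℝ))⁻¹ * x k)
      = Measure.pi fun _ => gaussianReal 0 ((d : ℝ≥0)⁻¹) := by
    rw [stdGauss, Measure.pi_map_pi (f := fun _ y => (√(d : ℝ))⁻¹ * y)
      fun _ => (measurable_const_mul _).aemeasurable]
    simp only [h1]
  have hm : Measurable fun (x : Fin d → ℝ) k => (√(d : ℝ))⁻¹ * x k :=
    measurable_pi_lambda _ fun k => (measurable_pi_apply k).const_mul _
  have hp2 : IsProbabilityMeasure ((stdGauss (Fin d)).map fun x k => (√(d : ℝ))⁻¹ * x k) :=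
    Measure.isProbabilityMeasure_map hm.aemeasurable
  rw [gaussRows, Measure.pi_map_pi (f := fun _ (x : Fin d → ℝ) k => (√(d : ℝ))⁻¹ * x k)
    fun _ => hm.aemeasurable]
  simp only [h2]
  rfl

lemma gaussianVectors_graph {n d : ℕ} (hd : 0 < d) {P : (Fin n → Fin d → ℝ) → Prop}
    {s : Set ℝ} (hs : MeasurableSet s)
    (hP : ∀ X, P (fun i k => (√(d : ℝ))⁻¹ * X i k) ↔ (gramTri X).All s) :
    gaussianVectors n d {x | P x} = gaussRows n d {X | (gramTri X).All s} := by
  have hd' : 0 < √(d : ℝ) := Real.sqrt_pos.2 (Nat.cast_pos.2 hd)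
  set f : (Fin n → Fin d → ℝ) → Fin n → Fin d → ℝ := fun X i k => (√(d : ℝ))⁻¹ * X i k with hf
  have hPm : MeasurableSet {x | P x} := by
    have : {x | P x} = (fun x : Fin n → Fin d → ℝ => fun i k => √(d : ℝ) * x i k) ⁻¹'
        {X | (gramTri X).All s} := by
      ext x
      simp only [mem_ofPred_eq, mem_preimage]
      rw [← hP]
      have : (fun i k => (√(d : ℝ))⁻¹ * (√(d : ℝ) * x i k)) = x := by
        funext i k; field_simp
      rw [this]
    rw [this]
    exact (measurable_gramTri (Tri.measurableSet_all hs n)).preimage (by fun_prop)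
  rw [gaussianVectors_eq_map hd, Measure.map_apply (by fun_prop) hPm]
  congr 1
  ext X
  exact hP X

lemma scaled_inner {n d : ℕ} (X : Fin n → Fin d → ℝ) (i j : Fin n) :
    ∑ k, (√(d : ℝ))⁻¹ * X i k * ((√(d : ℝ))⁻¹ * X j k)
      = (X i ⬝ᵥ X j) / √(d : ℝ) / √(d : ℝ) := by
  rw [dotProduct, Finset.sum_div, Finset.sum_div]
  refine Finset.sum_congr rfl fun k _ => ?_
  rw [div_eq_mul_inv, div_eq_mul_inv]; ring

lemma probRed_eq {n d : ℕ} (hd : 0 < d) (p : ℝ) :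
    probRed n d p = (gaussRows n d {X | (gramTri X).All (Iio (-cutoff p))}).toReal := by
  have hd' : 0 < √(d : ℝ) := Real.sqrt_pos.2 (Nat.cast_pos.2 hd)
  rw [probRed, Measure.real, gaussianVectors_graph hd (s := Iio (-cutoff p)) measurableSet_Iio]
  intro X
  rw [eq_bot_iff, SimpleGraph.le_iff_adj]
  simp only [gaussianGraph, SimpleGraph.bot_adj, scaled_inner, Tri.All, mem_Iio]
  refine forall_congr' fun i => forall_congr' fun j => ?_
  rw [imp_false, not_and, not_le]
  refine imp_congr_right fun h => ?_
  rw [mat_gramTri X i j h, div_lt_div_iff_of_pos_right hd']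

lemma probBlue_eq {n d : ℕ} (hd : 0 < d) (p : ℝ) :
    probBlue n d p = (gaussRows n d {X | (gramTri X).All (Ici (-cutoff p))}).toReal := by
  have hd' : 0 < √(d : ℝ) := Real.sqrt_pos.2 (Nat.cast_pos.2 hd)
  rw [probBlue, Measure.real, gaussianVectors_graph hd (s := Ici (-cutoff p)) measurableSet_Ici]
  intro X
  rw [eq_top_iff, SimpleGraph.le_iff_adj]
  simp only [gaussianGraph, SimpleGraph.top_adj, scaled_inner, Tri.All, mem_Ici]
  refine forall_congr' fun i => forall_congr' fun j => ?_
  refine imp_congr_right fun h => ?_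
  rw [mat_gramTri X i j h, div_le_div_iff_of_pos_right hd', and_iff_right h]

lemma toReal_le_exp {m : ℝ≥0∞} {n : ℕ} {a g T : ℝ}
    (h : m ≤ ENNReal.ofReal (Real.exp a) + 2 ^ n * ENNReal.ofReal (Real.exp g))
    (ha : a + 1 ≤ T) (hg : n + g + 1 ≤ T) : m.toReal ≤ Real.exp T := by
  refine ENNReal.toReal_le_of_le_ofReal (Real.exp_pos _).le (h.trans ?_)
  rw [show (2 : ℝ≥0∞) ^ n = ENNReal.ofReal (2 ^ n) by rw [ENNReal.ofReal_pow zero_le_two]; simp,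
    ← ENNReal.ofReal_mul (by positivity), ← ENNReal.ofReal_add (by positivity) (by positivity)]
  refine ENNReal.ofReal_le_ofReal ?_
  have h2e : (2 : ℝ) ≤ Real.exp 1 := by have := Real.exp_one_gt_d9; linarith
  have h1 : Real.exp a ≤ Real.exp (T - 1) := Real.exp_le_exp.2 (by linarith)
  have h2 : (2 : ℝ) ^ n * Real.exp g ≤ Real.exp (T - 1) := by
    calc (2 : ℝ) ^ n * Real.exp g ≤ Real.exp 1 ^ n * Real.exp g := by gcongr
      _ = Real.exp (n + g) := by rw [← Real.exp_nat_mul, ← Real.exp_add, mul_one]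
      _ ≤ _ := Real.exp_le_exp.2 (by linarith)
  have h3 : Real.exp T = Real.exp 1 * Real.exp (T - 1) := by rw [← Real.exp_add]; congr 1; ring
  rw [h3]
  nlinarith [Real.exp_pos (T - 1)]

lemma hazard_cutoff {p : ℝ} (h0 : 0 < p) (h1 : p < 1 / 2) :
    hazard (cutoff p) = cutoffDensity p / p := by
  rw [hazard, normalTail_cutoff h0 h1]; rfl

lemma hazard_neg_cutoff {p : ℝ} (h0 : 0 < p) (h1 : p < 1 / 2) :
    hazard (-cutoff p) = cutoffDensity p / (1 - p) := by
  rw [hazard, normalTail_neg, normalTail_cutoff h0 h1, normalPDF_neg]; rfl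

/-- The hazard rate increases and is at most `1` at `0`. This makes the blue constants uniform in
`p`. -/
lemma hazard_neg_cutoff_le_one {p : ℝ} (h0 : 0 < p) (h1 : p < 1 / 2) :
    cutoffDensity p / (1 - p) ≤ 1 := by
  rw [← hazard_neg_cutoff h0 h1]
  have h2 := hazard_upper le_rfl
  have h3 : √((0 : ℝ) ^ 2 + 4) = 2 := by
    rw [show (0 : ℝ) ^ 2 + 4 = 2 ^ 2 by norm_num, Real.sqrt_sq two_pos.le]
  have h4 := hazard_strictMono.monotone (show -cutoff p ≤ 0 by linarith [cutoff_pos h0 h1])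
  linarith

/-- The probability of a red clique. -/
theorem exists_probRed_le {p e₁ ζ : ℝ} (h0 : 0 < p) (h1 : p < 1 / 2) (he₁ : 0 < e₁)
    (h : cutoffDensity p / p * e₁ ≤ 1 ∨ 0.9 ≤ cutoff p) (hζ : 0 < ζ) :
    ∃ n₀ : ℕ, ∀ n ≥ n₀, ∀ d : ℕ, 0 < d → (n : ℝ) ≤ e₁ * √(d : ℝ) →
      probRed n d p ≤ Real.exp (n ^ 2 / 2 * Real.log p
        - (cutoffDensity p / p) ^ 3 * n ^ 3 / (6 * √(d : ℝ)) + ζ * n ^ 2) := by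
  set μ := cutoffDensity p / p with hμ
  set c := cutoff p with hc
  have hc0 : 0 < c := cutoff_pos h0 h1
  have hhc : hazard c = μ := hazard_cutoff h0 h1
  have hμ0 : 0 < μ := hhc ▸ hazard_pos c
  have htail : normalTail c = p := normalTail_cutoff h0 h1
  set L := Real.log p with hL
  have hL0 : L < 0 := Real.log_neg h0 (by linarith)
  -- Large enough that the exceptional event is rarer than the claimed bound, whose cubic term is at
  -- most `μ³e₁n²/6`.
  set B := -L / 2 + μ ^ 3 * e₁ / 6 with hB
  have hB0 : 0 ≤ B := by
    have : 0 ≤ μ ^ 3 * e₁ / 6 := by positivity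
    linarith
  obtain ⟨δ₁, hδ₁, F, hF, hred⟩ := exists_gaussRows_all_le hB0 he₁
  obtain ⟨δ₀, hδ₀, z, hz, hz1, n₁, hn₁⟩ := exists_gaussRows_red_le hc0 he₁ (by rwa [hhc]) hδ₁ hF
    (show 0 < ζ / 2 by positivity)
  obtain ⟨j, n₂, hn₂⟩ := hred δ₀ hδ₀ z hz
  -- Deleting `j` rows changes the exponent by a multiple of `n` only; `Q` collects these multiples.
  set Q := 2 + j * (-L) + μ ^ 3 * j * e₁ / 2 with hQ
  refine ⟨max (max n₂ (n₁ + j)) (max 1 ⌈Q / (ζ / 2)⌉₊), fun n hn d hd hnd => ?_⟩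
  have hn2 : n₂ ≤ n := (le_max_left _ _).trans ((le_max_left _ _).trans hn)
  have hnj : n₁ + j ≤ n := (le_max_right _ _).trans ((le_max_left _ _).trans hn)
  have hn1 : (1 : ℝ) ≤ n := by
    exact_mod_cast (le_max_left _ _).trans ((le_max_right _ _).trans hn)
  have hnQ : Q ≤ ζ / 2 * n := by
    rw [← div_le_iff₀' (by positivity)]
    exact (Nat.le_ceil _).trans (Nat.cast_le.2 ((le_max_right _ _).trans ((le_max_right _ _).trans hn)))
  have hrd : 0 < √(d : ℝ) := Real.sqrt_pos.2 (Nat.cast_pos.2 hd)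
  have hm : ((n - j : ℕ) : ℝ) = n - j := Nat.cast_sub (by omega)
  have hjn : (j : ℝ) ≤ n := by exact_mod_cast (by omega : j ≤ n)
  have hj0 : (0 : ℝ) ≤ j := Nat.cast_nonneg j
  have hgood := hn₁ (n - j) (by omega) d hd (by rw [hm]; linarith)
  have hall := hn₂ n hn2 d hd hnd (Iic (-c)) measurableSet_Iic
  rw [hhc, htail] at hgood
  have hsub : gaussRows n d {X | (gramTri X).All (Iio (-c))} ≤ gaussRows n d {X | (gramTri X).All (Iic (-c))} :=
    measure_mono fun X hX i k hik => Iio_subset_Iic_self (hX i k hik)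
  rw [probRed_eq hd]
  refine toReal_le_exp (hsub.trans (hall.trans (add_le_add le_rfl (mul_le_mul' le_rfl hgood)))) ?_ ?_
  · have h3 : μ ^ 3 * n ^ 3 / (6 * √(d : ℝ)) ≤ μ ^ 3 * e₁ / 6 * n ^ 2 := by
      rw [div_le_iff₀ (by positivity)]
      have : μ ^ 3 * n ^ 2 * n ≤ μ ^ 3 * n ^ 2 * (e₁ * √(d : ℝ)) := by gcongr
      linarith
    have h4 : 1 ≤ ζ * n ^ 2 := by
      have h5 : 2 ≤ ζ / 2 * n := by
        have h6 : 0 ≤ j * (-L) := mul_nonneg hj0 (by linarith)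
        have h7 : 0 ≤ μ ^ 3 * j * e₁ / 2 := by positivity
        linarith
      nlinarith
    rw [hB]
    linarith
  · have h3 : (n : ℝ) ^ 3 - 3 * j * n ^ 2 ≤ ((n - j : ℕ) : ℝ) ^ 3 := by
      rw [hm]
      have : (0 : ℝ) ≤ 3 * n * j ^ 2 - j ^ 3 := by nlinarith [mul_nonneg (sq_nonneg (j : ℝ)) (sub_nonneg.2 hjn), mul_nonneg (sq_nonneg (j : ℝ)) hj0]
      linarith
    have h4 : μ ^ 3 * ((n : ℝ) ^ 3 - 3 * j * n ^ 2) / (6 * √(d : ℝ))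
        ≤ μ ^ 3 * ((n - j : ℕ) : ℝ) ^ 3 / (6 * √(d : ℝ)) := by gcongr
    have h5 : μ ^ 3 * (3 * j * n ^ 2) / (6 * √(d : ℝ)) ≤ μ ^ 3 * j * e₁ / 2 * n := by
      rw [div_le_iff₀ (by positivity)]
      have : μ ^ 3 * j * n * n * 3 ≤ μ ^ 3 * j * n * (e₁ * √(d : ℝ)) * 3 := by gcongr
      linarith
    have h6 : μ ^ 3 * ((n : ℝ) ^ 3 - 3 * j * n ^ 2) / (6 * √(d : ℝ))
        = μ ^ 3 * n ^ 3 / (6 * √(d : ℝ)) - μ ^ 3 * (3 * j * n ^ 2) / (6 * √(d : ℝ)) := by ring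
    have h7 : ((n - j : ℕ) : ℝ) ^ 2 / 2 * L ≤ n ^ 2 / 2 * L + j * (-L) * n := by
      rw [hm]; nlinarith [mul_nonneg (sq_nonneg (j : ℝ)) (neg_nonneg.2 hL0.le)]
    have h8 : ζ / 2 * ((n - j : ℕ) : ℝ) ^ 2 ≤ ζ / 2 * n ^ 2 := by
      rw [hm]; gcongr; linarith
    have h9 := mul_le_mul_of_nonneg_right hnQ (show (0 : ℝ) ≤ n by linarith)
    rw [hQ] at h9
    linarith

/-- When the error term `f` is nonnegative and increases with the number of rows, deletion of `j`
rows costs only `j |L| n`, and the exceptional event is below the main term. Both blue estimates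
pass through this. -/
lemma exists_gaussRows_all_le_exp {L e₁ ζ : ℝ} (hL : L ≤ 0) (hζ : 0 < ζ) {s : Set ℝ}
    {G : ∀ n d : ℕ, Set (Fin n → Fin d → ℝ)} {j n₁ n₂ : ℕ}
    (hall : ∀ n ≥ n₂, ∀ d : ℕ, 0 < d → (n : ℝ) ≤ e₁ * √(d : ℝ) →
      gaussRows n d {X | (gramTri X).All s} ≤ ENNReal.ofReal (Real.exp (-(-L / 2 * n ^ 2)))
        + 2 ^ n * gaussRows (n - j) d (G (n - j) d))
    {f : ℕ → ℕ → ℝ} (hf0 : ∀ n d, 0 ≤ f n d) (hf : ∀ m n d, m ≤ n → f m d ≤ f n d)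
    (hgood : ∀ n ≥ n₁, ∀ d : ℕ, 0 < d → (n : ℝ) ≤ e₁ * √(d : ℝ) → gaussRows n d (G n d)
      ≤ ENNReal.ofReal (Real.exp (n ^ 2 / 2 * L + f n d + ζ / 2 * n ^ 2))) :
    ∃ n₀ : ℕ, ∀ n ≥ n₀, ∀ d : ℕ, 0 < d → (n : ℝ) ≤ e₁ * √(d : ℝ) →
      (gaussRows n d {X | (gramTri X).All s}).toReal
        ≤ Real.exp (n ^ 2 / 2 * L + f n d + ζ * n ^ 2) := by
  set Q := 2 + j * (-L) with hQ
  refine ⟨max (max n₂ (n₁ + j)) (max 1 ⌈Q / (ζ / 2)⌉₊), fun n hn d hd hnd => ?_⟩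
  have hn2 : n₂ ≤ n := (le_max_left _ _).trans ((le_max_left _ _).trans hn)
  have hnj : n₁ + j ≤ n := (le_max_right _ _).trans ((le_max_left _ _).trans hn)
  have hn1 : (1 : ℝ) ≤ n := by
    exact_mod_cast (le_max_left _ _).trans ((le_max_right _ _).trans hn)
  have hnQ : Q ≤ ζ / 2 * n := by
    rw [← div_le_iff₀' (by positivity)]
    exact (Nat.le_ceil _).trans (Nat.cast_le.2 ((le_max_right _ _).trans ((le_max_right _ _).trans hn)))
  have hm : ((n - j : ℕ) : ℝ) = n - j := Nat.cast_sub (by omega)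
  have hjn : (j : ℝ) ≤ n := by exact_mod_cast (by omega : j ≤ n)
  have hj0 : (0 : ℝ) ≤ j := Nat.cast_nonneg j
  have hmn : ((n - j : ℕ) : ℝ) ≤ n := by rw [hm]; linarith
  refine toReal_le_exp ((hall n hn2 d hd hnd).trans (add_le_add le_rfl
    (mul_le_mul' le_rfl (hgood (n - j) (by omega) d hd (hmn.trans hnd))))) ?_ ?_
  · have h4 : 1 ≤ ζ * n ^ 2 := by
      have h5 : 2 ≤ ζ / 2 * n := by
        have h6 : 0 ≤ j * (-L) := mul_nonneg hj0 (by linarith)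
        linarith
      nlinarith
    linarith [hf0 n d]
  · have h5 := hf (n - j) n d (Nat.sub_le n j)
    have h7 : ((n - j : ℕ) : ℝ) ^ 2 / 2 * L ≤ n ^ 2 / 2 * L + j * (-L) * n := by
      rw [hm]; nlinarith [mul_nonneg (sq_nonneg (j : ℝ)) (neg_nonneg.2 hL)]
    have h8 : ζ / 2 * ((n - j : ℕ) : ℝ) ^ 2 ≤ ζ / 2 * n ^ 2 := by gcongr
    have h9 := mul_le_mul_of_nonneg_right hnQ (show (0 : ℝ) ≤ n by linarith)
    rw [hQ] at h9
    linarith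

/-- The probability of a blue clique in high dimension. -/
theorem exists_probBlue_le :
    ∃ e₁ > 0, ∀ p : ℝ, 0 < p → p < 1 / 2 → ∀ ζ > 0, ∃ n₀ : ℕ, ∀ n ≥ n₀, ∀ d : ℕ, 0 < d → (n : ℝ) ≤ e₁ * √(d : ℝ) →
      probBlue n d p ≤ Real.exp (n ^ 2 / 2 * Real.log (1 - p)
        + ((cutoffDensity p / (1 - p)) ^ 3 * n ^ 3 / (6 * √(d : ℝ))
        + (cutoffDensity p / (1 - p)) ^ 4 * n ^ 4 / (2 * d)) + ζ * n ^ 2) := by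
  -- For `p < 1/2` one has `-log(1 - p)/2 ≤ 1/2`, so the rate `1/2` serves all `p` and the final
  -- `e₁` does not depend on `p`.
  obtain ⟨δ₁, hδ₁, F, hF, hred⟩ := exists_gaussRows_all_le one_half_pos.le one_pos
  obtain ⟨e₁, he₁, hblue⟩ := exists_gaussRows_blue_le hδ₁ hF zero_le_one
  refine ⟨min e₁ 1, lt_min he₁ one_pos, fun p h0 h1 ζ hζ => ?_⟩
  set b := cutoffDensity p / (1 - p) with hb
  set c := cutoff p with hc
  have hhc : hazard (-c) = b := hazard_neg_cutoff h0 h1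
  have hb0 : 0 < b := hhc ▸ hazard_pos _
  have hb1 : hazard (-c) ≤ 1 := hhc ▸ hazard_neg_cutoff_le_one h0 h1
  have htail : normalTail (-c) = 1 - p := by rw [normalTail_neg, normalTail_cutoff h0 h1]
  have hL0 : Real.log (1 - p) ≤ 0 := (Real.log_neg (by linarith) (by linarith)).le
  have hL1 : -Real.log (1 - p) / 2 ≤ 1 / 2 := by
    have h2 := Real.log_le_sub_one_of_pos (inv_pos.2 (show 0 < 1 - p by linarith))
    have h3 : (1 - p)⁻¹ ≤ 2 := by
      rw [inv_le_comm₀ (by linarith) two_pos]; linarith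
    rw [Real.log_inv] at h2
    linarith
  obtain ⟨δ₀, hδ₀, z, hz, hz1, n₁, hn₁⟩ := hblue (-c) hb1 (ζ / 2) (by positivity)
  obtain ⟨j, n₂, hn₂⟩ := hred δ₀ hδ₀ z hz
  rw [hhc, htail] at hn₁
  have hle : ∀ n d : ℕ, (n : ℝ) ≤ min e₁ 1 * √(d : ℝ) →
      (n : ℝ) ≤ e₁ * √(d : ℝ) ∧ (n : ℝ) ≤ 1 * √(d : ℝ) := fun n d h =>
    ⟨h.trans (mul_le_mul_of_nonneg_right (min_le_left _ _) (Real.sqrt_nonneg _)),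
      h.trans (mul_le_mul_of_nonneg_right (min_le_right _ _) (Real.sqrt_nonneg _))⟩
  obtain ⟨n₀, hn₀⟩ := exists_gaussRows_all_le_exp (f := fun n d =>
      b ^ 3 * n ^ 3 / (6 * √(d : ℝ)) + b ^ 4 * n ^ 4 / (2 * d)) hL0 hζ
    (fun n hn d hd hnd => (hn₂ n hn d hd (hle n d hnd).2 (Ici (-c)) measurableSet_Ici).trans
      (add_le_add_left (ENNReal.ofReal_le_ofReal (Real.exp_le_exp.2 (neg_le_neg
        (mul_le_mul_of_nonneg_right hL1 (sq_nonneg _))))) _))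
    (fun n d => by positivity) (fun m n d hmn => by gcongr)
    (fun n hn d hd hnd => (hn₁ n hn d hd (hle n d hnd).1).trans_eq (by rw [← add_assoc]))
  exact ⟨n₀, fun n hn d hd hnd => by rw [probBlue_eq hd]; exact hn₀ n hn d hd hnd⟩

/-! ### Blue cliques in low dimension -/

section

variable {κ : Type*} [Fintype κ] [DecidableEq κ]

/-- A Gaussian density is at most that of a larger covariance times the square root of the ratio of
determinants. This reduces rows with an arbitrary Gram matrix to covariances that contain an
independent standard part. -/
lemma gaussRatio_le_of_le {W V : Matrix κ κ ℝ} (hW : W.PosDef) (hV : V.PosDef)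
    (h : ∀ w : κ → ℝ, w ⬝ᵥ W *ᵥ w ≤ w ⬝ᵥ V *ᵥ w) (y : κ → ℝ) :
    gaussRatio W y ≤ √(V.det / W.det) * gaussRatio V y := by
  have h1 := dotProduct_inv_mulVec_anti hW hV h y
  have h2 : √(V.det / W.det) * (√V.det)⁻¹ = (√W.det)⁻¹ := by
    have := (Real.sqrt_pos.2 hV.det_pos).ne'
    rw [Real.sqrt_div hV.det_pos.le]; field_simp
  rw [gaussRatio, gaussRatio, ← mul_assoc, h2]
  gcongr

lemma one_add_max_div_le {c l : ℝ} (hc : 0 < c) (hl : c ≤ l) :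
    (1 + max (l - 1) 0) / l ≤ Real.exp (|l - 1| / c) := by
  have hl0 : 0 < l := hc.trans_le hl
  rcases le_total 1 l with h | h
  · rw [max_eq_left (by linarith), add_sub_cancel, div_self hl0.ne']
    exact Real.one_le_exp (by positivity)
  · rw [max_eq_right (by linarith), add_zero, abs_of_nonpos (by linarith)]
    calc 1 / l = (1 / l - 1) + 1 := by ring
      _ ≤ Real.exp (1 / l - 1) := Real.add_one_le_exp _
      _ ≤ _ := Real.exp_le_exp.2 (by
        calc 1 / l - 1 = (1 - l) / l := by field_simp
          _ ≤ (1 - l) / c := div_le_div_of_nonneg_left (by linarith) hc hl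
          _ = _ := by ring)

/-- A covariance matrix is dominated by the identity plus another one, at the cost of a small
factor in the determinant. -/
lemma exists_dominating {W : Matrix κ κ ℝ} (hW : W.IsSymm) {c : ℝ} (hc : 0 < c)
    (h : ∀ w : κ → ℝ, c * (w ⬝ᵥ w) ≤ w ⬝ᵥ W *ᵥ w) :
    ∃ B : Matrix κ κ ℝ, (∀ w : κ → ℝ, w ⬝ᵥ W *ᵥ w ≤ w ⬝ᵥ (1 + B * Bᵀ) *ᵥ w) ∧
      (∀ w : κ → ℝ, w ⬝ᵥ (B * Bᵀ) *ᵥ w ≤ w ⬝ᵥ W *ᵥ w) ∧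
      (1 + B * Bᵀ).det / W.det
        ≤ Real.exp (√(Fintype.card κ * ((W - 1) * (W - 1)).trace) / c) := by
  obtain ⟨U, l, h2, h1, hU⟩ := hW.exists_diagonalization
  have hl : ∀ i, c ≤ l i := le_eigenvalue h2 hU h
  -- Eigenvalues above `1` are kept and those below are raised to `1`. The determinant grows only
  -- through the latter, which is small when the Gram matrix is near the identity.
  set m : κ → ℝ := fun i => max (l i - 1) 0 with hm
  have hm0 : ∀ i, 0 ≤ m i := fun i => le_max_right _ _
  set B : Matrix κ κ ℝ := U * Matrix.diagonal fun i => √(m i) with hB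
  have hBB : B * Bᵀ = U * Matrix.diagonal m * Uᵀ := by
    rw [hB, Matrix.transpose_mul, Matrix.diagonal_transpose, ← Matrix.mul_assoc,
      Matrix.mul_assoc U, Matrix.diagonal_mul_diagonal]
    congr 3
    funext i
    exact Real.mul_self_sqrt (hm0 i)
  have hd1 : W.det = ∏ i, l i := by
    have := det_one_add_smul_of_diagonalization h1 hU 0 1
    simpa using this
  have hd2 : (1 + B * Bᵀ).det = ∏ i, (1 + m i) := by
    have := det_one_add_smul_of_diagonalization h1 hBB 1 1
    simpa using this
  have hW1 : W - 1 = U * Matrix.diagonal (fun i => l i - 1) * Uᵀ := by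
    have : Matrix.diagonal (fun i => l i - 1) = Matrix.diagonal l - (1 : Matrix κ κ ℝ) := by
      rw [← Matrix.diagonal_one, Matrix.diagonal_sub]
    rw [this, Matrix.mul_sub, Matrix.sub_mul, Matrix.mul_one, h1, ← hU]
  refine ⟨B, fun w => ?_, fun w => ?_, ?_⟩
  · rw [Matrix.add_mulVec, Matrix.one_mulVec, dotProduct_add, dotProduct_of_orthogonal h1 w w,
      dotProduct_mulVec_of_diagonalization hU, dotProduct_mulVec_of_diagonalization hBB,
      ← Finset.sum_add_distrib]
    refine Finset.sum_le_sum fun i _ => ?_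
    have : l i - 1 ≤ m i := le_max_left _ _
    have h3 := mul_le_mul_of_nonneg_right this (mul_self_nonneg ((Uᵀ *ᵥ w) i))
    linarith
  · rw [dotProduct_mulVec_of_diagonalization hU, dotProduct_mulVec_of_diagonalization hBB]
    exact Finset.sum_le_sum fun i _ => mul_le_mul_of_nonneg_right
      (max_le (by linarith) (hc.le.trans (hl i))) (mul_self_nonneg _)
  · rw [hd1, hd2, ← Finset.prod_div_distrib]
    calc ∏ i, (1 + m i) / l i ≤ ∏ i, Real.exp (|l i - 1| / c) :=
          Finset.prod_le_prod (fun i _ => div_nonneg (by linarith [hm0 i]) (hc.le.trans (hl i)))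
            fun i _ => one_add_max_div_le hc (hl i)
      _ = Real.exp ((∑ i, |l i - 1|) / c) := by rw [← Real.exp_sum, Finset.sum_div]
      _ ≤ _ := Real.exp_le_exp.2 (by
        gcongr
        refine Real.le_sqrt_of_sq_le ?_
        rw [trace_pow_two_of_diagonalization h2 hW1]
        have := sq_sum_le_card_mul_sum_sq (s := Finset.univ) (f := fun i => |l i - 1|)
        simpa using this)

/-- By log-concavity of the tail, a shift `v` of the normal variable costs at most the exponential
of a linear function of `v`. The term `hazard a ^ 2 / 2` is given away to complete the square. -/
lemma lintegral_indicator_exp_add_le (a t v : ℝ) :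
    ∫⁻ z, (Ici a).indicator (fun y => ENNReal.ofReal (Real.exp (t * y))) (z + v) ∂stdNormal
      ≤ ENNReal.ofReal (normalTail a * Real.exp ((t + hazard a) ^ 2 / 2)
        * Real.exp ((t + hazard a) * v)) := by
  have h1 : ∀ z, (Ici a).indicator (fun y => ENNReal.ofReal (Real.exp (t * y))) (z + v)
      = ENNReal.ofReal (Real.exp (t * v)) *
        (Ici (a - v)).indicator (fun z => ENNReal.ofReal (Real.exp (t * z))) z := fun z => by
    by_cases h : a ≤ z + v
    · rw [indicator_of_mem (mem_Ici.2 h), indicator_of_mem (mem_Ici.2 (by linarith)),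
        ← ENNReal.ofReal_mul (Real.exp_pos _).le, ← Real.exp_add]
      congr 2; ring
    · rw [indicator_of_notMem (by simpa using h), indicator_of_notMem
        (by rw [mem_Ici]; intro h'; exact h (by linarith)), mul_zero]
  simp only [h1]
  rw [lintegral_const_mul' _ _ ENNReal.ofReal_ne_top, lintegral_indicator measurableSet_Ici,
    lintegral_exp_mul_stdNormal_Ici, ← ENNReal.ofReal_mul (Real.exp_pos _).le]
  refine ENNReal.ofReal_le_ofReal ?_
  have h2 := log_normalTail_add_le a (-(v + t))
  have h3 : normalTail (a - v - t) ≤ normalTail a * Real.exp (hazard a * (v + t)) := by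
    rw [← Real.log_le_log_iff (normalTail_pos _) (mul_pos (normalTail_pos _) (Real.exp_pos _)),
      Real.log_mul (normalTail_pos _).ne' (Real.exp_pos _).ne', Real.log_exp,
      show a - v - t = a + -(v + t) by ring]
    linarith
  calc Real.exp (t * v) * (Real.exp (t ^ 2 / 2) * normalTail (a - v - t))
      ≤ Real.exp (t * v) * (Real.exp (t ^ 2 / 2) * (normalTail a * Real.exp (hazard a * (v + t)))) := by
        gcongr
    _ = normalTail a * Real.exp (t * v + t ^ 2 / 2 + hazard a * (v + t)) := by
        rw [Real.exp_add, Real.exp_add]; ring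
    _ ≤ normalTail a * Real.exp ((t + hazard a) ^ 2 / 2 + (t + hazard a) * v) := by
        refine mul_le_mul_of_nonneg_left (Real.exp_le_exp.2 ?_) (normalTail_pos a).le
        linarith [sq_nonneg (hazard a)]
    _ = _ := by rw [Real.exp_add]; ring

end

lemma lintegral_stdGauss_sum {κ : Type*} [Fintype κ] {f : (κ ⊕ κ → ℝ) → ℝ≥0∞} (hf : Measurable f) :
    ∫⁻ g, f g ∂stdGauss (κ ⊕ κ)
      = ∫⁻ h, ∫⁻ z, f (Sum.elim z h) ∂stdGauss κ ∂stdGauss κ := by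
  have h1 := (measurePreserving_sumPiEquivProdPi_symm fun _ : κ ⊕ κ => stdNormal)
  rw [stdGauss, ← h1.lintegral_comp hf, lintegral_prod_symm]
  · rfl
  · exact (hf.comp h1.measurable).aemeasurable

/-- The new row is replaced by `z + B h` with `z`, `h` independent and standard. Given `h`, the
coordinates are independent and produce the exponential of `b` times the sum of the coordinates of
`B h`. Averaging over `h` turns this into `b²/2` times the Gram form at the constant vector. -/
lemma lintegral_row_le {n d : ℕ} {X : Fin n → Fin d → ℝ} {c : ℝ} (hc : 0 < c)
    (h : ∀ w : Fin n → ℝ, c * (w ⬝ᵥ w) ≤ w ⬝ᵥ gram X *ᵥ w) (a : ℝ) (t : ℝ) :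
    ∫⁻ g, ∏ i, (Ici a).indicator (fun y => ENNReal.ofReal (Real.exp (t * y))) ((rowMat X *ᵥ g) i)
        ∂stdGauss (Fin d)
      ≤ ENNReal.ofReal (Real.exp (√(n * ((gram X - 1) * (gram X - 1)).trace) / c / 2)
        * (normalTail a * Real.exp ((t + hazard a) ^ 2 / 2)) ^ n
        * Real.exp ((t + hazard a) ^ 2 / 2 * ((fun _ => 1) ⬝ᵥ gram X *ᵥ fun _ => 1))) := by
  set b := t + hazard a with hb
  set f : (Fin n → ℝ) → ℝ≥0∞ := fun y =>
    ∏ i, (Ici a).indicator (fun y => ENNReal.ofReal (Real.exp (t * y))) (y i) with hf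
  have hind : Measurable ((Ici a).indicator fun y => ENNReal.ofReal (Real.exp (t * y))) :=
    Measurable.indicator (by fun_prop) measurableSet_Ici
  have hfm : Measurable f := Finset.measurable_prod _ fun i _ => hind.comp (measurable_pi_apply i)
  obtain ⟨B, hB1, hB2, hB3⟩ := exists_dominating (gram_isSymm X) hc h
  rw [Fintype.card_fin] at hB3
  have hWp : (gram X).PosDef := posDef_of_le (gram_isSymm X) hc h
  have hVs : (1 + B * Bᵀ).IsSymm := by
    rw [Matrix.IsSymm, Matrix.transpose_add, Matrix.transpose_one, Matrix.transpose_mul,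
      Matrix.transpose_transpose]
  have hVp : (1 + B * Bᵀ).PosDef := posDef_of_le hVs hc fun w => (h w).trans (hB1 w)
  set A : Matrix (Fin n) (Fin n ⊕ Fin n) ℝ := Matrix.fromCols 1 B with hA
  have hAA : A * Aᵀ = 1 + B * Bᵀ := by
    rw [hA, Matrix.transpose_fromCols, Matrix.fromCols_mul_fromRows, Matrix.transpose_one,
      Matrix.mul_one]
  have hAm : ∀ z h : Fin n → ℝ, A *ᵥ Sum.elim z h = z + B *ᵥ h := fun z h => by
    rw [hA, Matrix.fromCols_mulVec, Sum.elim_comp_inl, Sum.elim_comp_inr, Matrix.one_mulVec]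
  set ρ := Real.exp (√(n * ((gram X - 1) * (gram X - 1)).trace) / c / 2) with hρ
  have hsq : √((1 + B * Bᵀ).det / (gram X).det) ≤ ρ := by
    rw [Real.sqrt_le_left (Real.exp_pos _).le, ← Real.exp_nat_mul]
    refine hB3.trans_eq ?_
    congr 1; push_cast; ring
  have hfA : Measurable fun g : Fin n ⊕ Fin n → ℝ => f (A *ᵥ g) :=
    hfm.comp (show Continuous fun g : Fin n ⊕ Fin n → ℝ => A *ᵥ g by fun_prop).measurable
  have hprod : ∀ v : Fin n → ℝ, ∫⁻ z, f (z + v) ∂stdGauss (Fin n)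
      ≤ ENNReal.ofReal ((normalTail a * Real.exp (b ^ 2 / 2)) ^ n)
        * ENNReal.ofReal (Real.exp ((fun _ => b) ⬝ᵥ v)) := fun v => by
    simp only [hf, Pi.add_apply]
    rw [stdGauss, lintegral_pi_prod stdNormal (fun i z => (Ici a).indicator
      (fun y => ENNReal.ofReal (Real.exp (t * y))) (z + v i))
      fun i => hind.comp (measurable_add_const _)]
    refine (Finset.prod_le_prod' fun i _ => lintegral_indicator_exp_add_le a t (v i)).trans_eq ?_
    rw [← ENNReal.ofReal_prod_of_nonneg fun i _ => mul_nonneg (mul_nonneg (normalTail_pos a).le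
      (Real.exp_pos _).le) (Real.exp_pos _).le, Finset.prod_mul_distrib, Finset.prod_const,
      Finset.card_univ, Fintype.card_fin, ← Real.exp_sum,
      ENNReal.ofReal_mul (pow_nonneg (mul_nonneg (normalTail_pos a).le (Real.exp_pos _).le) _)]
    rfl
  calc ∫⁻ g, f (rowMat X *ᵥ g) ∂stdGauss (Fin d)
      = ∫⁻ y, f y * ENNReal.ofReal (gaussRatio (gram X) y) ∂stdGauss (Fin n) :=
        lintegral_mulVec_stdGauss (A := rowMat X) hWp hfm
    _ ≤ ∫⁻ y, ENNReal.ofReal ρ * (f y * ENNReal.ofReal (gaussRatio (1 + B * Bᵀ) y))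
        ∂stdGauss (Fin n) := lintegral_mono fun y => by
          rw [mul_left_comm, ← ENNReal.ofReal_mul (Real.exp_pos _).le]
          refine mul_le_mul' le_rfl (ENNReal.ofReal_le_ofReal
            ((gaussRatio_le_of_le hWp hVp hB1 y).trans ?_))
          exact mul_le_mul_of_nonneg_right hsq (gaussRatio_nonneg _ _)
    _ = ENNReal.ofReal ρ * ∫⁻ g, f (A *ᵥ g) ∂stdGauss (Fin n ⊕ Fin n) := by
          rw [lintegral_const_mul' _ _ ENNReal.ofReal_ne_top,
            lintegral_mulVec_stdGauss (A := A) (by rwa [hAA]) hfm, hAA]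
    _ = ENNReal.ofReal ρ * ∫⁻ h, ∫⁻ z, f (z + B *ᵥ h) ∂stdGauss (Fin n) ∂stdGauss (Fin n) := by
          rw [lintegral_stdGauss_sum hfA]
          simp only [hAm]
    _ ≤ ENNReal.ofReal ρ * ∫⁻ h, ENNReal.ofReal ((normalTail a * Real.exp (b ^ 2 / 2)) ^ n)
        * ENNReal.ofReal (Real.exp (((fun _ => b) ᵥ* B) ⬝ᵥ h)) ∂stdGauss (Fin n) := by
          refine mul_le_mul' le_rfl (lintegral_mono fun h => (hprod _).trans_eq ?_)
          rw [Matrix.dotProduct_mulVec]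
    _ ≤ _ := by
          have hp0 : 0 ≤ (normalTail a * Real.exp (b ^ 2 / 2)) ^ n :=
            pow_nonneg (mul_nonneg (normalTail_pos a).le (Real.exp_pos _).le) _
          rw [lintegral_const_mul' _ _ ENNReal.ofReal_ne_top, lintegral_exp_dotProduct_stdGauss,
            ← mul_assoc, ← ENNReal.ofReal_mul (Real.exp_pos _).le,
            ← ENNReal.ofReal_mul (mul_nonneg (Real.exp_pos _).le hp0)]
          refine ENNReal.ofReal_le_ofReal ?_
          refine mul_le_mul_of_nonneg_left (Real.exp_le_exp.2 ?_)
            (mul_nonneg (Real.exp_pos _).le hp0)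
          have h5 : (fun _ : Fin n => b) = b • fun _ => (1 : ℝ) := by
            funext i; simp
          have h6 := hB2 fun _ => 1
          rw [← Matrix.mulVec_mulVec, Matrix.dotProduct_mulVec, Matrix.mulVec_transpose] at h6
          rw [h5, Matrix.smul_vecMul, smul_dotProduct, dotProduct_smul, smul_eq_mul, smul_eq_mul]
          have h7 := mul_le_mul_of_nonneg_left h6 (show 0 ≤ b ^ 2 / 2 by positivity)
          linarith

/-- The Gram form at the constant vector is the squared norm of the sum of the rows divided by `d`.
A weight on it therefore becomes a tilt of the entries of the last row. -/
lemma quad_one_snoc {n d : ℕ} (X : Fin n → Fin d → ℝ) (g : Fin d → ℝ) :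
    (fun _ => 1) ⬝ᵥ gram (Fin.snoc (α := fun _ => Fin d → ℝ) X g) *ᵥ (fun _ => 1)
      = (fun _ => 1) ⬝ᵥ gram X *ᵥ (fun _ => 1) + 2 / √(d : ℝ) * ∑ i, (rowMat X *ᵥ g) i
        + (g ⬝ᵥ g) / d := by
  have h1 : ∑ i, (rowMat X *ᵥ g) i = (rowComb (fun _ => 1) X ⬝ᵥ g) / √(d : ℝ) := by
    simp only [rowMat_mulVec, rowComb, one_smul]
    rw [← Finset.sum_div, sum_dotProduct]
  have h2 : rowComb (fun _ => 1) (Fin.snoc (α := fun _ => Fin d → ℝ) X g)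
      = rowComb (fun _ => 1) X + g := by
    simp [rowComb, Fin.sum_univ_castSucc]
  have h3 : 2 / √(d : ℝ) * ((rowComb (fun _ => 1) X ⬝ᵥ g) / √(d : ℝ))
      = 2 * (rowComb (fun _ => 1) X ⬝ᵥ g) / d := by
    rw [div_mul_div_comm, Real.mul_self_sqrt (Nat.cast_nonneg d)]
  rw [dotProduct_gram_mulVec, dotProduct_gram_mulVec, h1, h2, h3, add_dotProduct, dotProduct_add,
    dotProduct_add, dotProduct_comm g]
  ring

-- Integrating out the last row under a weight `κ/2` on the Gram form at the constant vector tilts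
-- its entries by `κ/√d` and leaves the weight `(κ + u²)/2`, with `u = κ/√d + hazard a`. The
-- hypothesis on `β` is the fixed-point condition that keeps `u ≤ β`, so that the weight never
-- exceeds `β²N`. The loss per row consists of the determinant factor, `κ` from the norm of the row,
-- and `u²/2` for each entry.
open Classical in
lemma lintegral_blue_le {δ₀ δ₁ z v : ℝ} (hδ₀ : δ₀ ≤ 1) (hδ₁ : 0 < δ₁) (hv : 0 ≤ v) {d N : ℕ}
    {a β : ℝ} (hβ : hazard a + β ^ 2 * N / √(d : ℝ) ≤ β) : ∀ (n : ℕ) (κ : ℝ), n ≤ N → 0 ≤ κ →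
    κ + β ^ 2 * n ≤ β ^ 2 * N →
    ∫⁻ X, (if GoodRows δ₀ δ₁ z v X ∧ (gramTri X).All (Ici a) then ENNReal.ofReal (Real.exp
      (κ / 2 * ((fun _ => 1) ⬝ᵥ gram X *ᵥ fun _ => 1))) else 0) ∂gaussRows n d
      ≤ ENNReal.ofReal (normalTail a ^ n.choose 2
        * Real.exp (n * (√(N * (N * δ₀ ^ 2 + v)) / δ₁ / 2 + β ^ 2 * N * (3 / 2))))
  | 0, κ, _, _, _ => by
    calc _ ≤ ∫⁻ _, 1 ∂gaussRows 0 d := lintegral_mono fun X => by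
          split_ifs
          · simp
          · exact zero_le
      _ ≤ _ := by simp
  | n + 1, κ, hnN, hκ, hκN => by
    set s := √(N * (N * δ₀ ^ 2 + v)) / δ₁ with hs
    set u := κ / √(d : ℝ) + hazard a with hu
    have hu0 : 0 ≤ u := add_nonneg (div_nonneg hκ (Real.sqrt_nonneg _)) (hazard_pos a).le
    have hκN' : κ ≤ β ^ 2 * N := by
      have : 0 ≤ β ^ 2 * ((n + 1 : ℕ) : ℝ) := by positivity
      linarith
    have huβ : u ≤ β := by
      refine le_trans ?_ hβ
      rw [hu, add_comm]
      gcongr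
    have hu2 : u ^ 2 ≤ β ^ 2 := pow_le_pow_left₀ hu0 huβ 2
    have hnN' : (n : ℝ) ≤ N := by exact_mod_cast (Nat.le_succ n).trans hnN
    have hIH := lintegral_blue_le (z := z) hδ₀ hδ₁ hv hβ n (κ + u ^ 2) ((Nat.le_succ n).trans hnN)
      (by positivity) (by push_cast at hκN; linarith)
    have hinit : ∀ (X : Fin n → Fin d → ℝ) (g : Fin d → ℝ),
        initRows (Fin.snoc (α := fun _ => Fin d → ℝ) X g) = X := fun X g => by
      funext i; simp [initRows]
    have hgood : ∀ (X : Fin n → Fin d → ℝ) (g : Fin d → ℝ),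
        GoodRows δ₀ δ₁ z v (Fin.snoc (α := fun _ => Fin d → ℝ) X g) → GoodRows δ₀ δ₁ z v X :=
      fun X g h => by have := h.init; rwa [hinit] at this
    have hall : ∀ (X : Fin n → Fin d → ℝ) (g : Fin d → ℝ),
        (gramTri (Fin.snoc (α := fun _ => Fin d → ℝ) X g)).All (Ici a) →
        (gramTri X).All (Ici a) ∧ ∀ i, a ≤ (rowMat X *ᵥ g) i := fun X g h => by
      rw [Tri.all_succ, gramTri, hinit, Fin.snoc_last] at h
      exact h
    set J : (m : ℕ) → (Fin m → Fin d → ℝ) → ℝ := fun m X => (fun _ => 1) ⬝ᵥ gram X *ᵥ fun _ => 1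
      with hJ
    rw [gaussRows, lintegral_pi_succ]
    refine (lintegral_prod_le _).trans ?_
    calc _ ≤ ∫⁻ X, (if GoodRows δ₀ δ₁ z v X ∧ (gramTri X).All (Ici a) then ENNReal.ofReal (Real.exp
            ((κ + u ^ 2) / 2 * J n X)) else 0) * ENNReal.ofReal (normalTail a ^ n
              * Real.exp (s / 2 + β ^ 2 * N * (3 / 2))) ∂gaussRows n d := by
          refine lintegral_mono fun X => ?_
          by_cases hX : GoodRows δ₀ δ₁ z v X ∧ (gramTri X).All (Ici a)
          · rw [if_pos hX]
            calc _ ≤ ∫⁻ g, ENNReal.ofReal (Real.exp (κ / 2 * J n X + κ)) *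
                ∏ i, (Ici a).indicator (fun y => ENNReal.ofReal (Real.exp (κ / √(d : ℝ) * y)))
                  ((rowMat X *ᵥ g) i) ∂stdGauss (Fin d) := lintegral_mono fun g => by
                  split_ifs with h
                  · have h1 := (hall X g h.2).2
                    have h2 := h.1.norm_le (Fin.last n)
                    rw [gram_apply, Fin.snoc_last] at h2
                    rw [Finset.prod_congr rfl fun i _ => indicator_of_mem (mem_Ici.2 (h1 i)) _,
                      ← ENNReal.ofReal_prod_of_nonneg fun i _ => (Real.exp_pos _).le,
                      ← Real.exp_sum, ← Finset.mul_sum, ← ENNReal.ofReal_mul (Real.exp_pos _).le,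
                      ← Real.exp_add]
                    refine ENNReal.ofReal_le_ofReal (Real.exp_le_exp.2 ?_)
                    rw [quad_one_snoc]
                    have h3 := mul_le_mul_of_nonneg_left (h2.trans (add_le_add_right hδ₀ 1))
                      (show 0 ≤ κ / 2 by positivity)
                    have h4 : κ / 2 * (2 / √(d : ℝ) * ∑ i, (rowMat X *ᵥ g) i)
                        = κ / √(d : ℝ) * ∑ i, (rowMat X *ᵥ g) i := by ring
                    rw [mul_add, mul_add, h4]
                    linarith
                  · exact zero_le
              _ ≤ ENNReal.ofReal (Real.exp (κ / 2 * J n X + κ)) * ENNReal.ofReal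
                  (Real.exp (s / 2) * (normalTail a * Real.exp (u ^ 2 / 2)) ^ n
                    * Real.exp (u ^ 2 / 2 * J n X)) := by
                  rw [lintegral_const_mul' _ _ ENNReal.ofReal_ne_top]
                  refine mul_le_mul' le_rfl ((lintegral_row_le hδ₁ hX.1.quad a _).trans
                    (ENNReal.ofReal_le_ofReal ?_))
                  have hp0 : 0 ≤ (normalTail a * Real.exp (u ^ 2 / 2)) ^ n :=
                    pow_nonneg (mul_nonneg (normalTail_pos a).le (Real.exp_pos _).le) _
                  refine mul_le_mul_of_nonneg_right (mul_le_mul_of_nonneg_right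
                    (Real.exp_le_exp.2 ?_) hp0) (Real.exp_pos _).le
                  have h5 : n * ((gram X - 1) * (gram X - 1)).trace ≤ N * (N * δ₀ ^ 2 + v) :=
                    (mul_le_mul_of_nonneg_left (hX.1.trace_sub_one_sq_le) (Nat.cast_nonneg n)).trans
                      (by gcongr)
                  rw [hs]
                  gcongr
              _ ≤ _ := by
                  rw [← ENNReal.ofReal_mul (Real.exp_pos _).le, ← ENNReal.ofReal_mul (Real.exp_pos _).le]
                  refine ENNReal.ofReal_le_ofReal ?_
                  rw [mul_pow, ← Real.exp_nat_mul]
                  calc Real.exp (κ / 2 * J n X + κ) * (Real.exp (s / 2) * (normalTail a ^ n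
                        * Real.exp (n * (u ^ 2 / 2))) * Real.exp (u ^ 2 / 2 * J n X))
                      = normalTail a ^ n * Real.exp (κ / 2 * J n X + κ + s / 2 + n * (u ^ 2 / 2)
                        + u ^ 2 / 2 * J n X) := by simp only [Real.exp_add]; ring
                    _ ≤ normalTail a ^ n * Real.exp ((κ + u ^ 2) / 2 * J n X
                        + (s / 2 + β ^ 2 * N * (3 / 2))) := by
                        refine mul_le_mul_of_nonneg_left (Real.exp_le_exp.2 ?_)
                          (pow_nonneg (normalTail_pos a).le _)
                        have : n * (u ^ 2 / 2) ≤ N * (β ^ 2 / 2) := by gcongr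
                        linarith
                    _ = _ := by rw [Real.exp_add]; ring
          · rw [if_neg hX, zero_mul, nonpos_iff_eq_zero]
            have : ∀ g : Fin d → ℝ, ¬ (GoodRows δ₀ δ₁ z v (Fin.snoc (α := fun _ => Fin d → ℝ) X g) ∧
                (gramTri (Fin.snoc (α := fun _ => Fin d → ℝ) X g)).All (Ici a)) :=
              fun g h => hX ⟨hgood X g h.1, (hall X g h.2).1⟩
            simp [this]
      _ ≤ ENNReal.ofReal (normalTail a ^ n.choose 2 * Real.exp (n * (s / 2 + β ^ 2 * N * (3 / 2))))
          * ENNReal.ofReal (normalTail a ^ n * Real.exp (s / 2 + β ^ 2 * N * (3 / 2))) := by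
          rw [lintegral_mul_const' _ _ ENNReal.ofReal_ne_top]
          exact mul_le_mul' hIH le_rfl
      _ = _ := by
          rw [← ENNReal.ofReal_mul (mul_nonneg (pow_nonneg (normalTail_pos a).le _) (Real.exp_pos _).le),
            Nat.choose_succ_succ' n 1, Nat.choose_one_right, pow_add]
          congr 1
          have h6 : ∀ x : ℝ, ((n + 1 : ℕ) : ℝ) * x = n * x + x := fun x => by push_cast; ring
          rw [h6, Real.exp_add (n * _)]
          ring

/-- The probability of a blue clique, in a wide range of dimensions. -/
theorem exists_probBlue_le_of_mul_le {p e₁ ζ : ℝ} (h0 : 0 < p) (h1 : p < 1 / 2) (he₁ : 0 < e₁)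
    (he : 4 * (cutoffDensity p / (1 - p)) * e₁ ≤ 1) (hζ : 0 < ζ) :
    ∃ n₀ : ℕ, ∀ n ≥ n₀, ∀ d : ℕ, 0 < d → (n : ℝ) ≤ e₁ * √(d : ℝ) →
      probBlue n d p ≤ Real.exp (n ^ 2 / 2 * Real.log (1 - p)
        + 6 * (cutoffDensity p / (1 - p)) ^ 2 * n ^ 2 + ζ * n ^ 2) := by
  classical
  set b := cutoffDensity p / (1 - p) with hb
  set c := cutoff p with hc
  have hhc : hazard (-c) = b := hazard_neg_cutoff h0 h1
  have hb0 : 0 < b := hhc ▸ hazard_pos _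
  have htail : normalTail (-c) = 1 - p := by rw [normalTail_neg, normalTail_cutoff h0 h1]
  set L := Real.log (1 - p) with hL
  have hL0 : L ≤ 0 := (Real.log_neg (by linarith) (by linarith)).le
  obtain ⟨δ₁, hδ₁, F, hF, hred⟩ := exists_gaussRows_all_le (show 0 ≤ -L / 2 by linarith) he₁
  set δ₀ := min 1 (ζ / 4 * δ₁) with hδ
  have hδ0 : 0 < δ₀ := lt_min one_pos (by positivity)
  have hδ2 : δ₀ / δ₁ ≤ ζ / 4 := by rw [div_le_iff₀ hδ₁]; exact min_le_right _ _
  obtain ⟨j, n₂, hn₂⟩ := hred δ₀ hδ0 1 one_pos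
  refine Exists.imp (fun n₀ hn₀ n hn d hd hnd => ?_) (exists_gaussRows_all_le_exp
    (f := fun n d => 6 * b ^ 2 * (n : ℝ) ^ 2)
    (G := fun n d => {X | GoodRows δ₀ δ₁ 1 (2 * F * (n : ℝ) ^ 2 / d) X ∧ (gramTri X).All (Ici (-c))})
    (n₁ := max 1 (max ⌈-L / 2 / (ζ / 4)⌉₊ ⌈2 * F * e₁ ^ 2 / (3 * δ₀ ^ 2)⌉₊)) hL0 hζ
    (fun n hn d hd hnd => hn₂ n hn d hd hnd (Ici (-c)) measurableSet_Ici)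
    (fun n d => by positivity) (fun m n d hmn => by gcongr) fun n hn d hd hnd => ?_)
  · rw [probBlue_eq hd]; exact hn₀ n hn d hd hnd
  have hn1 : (1 : ℝ) ≤ n := by exact_mod_cast (le_max_left _ _).trans hn
  have hn3 : -L / 2 ≤ ζ / 4 * n := by
    rw [← div_le_iff₀' (by positivity)]
    exact (Nat.le_ceil _).trans (Nat.cast_le.2 ((le_max_left _ _).trans ((le_max_right _ _).trans hn)))
  have hn4 : 2 * F * e₁ ^ 2 ≤ 3 * δ₀ ^ 2 * n := by
    rw [← div_le_iff₀' (by positivity)]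
    exact (Nat.le_ceil _).trans (Nat.cast_le.2 ((le_max_right _ _).trans ((le_max_right _ _).trans hn)))
  have hd' : (0 : ℝ) < d := Nat.cast_pos.2 hd
  have hrd : 0 < √(d : ℝ) := Real.sqrt_pos.2 hd'
  set v := 2 * F * n ^ 2 / d with hv
  have hv0 : 0 ≤ v := by positivity
  -- `β = 2b` solves the fixed-point condition exactly when `4bn/√d ≤ 1`; the resulting loss
  -- `(3/2)β²n²` is the term `6b²n²`.
  have hβ : hazard (-c) + (2 * b) ^ 2 * n / √(d : ℝ) ≤ 2 * b := by
    rw [hhc]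
    have : (2 * b) ^ 2 * n / √(d : ℝ) ≤ b := by
      rw [div_le_iff₀ hrd]
      have h2 := mul_le_mul_of_nonneg_left hnd (show 0 ≤ 4 * b ^ 2 by positivity)
      have h3 := mul_le_mul_of_nonneg_right he (show 0 ≤ b * √(d : ℝ) by positivity)
      linarith
    linarith
  have hmain := lintegral_blue_le (δ₀ := δ₀) (z := 1) (v := v) (min_le_left _ _) hδ₁ hv0 hβ n 0 le_rfl le_rfl
    (by rw [zero_add])
  simp only [zero_div, zero_mul, Real.exp_zero, ENNReal.ofReal_one] at hmain
  have hms : MeasurableSet {X : Fin n → Fin d → ℝ | GoodRows δ₀ δ₁ 1 v X ∧ (gramTri X).All (Ici (-c))} :=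
    (isClosed_goodRows δ₀ δ₁ 1 v n d).measurableSet.inter
      (measurable_gramTri (Tri.measurableSet_all measurableSet_Ici n))
  have hmeas : gaussRows n d {X | GoodRows δ₀ δ₁ 1 v X ∧ (gramTri X).All (Ici (-c))}
      = ∫⁻ X, (if GoodRows δ₀ δ₁ 1 v X ∧ (gramTri X).All (Ici (-c)) then 1 else 0) ∂gaussRows n d := by
    rw [← lintegral_indicator_one hms]
    exact lintegral_congr fun X => by simp [indicator_apply]
  refine (hmeas.trans_le hmain).trans (ENNReal.ofReal_le_ofReal ?_)
  rw [htail, ← Real.exp_log (show 0 < 1 - p by linarith), ← Real.exp_nat_mul, ← Real.exp_add,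
    Real.exp_le_exp, Nat.cast_choose_two, ← hL]
  have hvb : v ≤ 2 * F * e₁ ^ 2 := by
    rw [hv, div_le_iff₀ hd']
    have h2 : (n : ℝ) ^ 2 ≤ (e₁ * √(d : ℝ)) ^ 2 := pow_le_pow_left₀ (by linarith) hnd 2
    rw [mul_pow, Real.sq_sqrt hd'.le] at h2
    have := mul_le_mul_of_nonneg_left h2 (show 0 ≤ 2 * F by positivity)
    linarith
  have hs : √(n * (n * δ₀ ^ 2 + v)) ≤ 2 * n * δ₀ := by
    rw [Real.sqrt_le_left (by positivity)]
    have := mul_le_mul_of_nonneg_left (hvb.trans hn4) (show (0 : ℝ) ≤ n by linarith)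
    linarith
  have hs2 : √(n * (n * δ₀ ^ 2 + v)) / δ₁ ≤ ζ / 2 * n := by
    rw [div_le_iff₀ hδ₁]
    rw [div_le_iff₀ hδ₁] at hδ2
    have := mul_le_mul_of_nonneg_left hδ2 (show 0 ≤ 2 * (n : ℝ) by linarith)
    linarith
  have h5 := mul_le_mul_of_nonneg_left hs2 (show (0 : ℝ) ≤ n by linarith)
  have h6 := mul_le_mul_of_nonneg_left hn3 (show (0 : ℝ) ≤ n by linarith)
  linarith

/-! ### Ramsey numbers -/

/-- Ramsey's theorem for two colours. -/
theorem exists_isNClique_or_isNClique_compl (l k : ℕ) :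
    ∃ N : ℕ, ∀ {V : Type} (G : SimpleGraph V) (s : Finset V), N ≤ s.card →
      (∃ t ⊆ s, G.IsNClique l t) ∨ ∃ t ⊆ s, Gᶜ.IsNClique k t := by
  induction hm : l + k generalizing l k with
  | zero =>
    obtain rfl : l = 0 := by omega
    exact ⟨0, fun G s _ => .inl ⟨∅, Finset.empty_subset _, by simp⟩⟩
  | succ m ih =>
    rcases Nat.eq_zero_or_pos l with rfl | hl
    · exact ⟨0, fun G s _ => .inl ⟨∅, Finset.empty_subset _, by simp⟩⟩
    rcases Nat.eq_zero_or_pos k with rfl | hk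
    · exact ⟨0, fun G s _ => .inr ⟨∅, Finset.empty_subset _, by simp⟩⟩
    obtain ⟨a, rfl⟩ : ∃ a, l = a + 1 := ⟨l - 1, by omega⟩
    obtain ⟨b, rfl⟩ : ∃ b, k = b + 1 := ⟨k - 1, by omega⟩
    obtain ⟨N₁, h₁⟩ := ih a (b + 1) (by omega)
    obtain ⟨N₂, h₂⟩ := ih (a + 1) b (by omega)
    refine ⟨N₁ + N₂ + 1, fun {V} G s hs => ?_⟩
    classical
    obtain ⟨v, hv⟩ : s.Nonempty := Finset.card_pos.1 (by omega)
    set A := (s.erase v).filter fun w => G.Adj v w with hA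
    set B := (s.erase v).filter fun w => ¬ G.Adj v w with hB
    have hAB : A.card + B.card = (s.erase v).card := Finset.card_filter_add_card_filter_not _
    have hAs : A ⊆ s := (Finset.filter_subset _ _).trans (Finset.erase_subset _ _)
    have hBs : B ⊆ s := (Finset.filter_subset _ _).trans (Finset.erase_subset _ _)
    rw [Finset.card_erase_of_mem hv] at hAB
    rcases (by omega : N₁ ≤ A.card ∨ N₂ ≤ B.card) with h | h
    · rcases h₁ G A h with ⟨t, ht, hc⟩ | ⟨t, ht, hc⟩
      · exact .inl ⟨insert v t, Finset.insert_subset hv (ht.trans hAs),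
          hc.insert fun b hb => (Finset.mem_filter.1 (ht hb)).2⟩
      · exact .inr ⟨t, ht.trans hAs, hc⟩
    · rcases h₂ G B h with ⟨t, ht, hc⟩ | ⟨t, ht, hc⟩
      · exact .inl ⟨t, ht.trans hBs, hc⟩
      · refine .inr ⟨insert v t, Finset.insert_subset hv (ht.trans hBs), hc.insert fun b hb => ?_⟩
        have hb' := Finset.mem_filter.1 (ht hb)
        exact (SimpleGraph.compl_adj _ _ _).2 ⟨(Finset.ne_of_mem_erase hb'.1).symm, hb'.2⟩

/-- Ramsey's theorem is needed because the infimum of an empty set of naturals would be `0`. Once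
the infimum is attained, a good colouring on `n` vertices restricts to any smaller number. -/
lemma lt_ramsey {l k n : ℕ} {G : SimpleGraph (Fin n)} (h1 : G.CliqueFree l)
    (h2 : Gᶜ.CliqueFree k) : n < ramsey l k := by
  have hne : {n : ℕ | ∀ G : SimpleGraph (Fin n), ¬ G.CliqueFree l ∨ ¬ Gᶜ.CliqueFree k}.Nonempty := by
    obtain ⟨N, hN⟩ := exists_isNClique_or_isNClique_compl l k
    refine ⟨N, fun G => ?_⟩
    rcases hN G Finset.univ (by simp) with ⟨t, _, ht⟩ | ⟨t, _, ht⟩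
    · exact .inl fun h => h t ht
    · exact .inr fun h => h t ht
  by_contra hcon
  have hm : ∀ G : SimpleGraph (Fin (ramsey l k)), ¬ G.CliqueFree l ∨ ¬ Gᶜ.CliqueFree k :=
    Nat.sInf_mem hne
  set f := Fin.castLEEmb (not_lt.1 hcon) with hf
  rcases hm (G.comap f) with h | h
  · exact h (h1.comap (SimpleGraph.Embedding.comap f G).isContained)
  · refine h ?_
    have : (G.comap f)ᶜ = Gᶜ.comap f := by
      ext i j; simp [SimpleGraph.compl_adj]
    rw [this]
    exact h2.comap (SimpleGraph.Embedding.comap f Gᶜ).isContained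

instance {n d : ℕ} : IsProbabilityMeasure (gaussianVectors n d) := by
  unfold gaussianVectors; infer_instance

lemma measurableSet_gaussianGraph {m d : ℕ} (p : ℝ) (G : SimpleGraph (Fin m)) :
    MeasurableSet {x : Fin m → Fin d → ℝ | gaussianGraph p x = G} := by
  have : {x : Fin m → Fin d → ℝ | gaussianGraph p x = G}
      = ⋂ i, ⋂ j, {x | (i ≠ j ∧ -cutoff p / √(d : ℝ) ≤ ∑ k, x i k * x j k) ↔ G.Adj i j} := by
    ext x
    simp only [mem_ofPred_eq, mem_iInter, SimpleGraph.ext_iff, funext_iff, eq_iff_iff]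
    rfl
  rw [this]
  refine MeasurableSet.iInter fun i => MeasurableSet.iInter fun j => ?_
  have hm : MeasurableSet {x : Fin m → Fin d → ℝ | -cutoff p / √(d : ℝ) ≤ ∑ k, x i k * x j k} :=
    measurableSet_le measurable_const (by fun_prop)
  exact ((MeasurableSet.const _).inter hm).iff (MeasurableSet.const _)

lemma gaussianVectors_exists_embedding_le {n m d : ℕ} (p : ℝ) (H : SimpleGraph (Fin m)) :
    (gaussianVectors n d).real {x | ∃ f : Fin m ↪ Fin n, gaussianGraph p (fun i => x (f i)) = H}
      ≤ n ^ m * (gaussianVectors m d).real {x | gaussianGraph p x = H} := by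
  have h1 : {x : Fin n → Fin d → ℝ | ∃ f : Fin m ↪ Fin n, gaussianGraph p (fun i => x (f i)) = H}
      = ⋃ f : Fin m ↪ Fin n, (fun x i => x (f i)) ⁻¹' {x | gaussianGraph p x = H} := by
    ext x; simp
  rw [h1]
  refine (measureReal_iUnion_fintype_le _).trans ?_
  have h2 : ∀ f : Fin m ↪ Fin n, (gaussianVectors n d).real
      ((fun x i => x (f i)) ⁻¹' {x | gaussianGraph p x = H})
      = (gaussianVectors m d).real {x | gaussianGraph p x = H} := fun f => by
    rw [Measure.real, Measure.real]
    congr 1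
    exact (measurePreserving_comp_pi _ f.injective).measure_preimage
      (measurableSet_gaussianGraph p H).nullMeasurableSet
  rw [Finset.sum_congr rfl fun f _ => h2 f, Finset.sum_const, nsmul_eq_mul]
  refine mul_le_mul_of_nonneg_right ?_ measureReal_nonneg
  have h3 : Fintype.card (Fin m ↪ Fin n) ≤ Fintype.card (Fin m → Fin n) :=
    Fintype.card_le_of_injective _ DFunLike.coe_injective
  rw [Fintype.card_fun, Fintype.card_fin, Fintype.card_fin] at h3
  exact_mod_cast h3

/-- The union bound for Ramsey numbers with the Gaussian random geometric graph. -/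
theorem lt_ramsey_of_prob {l k n d : ℕ} {p : ℝ}
    (h : n ^ l * probRed l d p + n ^ k * probBlue k d p < 1) : n < ramsey l k := by
  set bad₁ := {x : Fin n → Fin d → ℝ | ∃ f : Fin l ↪ Fin n, gaussianGraph p (fun i => x (f i)) = ⊥}
  set bad₂ := {x : Fin n → Fin d → ℝ | ∃ f : Fin k ↪ Fin n, gaussianGraph p (fun i => x (f i)) = ⊤}
  obtain ⟨x, hx⟩ : ∃ x, x ∉ bad₁ ∪ bad₂ := by
    by_contra! hcon
    have h1 : bad₁ ∪ bad₂ = univ := eq_univ_of_forall hcon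
    have h2 := measureReal_union_le (μ := gaussianVectors n d) bad₁ bad₂
    rw [h1, probReal_univ] at h2
    have h3 := gaussianVectors_exists_embedding_le (n := n) (d := d) p (⊥ : SimpleGraph (Fin l))
    have h4 := gaussianVectors_exists_embedding_le (n := n) (d := d) p (⊤ : SimpleGraph (Fin k))
    exact absurd h (not_lt.2 (h2.trans (add_le_add h3 h4)))
  rw [mem_union, not_or] at hx
  -- Red edges are the non-adjacent pairs, so the red colour class is the complement of the
  -- geometric graph.
  refine lt_ramsey (G := (gaussianGraph p x)ᶜ) ?_ ?_
  · by_contra hcon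
    obtain ⟨φ⟩ := SimpleGraph.not_cliqueFree_iff_top_isContained _ |>.1 hcon
    refine hx.1 ⟨⟨φ, φ.injective⟩, ?_⟩
    rw [eq_bot_iff, SimpleGraph.le_iff_adj]
    intro i j hij
    have h1 : (gaussianGraph p x)ᶜ.Adj (φ i) (φ j) := φ.toHom.map_adj ((SimpleGraph.top_adj _ _).2 hij.ne)
    exact absurd ⟨h1.ne, hij.2⟩ ((SimpleGraph.compl_adj _ _ _).1 h1).2
  · rw [compl_compl]
    by_contra hcon
    obtain ⟨φ⟩ := SimpleGraph.not_cliqueFree_iff_top_isContained _ |>.1 hcon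
    refine hx.2 ⟨⟨φ, φ.injective⟩, ?_⟩
    rw [eq_top_iff, SimpleGraph.le_iff_adj]
    intro i j hij
    have h1 : (gaussianGraph p x).Adj (φ i) (φ j) := φ.toHom.map_adj hij
    exact ⟨hij.ne, h1.2⟩

/-! ### Exponential rates -/

lemma mul_le_sqrt_ceil (D x : ℝ) : D * x ≤ √(⌈D ^ 2 * x ^ 2⌉₊ : ℝ) := by
  refine Real.le_sqrt_of_sq_le ?_
  rw [mul_pow]; exact Nat.le_ceil _

lemma sqrt_ceil_le {D x : ℝ} (hD : 0 < D) (hx : 0 ≤ x) :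
    √(⌈D ^ 2 * x ^ 2⌉₊ : ℝ) ≤ D * x + 1 := by
  refine Real.sqrt_le_left (by positivity) |>.2 ?_
  have h := (Nat.ceil_lt_add_one (show 0 ≤ D ^ 2 * x ^ 2 by positivity)).le
  have : 0 ≤ D * x := by positivity
  linarith

lemma eventually_natCast_ge (x : ℝ) : ∀ᶠ l : ℕ in atTop, x ≤ (l : ℝ) :=
  tendsto_natCast_atTop_atTop.eventually_ge_atTop x

lemma ceil_pos_of_pos {D : ℝ} (hD : 0 < D) {l : ℕ} (hl : (1 : ℝ) ≤ l) :
    0 < ⌈D ^ 2 * (l : ℝ) ^ 2⌉₊ := Nat.ceil_pos.2 (by positivity)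

/-- Lower bounds for Ramsey numbers from the exponential rates of the clique probabilities. -/
lemma exists_ramseyBound_of_prob_le {C p A B ρ : ℝ} {d : ℕ → ℕ} (hC : 0 < C) (hρ : 0 ≤ ρ)
    (hA : ρ < A) (hB : ρ < B)
    (hred : ∀ᶠ l : ℕ in atTop, probRed l (d l) p ≤ Real.exp (-(A * l ^ 2)))
    (hblue : ∀ᶠ l : ℕ in atTop, probBlue ⌊C * (l : ℝ)⌋₊ (d l) p ≤ Real.exp (-(B * C * l ^ 2))) :
    ∀ᶠ l : ℕ in atTop, Real.exp ρ ^ l ≤ (ramsey l ⌊C * (l : ℝ)⌋₊ : ℝ) := by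
  filter_upwards [hred, hblue, eventually_natCast_ge (3 / (A - ρ)), eventually_natCast_ge (3 / (B - ρ)),
    eventually_natCast_ge 1, eventually_natCast_ge (1 / C)] with l hr hb h1 h2 h3 h4
  set k := ⌊C * (l : ℝ)⌋₊ with hk
  have hkC : (k : ℝ) ≤ C * l := Nat.floor_le (by positivity)
  have hCl : 1 ≤ C * l := by rwa [div_le_iff₀' hC] at h4
  rw [div_le_iff₀' (by linarith)] at h1 h2
  -- The rounding costs a factor `e` at most. The thresholds `3/(A - ρ)` and `3/(B - ρ)` on `l`
  -- absorb it and leave each term of the union bound at most `e⁻¹`.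
  set n := ⌈Real.exp (ρ * l)⌉₊ with hn
  have hn1 : (n : ℝ) ≤ Real.exp (ρ * l + 1) := by
    have h5 := (Nat.ceil_lt_add_one (Real.exp_pos (ρ * l)).le).le
    have h6 : 1 ≤ Real.exp (ρ * l) := Real.one_le_exp (by positivity)
    have h7 : 2 ≤ Real.exp 1 := by have := Real.exp_one_gt_d9; linarith
    rw [Real.exp_add]
    have := mul_le_mul_of_nonneg_left h7 (Real.exp_pos (ρ * l)).le
    linarith
  have hexp : ∀ m : ℕ, (n : ℝ) ^ m ≤ Real.exp (m * (ρ * l + 1)) := fun m => by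
    rw [Real.exp_nat_mul]; exact pow_le_pow_left₀ (Nat.cast_nonneg n) hn1 m
  have hhalf : Real.exp (-1) < 1 / 2 := by
    rw [Real.exp_neg, inv_lt_comm₀ (Real.exp_pos _) (by norm_num)]
    have := Real.exp_one_gt_d9; norm_num; linarith
  have hlt : n ^ l * probRed l (d l) p + n ^ k * probBlue k (d l) p < 1 := by
    have e1 : n ^ l * probRed l (d l) p ≤ Real.exp (-1) := by
      refine (mul_le_mul (hexp l) hr measureReal_nonneg (Real.exp_pos _).le).trans ?_
      rw [← Real.exp_add, Real.exp_le_exp]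
      have := mul_le_mul_of_nonneg_right h1 (show (0 : ℝ) ≤ l by linarith)
      linarith
    have e2 : n ^ k * probBlue k (d l) p ≤ Real.exp (-1) := by
      refine (mul_le_mul (hexp k) hb measureReal_nonneg (Real.exp_pos _).le).trans ?_
      rw [← Real.exp_add, Real.exp_le_exp]
      have h5 := mul_le_mul_of_nonneg_right hkC (show 0 ≤ ρ * l + 1 by positivity)
      have h6 := mul_le_mul_of_nonneg_right h2 (show (0 : ℝ) ≤ C * l by positivity)
      linarith
    linarith
  calc Real.exp ρ ^ l = Real.exp (ρ * l) := by rw [← Real.exp_nat_mul, mul_comm]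
    _ ≤ n := Nat.le_ceil _
    _ ≤ _ := Nat.cast_le.2 (lt_ramsey_of_prob hlt).le

lemma eventually_probRed_le {p D A : ℝ} (h0 : 0 < p) (h1 : p < 1 / 2) (hD : 0 < D)
    (happ : cutoffDensity p / p / D ≤ 1 ∨ 0.9 ≤ cutoff p)
    (hA : A < -(1 / 2) * Real.log p + (cutoffDensity p / p) ^ 3 / (6 * D)) :
    ∀ᶠ l : ℕ in atTop, probRed l ⌈D ^ 2 * (l : ℝ) ^ 2⌉₊ p ≤ Real.exp (-(A * l ^ 2)) := by
  set μ := cutoffDensity p / p with hμ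
  have hμ0 : 0 < μ := by have := hazard_pos (cutoff p); rwa [hazard_cutoff h0 h1] at this
  obtain ⟨g, hg, hAg⟩ : ∃ g > 0, A + 2 * g = -(1 / 2) * Real.log p + μ ^ 3 / (6 * D) :=
    ⟨(-(1 / 2) * Real.log p + μ ^ 3 / (6 * D) - A) / 2, by linarith, by ring⟩
  obtain ⟨n₀, hn₀⟩ := exists_probRed_le h0 h1 (inv_pos.2 hD) (by rwa [← div_eq_mul_inv]) hg
  filter_upwards [eventually_ge_atTop n₀, eventually_natCast_ge 1,
    eventually_natCast_ge (μ ^ 3 / (6 * D ^ 2 * g))] with l hl hl1 hl2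
  have hl0 : (0 : ℝ) < l := by linarith
  set d := ⌈D ^ 2 * (l : ℝ) ^ 2⌉₊ with hd
  have hlow : D * l ≤ √(d : ℝ) := mul_le_sqrt_ceil D l
  have hup : √(d : ℝ) ≤ D * l + 1 := sqrt_ceil_le hD hl0.le
  have hDl : 0 < D * l := by positivity
  have hr : 0 < √(d : ℝ) := hDl.trans_le hlow
  refine (hn₀ l hl d (ceil_pos_of_pos hD hl1) (by rwa [inv_mul_eq_div, le_div_iff₀' hD])).trans
    (Real.exp_le_exp.2 ?_)
  have h3 : μ ^ 3 * l ^ 2 / (6 * D) - g * l ^ 2 ≤ μ ^ 3 * l ^ 3 / (6 * √(d : ℝ)) := by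
    rw [le_div_iff₀ (by positivity)]
    rw [div_le_iff₀ (by positivity)] at hl2
    have h4 : μ ^ 3 * l ^ 2 / (6 * D) * (6 * √(d : ℝ)) ≤ μ ^ 3 * l ^ 2 / (6 * D) * (6 * (D * l + 1)) := by
      gcongr
    have h5 : μ ^ 3 * l ^ 2 / (6 * D) * (6 * (D * l + 1)) = μ ^ 3 * l ^ 3 + l ^ 2 * (μ ^ 3 / D) := by
      field_simp
    have h6 : g * l ^ 2 * (6 * (D * l)) ≤ g * l ^ 2 * (6 * √(d : ℝ)) := by gcongr
    have h7 : μ ^ 3 / D ≤ 6 * D * g * l := by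
      rw [div_le_iff₀ hD]; linarith
    have h8 := mul_le_mul_of_nonneg_left h7 (sq_nonneg (l : ℝ))
    linarith
  have h9 : A * l ^ 2 = (-(1 / 2) * Real.log p + μ ^ 3 / (6 * D) - 2 * g) * l ^ 2 := by
    rw [← hAg]; ring
  have h10 : μ ^ 3 / (6 * D) * l ^ 2 = μ ^ 3 * l ^ 2 / (6 * D) := by ring
  linarith

lemma choose_two_ge_of_floor {C : ℝ} (hC : 0 < C) {l : ℕ} (hl : 1 ≤ C * l) :
    (C * l) ^ 2 / 2 - 3 * (C * l) / 2 ≤ ((⌊C * (l : ℝ)⌋₊.choose 2 : ℕ) : ℝ) := by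
  have h1 := (Nat.lt_floor_add_one (C * (l : ℝ))).le
  have h2 := Nat.floor_le (show 0 ≤ C * (l : ℝ) by positivity)
  rw [Nat.cast_choose_two]
  have h3 : (C * l - 1) * (C * l - 1) ≤ (⌊C * (l : ℝ)⌋₊ : ℝ) * ⌊C * (l : ℝ)⌋₊ :=
    mul_self_le_mul_self (by linarith) (by linarith)
  linarith

lemma eventually_probBlue_le_of_hmsEstimates {C p K D D' B : ℝ} (hC : 0 < C) (h0 : 0 < p)
    (h1 : p < 1 / 2) (hK : 0 ≤ K) (hD : 0 < D) (hDD : D ≤ D') (h : HMSEstimates C p K D)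
    (hB : B < rhoBlue C p K D') :
    ∀ᶠ l : ℕ in atTop, probBlue ⌊C * (l : ℝ)⌋₊ ⌈D' ^ 2 * (l : ℝ) ^ 2⌉₊ p
      ≤ Real.exp (-(B * C * l ^ 2)) := by
  obtain ⟨g, hg, hBg⟩ : ∃ g > 0, B + 2 * g = rhoBlue C p K D' :=
    ⟨(rhoBlue C p K D' - B) / 2, by linarith, by ring⟩
  have hD' : 0 < D' := hD.trans_le hDD
  set L := Real.log (1 - p) with hL
  have hL0 : L < 0 := Real.log_neg (by linarith) (by linarith)
  have ha0 : 0 ≤ cutoffDensity p := gaussianPDFReal_nonneg _ _ _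
  filter_upwards [h (C * g) (by positivity), eventually_natCast_ge 1, eventually_natCast_ge (1 / C),
    eventually_natCast_ge (-(3 / 2) * L / g)] with l hl hl1 hl2 hl3
  have hl0 : (0 : ℝ) < l := by linarith
  have hCl : 1 ≤ C * l := by rwa [div_le_iff₀' hC] at hl2
  set d := ⌈D' ^ 2 * (l : ℝ) ^ 2⌉₊ with hd
  set k := ⌊C * (l : ℝ)⌋₊ with hk
  have hkC : (k : ℝ) ≤ C * l := Nat.floor_le (by positivity)
  have hlow : D' * l ≤ √(d : ℝ) := mul_le_sqrt_ceil D' l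
  -- The dimension is rounded up to an integer, so the estimate is applied with this slightly larger
  -- `E` in place of `D'`; the uniformity over all `E ≥ D` allows it.
  set E := √(d : ℝ) / l with hE
  have hED : D' ≤ E := by rw [hE, le_div_iff₀ hl0]; exact hlow
  have hE0 : 0 < E := hD'.trans_le hED
  have hr : 0 < √(d : ℝ) := (show 0 < D' * l by positivity).trans_le hlow
  refine (hl E d k (hDD.trans hED) ?_ hkC).2.trans ?_
  · rw [hE, ← mul_pow, div_mul_cancel₀ _ hl0.ne', Real.sq_sqrt (Nat.cast_nonneg d)]
  rw [← Real.exp_log (show 0 < 1 - p by linarith), ← Real.exp_nat_mul, ← Real.exp_add,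
    Real.exp_le_exp, Real.exp_log (show 0 < 1 - p by linarith), ← hL]
  have e1 := mul_le_mul_of_nonpos_right (choose_two_ge_of_floor hC hCl) hL0.le
  have hk3 : (k : ℝ) ^ 3 ≤ (C * l) ^ 3 := pow_le_pow_left₀ (Nat.cast_nonneg k) hkC 3
  have hch : ((k.choose 3 : ℕ) : ℝ) ≤ (C * l) ^ 3 / 6 := by
    have := Nat.choose_le_pow_div (α := ℝ) 3 k
    norm_num [Nat.factorial] at this
    linarith
  have h1p : 0 < 1 - p := by linarith
  have e2 : cutoffDensity p ^ 3 / ((1 - p) ^ 3 * √(d : ℝ)) * ((k.choose 3 : ℕ) : ℝ)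
      ≤ cutoffDensity p ^ 3 / ((1 - p) ^ 3 * (D' * l)) * ((C * l) ^ 3 / 6) := by
    gcongr
  have e3 : K * (k : ℝ) ^ 3 / (E * √(d : ℝ)) ≤ K * (C * l) ^ 3 / (D' * (D' * l)) := by
    gcongr
  have e4 : cutoffDensity p ^ 3 / ((1 - p) ^ 3 * (D' * l)) * ((C * l) ^ 3 / 6)
      = C * l ^ 2 * (C ^ 2 * (cutoffDensity p ^ 3 / (6 * (1 - p) ^ 3)) / D') := by
    field_simp
  have e5 : K * (C * l) ^ 3 / (D' * (D' * l)) = C * l ^ 2 * (K * C ^ 2 / D' ^ 2) := by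
    field_simp
  have e6 : B = rhoBlue C p K D' - 2 * g := by linarith
  rw [div_le_iff₀ hg] at hl3
  have e7 := mul_le_mul_of_nonneg_left hl3 (show 0 ≤ C * l by positivity)
  rw [e6, rhoBlue, ← hL]
  rw [e4] at e2
  rw [e5] at e3
  linarith

lemma eventually_probBlue_le_of_mul_le {C p D B : ℝ} (hC : 0 < C) (h0 : 0 < p) (h1 : p < 1 / 2)
    (hD : 0 < D) (happ : 4 * (cutoffDensity p / (1 - p)) * (C / D) ≤ 1)
    (hB : B < C * (-(1 / 2) * Real.log (1 - p) - 6 * (cutoffDensity p / (1 - p)) ^ 2)) :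
    ∀ᶠ l : ℕ in atTop, probBlue ⌊C * (l : ℝ)⌋₊ ⌈D ^ 2 * (l : ℝ) ^ 2⌉₊ p
      ≤ Real.exp (-(B * C * l ^ 2)) := by
  set b := cutoffDensity p / (1 - p) with hb
  set L := Real.log (1 - p) with hL
  have hL0 : L < 0 := Real.log_neg (by linarith) (by linarith)
  obtain ⟨g, hg, hBg⟩ : ∃ g > 0, B + 2 * C * g = C * (-(1 / 2) * L - 6 * b ^ 2) :=
    ⟨(C * (-(1 / 2) * L - 6 * b ^ 2) - B) / (2 * C), div_pos (by linarith) (by positivity),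
      by field_simp; ring⟩
  obtain ⟨n₀, hn₀⟩ := exists_probBlue_le_of_mul_le h0 h1 (div_pos hC hD) happ hg
  filter_upwards [eventually_natCast_ge (n₀ / C + 1 / C), eventually_natCast_ge 1,
    eventually_natCast_ge (-L / (C * g))] with l hl hl1 hl2
  have hl0 : (0 : ℝ) < l := by linarith
  have hCl : n₀ + 1 ≤ C * l := by
    rw [← add_div, div_le_iff₀' hC] at hl; exact hl
  set d := ⌈D ^ 2 * (l : ℝ) ^ 2⌉₊ with hd
  set k := ⌊C * (l : ℝ)⌋₊ with hk
  have hkC : (k : ℝ) ≤ C * l := Nat.floor_le (by positivity)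
  have hkC' : C * l - 1 ≤ k := by have := (Nat.lt_floor_add_one (C * (l : ℝ))).le; linarith
  have hlow : D * l ≤ √(d : ℝ) := mul_le_sqrt_ceil D l
  have hkn : n₀ ≤ k := by
    have : (n₀ : ℝ) ≤ k := by linarith
    exact_mod_cast this
  refine (hn₀ k hkn d (ceil_pos_of_pos hD hl1) (hkC.trans ?_)).trans (Real.exp_le_exp.2 ?_)
  · calc C * l = C / D * (D * l) := by field_simp
      _ ≤ _ := by gcongr
  have hk2 : (k : ℝ) ^ 2 ≤ (C * l) ^ 2 := pow_le_pow_left₀ (Nat.cast_nonneg k) hkC 2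
  have hk3 : (C * l) ^ 2 - 2 * (C * l) ≤ (k : ℝ) ^ 2 := by
    have : (C * l - 1) ^ 2 ≤ (k : ℝ) ^ 2 :=
      pow_le_pow_left₀ (by linarith [(Nat.cast_nonneg n₀ : (0 : ℝ) ≤ n₀)]) hkC' 2
    linarith
  have e1 := mul_le_mul_of_nonpos_right hk3 hL0.le
  have e2 := mul_le_mul_of_nonneg_left hk2 (show 0 ≤ 6 * b ^ 2 + g by positivity)
  rw [div_le_iff₀ (by positivity)] at hl2
  have e3 := mul_le_mul_of_nonneg_left hl2 (show 0 ≤ C * l by positivity)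
  have e4 : B * C * l ^ 2 = C ^ 2 * l ^ 2 * (-(1 / 2) * L - 6 * b ^ 2) - 2 * C ^ 2 * g * l ^ 2 := by
    have : B = C * (-(1 / 2) * L - 6 * b ^ 2) - 2 * C * g := by linarith
    rw [this]; ring
  linarith

/-! ### The clique estimates hold in high dimension -/

lemma pow_three_le_choose (r : ℕ) : (r : ℝ) ^ 3 ≤ 6 * ((r.choose 3 : ℕ) : ℝ) + 6 * (r : ℝ) ^ 2 := by
  have hc : (0 : ℝ) ≤ ((r.choose 3 : ℕ) : ℝ) := Nat.cast_nonneg _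
  rcases lt_or_ge r 2 with h | h
  · have : (r : ℝ) ≤ 6 := by exact_mod_cast (by omega : r ≤ 6)
    have := mul_le_mul_of_nonneg_left this (sq_nonneg (r : ℝ))
    linarith
  · have h1 := Nat.pow_le_choose (α := ℝ) 3 r
    rw [show r + 1 - 3 = r - 2 by omega, Nat.cast_sub h] at h1
    norm_num [Nat.factorial] at h1
    have h2 : (2 : ℝ) ≤ r := by exact_mod_cast h
    linarith

lemma choose_two_le_sq (r : ℕ) : ((r.choose 2 : ℕ) : ℝ) ≤ (r : ℝ) ^ 2 / 2 := by
  rw [Nat.cast_choose_two]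
  have : (0 : ℝ) ≤ r := Nat.cast_nonneg r
  linarith

/-- The red estimate has no second-order error, and the quartic error of the blue one is `b⁴r⁴/(2d)
≤ C r³/(E√d)` because `b ≤ 1` and `r ≤ Cℓ`. For `r` below a fixed threshold the probability is
bounded by `1` and the slack `ζℓ²` makes the exponent nonnegative. -/
lemma exists_hmsEstimates {C u : ℝ} (hC : 0 < C) (hu : 0 < u) :
    ∃ D₀ > 0, ∀ D ≥ D₀, ∀ p, u ≤ p → p < 1 / 2 → HMSEstimates C p C D := by
  obtain ⟨e₁, he₁, hblue⟩ := exists_probBlue_le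
  refine ⟨max (C / e₁) (C / u), lt_max_of_lt_left (by positivity), fun D hD p hup h1 ζ hζ => ?_⟩
  have h0 : 0 < p := hu.trans_le hup
  have hD0 : 0 < D := (show 0 < C / e₁ by positivity).trans_le ((le_max_left _ _).trans hD)
  have hDe : C / D ≤ e₁ := by
    rw [div_le_comm₀ hD0 he₁]; exact (le_max_left _ _).trans hD
  have hDu : C / D ≤ u := by
    rw [div_le_comm₀ hD0 hu]; exact (le_max_right _ _).trans hD
  set a := cutoffDensity p with ha
  have ha0 : 0 < a := gaussianPDFReal_pos _ _ _ one_ne_zero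
  have hb1 : a / (1 - p) ≤ 1 := hazard_neg_cutoff_le_one h0 h1
  have h1p : 0 < 1 - p := by linarith
  have ha1 : a ≤ 1 := by rw [div_le_one h1p] at hb1; linarith
  have happ : a / p * (C / D) ≤ 1 := by
    calc a / p * (C / D) ≤ 1 / p * p := by gcongr; exact hDu.trans hup
      _ = 1 := by field_simp
  set b := a / (1 - p) with hb
  have hb0 : 0 < b := by positivity
  set μ := a / p with hμ
  have hμ0 : 0 < μ := by positivity
  obtain ⟨n₁, hn₁⟩ := exists_probRed_le h0 h1 (div_pos hC hD0) (.inl happ)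
    (show 0 < ζ / (2 * C ^ 2) by positivity)
  obtain ⟨n₂, hn₂⟩ := hblue p h0 h1 (ζ / (2 * C ^ 2)) (by positivity)
  set n₀ := max n₁ n₂ with hn₀
  set L := Real.log p with hL
  set M := Real.log (1 - p) with hM
  have hL0 : L < 0 := Real.log_neg h0 (by linarith)
  have hM0 : M < 0 := Real.log_neg h1p (by linarith)
  filter_upwards [eventually_natCast_ge 1,
    eventually_natCast_ge ((-(n₀ ^ 2 / 2 * (L + M)) + μ ^ 3 / D * n₀ ^ 3) / ζ),
    eventually_natCast_ge (2 * C ^ 2 / (D * ζ))] with l hl1 hl2 hl3 E d r hE hd hr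
  have hl0 : (0 : ℝ) < l := by linarith
  have hE0 : 0 < E := hD0.trans_le hE
  have hrd : √(d : ℝ) = E * l := by rw [hd, ← mul_pow, Real.sqrt_sq (by positivity)]
  have hrd0 : 0 < √(d : ℝ) := by rw [hrd]; positivity
  have hd0 : 0 < d := by
    have : (0 : ℝ) < d := Real.sqrt_pos.1 hrd0
    exact_mod_cast this
  have hrC : (r : ℝ) ≤ C / D * √(d : ℝ) := by
    rw [hrd]
    calc (r : ℝ) ≤ C * l := hr
      _ = C / D * (D * l) := by field_simp
      _ ≤ _ := by gcongr
  have hr0 : (0 : ℝ) ≤ r := Nat.cast_nonneg r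
  have hr2 : (r : ℝ) ^ 2 ≤ C ^ 2 * l ^ 2 := by rw [← mul_pow]; exact pow_le_pow_left₀ hr0 hr 2
  have hζr : ζ / (2 * C ^ 2) * r ^ 2 ≤ ζ / 2 * l ^ 2 := by
    calc ζ / (2 * C ^ 2) * r ^ 2 ≤ ζ / (2 * C ^ 2) * (C ^ 2 * l ^ 2) := by gcongr
      _ = _ := by field_simp
  have hpow : ∀ x : ℝ, 0 < x → ∀ m : ℕ, x ^ m = Real.exp (m * Real.log x) := fun x hx m => by
    rw [Real.exp_nat_mul, Real.exp_log hx]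
  have hK : 0 ≤ C * (r : ℝ) ^ 3 / (E * √(d : ℝ)) := by positivity
  have hc2 := choose_two_le_sq r
  have hc3 : ((r.choose 3 : ℕ) : ℝ) ≤ (r : ℝ) ^ 3 / 6 := by
    have := Nat.choose_le_pow_div (α := ℝ) 3 r
    norm_num [Nat.factorial] at this
    exact this
  have e1 := mul_le_mul_of_nonpos_right hc2 hL0.le
  have e2 := mul_le_mul_of_nonpos_right hc2 hM0.le
  have eμ : a ^ 3 / (p ^ 3 * √(d : ℝ)) = μ ^ 3 / √(d : ℝ) := by rw [hμ, div_pow, div_div]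
  have eb : a ^ 3 / ((1 - p) ^ 3 * √(d : ℝ)) = b ^ 3 / √(d : ℝ) := by rw [hb, div_pow, div_div]
  rw [hpow p h0, hpow (1 - p) h1p, ← Real.exp_add, ← Real.exp_add, eμ, eb, ← hL, ← hM]
  have e3 : μ ^ 3 / √(d : ℝ) * ((r.choose 3 : ℕ) : ℝ) ≤ μ ^ 3 / √(d : ℝ) * ((r : ℝ) ^ 3 / 6) := by
    gcongr
  have hb3 : 0 ≤ b ^ 3 / √(d : ℝ) * ((r.choose 3 : ℕ) : ℝ) := by positivity
  rcases lt_or_ge r n₀ with hrn | hrn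
  · have hrn' : (r : ℝ) ≤ n₀ := by exact_mod_cast hrn.le
    have hrn2 : (r : ℝ) ^ 2 ≤ n₀ ^ 2 := pow_le_pow_left₀ hr0 hrn' 2
    have hll : (l : ℝ) ≤ l ^ 2 := by
      have := mul_le_mul_of_nonneg_left hl1 hl0.le
      linarith
    rw [div_le_iff₀ hζ] at hl2
    have e4 : μ ^ 3 / √(d : ℝ) * ((r : ℝ) ^ 3 / 6) ≤ μ ^ 3 / D * n₀ ^ 3 := by
      have : D ≤ √(d : ℝ) := by
        rw [hrd]; calc D = D * 1 := (mul_one D).symm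
          _ ≤ _ := by gcongr
      have h6 : (r : ℝ) ^ 3 / 6 ≤ n₀ ^ 3 := by
        have := pow_le_pow_left₀ hr0 hrn' 3
        have : (0 : ℝ) ≤ r ^ 3 := by positivity
        linarith
      gcongr
    have e5 := mul_le_mul_of_nonpos_right hrn2 hL0.le
    have e6 := mul_le_mul_of_nonpos_right hrn2 hM0.le
    have e7 := mul_le_mul_of_nonneg_right hll hζ.le
    have e8 : 0 ≤ μ ^ 3 / D * n₀ ^ 3 := by positivity
    have e9 : (n₀ : ℝ) ^ 2 * L ≤ 0 := mul_nonpos_of_nonneg_of_nonpos (by positivity) hL0.le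
    have e10 : (n₀ : ℝ) ^ 2 * M ≤ 0 := mul_nonpos_of_nonneg_of_nonpos (by positivity) hM0.le
    exact ⟨measureReal_le_one.trans (Real.one_le_exp (by linarith)),
      measureReal_le_one.trans (Real.one_le_exp (by linarith))⟩
  · refine ⟨(hn₁ r ((le_max_left _ _).trans hrn) d hd0 hrC).trans (Real.exp_le_exp.2 ?_),
      (hn₂ r ((le_max_right _ _).trans hrn) d hd0 (hrC.trans (by gcongr))).trans
        (Real.exp_le_exp.2 ?_)⟩
    · have : μ ^ 3 * r ^ 3 / (6 * √(d : ℝ)) = μ ^ 3 / √(d : ℝ) * ((r : ℝ) ^ 3 / 6) := by ring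
      rw [this]
      have : 0 ≤ ζ / 2 * l ^ 2 := by positivity
      linarith
    · have e4 : b ^ 3 * r ^ 3 / (6 * √(d : ℝ))
          ≤ b ^ 3 / √(d : ℝ) * ((r.choose 3 : ℕ) : ℝ) + ζ / 2 * l ^ 2 := by
        have h6 := mul_le_mul_of_nonneg_left (pow_three_le_choose r)
          (show 0 ≤ b ^ 3 / (6 * √(d : ℝ)) by positivity)
        have h7 : b ^ 3 / √(d : ℝ) * (r : ℝ) ^ 2 ≤ ζ / 2 * l ^ 2 := by
          calc b ^ 3 / √(d : ℝ) * (r : ℝ) ^ 2 ≤ 1 / (D * l) * (C ^ 2 * l ^ 2) := by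
                have : D * l ≤ √(d : ℝ) := by rw [hrd]; gcongr
                have : b ^ 3 ≤ 1 := pow_le_one₀ hb0.le hb1
                gcongr
            _ = C ^ 2 / D * l := by field_simp
            _ ≤ ζ / 2 * l * l := by
                refine mul_le_mul_of_nonneg_right ?_ hl0.le
                rw [div_le_iff₀ (by positivity)] at hl3
                rw [div_le_iff₀ hD0]
                linarith
            _ = _ := by ring
        have h8 : b ^ 3 / (6 * √(d : ℝ)) * (6 * ((r.choose 3 : ℕ) : ℝ) + 6 * (r : ℝ) ^ 2)
            = b ^ 3 / √(d : ℝ) * ((r.choose 3 : ℕ) : ℝ) + b ^ 3 / √(d : ℝ) * (r : ℝ) ^ 2 := by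
          field_simp
        have h9 : b ^ 3 * r ^ 3 / (6 * √(d : ℝ)) = b ^ 3 / (6 * √(d : ℝ)) * r ^ 3 := by ring
        rw [h9]
        linarith
      have e5 : b ^ 4 * r ^ 4 / (2 * d) ≤ C * (r : ℝ) ^ 3 / (E * √(d : ℝ)) := by
        have h6 : (2 * (d : ℝ)) = 2 * (E * √(d : ℝ)) * l := by
          rw [hrd, hd]; ring
        rw [h6]
        calc b ^ 4 * r ^ 4 / (2 * (E * √(d : ℝ)) * l)
            = b ^ 4 * r / (2 * l) * (r ^ 3 / (E * √(d : ℝ))) := by field_simp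
          _ ≤ C * (r ^ 3 / (E * √(d : ℝ))) := by
              refine mul_le_mul_of_nonneg_right ?_ (by positivity)
              rw [div_le_iff₀ (by positivity)]
              have h7 : b ^ 4 * r ≤ 1 * r :=
                mul_le_mul_of_nonneg_right (pow_le_one₀ hb0.le hb1) hr0
              have : 0 ≤ C * l := by positivity
              linarith
          _ = _ := by ring
      linarith

/-! ### The edge parameter `p_C` -/

lemma solvesErdos_iff {C p : ℝ} :
    SolvesErdos C p ↔ (0 < p ∧ p < 1 / 2) ∧ Real.log p = C * Real.log (1 - p) := by
  refine and_congr_right fun hp => ?_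
  have : Real.log (1 - p) ≠ 0 := (Real.log_neg (by linarith [hp.2]) (by linarith [hp.1])).ne
  rw [eq_div_iff this, eq_comm]

theorem existsUnique_solvesErdos {C : ℝ} (hC : 1 < C) : ∃! p : ℝ, SolvesErdos C p := by
  have hstrict : ∀ p p' : ℝ, 0 < p → p < p' → p' < 1 / 2 →
      Real.log p - C * Real.log (1 - p) < Real.log p' - C * Real.log (1 - p') := fun p p' h0 h h1 => by
    have h2 := Real.log_lt_log h0 h
    have h3 := mul_lt_mul_of_pos_left (Real.log_lt_log (show 0 < 1 - p' by linarith)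
      (show 1 - p' < 1 - p by linarith)) (show 0 < C by linarith)
    linarith
  -- At this end `log p` equals `-2C`, while `C log(1 - p) ≥ -C`, so the increasing function `log p
  -- - C log(1 - p)` is negative; at `1/2` it is positive since `C > 1`.
  set q := Real.exp (-(2 * C)) with hq
  have hq0 : 0 < q := Real.exp_pos _
  have hq1 : q ≤ 1 / 2 := by
    rw [hq, Real.exp_neg, inv_le_comm₀ (Real.exp_pos _) (by norm_num)]
    have := Real.add_one_le_exp (2 * C)
    norm_num; linarith
  have hcont : ContinuousOn (fun p => Real.log p - C * Real.log (1 - p)) (Icc q (1 / 2)) := by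
    refine ContinuousOn.sub (ContinuousOn.log continuousOn_id fun p hp => (hq0.trans_le hp.1).ne')
      (ContinuousOn.mul continuousOn_const (ContinuousOn.log (by fun_prop) fun p hp => ?_))
    have := hp.2
    exact (show 0 < 1 - p by linarith).ne'
  have hlog2 : 0 < Real.log 2 := Real.log_pos one_lt_two
  have hhalf : Real.log (1 / 2) = -Real.log 2 := by rw [one_div, Real.log_inv]
  have hlow : Real.log q - C * Real.log (1 - q) ≤ 0 := by
    rw [hq, Real.log_exp, ← hq]
    have h2 : -1 ≤ Real.log (1 - q) := by
      have := Real.log_le_log (show (0 : ℝ) < 1 / 2 by norm_num) (show 1 / 2 ≤ 1 - q by linarith)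
      have h3 := Real.log_two_lt_d9
      linarith
    have := mul_le_mul_of_nonneg_left h2 (show 0 ≤ C by linarith)
    linarith
  have hhigh : 0 < Real.log (1 / 2 : ℝ) - C * Real.log (1 - 1 / 2) := by
    rw [show (1 : ℝ) - 1 / 2 = 1 / 2 by norm_num, hhalf]
    have := mul_lt_mul_of_pos_right hC hlog2
    linarith
  obtain ⟨p, hp, hpf⟩ := intermediate_value_Icc hq1 hcont ⟨hlow, hhigh.le⟩
  have hp1 : p < 1 / 2 := lt_of_le_of_ne hp.2 fun h => by
    rw [h] at hpf; exact hhigh.ne' hpf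
  refine ⟨p, solvesErdos_iff.2 ⟨⟨hq0.trans_le hp.1, hp1⟩, by linarith [hpf]⟩, fun p' hp' => ?_⟩
  obtain ⟨⟨h0, h1⟩, h⟩ := solvesErdos_iff.1 hp'
  simp only at hpf
  rcases lt_trichotomy p p' with hlt | heq | hlt
  · have := hstrict p p' (hq0.trans_le hp.1) hlt h1
    linarith
  · exact heq.symm
  · have := hstrict p' p h0 hlt hp1
    linarith

lemma pC_spec {C : ℝ} (hC : 1 < C) :
    (0 < pC C ∧ pC C < 1 / 2) ∧ Real.log (pC C) = C * Real.log (1 - pC C) :=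
  solvesErdos_iff.1 (Classical.epsilon_spec (existsUnique_solvesErdos hC).exists)

/-- The difference of the two sides vanishes at `0` and `1/2`, and its derivative is `1` minus twice
the binary entropy, which decreases strictly. It is strictly concave and hence positive in between.
-/
lemma sq_mul_log_lt {x : ℝ} (h0 : 0 < x) (h1 : x < 1 / 2) :
    (1 - x) ^ 2 * Real.log (1 - x) < x ^ 2 * Real.log x := by
  set k : ℝ → ℝ := fun x => x * (x * Real.log x) - (1 - x) * ((1 - x) * Real.log (1 - x)) with hk
  have hcont : Continuous k := by
    have h2 : Continuous fun x : ℝ => (1 - x) * Real.log (1 - x) :=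
      Real.continuous_mul_log.comp (continuous_const.sub continuous_id)
    exact (continuous_id.mul Real.continuous_mul_log).sub
      ((continuous_const.sub continuous_id).mul h2)
  have hderiv : ∀ y ∈ Ioo (0 : ℝ) (1 / 2), deriv k y = 1 - 2 * Real.binEntropy y := fun y hy => by
    have hy1 : 1 - y ≠ 0 := by have := hy.2; linarith
    have d1 := (hasDerivAt_id y).mul (Real.hasDerivAt_mul_log hy.1.ne')
    have d2 : HasDerivAt (fun x : ℝ => 1 - x) (-1) y := by
      simpa using (hasDerivAt_id y).const_sub 1
    have d3 := d2.mul ((Real.hasDerivAt_mul_log hy1).comp y d2)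
    have d4 := (d1.sub d3).deriv
    refine (Eq.trans ?_ d4).trans ?_
    · rfl
    · simp only [Function.comp, id]
      rw [Real.binEntropy, Real.log_inv, Real.log_inv]
      ring
  have hconc : StrictConcaveOn ℝ (Icc (0 : ℝ) (1 / 2)) k := by
    refine StrictAntiOn.strictConcaveOn_of_deriv (convex_Icc _ _) hcont.continuousOn ?_
    rw [interior_Icc]
    intro y hy z hz hyz
    rw [hderiv y hy, hderiv z hz]
    have := Real.binEntropy_strictMonoOn (a := y) (b := z) ⟨hy.1.le, by have := hy.2; linarith⟩
      ⟨hz.1.le, by have := hz.2; linarith⟩ hyz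
    linarith
  have h2 := hconc.2 (x := 0) (y := 1 / 2) ⟨le_rfl, by norm_num⟩ ⟨by norm_num, le_rfl⟩ (by norm_num)
    (show 0 < 1 - 2 * x by linarith) (show 0 < 2 * x by linarith) (by ring)
  have h3 : k 0 = 0 := by simp [hk]
  have h4 : k (1 / 2) = 0 := by simp only [hk]; norm_num
  rw [h3, h4, smul_zero, smul_zero, add_zero, zero_add, smul_eq_mul,
    show 2 * x * (1 / 2) = x by ring] at h2
  simp only [hk] at h2
  linarith

/-- The hazard rates at the edge parameter `p_C`. -/
lemma mul_hazard_sq_lt {C : ℝ} (hC : 1 < C) :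
    C * hazard (-cutoff (pC C)) ^ 2 < hazard (cutoff (pC C)) ^ 2 := by
  obtain ⟨⟨h0, h1⟩, hlog⟩ := pC_spec hC
  set q := pC C with hq
  rw [hazard_cutoff h0 h1, hazard_neg_cutoff h0 h1, div_pow, div_pow]
  have ha : 0 < cutoffDensity q := gaussianPDFReal_pos _ _ _ one_ne_zero
  have hM : Real.log (1 - q) < 0 := Real.log_neg (by linarith) (by linarith)
  have h2 := sq_mul_log_lt h0 h1
  rw [hlog] at h2
  have h3 : C * q ^ 2 < (1 - q) ^ 2 := by
    by_contra hcon
    have := mul_le_mul_of_nonpos_right (not_lt.1 hcon) hM.le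
    linarith
  rw [← mul_div_assoc, div_lt_div_iff₀ (pow_pos (by linarith) 2) (pow_pos h0 2)]
  have := mul_lt_mul_of_pos_left h3 (pow_pos ha 2)
  linarith

/-! ### Existence of a positive constant -/

/-- First-order analysis in `s = 1/D`: a positive slope at `0` beats the quadratic loss `k s²`. -/
lemma eventually_lt_add_mul {f g : ℝ → ℝ} {f' k : ℝ} (hf : HasDerivAt f f' 0)
    (hg : ContinuousAt g 0) (h : 0 < f' + g 0) :
    ∀ᶠ s in 𝓝[>] (0 : ℝ), f 0 < f s + g s * s - k * s ^ 2 := by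
  have h1 := hf.tendsto_slope_zero_right
  have h2 : Tendsto (fun s => g s - k * s) (𝓝[>] (0 : ℝ)) (𝓝 (g 0 - k * 0)) :=
    (hg.sub (by fun_prop)).tendsto.mono_left nhdsWithin_le_nhds
  have h3 := h1.add h2
  rw [mul_zero, sub_zero] at h3
  filter_upwards [h3.eventually_const_lt h, self_mem_nhdsWithin] with s hs hs0
  have hs0' : 0 < s := hs0
  rw [zero_add, smul_eq_mul] at hs
  have h4 := mul_pos hs hs0'
  have h5 : (s⁻¹ * (f s - f 0) + (g s - k * s)) * s = f s - f 0 + g s * s - k * s ^ 2 := by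
    field_simp
    ring
  linarith

/-- With `p = normalTail (c - κ/D)`, the red exponent changes to first order in `1/D` by `μ³/6 -
κμ/2` and the blue one by `C b κ/2 - C²b³/6`. Both are positive when `C b² < 3κ < μ²`, and
`mul_hazard_sq_lt` says that this window is not empty. -/
lemma exists_improving_parameters {C : ℝ} (hC : 1 < C) :
    ∃ u v D p, 0 < u ∧ u < pC C ∧ pC C < v ∧ v < 1 / 2 ∧ 0 < D ∧ p ∈ Icc u v ∧
      (∀ p ∈ Icc u v, HMSEstimates C p C D) ∧ cutoffDensity p / p / D ≤ 1 ∧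
      -(1 / 2) * Real.log (pC C) < rhoRed p C D ∧ -(1 / 2) * Real.log (pC C) < rhoBlue C p C D := by
  obtain ⟨⟨h0, h1⟩, hlog⟩ := pC_spec hC
  have hlt := mul_hazard_sq_lt hC
  set q := pC C with hq
  set c := cutoff q with hc
  have hqc : normalTail c = q := normalTail_cutoff h0 h1
  have hqc' : normalTail (-c) = 1 - q := by rw [normalTail_neg, hqc]
  set μ := hazard c with hμ
  set b := hazard (-c) with hb
  have hμ0 : 0 < μ := hazard_pos _
  have hb0 : 0 < b := hazard_pos _
  obtain ⟨κ, hκ1, hκ2⟩ : ∃ κ, C * b ^ 2 < 3 * κ ∧ 3 * κ < μ ^ 2 :=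
    ⟨(C * b ^ 2 + μ ^ 2) / 6, by linarith, by linarith⟩
  have hκ0 : 0 < κ := by
    have : 0 ≤ C * b ^ 2 := by positivity
    linarith
  have hlin : HasDerivAt (fun s : ℝ => c - κ * s) (-κ) 0 := by
    simpa using ((hasDerivAt_id (0 : ℝ)).const_mul κ).const_sub c
  have hlin' : HasDerivAt (fun s : ℝ => -(c - κ * s)) κ 0 := by
    have := hlin.neg
    rwa [neg_neg] at this
  have hd1 : HasDerivAt (fun s : ℝ => -(1 / 2) * Real.log (normalTail (c - κ * s)))
      (-(1 / 2) * (κ * μ)) 0 := by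
    have := (HasDerivAt.comp (0 : ℝ) (h₂ := fun x => Real.log (normalTail x))
      (by simpa using hasDerivAt_log_normalTail c) hlin).const_mul (-(1 / 2))
    exact this.congr_deriv (by ring)
  have hd2 : HasDerivAt (fun s : ℝ => -(C / 2) * Real.log (normalTail (-(c - κ * s))))
      (C / 2 * (κ * b)) 0 := by
    have := (HasDerivAt.comp (0 : ℝ) (h₂ := fun x => Real.log (normalTail x))
      (by simpa using hasDerivAt_log_normalTail (-c)) hlin').const_mul (-(C / 2))
    exact this.congr_deriv (by ring)
  have hg1 : ContinuousAt (fun s : ℝ => hazard (c - κ * s) ^ 3 / 6) 0 :=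
    (((continuous_hazard.comp (by fun_prop)).pow 3).div_const 6).continuousAt
  have hg2 : ContinuousAt (fun s : ℝ => -(C ^ 2 * (hazard (-(c - κ * s)) ^ 3 / 6))) 0 :=
    (continuous_const.mul (((continuous_hazard.comp (by fun_prop)).pow 3).div_const 6)).neg.continuousAt
  have hR := eventually_lt_add_mul (k := C) hd1 hg1 (by
    simp only [mul_zero, sub_zero, ← hμ]
    have := mul_lt_mul_of_pos_right hκ2 hμ0
    linarith)
  have hB := eventually_lt_add_mul (k := C * C ^ 2) hd2 hg2 (by
    simp only [mul_zero, sub_zero, ← hb]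
    have := mul_lt_mul_of_pos_right hκ1 (show 0 < C * b by positivity)
    linarith)
  obtain ⟨D₀, hD₀, hest⟩ := exists_hmsEstimates (show 0 < C by linarith) (half_pos h0)
  have hT : Tendsto (fun s : ℝ => normalTail (c - κ * s)) (𝓝[>] 0) (𝓝 q) := by
    have : Continuous fun s : ℝ => normalTail (c - κ * s) :=
      continuous_normalTail.comp (by fun_prop)
    have h2 := this.tendsto 0
    simp only [mul_zero, sub_zero, hqc] at h2
    exact h2.mono_left nhdsWithin_le_nhds
  have hIcc := hT.eventually (Icc_mem_nhds (show q / 2 < q by linarith)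
    (show q < (q + 1 / 2) / 2 by linarith))
  have hinv := tendsto_inv_atTop_nhdsGT_zero (𝕜 := ℝ)
  obtain ⟨D, hDR, hDB, hDI, hD0, hDq⟩ := ((hinv.eventually hR).and ((hinv.eventually hB).and
    ((hinv.eventually hIcc).and ((eventually_ge_atTop D₀).and
      (eventually_ge_atTop (2 / q)))))).exists
  have hDpos : 0 < D := hD₀.trans_le hD0
  set p := normalTail (c - κ * D⁻¹) with hp
  have hp0 : 0 < p := normalTail_pos _
  have hp1 : p < 1 / 2 := by
    have := hDI.2
    linarith
  have hcp : cutoff p = c - κ * D⁻¹ := cutoff_eq hp.symm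
  refine ⟨q / 2, (q + 1 / 2) / 2, D, p, by linarith, by linarith, by linarith, by linarith, hDpos,
    hDI, fun x hx => hest D hD0 x hx.1 (by have := hx.2; linarith), ?_, ?_, ?_⟩
  · have ha := hazard_neg_cutoff_le_one hp0 hp1
    rw [div_le_one (by linarith)] at ha
    rw [div_le_one hDpos]
    refine le_trans ?_ hDq
    rw [div_le_div_iff₀ hp0 h0]
    have h2 : q ≤ 2 * p := by have := hDI.1; linarith
    have := mul_le_mul_of_nonneg_right (show cutoffDensity p ≤ 1 by linarith) h0.le
    linarith
  · simp only [mul_zero, sub_zero, hqc] at hDR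
    refine hDR.trans_eq ?_
    rw [rhoRed, ← hcp, hazard_cutoff hp0 hp1]
    field_simp
  · simp only [mul_zero, sub_zero, hqc'] at hDB
    have h2 : -(C / 2) * Real.log (1 - q) = -(1 / 2) * Real.log q := by rw [hlog]; ring
    rw [h2] at hDB
    refine hDB.trans_eq ?_
    rw [rhoBlue, ← hcp, hazard_neg_cutoff hp0 hp1, normalTail_neg, normalTail_cutoff hp0 hp1]
    have : 1 - p ≠ 0 := by linarith
    field_simp
    ring

lemma rpow_neg_half {q : ℝ} (hq : 0 < q) : q ^ (-(1 / 2) : ℝ) = Real.exp (-(1 / 2) * Real.log q) := by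
  rw [Real.rpow_def_of_pos hq, mul_comm]

/-- Without boundedness the supremum that defines the exponent would have the default value `0`.
Positivity of `K` makes the red rate bounded. -/
lemma bddAbove_rates {C u v D : ℝ} {K : ℝ → ℝ} (hu : 0 < u) (hv : v < 1 / 2) (hD : 0 < D)
    (hK : ∀ p ∈ Icc u v, 0 < K p) :
    BddAbove ((fun p => min (rhoRed p (K p) D) (rhoBlue C p (K p) D)) '' Icc u v) := by
  refine ⟨-(1 / 2) * Real.log u + 1 / (6 * u ^ 3) / D, ?_⟩
  rintro _ ⟨p, hp, rfl⟩
  refine (min_le_left _ _).trans ?_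
  have h0 : 0 < p := hu.trans_le hp.1
  have h1 : p < 1 / 2 := hp.2.trans_lt hv
  have h2 := Real.log_le_log hu hp.1
  have ha := hazard_neg_cutoff_le_one h0 h1
  rw [div_le_one (by linarith)] at ha
  have ha0 : 0 ≤ cutoffDensity p := gaussianPDFReal_nonneg _ _ _
  have h3 : cutoffDensity p ^ 3 / (6 * p ^ 3) / D ≤ 1 / (6 * u ^ 3) / D := by
    have := pow_le_one₀ ha0 (show cutoffDensity p ≤ 1 by linarith) (n := 3)
    have := hp.1
    gcongr
  have h4 : 0 < K p / D ^ 2 := div_pos (hK p hp) (by positivity)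
  rw [rhoRed]
  linarith

theorem exists_pos_hmsConstant {C : ℝ} (hC : 1 < C) : ∃ ε : ℝ, 0 < ε ∧ IsHMSConstant C ε := by
  obtain ⟨u, v, D, p, hu, huq, hqv, hv, hD, hp, hest, -, hR, hB⟩ := exists_improving_parameters hC
  have hq : 0 < pC C := hu.trans huq
  set ρ := rhoHMS C u v (fun _ => C) D with hρ
  have hlt : -(1 / 2) * Real.log (pC C) < ρ :=
    (lt_min hR hB).trans_le (le_csSup (bddAbove_rates hu hv hD fun _ _ => by linarith)
      (mem_image_of_mem (fun p => min (rhoRed p C D) (rhoBlue C p C D)) hp))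
  refine ⟨Real.exp ρ - pC C ^ (-(1 / 2) : ℝ), ?_, u, v, D, fun _ => C, hu, huq, hqv, hv, hD,
    continuousOn_const, fun _ _ => by linarith, hest, by ring⟩
  rw [rpow_neg_half hq, sub_pos]
  exact Real.exp_lt_exp.2 hlt

/-! ### The improvement of every HMS constant. -/

/-- The red hypothesis carries no `K`, as the sharp red estimate is used, whereas the blue one is
the assumed estimate in a dimension that may be enlarged from `D` to `D'`. -/
lemma exists_rate_gt {C p K D D' ρ : ℝ} (hC : 0 < C) (h0 : 0 < p) (h1 : p < 1 / 2) (hK : 0 ≤ K)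
    (hD : 0 < D) (hDD : D ≤ D') (hest : HMSEstimates C p K D) (hρ : 0 ≤ ρ)
    (happ : cutoffDensity p / p / D' ≤ 1 ∨ 0.9 ≤ cutoff p)
    (hR : ρ < -(1 / 2) * Real.log p + (cutoffDensity p / p) ^ 3 / (6 * D'))
    (hB : ρ < rhoBlue C p K D') :
    ∃ ρ' > ρ, ∀ᶠ l : ℕ in atTop, Real.exp ρ' ^ l ≤ (ramsey l ⌊C * (l : ℝ)⌋₊ : ℝ) := by
  obtain ⟨m, hm1, hm2⟩ := exists_between (lt_min hR hB)
  obtain ⟨ρ', hρ', hρm⟩ := exists_between hm1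
  exact ⟨ρ', hρ', exists_ramseyBound_of_prob_le hC (hρ.trans hρ'.le) hρm hρm
    (eventually_probRed_le h0 h1 (hD.trans_le hDD) happ (hm2.trans_le (min_le_left _ _)))
    (eventually_probBlue_le_of_hmsEstimates hC h0 h1 hK hD hDD hest (hm2.trans_le (min_le_right _ _)))⟩

/-- With `t = -log(1 - p)/2` the right-hand side is `(2 sinh t)²`, and `t ≤ sinh t`. -/
lemma neg_log_one_sub_sq_le {p : ℝ} (h0 : 0 < p) (h1 : p < 1) :
    Real.log (1 - p) ^ 2 ≤ p ^ 2 / (1 - p) := by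
  set t := -Real.log (1 - p) / 2 with ht
  have hp : 0 < 1 - p := by linarith
  have ht0 : 0 ≤ t := by
    have := Real.log_nonpos hp.le (by linarith)
    linarith
  have h2 := Real.self_le_sinh_iff.2 ht0
  have h3 : (2 * t) ^ 2 ≤ (2 * Real.sinh t) ^ 2 := pow_le_pow_left₀ (by linarith) (by linarith) 2
  have h4 : Real.exp t ^ 2 = (1 - p)⁻¹ := by
    rw [← Real.exp_nat_mul, ht, show ((2 : ℕ) : ℝ) * (-Real.log (1 - p) / 2) = -Real.log (1 - p) by
      push_cast; ring, Real.exp_neg, Real.exp_log hp]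
  have h5 : Real.exp (-t) ^ 2 = 1 - p := by
    rw [Real.exp_neg, inv_pow, h4, inv_inv]
  have h6 : Real.exp t * Real.exp (-t) = 1 := by rw [← Real.exp_add, add_neg_cancel, Real.exp_zero]
  have h7 : (2 * Real.sinh t) ^ 2 = p ^ 2 / (1 - p) := by
    rw [Real.sinh_eq, show (2 * ((Real.exp t - Real.exp (-t)) / 2)) ^ 2 = Real.exp t ^ 2
      - 2 * (Real.exp t * Real.exp (-t)) + Real.exp (-t) ^ 2 by ring, h4, h5, h6]
    field_simp
    ring
  calc Real.log (1 - p) ^ 2 = (2 * t) ^ 2 := by rw [ht]; ring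
    _ ≤ _ := h3.trans_eq h7

/-- The function `-p log p` is concave, so its minimum on the interval is at an end; at `0.165` the
comparison `2³¹ ≤ 0.165⁻¹²` reduces the logarithm to `log 2`. -/
lemma mul_neg_log_ge {p : ℝ} (h0 : 0.165 ≤ p) (h1 : p ≤ 1 / 2) : 0.2946 ≤ p * -Real.log p := by
  have h2 := Real.concaveOn_negMulLog.min_le_of_mem_Icc (x := 0.165) (y := 1 / 2)
    (mem_Ici.2 (by norm_num)) (mem_Ici.2 (by norm_num)) ⟨h0, h1⟩
  have h3 : p * -Real.log p = Real.negMulLog p := by rw [Real.negMulLog]; ring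
  rw [h3]
  refine le_trans (le_min ?_ ?_) h2
  · have h4 : 31 * Real.log 2 ≤ 12 * -Real.log 0.165 := by
      have h5 : Real.log ((2 : ℝ) ^ 31) ≤ Real.log ((0.165⁻¹ : ℝ) ^ 12) :=
        Real.log_le_log (by norm_num) (by norm_num)
      rw [Real.log_pow, Real.log_pow, Real.log_inv] at h5
      exact_mod_cast h5
    have := Real.log_two_gt_d9
    rw [Real.negMulLog]
    linarith
  · have := Real.log_two_gt_d9
    rw [Real.negMulLog, one_div, Real.log_inv]
    linarith

/-- The edge parameters for which the blue rate exceeds the trivial one are in the range of the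
estimate for red cliques. -/
lemma red_range_of_lt_rhoBlue {C p K D : ℝ} (hC : 1 < C) (h0 : 0 < p) (h1 : p < 1 / 2) (hK : 0 ≤ K)
    (hD : 0 < D) (h : -(1 / 2) * Real.log (pC C) < rhoBlue C p K D) :
    cutoffDensity p / p / D ≤ 1 ∨ 0.9 ≤ cutoff p := by
  rcases le_or_gt p 0.165 with hp | hp
  · exact .inr (cutoff_ge_of_small h0 hp)
  left
  obtain ⟨⟨hq0, hq1⟩, hlog⟩ := pC_spec hC
  set q := pC C with hq
  set a := cutoffDensity p with ha
  have ha0 : 0 < a := gaussianPDFReal_pos _ _ _ one_ne_zero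
  have h1p : 0 < 1 - p := by linarith
  set Q := -Real.log (1 - p) with hQ
  set r := -Real.log (1 - q) with hr
  have hr0 : 0 < r := by
    have := Real.log_neg (show 0 < 1 - q by linarith) (by linarith)
    linarith
  set T := a ^ 3 / ((1 - p) ^ 3 * D) with hT
  have hT0 : 0 < T := by positivity
  have hb : C ^ 2 * (a ^ 3 / (6 * (1 - p) ^ 3)) / D = C ^ 2 * T / 6 := by
    rw [hT]; field_simp
  have hKD : 0 ≤ K * C ^ 2 / D ^ 2 := by positivity
  rw [rhoBlue, hb, hlog] at h
  -- The cubic loss in the blue exponent must be less than what a parameter `p` above `p_C` gains;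
  -- in particular `p > p_C`.
  have h2 : C * T < 3 * (Q - r) := by
    have : C * (C * T) < C * (3 * (Q - r)) := by linarith
    exact lt_of_mul_lt_mul_left this (by linarith)
  have hqp : q < p := by
    have h3 : 0 < C * T := by positivity
    have h4 : Real.log (1 - p) < Real.log (1 - q) := by linarith
    have := (Real.log_lt_log_iff h1p (by linarith)).1 h4
    linarith
  have h3 : -Real.log p < C * r := by
    have := Real.log_lt_log hq0 hqp
    linarith
  -- Multiplying by `-log p < C r` gives `3r(Q - r)`, which is at most `3Q²/4` whatever `r` is; this
  -- eliminates `C` and `p_C`.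
  have h4 : -Real.log p * T < 3 / 4 * Q ^ 2 := by
    have h5 := mul_lt_mul_of_pos_right h3 hT0
    have h6 := mul_lt_mul_of_pos_left h2 hr0
    have h7 := sq_nonneg (Q - 2 * r)
    linarith
  have hQ2 : Q ^ 2 ≤ p ^ 2 / (1 - p) := by
    rw [hQ, neg_sq]; exact neg_log_one_sub_sq_le h0 (by linarith)
  have hL := mul_neg_log_ge hp.le h1.le
  set L := -Real.log p with hLdef
  have hL0 : 0 < L := by
    by_contra hcon
    have := mul_nonpos_of_nonneg_of_nonpos h0.le (not_lt.1 hcon)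
    linarith
  have hφ := normalPDF_ge_mul (cutoff_pos h0 h1).le
  rw [normalTail_cutoff h0 h1, show normalPDF (cutoff p) = a from rfl] at hφ
  have hφ2 : (4 * normalPDF 0 * (p * (1 - p))) ^ 2 ≤ a ^ 2 :=
    pow_le_pow_left₀ (by have := (normalPDF_pos 0).le; positivity) hφ 2
  have hφ0 : normalPDF 0 ^ 2 = 1 / (2 * Real.pi) := by
    rw [normalPDF_zero, inv_pow, Real.sq_sqrt (by positivity), one_div]
  rw [mul_pow, mul_pow, hφ0, mul_pow] at hφ2
  set Y := a / D with hY
  have hY0 : 0 < Y := by positivity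
  have hTY : T = a ^ 2 * Y / (1 - p) ^ 3 := by rw [hT, hY]; field_simp
  have h5 : L * (a ^ 2 * Y) < 3 / 4 * (p ^ 2 * (1 - p) ^ 2) := by
    have h6 := h4.trans_le (mul_le_mul_of_nonneg_left hQ2 (show (0 : ℝ) ≤ 3 / 4 by norm_num))
    rw [hTY, ← mul_div_assoc, div_lt_iff₀ (by positivity)] at h6
    refine h6.trans_eq ?_
    field_simp
  have h6 : L * (4 ^ 2 * (1 / (2 * Real.pi)) * (p ^ 2 * (1 - p) ^ 2) * Y) ≤ L * (a ^ 2 * Y) := by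
    gcongr
  have h7 : L * Y * (4 ^ 2 * (1 / (2 * Real.pi))) < 3 / 4 := by
    refine lt_of_mul_lt_mul_right ((le_of_eq ?_).trans_lt (h6.trans_lt h5))
      (show 0 ≤ p ^ 2 * (1 - p) ^ 2 by positivity)
    ring
  have hπ := Real.pi_lt_d4
  -- The density bound `a ≥ 4φ(0)p(1 - p)` cancels the powers of `p` and `1 - p` and leaves `-log p
  -- · a/D < 3π/32`, a number just below `0.2946`. Since `-p log p` is at least that, `a/D < p`.
  have h8 : L * Y < 0.2946 := by
    have h9 : L * Y * (4 ^ 2 * (1 / (2 * Real.pi))) = L * Y * 8 / Real.pi := by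
      field_simp; norm_num
    rw [h9, div_lt_iff₀ Real.pi_pos] at h7
    linarith
  have h9 : Y < p := by
    refine lt_of_mul_lt_mul_left ?_ hL0.le
    linarith
  rw [div_div, div_le_one (by positivity), mul_comm]
  rw [hY, div_lt_iff₀ hD] at h9
  linarith

/-- Every HMS constant can be improved. -/
theorem exists_gt_ramseyBound {C ε : ℝ} (hC : 1 < C) (hε : IsHMSConstant C ε) :
    ∃ η : ℝ, ε < η ∧ RamseyBound C η := by
  obtain ⟨u, v, D, K, hu, huq, hqv, hv, hD, hKc, hK, hest, heq⟩ := hε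
  obtain ⟨⟨hq0, hq1⟩, hlog⟩ := pC_spec hC
  set ρ := rhoHMS C u v K D with hρ
  suffices h : ∃ ρ' > ρ, ∀ᶠ l : ℕ in atTop, Real.exp ρ' ^ l ≤ (ramsey l ⌊C * (l : ℝ)⌋₊ : ℝ) by
    obtain ⟨ρ', hρ', hl⟩ := h
    refine ⟨Real.exp ρ' - pC C ^ (-(1 / 2) : ℝ), ?_, ?_⟩
    · have := Real.exp_lt_exp.2 hρ'
      linarith
    · filter_upwards [hl] with l h
      rwa [add_sub_cancel]
  have hC0 : 0 < C := by linarith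
  have hlo : 0 ≤ -(1 / 2) * Real.log (pC C) := by
    have := Real.log_nonpos hq0.le (by linarith)
    linarith
  -- If the given exponent does not beat the trivial one, any improving parameters do. Otherwise the
  -- near-optimal `p` has blue rate above the trivial one, so the red estimate applies to it.
  rcases le_or_gt ρ (-(1 / 2) * Real.log (pC C)) with hρq | hρq
  · obtain ⟨u', v', D', p, hu', huq', hqv', hv', hD', hp, hest', happ, hR, hB⟩ :=
      exists_improving_parameters hC
    have h0 : 0 < p := hu'.trans_le hp.1
    have hR' : -(1 / 2) * Real.log (pC C) < -(1 / 2) * Real.log p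
        + (cutoffDensity p / p) ^ 3 / (6 * D') := by
      refine hR.trans_le ?_
      have h1 : cutoffDensity p ^ 3 / (6 * p ^ 3) / D' = (cutoffDensity p / p) ^ 3 / (6 * D') := by
        field_simp
      have h2 : 0 ≤ C / D' ^ 2 := by positivity
      rw [rhoRed, h1]
      linarith
    obtain ⟨ρ', hρ', h⟩ := exists_rate_gt hC0 h0 (hp.2.trans_lt hv') hC0.le hD' le_rfl (hest' p hp)
      hlo (.inl happ) hR' hB
    exact ⟨ρ', hρq.trans_lt hρ', h⟩
  · obtain ⟨x, hx, hxmin⟩ := isCompact_Icc.exists_isMinOn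
      (nonempty_Icc.2 (huq.trans hqv).le) hKc
    set k := K x with hk
    have hk0 : 0 < k := hK x hx
    set s := D⁻¹ with hs
    have hs0 : 0 < s := inv_pos.2 hD
    -- In terms of `s = 1/D` the new dimension has `1/D' = s - τ`. The second bound makes the loss
    -- `a³τ/(6p³)` of the red cubic term at most half of the error `k s²` that is saved, since `a ≤
    -- 1` and `p ≥ u`.
    set τ := min (s / 2) (3 * k * s ^ 2 * u ^ 3) with hτ
    have hτ0 : 0 < τ := lt_min (by positivity) (by positivity)
    have hτs : τ ≤ s / 2 := min_le_left _ _
    have hτk : τ ≤ 3 * k * s ^ 2 * u ^ 3 := min_le_right _ _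
    have hs' : 0 < s - τ := by linarith
    set D' := (s - τ)⁻¹ with hD'
    have hDD : D ≤ D' := by
      rw [hD', le_inv_comm₀ hD hs']
      linarith
    -- Lower bounds for the net gains on the red and on the blue side. The supremum need not be
    -- attained, so `p` is taken within `g` of it.
    set g := min (k * s ^ 2 / 2) (C ^ 2 * k * τ * s) with hg
    have hg0 : 0 < g := lt_min (by positivity) (by positivity)
    obtain ⟨_, ⟨p, hp, rfl⟩, hmax⟩ := exists_lt_of_lt_csSup
      (Nonempty.image _ (nonempty_Icc.2 (huq.trans hqv).le))
      (show max (-(1 / 2) * Real.log (pC C)) (ρ - g) < sSup _ from max_lt hρq (by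
        rw [hρ, rhoHMS]; linarith))
    have h0 : 0 < p := hu.trans_le hp.1
    have h1 : p < 1 / 2 := hp.2.trans_lt hv
    have hR := hmax.trans_le (min_le_left _ _)
    have hB := hmax.trans_le (min_le_right _ _)
    have hRg := (le_max_right _ _).trans_lt hR
    have hBg := (le_max_right _ _).trans_lt hB
    have hKp : k ≤ K p := hxmin hp
    have hKp0 : 0 < K p := hK p hp
    set a := cutoffDensity p with ha
    have ha0 : 0 < a := gaussianPDFReal_pos _ _ _ one_ne_zero
    have ha1 : a ≤ 1 := by
      have := hazard_neg_cutoff_le_one h0 h1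
      rw [div_le_one (by linarith)] at this
      linarith
    have hDs : ∀ y : ℝ, y / D = y * s := fun y => div_eq_mul_inv y D
    have hDs' : ∀ y : ℝ, y / D' = y * (s - τ) := fun y => by rw [hD', div_inv_eq_mul]
    have happ := red_range_of_lt_rhoBlue hC h0 h1 hKp0.le hD ((le_max_left _ _).trans_lt hB)
    have happ' : a / p / D' ≤ 1 ∨ 0.9 ≤ cutoff p := by
      refine happ.imp_left fun h => le_trans ?_ h
      exact div_le_div_of_nonneg_left (by positivity) hD hDD
    refine exists_rate_gt hC0 h0 h1 hKp0.le hD hDD (hest p hp) (hlo.trans hρq.le) happ' ?_ ?_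
    · have e1 : (a / p) ^ 3 / (6 * D') = a ^ 3 / (6 * p ^ 3) * (s - τ) := by
        rw [← hDs']; field_simp
      have e2 : K p / D ^ 2 = K p * s ^ 2 := by rw [hs, inv_pow, div_eq_mul_inv]
      rw [rhoRed, hDs, e2] at hRg
      have e3 : a ^ 3 / (6 * p ^ 3) * τ ≤ k * s ^ 2 / 2 := by
        have hup := hp.1
        have ha3 := pow_le_one₀ ha0.le ha1 (n := 3)
        calc a ^ 3 / (6 * p ^ 3) * τ ≤ 1 / (6 * u ^ 3) * (3 * k * s ^ 2 * u ^ 3) := by gcongr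
          _ = _ := by field_simp; norm_num
      have e4 := mul_le_mul_of_nonneg_right hKp (sq_nonneg s)
      have e5 : g ≤ k * s ^ 2 / 2 := min_le_left _ _
      rw [e1]
      linarith
    · have e2 : K p * C ^ 2 / D ^ 2 = K p * C ^ 2 * s ^ 2 := by rw [hs, inv_pow, div_eq_mul_inv]
      have e3 : K p * C ^ 2 / D' ^ 2 = K p * C ^ 2 * (s - τ) ^ 2 := by
        rw [hD', inv_pow, div_inv_eq_mul]
      rw [rhoBlue, hDs, e2] at hBg
      rw [rhoBlue, hDs', e3]
      have e4 : 0 ≤ C ^ 2 * (a ^ 3 / (6 * (1 - p) ^ 3)) * τ := by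
        have : 0 < 1 - p := by linarith
        positivity
      have e5 : g ≤ C ^ 2 * k * τ * s := min_le_right _ _
      have e6 : C ^ 2 * k * τ * s ≤ K p * C ^ 2 * (τ * (2 * s - τ)) := by
        calc C ^ 2 * k * τ * s = k * C ^ 2 * (τ * s) := by ring
          _ ≤ _ := by gcongr; linarith
      linarith

/-! ### Large `C` -/

lemma eventually_pC_lt {δ : ℝ} (hδ : 0 < δ) : ∀ᶠ C : ℝ in atTop, pC C < δ := by
  set e := min δ (1 / 4) with he
  have he0 : 0 < e := lt_min hδ (by norm_num)
  have he1 : e ≤ 1 / 4 := min_le_right _ _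
  have hlog : Real.log (1 - e) < 0 := Real.log_neg (by linarith) (by linarith)
  filter_upwards [eventually_gt_atTop 1, eventually_gt_atTop (Real.log e / Real.log (1 - e))]
    with C hC hCe
  refine lt_of_lt_of_le ?_ (min_le_left δ (1 / 4))
  by_contra! h
  obtain ⟨⟨h0, h1⟩, hq⟩ := pC_spec hC
  have h2 := Real.log_le_log he0 h
  have h3 := Real.log_le_log (show 0 < 1 - pC C by linarith) (show 1 - pC C ≤ 1 - e by linarith)
  have h4 := mul_le_mul_of_nonneg_left h3 (show 0 ≤ C by linarith)
  rw [div_lt_iff_of_neg hlog] at hCe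
  linarith

lemma hazard_le_mul {c : ℝ} (hc : 20 ≤ c) : hazard c ≤ 1.01 * c := by
  have h := hazard_upper (show 0 ≤ c by linarith)
  have h2 : √(c ^ 2 + 4) ≤ 1.02 * c := by
    rw [Real.sqrt_le_left (by linarith)]
    nlinarith
  linarith

lemma log_normalTail_eq (c : ℝ) :
    Real.log (normalTail c) = -Real.log (√(2 * Real.pi)) - c ^ 2 / 2 - Real.log (hazard c) := by
  have h : normalTail c = normalPDF c / hazard c := by
    rw [normalPDF_eq_hazard_mul, mul_div_cancel_left₀ _ (hazard_pos c).ne']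
  have h2 : √(2 * Real.pi) ≠ 0 := by positivity
  rw [h, Real.log_div (normalPDF_pos c).ne' (hazard_pos c).ne', normalPDF_eq,
    Real.log_mul (inv_ne_zero h2) (Real.exp_pos _).ne', Real.log_inv, Real.log_exp]
  ring

lemma log_normalTail_bounds {c : ℝ} (hc : 20 ≤ c) :
    c ^ 2 / 2 ≤ -Real.log (normalTail c) ∧ -Real.log (normalTail c) ≤ 0.6 * c ^ 2 := by
  have h1 : 1 ≤ √(2 * Real.pi) := by
    rw [Real.one_le_sqrt]
    linarith [Real.pi_gt_three]
  have h2 : √(2 * Real.pi) ≤ 3 := by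
    rw [Real.sqrt_le_left (by norm_num)]
    linarith [Real.pi_lt_four]
  have h3 := Real.log_nonneg h1
  have h4 := Real.log_le_sub_one_of_pos (show 0 < √(2 * Real.pi) by linarith)
  have h5 := lt_hazard c
  have h6 := hazard_le_mul hc
  have h7 := Real.log_nonneg (show 1 ≤ hazard c by linarith)
  have h8 := Real.log_le_sub_one_of_pos (hazard_pos c)
  rw [log_normalTail_eq]
  exact ⟨by linarith, by nlinarith⟩

/-- Used to bound the loss `6b²C` of the low-dimensional blue estimate by a constant: `bC` is of
order `c³`, and `b` of order `c exp(-c²/2)` at most. -/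
lemma pow_four_mul_exp_le {c : ℝ} (hc : 20 ≤ c) : c ^ 4 * Real.exp (-(c ^ 2 / 2)) ≤ 0.12 := by
  have h := Real.pow_div_factorial_le_exp (c ^ 2 / 2) (by positivity) 3
  norm_num [Nat.factorial] at h
  rw [Real.exp_neg, ← div_eq_mul_inv, div_le_iff₀ (Real.exp_pos _)]
  have h2 : 400 * c ^ 4 ≤ c ^ 6 := by
    have : (20 : ℝ) ^ 2 ≤ c ^ 2 := pow_le_pow_left₀ (by norm_num) hc 2
    calc 400 * c ^ 4 = 20 ^ 2 * c ^ 4 := by norm_num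
      _ ≤ c ^ 2 * c ^ 4 := by gcongr
      _ = c ^ 6 := by ring
  have h3 : (c ^ 2 / 2) ^ 3 / 6 = c ^ 6 / 48 := by ring
  linarith

/-- For large `C` the density parameter `1.02 p_C` in dimension `(3 c ^ 3 ℓ) ^ 2`, with `c` its
cutoff, yields a gain of more than `1 / 24` in the exponent. -/
theorem eventually_exp_pow_le_ramsey : ∀ᶠ C : ℝ in atTop, ∀ᶠ l : ℕ in atTop,
    Real.exp (-(1 / 2) * Real.log (pC C) + (1 / 24 + 1 / 640)) ^ l
      ≤ (ramsey l ⌊C * (l : ℝ)⌋₊ : ℝ) := by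
  filter_upwards [eventually_gt_atTop 1, eventually_pC_lt (show (0 : ℝ) < 0.005 by norm_num),
    eventually_pC_lt (show 0 < normalTail 20 / 1.02 from div_pos (normalTail_pos _) (by norm_num))]
    with C hC hq1 hq2
  obtain ⟨⟨hq0, -⟩, hq⟩ := pC_spec hC
  set q := pC C
  have hC0 : 0 < C := by linarith
  -- Raising `p` by two per cent costs the red exponent at most `0.01`, but adds one per cent of `L
  -- = -log p_C`, which is at least `200`, to the blue one, more than the constant loss there.
  obtain ⟨p, hp⟩ : ∃ p, p = 1.02 * q := ⟨_, rfl⟩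
  have hp0 : 0 < p := by rw [hp]; positivity
  have hp1 : p < 1 / 2 := by linarith
  have hlogp : Real.log p = Real.log 1.02 + Real.log q := by
    rw [hp, Real.log_mul (by norm_num) hq0.ne']
  have h102 : Real.log 1.02 ≤ 0.02 := by
    have := Real.log_le_sub_one_of_pos (show (0 : ℝ) < 1.02 by norm_num)
    linarith
  have h102' : 0 ≤ Real.log 1.02 := Real.log_nonneg (by norm_num)
  have htail := normalTail_cutoff hp0 hp1
  have hμ := hazard_cutoff hp0 hp1
  set c := cutoff p with hcdef
  have hc : 20 ≤ c := by
    rw [← normalTail_strictAnti.le_iff_ge, htail, hp]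
    rw [lt_div_iff₀ (by norm_num)] at hq2
    linarith
  have hc0 : 0 < c := by linarith
  obtain ⟨hL1, hL2⟩ := log_normalTail_bounds hc
  rw [htail] at hL1 hL2
  have hh1 := lt_hazard c
  have hh2 := hazard_le_mul hc
  rw [hμ] at hh1 hh2
  set h := cutoffDensity p / p with hh
  set b := cutoffDensity p / (1 - p) with hb
  have hp99 : 0.99 ≤ 1 - p := by linarith
  have hbh : b = h * p / (1 - p) := by
    rw [hb, hh, div_mul_cancel₀ _ hp0.ne']
  set L := -Real.log q with hL
  have hcc : 400 ≤ c ^ 2 := by nlinarith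
  have hLc : c ^ 2 / 2 ≤ L := by linarith
  have hLc' : L ≤ 0.601 * c ^ 2 := by linarith
  have hCq : C * q ≤ L := by
    have h1 := Real.log_le_sub_one_of_pos (show 0 < 1 - q by linarith)
    have h2 := mul_le_mul_of_nonneg_left (show q ≤ -Real.log (1 - q) by linarith) hC0.le
    linarith
  have hCp : C * p ≤ 0.6131 * c ^ 2 := by
    rw [hp]
    nlinarith
  have hpc : p ≤ Real.exp (-(c ^ 2 / 2)) := by
    rw [← Real.log_le_iff_le_exp hp0]
    linarith
  have hb0 : 0 ≤ b := div_nonneg (gaussianPDFReal_pos _ _ _ one_ne_zero).le (by linarith)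
  have hbC : b * C ≤ 0.63 * c ^ 3 := by
    rw [hbh, div_mul_eq_mul_div, div_le_iff₀ (by linarith)]
    calc h * p * C = h * (C * p) := by ring
      _ ≤ 1.01 * c * (0.6131 * c ^ 2) := by gcongr
      _ = 0.619231 * c ^ 3 := by ring
      _ ≤ 0.63 * c ^ 3 * 0.99 := by
        have : 0 ≤ c ^ 3 := by positivity
        linarith
      _ ≤ _ := by gcongr
  have hb1 : b ≤ 1.03 * c * Real.exp (-(c ^ 2 / 2)) := by
    rw [hbh, div_le_iff₀ (by linarith)]
    have := Real.exp_pos (-(c ^ 2 / 2))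
    calc h * p ≤ 1.01 * c * Real.exp (-(c ^ 2 / 2)) := by gcongr
      _ ≤ 1.03 * c * Real.exp (-(c ^ 2 / 2)) * 0.99 := by
        have : 0 ≤ c * Real.exp (-(c ^ 2 / 2)) := by positivity
        linarith
      _ ≤ _ := by gcongr
  have hbb : 6 * b ^ 2 * C ≤ 0.47 := by
    have h1 := pow_four_mul_exp_le hc
    calc 6 * b ^ 2 * C = 6 * (b * C) * b := by ring
      _ ≤ 6 * (0.63 * c ^ 3) * (1.03 * c * Real.exp (-(c ^ 2 / 2))) := by gcongr
      _ = 3.8934 * (c ^ 4 * Real.exp (-(c ^ 2 / 2))) := by ring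
      _ ≤ 3.8934 * 0.12 := by gcongr
      _ ≤ 0.47 := by norm_num
  -- Bernoulli: `(1 - q)^1.02 ≥ 1 - 1.02 q`.
  have hlog1p : 1.02 * Real.log (1 - q) ≥ Real.log (1 - p) := by
    have h1 := one_add_mul_self_le_rpow_one_add (show -1 ≤ -q by linarith)
      (show (1 : ℝ) ≤ 1.02 by norm_num)
    have h2 := Real.log_le_log (show 0 < 1 - p by linarith)
      (show 1 - p ≤ (1 + -q) ^ (1.02 : ℝ) by linarith)
    rwa [Real.log_rpow (by linarith), ← sub_eq_add_neg] at h2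
  have hblue : 0.51 * L - 0.47 ≤ C * (-(1 / 2) * Real.log (1 - p) - 6 * b ^ 2) := by
    have h1 := mul_le_mul_of_nonneg_left hlog1p hC0.le
    linarith
  -- Because `hazard c > c`, dimension parameter `3c³` gives a red gain of at least `1/18`.
  have hcube : 1 / 18 ≤ h ^ 3 / (6 * (3 * c ^ 3)) := by
    rw [div_le_div_iff₀ (by norm_num) (by positivity)]
    have := pow_le_pow_left₀ hc0.le hh1.le 3
    linarith
  -- `1/18 - 0.01 > 0.0445 > 1/24 + 1/640`. The factor `3` in `3c³` is admissible for the blue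
  -- estimate since `4bC/(3c³) ≤ 4 · 0.63/3 < 1`.
  refine exists_ramseyBound_of_prob_le (A := L / 2 + 0.0445) (B := 0.51 * L - 0.48)
    (p := p) (d := fun l => ⌈(3 * c ^ 3) ^ 2 * (l : ℝ) ^ 2⌉₊) hC0 ?_ ?_ ?_ ?_ ?_
  · linarith
  · norm_num; linarith
  · norm_num; linarith
  · refine eventually_probRed_le hp0 hp1 (by positivity) (.inr (by linarith)) ?_
    linarith
  · refine eventually_probBlue_le_of_mul_le hC0 hp0 hp1 (by positivity) ?_ (by linarith)
    rw [mul_div_assoc', div_le_one (by positivity)]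
    have : 0 ≤ c ^ 3 := by positivity
    linarith

/-- The exponent has a surplus of `1/640` over `1/24`, independent of `C`. Once `log C ≥ 10`, the
factor `1 + 1/(64 log C)` is at most `1 + 1/640 ≤ exp(1/640)`. -/
lemma eventually_ramseyBound : ∀ᶠ C : ℝ in atTop, RamseyBound C
    ((Real.exp (1 / 24) - 1) * pC C ^ (-(1 / 2) : ℝ)
      + Real.exp (1 / 24) / 64 * (pC C ^ (-(1 / 2) : ℝ) / Real.log C)) := by
  filter_upwards [eventually_exp_pow_le_ramsey, eventually_gt_atTop 1,
    Real.tendsto_log_atTop.eventually_ge_atTop 10] with C h hC hlog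
  filter_upwards [h] with l hl
  have hq := (pC_spec hC).1.1
  refine le_trans (pow_le_pow_left₀ ?_ ?_ l) hl
  · have h1 : 0 ≤ Real.exp (1 / 24) - 1 := by
      have := Real.add_one_le_exp (1 / 24 : ℝ)
      linarith
    positivity
  · rw [Real.exp_add, ← rpow_neg_half hq, Real.exp_add]
    have h1 : 1 + 1 / 640 ≤ Real.exp (1 / 640) := by
      have := Real.add_one_le_exp (1 / 640 : ℝ)
      linarith
    have h2 : 1 / (64 * Real.log C) ≤ 1 / 640 :=
      one_div_le_one_div_of_le (by norm_num) (by linarith)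
    calc _ = pC C ^ (-(1 / 2) : ℝ) * (Real.exp (1 / 24) * (1 + 1 / (64 * Real.log C))) := by
          field_simp
          ring
      _ ≤ _ := by gcongr; linarith

theorem exists_ramseyBound_asymptotic : ∃ η : ℝ → ℝ,
    (∀ᶠ C : ℝ in atTop, RamseyBound C (η C)) ∧
    (∀ᶠ C : ℝ in atTop, (Real.exp (1 / 24) - 1) * pC C ^ (-(1 / 2) : ℝ) < η C) ∧
    ((fun C : ℝ => η C - (Real.exp (1 / 24) - 1) * pC C ^ (-(1 / 2) : ℝ))
      =Θ[atTop] fun C : ℝ => pC C ^ (-(1 / 2) : ℝ) / Real.log C) ∧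
    ((fun C : ℝ => η C - (Real.exp (1 / 24) - 1) * pC C ^ (-(1 / 2) : ℝ)
        - Real.exp (1 / 24) / 64 * (pC C ^ (-(1 / 2) : ℝ) / Real.log C))
      =o[atTop] fun C : ℝ => pC C ^ (-(1 / 2) : ℝ) / Real.log C) := by
  -- The function consists of exactly the two main terms, so the error term is identically zero.
  refine ⟨_, eventually_ramseyBound, ?_, ?_, ?_⟩
  · filter_upwards [eventually_gt_atTop 1] with C hC
    have hq := (pC_spec hC).1.1
    have hlog := Real.log_pos hC
    exact lt_add_of_pos_right _ (by positivity)
  · simp only [add_sub_cancel_left]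
    exact (isTheta_const_mul_left (by positivity)).2 (isTheta_refl _ _)
  · simp only [add_sub_cancel_left, sub_self]
    exact isLittleO_zero _ _

theorem theorem1p1 :
    (∀ C : ℝ, 1 < C →
      (∃! p : ℝ, SolvesErdos C p) ∧
      (∃ ε : ℝ, 0 < ε ∧ IsHMSConstant C ε) ∧
      (∀ ε : ℝ, IsHMSConstant C ε → ∃ η : ℝ, ε < η ∧ RamseyBound C η)) ∧
    (∃ η : ℝ → ℝ,
      (∀ᶠ C : ℝ in atTop, RamseyBound C (η C)) ∧
      (∀ᶠ C : ℝ in atTop, (Real.exp (1 / 24) - 1) * pC C ^ (-(1 / 2) : ℝ) < η C) ∧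
      ((fun C : ℝ => η C - (Real.exp (1 / 24) - 1) * pC C ^ (-(1 / 2) : ℝ))
        =Θ[atTop] fun C : ℝ => pC C ^ (-(1 / 2) : ℝ) / Real.log C) ∧
      ((fun C : ℝ => η C - (Real.exp (1 / 24) - 1) * pC C ^ (-(1 / 2) : ℝ)
          - Real.exp (1 / 24) / 64 * (pC C ^ (-(1 / 2) : ℝ) / Real.log C))
        =o[atTop] fun C : ℝ => pC C ^ (-(1 / 2) : ℝ) / Real.log C)) :=
  ⟨fun _ hC => ⟨existsUnique_solvesErdos hC, exists_pos_hmsConstant hC,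
    fun _ hε => exists_gt_ramseyBound hC hε⟩, exists_ramseyBound_asymptotic⟩
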